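/- **Setting.** Let $g\ge 2$, $n=8g-4$, indices mod $n$. Let $\mathbb D$ be the unit disk with metric $2|dz|/(1-|z|^2)$ and boundary circle $\mathbb S$; $[a,b]$, $[a,b)$ denote counterclockwise arcs of $\mathbb S$. Put $\sigma(i)=4g-i$ for odd $i$, $\sigma(i)=2-i$ for even $i$, $\rho(i)=\sigma(i)+1$, $\tau(i)=i+4g-2$. Let $M=\Gamma\backslash\mathbb D$ be a compact surface of genus $g$, where $\Gamma$ acts freely and has a convex fundamental polygon $\mathcal F$ with vertices $V_1,\dots,V_n$ in counterclockwise order, whose side $i$ joins $V_i$ to $V_{i+1}$ and lies on the oriented geodesic from $P_i$ to $Q_{i+1}$, where $P_1,Q_1,P_2,Q_2,\dots,P_n,Q_n$ are in counterclockwise order on $\mathbb S$; the geodesics extending the sides never meet the interior of $\gamma\mathcal F$, $\gamma\in\Gamma$; and $\Gamma$ is generated by Möbius transformations $T_i$ with $T_i(V_i)=V_{\rho(i)}$, $T_{\sigma(i)}T_i=\mathrm{Id}$, $T_{\rho^3(i)}T_{\rho^2(i)}T_{\rho(i)}T_i=\mathrm{Id}$. Let $\bar A=(A_1,\dots,A_n)$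 be extremal: $A_i\in\{P_i,Q_i\}$ for every $i$. Let $F_{\bar A}(u,w)=(T_iu,T_iw)$ for $w\in[A_i,A_{i+1})$. Let $G_1,\dots,G_n$ be the unique points with $G_i\in[P_i,P_{i+1}]$, $G_{\sigma(i)}=T_iG_{i-2}$ if $A_i=P_i$, and $G_{\sigma(i)}=T_{\tau(i)+1}G_{\tau(i)}$ if $A_i=Q_i$; put $U_i=T_{\sigma(i)}T_{\tau(i)-1}$, $H_i=U_iG_{\tau(i)-1}$ and $$\Omega_{\bar A}=\bigcup_{i=1}^{n}[H_{i+1},G_{i-2}]\times[P_i,Q_i]\ \cup\ [H_{i+1},G_{i-1}]\times[Q_i,P_{i+1}].$$ A sequence $(n_k)_{k\in\mathbb Z}\in\{1,\dots,n\}^{\mathbb Z}$ is *admissible*, and is a code of the geodesic $u_0w_0$, if there is a full $F_{\bar A}$-orbit $(u_k,w_k)_{k\in\mathbb Z}$ in $\Omega_{\bar A}$ with $n_k=\sigma(i)$ for the index $i$ such that $w_k\in[A_i,A_{i+1})$. Let $X_{\bar A}$ be the closure of the set of admissible sequences, with the left shift, again denoted by $\sigma$. For $(u,w)\in\Omega_{\bar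 A}$ let $\varphi(u,w)$ be the unit tangent vector at which the geodesic $uw$ enters $\mathcal F$ or, if it does not meet $\mathcal F$, at which it enters $U_j\mathcal F$, where $j=i$ if $(u,w)\in[P_{i-1},P_i]\times[Q_i,Q_{i+1}]$ and $j=i+1$ if $(u,w)\in[Q_{i+1},Q_{i+2}]\times[P_i,P_{i+1}]$. Let $\pi:S\mathbb D\to SM$ be the projection and $C_{\bar A}=\pi(\varphi(\Omega_{\bar A}))\subset SM$ the arithmetic cross-section. Call a geodesic *regular* if it passes through no vertex of the tessellation $\{\gamma\mathcal F\}$. **Theorem.** For every extremal $\bar A$: 1. The shift on $X_{\bar A}$ is sofic over the alphabet $\{1,\dots,8g-4\}$: $X_{\bar A}$ is the image of a topological Markov chain on a finite alphabet under a continuous map that commutes with the shifts. 2. The geodesic flow $\{\varphi^t\}$ on $SM$ is a special flow over this sofic system, up to the exceptional geodesics through vertices. Precisely: * To every $\bar x\in X_{\bar A}$ there is exactly one pair $(u,w)$ such that $(\bar x,(u,w))$ is a limit of pairs (admissible sequence, geodesic with this code), and $(u,w)\in\Omega_{\bar A}$. Put $\mathrm{Cod}(\bar x)=\pi(\varphi(u,w))$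 and let $X^0\subset X_{\bar A}$ be the set of $\bar x$ with $uw$ regular. From every $u\in\mathbb S$ only countably many geodesics are not regular, and $X^0$ is dense in $X_{\bar A}$. * Every regular geodesic of $M$ visits $C_{\bar A}$ at arbitrarily large positive and arbitrarily large negative times. * $\sigma$ maps $X^0$ bijectively onto itself. $\mathrm{Cod}$ is continuous and finite-to-one on $X^0$, and maps it onto the set of vectors of $C_{\bar A}$ whose geodesic is regular. * For $\bar x\in X^0$ the time $g_{\bar A}(\bar x)=\min\{t>0:\varphi^t(\mathrm{Cod}(\bar x))\in C_{\bar A}\}$ of first return exists, and $\varphi^{g_{\bar A}(\bar x)}(\mathrm{Cod}(\bar x))=\mathrm{Cod}(\sigma\bar x)$. * The map $(\bar x,s)\mapsto\varphi^s(\mathrm{Cod}(\bar x))$ is well defined, continuous and finite-to-one on the space of the special flow over $(X^0,\sigma)$ with ceiling function $g_{\bar A}$ (that is, $X^0\times\mathbb R$ modulo $(\bar x,s+g_{\bar A}(\bar x))\sim(\sigma\bar x,s)$); its image is the set of all vectors of $SM$ whose geodesic is regular; and it carries the special flow to the geodesic flow. -/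

import Mathlib

open Complex Topology
open scoped ComplexConjugate

noncomputable section

namespace GeodesicCoding

/-! ### Symbolic dynamics -/

/-- The left shift on bi-infinite sequences. -/
def shift {α : Type*} (x : ℤ → α) : ℤ → α := fun k => x (k + 1)

/-- The one-step topological Markov chain (subshift of finite type) with transition relation `M`,
that is, with the zero-one matrix whose `(a, b)` entry is `1` iff `M a b`. -/
def markovChain {β : Type*} (M : β → β → Prop) : Set (ℤ → β) :=
  {y | ∀ k, M (y k) (y (k + 1))}

/-- A set of bi-infinite sequences is (the space of) a sofic shift if it is a factor of a
topological Markov chain over a finite alphabet: the image of such a chain under a continuous map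
that commutes with the shifts. -/
def IsSofic {α : Type*} [TopologicalSpace α] (X : Set (ℤ → α)) : Prop :=
  ∃ (m : ℕ) (M : Fin m → Fin m → Prop) (f : (ℤ → Fin m) → (ℤ → α)),
    ContinuousOn f (markovChain M) ∧ f '' markovChain M = X ∧
      ∀ y ∈ markovChain M, f (shift y) = shift (f y)

/-- The space of the special flow over the shift on a set `X` of sequences with ceiling
function `h`: the quotient of `X × ℝ` by the relation generated by `(x, s + h x) ∼ (shift x, s)`.
When every `x` is eventually followed by arbitrarily large sums of ceilings in both time
directions, a fundamental domain is `{(x, s) : 0 ≤ s < h x}`. -/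
def SpecialFlowSpace {α : Type*} (X : Set (ℤ → α)) (h : (ℤ → α) → ℝ) : Type _ :=
  Quot (fun a b : X × ℝ => (b.1 : ℤ → α) = shift (a.1 : ℤ → α) ∧ a.2 = b.2 + h a.1)

/-- The class of `(x, s)` in the space of the special flow. -/
def SpecialFlowSpace.mk {α : Type*} {X : Set (ℤ → α)} (h : (ℤ → α) → ℝ) (x : X) (s : ℝ) :
    SpecialFlowSpace X h :=
  Quot.mk _ (x, s)

instance {α : Type*} [TopologicalSpace α] (X : Set (ℤ → α)) (h : (ℤ → α) → ℝ) :
    TopologicalSpace (SpecialFlowSpace X h) :=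
  inferInstanceAs (TopologicalSpace (Quot _))

/-- The special flow: vertical translation, `(x, s) ↦ (x, s + t)`. -/
def specialFlow {α : Type*} {X : Set (ℤ → α)} {h : (ℤ → α) → ℝ} (t : ℝ) :
    SpecialFlowSpace X h → SpecialFlowSpace X h :=
  Quot.map (fun a => (a.1, a.2 + t)) (by
    rintro a b ⟨h1, h2⟩
    exact ⟨h1, by simp only [h2]; ring⟩)

/-! ### The unit disk, its boundary and its unit tangent bundle -/

/-- The group `SU(1,1)` of matrices `(a, b; conj b, conj a)` of determinant `1`. It acts by Möbius
transformations `z ↦ (a z + b) / (conj b z + conj a)`, which give all orientation-preserving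
isometries of the disk with the metric `2 |dz| / (1 - |z| ^ 2)`. -/
def SU11 : Subgroup (Matrix.SpecialLinearGroup (Fin 2) ℂ) where
  carrier := {A | A 1 0 = conj (A 0 1) ∧ A 1 1 = conj (A 0 0)}
  one_mem' := by simp
  mul_mem' := by
    rintro A B ⟨h1, h2⟩ ⟨h3, h4⟩
    constructor <;> simp [Matrix.mul_apply, Fin.sum_univ_two, h1, h2, h3, h4] <;> ring
  inv_mem' := by
    rintro A ⟨h1, h2⟩
    constructor <;> simp [Matrix.adjugate_fin_two, h1, h2]

/-- The entry `a` of `(a, b; conj b, conj a)`. -/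
def coefA (A : SU11) : ℂ := A.1 0 0

/-- The entry `b` of `(a, b; conj b, conj a)`. -/
def coefB (A : SU11) : ℂ := A.1 0 1

/-- The denominator `conj b z + conj a` of the Möbius transformation. -/
def mden (A : SU11) (z : ℂ) : ℂ := conj (coefB A) * z + conj (coefA A)

/-- The numerator `a z + b` of the Möbius transformation. -/
def mnum (A : SU11) (z : ℂ) : ℂ := coefA A * z + coefB A

theorem mob_normSq_sub (A : SU11) : normSq (coefA A) - normSq (coefB A) = 1 := by
  have h := A.1.det_coe
  rw [Matrix.det_fin_two, A.2.1, A.2.2, mul_conj, mul_conj] at h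
  exact_mod_cast h

theorem mob_a_mul (A B : SU11) : coefA (A * B) = coefA A * coefA B + coefB A * conj (coefB B) := by
  simp [coefA, coefB, Matrix.mul_apply, Fin.sum_univ_two, B.2.1]

theorem mob_b_mul (A B : SU11) : coefB (A * B) = coefA A * coefB B + coefB A * conj (coefA B) := by
  simp [coefA, coefB, Matrix.mul_apply, Fin.sum_univ_two, B.2.2]

theorem mob_normSq_den_sub (A : SU11) (z : ℂ) :
    normSq (mden A z) - normSq (mnum A z) = 1 - normSq z := by
  have h := mob_normSq_sub A
  simp only [mden, mnum, normSq_apply, add_re, add_im, mul_re, mul_im, conj_re,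
    conj_im] at h ⊢
  linear_combination (1 - z.re * z.re - z.im * z.im) * h

theorem mob_den_ne_zero (A : SU11) {z : ℂ} (hz : ‖z‖ ≤ 1) : mden A z ≠ 0 := by
  intro h
  have h1 := mob_normSq_sub A
  have h2 : conj (coefA A) = -(conj (coefB A) * z) := by
    rw [mden] at h
    linear_combination h
  have h3 : ‖coefA A‖ = ‖coefB A‖ * ‖z‖ := by simpa using congrArg norm h2
  rw [normSq_eq_norm_sq, normSq_eq_norm_sq, h3] at h1
  nlinarith [norm_nonneg (coefB A), norm_nonneg z, mul_le_one₀ hz (norm_nonneg z) hz,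
    sq_nonneg ‖coefB A‖]

theorem mob_den_mul (A B : SU11) {z : ℂ} (hz : ‖z‖ ≤ 1) :
    mden (A * B) z = mden A (mnum B z / mden B z) * mden B z := by
  have h := mob_den_ne_zero B hz
  rw [mden.eq_1 A, add_mul, mul_assoc, div_mul_cancel₀ _ h]
  simp only [mden, mnum, mob_a_mul, mob_b_mul, map_add, map_mul, conj_conj]
  ring

theorem mob_num_mul (A B : SU11) {z : ℂ} (hz : ‖z‖ ≤ 1) :
    mnum (A * B) z = mnum A (mnum B z / mden B z) * mden B z := by
  have h := mob_den_ne_zero B hz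
  rw [mnum.eq_1 A, add_mul, mul_assoc, div_mul_cancel₀ _ h]
  simp only [mden, mnum, mob_a_mul, mob_b_mul]
  ring

theorem mob_norm_lt_one (A : SU11) (z : UnitDisc) : ‖mnum A z / mden A z‖ < 1 := by
  have h := mob_den_ne_zero A z.norm_lt_one.le
  have h1 := mob_normSq_den_sub A z
  have h2 := z.normSq_lt_one
  rw [norm_div, div_lt_one (norm_pos_iff.2 h)]
  rw [normSq_eq_norm_sq, normSq_eq_norm_sq] at h1
  nlinarith [norm_nonneg (mnum A z), norm_nonneg (mden A z)]

/-- The Möbius action on the open disk. -/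
instance : MulAction SU11 UnitDisc where
  smul A z := UnitDisc.mk (mnum A z / mden A z) (mob_norm_lt_one A z)
  one_smul z := by
    apply UnitDisc.coe_injective
    change mnum (1 : SU11) z / mden (1 : SU11) z = (z : ℂ)
    simp [mnum, mden, coefA, coefB]
  mul_smul A B z := by
    apply UnitDisc.coe_injective
    change mnum (A * B) z / mden (A * B) z
      = mnum A (mnum B z / mden B z) / mden A (mnum B z / mden B z)
    rw [mob_num_mul A B z.norm_lt_one.le, mob_den_mul A B z.norm_lt_one.le,
      mul_div_mul_right _ _ (mob_den_ne_zero B z.norm_lt_one.le)]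

theorem mob_coe_smul_disc (A : SU11) (z : UnitDisc) :
    ((A • z : UnitDisc) : ℂ) = mnum A z / mden A z := rfl

theorem mob_norm_div_circle (A : SU11) (w : Circle) : ‖mnum A w / mden A w‖ = 1 := by
  have h := mob_den_ne_zero A w.norm_coe.le
  have h1 := mob_normSq_den_sub A w
  rw [normSq_eq_norm_sq, normSq_eq_norm_sq, w.normSq_coe, sub_self, sub_eq_zero] at h1
  rw [norm_div, div_eq_one_iff_eq (norm_ne_zero_iff.2 h)]
  exact ((sq_eq_sq₀ (norm_nonneg _) (norm_nonneg _)).1 h1).symm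

/-- The Möbius action on the circle at infinity. -/
instance : MulAction SU11 Circle where
  smul A w := ⟨mnum A w / mden A w, mem_sphere_zero_iff_norm.2 (mob_norm_div_circle A w)⟩
  one_smul w := by
    apply Circle.coe_injective
    change mnum (1 : SU11) w / mden (1 : SU11) w = (w : ℂ)
    simp [mnum, mden, coefA, coefB]
  mul_smul A B w := by
    apply Circle.coe_injective
    change mnum (A * B) w / mden (A * B) w
      = mnum A (mnum B w / mden B w) / mden A (mnum B w / mden B w)
    rw [mob_num_mul A B w.norm_coe.le, mob_den_mul A B w.norm_coe.le,
      mul_div_mul_right _ _ (mob_den_ne_zero B w.norm_coe.le)]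

/-- The unit tangent bundle `S𝔻` of the disk. A unit tangent vector is given by its base point
and its (Euclidean) direction; its Euclidean length `(1 - |z| ^ 2) / 2` is determined by the
base point. -/
@[ext]
structure UnitTangent where
  base : UnitDisc
  dir : Circle

instance : TopologicalSpace UnitTangent :=
  TopologicalSpace.induced (fun v => (v.base, v.dir)) inferInstance

instance : Nonempty UnitTangent := ⟨⟨0, 1⟩⟩

/-- The derivative action on unit tangent vectors: the derivative of the Möbius transformation is
`1 / d ^ 2` with `d = conj b z + conj a`, and its direction is `conj d / d`. -/
instance : MulAction SU11 UnitTangent where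
  smul A v := ⟨A • v.base, v.dir * Circle.ofConjDivSelf (mden A v.base)
    (mob_den_ne_zero A v.base.norm_lt_one.le)⟩
  one_smul v := by
    apply UnitTangent.ext
    · exact one_smul _ _
    · apply Circle.coe_injective
      change (v.dir : ℂ) * (conj (mden (1 : SU11) v.base) / mden (1 : SU11) v.base) = v.dir
      simp [mden, coefA, coefB]
  mul_smul A B v := by
    apply UnitTangent.ext
    · exact mul_smul _ _ _
    · apply Circle.coe_injective
      change (v.dir : ℂ) * (conj (mden (A * B) v.base) / mden (A * B) v.base)
        = (v.dir : ℂ) * (conj (mden B v.base) / mden B v.base) *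
          (conj (mden A (B • v.base : UnitDisc)) / mden A (B • v.base : UnitDisc))
      rw [mob_coe_smul_disc, mob_den_mul A B v.base.norm_lt_one.le, map_mul,
        mul_div_mul_comm]
      ring

theorem den_flow_ne_zero (z : UnitDisc) (ζ : Circle) {s : ℝ} (hs : |s| ≤ 1) :
    1 + conj (z : ℂ) * ζ * s ≠ 0 := by
  intro h
  have h1 : ‖conj (z : ℂ) * ζ * s‖ = 1 := by
    rw [show conj (z : ℂ) * ζ * s = -1 by linear_combination h]
    simp
  rw [norm_mul, norm_mul, Circle.norm_coe, RCLike.norm_conj, mul_one, norm_real,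
    Real.norm_eq_abs] at h1
  nlinarith [z.norm_lt_one, norm_nonneg (z : ℂ), abs_nonneg s]

theorem norm_flow_lt_one (z : UnitDisc) (ζ : Circle) {s : ℝ} (hs : |s| < 1) :
    ‖((z : ℂ) + ζ * s) / (1 + conj (z : ℂ) * ζ * s)‖ < 1 := by
  have h0 := den_flow_ne_zero z ζ hs.le
  have hz := z.normSq_lt_one
  have hc := ζ.normSq_coe
  have hs2 : s ^ 2 < 1 := (sq_lt_one_iff_abs_lt_one s).2 hs
  have key : normSq (1 + conj (z : ℂ) * ζ * s) - normSq ((z : ℂ) + ζ * s)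
      = (1 - normSq (z : ℂ)) * (1 - s ^ 2) := by
    simp only [normSq_apply, add_re, add_im, mul_re, mul_im, conj_re, conj_im, ofReal_re,
      ofReal_im, one_re, one_im] at hc ⊢
    linear_combination (((z : ℂ).re ^ 2 + (z : ℂ).im ^ 2) * s ^ 2 - s ^ 2) * hc
  rw [norm_div, div_lt_one (norm_pos_iff.2 h0)]
  rw [normSq_eq_norm_sq, normSq_eq_norm_sq] at key
  have hpos : 0 < (1 - normSq (z : ℂ)) * (1 - s ^ 2) := by
    apply mul_pos <;> linarith
  nlinarith [norm_nonneg ((z : ℂ) + ζ * s), norm_nonneg (1 + conj (z : ℂ) * ζ * s)]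

theorem abs_tanh_lt_one (t : ℝ) : |Real.tanh t| < 1 :=
  abs_lt.2 ⟨Real.neg_one_lt_tanh t, Real.tanh_lt_one t⟩

/-- The geodesic flow on `S𝔻`. The unit-speed geodesic with initial point `z` and initial
direction `ζ` is the image of the diameter `t ↦ ζ tanh (t / 2)` under the isometry
`m ↦ (m + z) / (1 + conj z m)`, namely
`t ↦ (z + ζ tanh (t / 2)) / (1 + conj z ζ tanh (t / 2))`; the second component is
the direction of its velocity. -/
def diskFlow (t : ℝ) (v : UnitTangent) : UnitTangent where
  base := UnitDisc.mk _ (norm_flow_lt_one v.base v.dir (abs_tanh_lt_one (t / 2)))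
  dir := v.dir * Circle.ofConjDivSelf _
    (den_flow_ne_zero v.base v.dir (abs_tanh_lt_one (t / 2)).le)

theorem dir_aux {ζ d d' x x' y y' c c' : ℂ} (h : d * x = c * y) (h' : d' * x' = c' * y') :
    ζ * (c' / c) * (y' / y) = ζ * (x' / x) * (d' / d) := by
  rw [mul_assoc, mul_assoc, ← mul_div_mul_comm, ← mul_div_mul_comm, ← h, ← h', mul_comm d,
    mul_comm d']

theorem diskFlow_smul (A : SU11) (t : ℝ) (v : UnitTangent) :
    diskFlow t (A • v) = A • diskFlow t v := by
  obtain ⟨z, ζ⟩ := v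
  have hd := mob_den_ne_zero A z.norm_lt_one.le
  have hcd : conj (mden A z) ≠ 0 := by simpa using hd
  set s : ℝ := Real.tanh (t / 2)
  have hs : |s| < 1 := abs_tanh_lt_one (t / 2)
  have hq := den_flow_ne_zero z ζ hs.le
  have e1 : mnum A (((z : ℂ) + ζ * s) / (1 + conj (z : ℂ) * ζ * s)) * (1 + conj (z : ℂ) * ζ * s)
      = mnum A z + ζ * s * conj (mden A z) := by
    rw [mnum, add_mul, mul_assoc, div_mul_cancel₀ _ hq]
    simp only [mnum, mden, map_add, map_mul, conj_conj]
    ring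
  have e2 : mden A (((z : ℂ) + ζ * s) / (1 + conj (z : ℂ) * ζ * s)) * (1 + conj (z : ℂ) * ζ * s)
      = mden A z + ζ * s * conj (mnum A z) := by
    rw [mden, add_mul, mul_assoc, div_mul_cancel₀ _ hq]
    simp only [mnum, mden, map_add, map_mul]
    ring
  have e3 : mden A z * (1 + conj (mnum A z / mden A z) * (ζ * (conj (mden A z) / mden A z)) * s)
      = mden A z + ζ * s * conj (mnum A z) := by
    rw [map_div₀]
    field_simp
  have e4 : mden A z * (mnum A z / mden A z + (ζ * (conj (mden A z) / mden A z)) * s)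
      = mnum A z + ζ * s * conj (mden A z) := by
    field_simp
  apply UnitTangent.ext
  · apply UnitDisc.coe_injective
    change (mnum A z / mden A z + (ζ * (conj (mden A z) / mden A z)) * s) /
        (1 + conj (mnum A z / mden A z) * (ζ * (conj (mden A z) / mden A z)) * s)
      = mnum A (((z : ℂ) + ζ * s) / (1 + conj (z : ℂ) * ζ * s)) /
        mden A (((z : ℂ) + ζ * s) / (1 + conj (z : ℂ) * ζ * s))
    rw [← mul_div_mul_left _ _ hd, e3, e4, ← e1, ← e2, mul_div_mul_right _ _ hq]
  · apply Circle.coe_injective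
    change (ζ * (conj (mden A z) / mden A z)) *
        (conj (1 + conj (mnum A z / mden A z) * (ζ * (conj (mden A z) / mden A z)) * s) /
          (1 + conj (mnum A z / mden A z) * (ζ * (conj (mden A z) / mden A z)) * s))
      = ζ * (conj (1 + conj (z : ℂ) * ζ * s) / (1 + conj (z : ℂ) * ζ * s)) *
        (conj (mden A (((z : ℂ) + ζ * s) / (1 + conj (z : ℂ) * ζ * s))) /
          mden A (((z : ℂ) + ζ * s) / (1 + conj (z : ℂ) * ζ * s)))
    have e5 := e2.trans e3.symm
    have e6 := congrArg conj e5
    rw [map_mul, map_mul] at e6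
    exact dir_aux e5 e6

/-- The end point on the circle at infinity of the geodesic ray from `z` in direction `ζ`, that is,
`(z + ζ) / (1 + conj z ζ)`. -/
def endpoint (z : UnitDisc) (ζ : Circle) : Circle :=
  ζ * Circle.ofConjDivSelf (1 + conj (z : ℂ) * ζ * (1 : ℝ))
    (den_flow_ne_zero z ζ (by simp))

/-- The pair `(u, w)` of the beginning and the end of the oriented geodesic tangent to `v`. -/
def ends (v : UnitTangent) : Circle × Circle :=
  (endpoint v.base (-v.dir), endpoint v.base v.dir)

/-- The oriented geodesic `p = (u, w)` meets the set `K`. -/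
def Meets (p : Circle × Circle) (K : Set UnitDisc) : Prop :=
  ∃ v, ends v = p ∧ v.base ∈ K

/-- The geodesic tangent to `v` enters the set `K` at the base point of `v`. -/
def Enters (v : UnitTangent) (K : Set UnitDisc) : Prop :=
  v.base ∈ K ∧ ∀ t < 0, (diskFlow t v).base ∉ K

/-- The counterclockwise angle in `[0, 2π)` from `a` to `x`. -/
def ccw (a x : Circle) : ℝ := toIcoMod Real.two_pi_pos 0 (Complex.arg (x / a : Circle))

/-- The closed counterclockwise arc `[a, b]`. -/
def arcIcc (a b : Circle) : Set Circle := {x | ccw a x ≤ ccw a b}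

/-- The half-open counterclockwise arc `[a, b)`. -/
def arcIco (a b : Circle) : Set Circle := {x | ccw a x < ccw a b}

/-- Position of `z` relative to the oriented geodesic from `p` to `q`: zero on the geodesic,
positive to its left, negative to its right (on the side of the counterclockwise arc from `p`
to `q`). It is computed in the projective model, where geodesics are chords: the change of models
is `z ↦ 2 z / (1 + |z| ^ 2)`, and the positive factor `1 + |z| ^ 2` has been cleared. -/
def sidePos (p q : Circle) (z : UnitDisc) : ℝ :=
  (conj ((q : ℂ) - p) * (2 * (z : ℂ) - (1 + normSq (z : ℂ)) * p)).im

/-! ### The fundamental polygon -/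

/-- Side labels `1, …, 8g - 4`, modulo `8g - 4`. -/
abbrev Idx (g : ℕ) : Type := ZMod (8 * g - 4)

/-- The side pairing: `σ(i) = 4g - i` for odd `i` and `σ(i) = 2 - i` for even `i`. -/
def sig {g : ℕ} (i : Idx g) : Idx g := if Odd i.val then 4 * (g : Idx g) - i else 2 - i

/-- `ρ(i) = σ(i) + 1`. -/
def rho {g : ℕ} (i : Idx g) : Idx g := sig i + 1

/-- `τ(i) = i + (4g - 2)`. -/
def tau {g : ℕ} (i : Idx g) : Idx g := i + (4 * (g : Idx g) - 2)

/-- The closed convex polygon bounded by the geodesics `P_i Q_{i+1}`. -/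
def polygon {g : ℕ} (P Q : Idx g → Circle) : Set UnitDisc :=
  {z | ∀ i, 0 ≤ sidePos (P i) (Q (i + 1)) z}

/-- The group generated by the side pairings. -/
def sideGroup {g : ℕ} (T : Idx g → SU11) : Subgroup SU11 := Subgroup.closure (Set.range T)

/-- A surface of genus `g`, presented by an `(8g-4)`-sided fundamental polygon of its Fuchsian group
with the extension property: the polygon has vertices `V i` in counterclockwise order, side `i`
joins `V i` to `V (i + 1)` and lies on the oriented geodesic from `P i` to `Q (i + 1)`, and
`T i` is the generator that maps side `i` to side `σ(i)`. -/
structure Surface (g : ℕ) where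
  T : Idx g → SU11
  P : Idx g → Circle
  Q : Idx g → Circle
  V : Idx g → UnitDisc
  /-- The counterclockwise order of the points is `P_1, Q_1, P_2, Q_2, …, P_{8g-4}, Q_{8g-4}`. -/
  order_PQ : ∀ k : ℕ, 1 ≤ k → k ≤ 8 * g - 4 →
    ccw (P 1) (P (k : Idx g)) < ccw (P 1) (Q (k : Idx g))
  order_QP : ∀ k : ℕ, 1 ≤ k → k < 8 * g - 4 →
    ccw (P 1) (Q (k : Idx g)) < ccw (P 1) (P ((k + 1 : ℕ) : Idx g))
  /-- `V i` is the common point of the lines carrying the sides `i - 1` and `i`. -/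
  vertex_left : ∀ i, sidePos (P (i - 1)) (Q i) (V i) = 0
  vertex_right : ∀ i, sidePos (P i) (Q (i + 1)) (V i) = 0
  /-- Side pairing and relations between the generators, as Möbius transformations. -/
  map_vertex : ∀ i, T i • V i = V (rho i)
  pairing : ∀ (i : Idx g) (z : UnitDisc), T (sig i) • T i • z = z
  cycle : ∀ (i : Idx g) (z : UnitDisc),
    T (rho (rho (rho i))) • T (rho (rho i)) • T (rho i) • T i • z = z
  /-- The polygon is a fundamental domain of the group. -/
  covers : ∀ z : UnitDisc, ∃ γ ∈ sideGroup T, γ • z ∈ polygon P Q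
  disjoint_interiors : ∀ γ ∈ sideGroup T, ∀ z ∈ interior (polygon P Q),
    γ • z ∈ interior (polygon P Q) → ∀ z' : UnitDisc, γ • z' = z'
  /-- The group acts freely on the disk. -/
  free : ∀ γ ∈ sideGroup T, ∀ z : UnitDisc, γ • z = z → ∀ z' : UnitDisc, γ • z' = z'
  /-- The full geodesics extending the sides never enter the interior of an image of
  the polygon. -/
  extension_condition : ∀ (i : Idx g) (z : UnitDisc), sidePos (P i) (Q (i + 1)) z = 0 →
    ∀ γ ∈ sideGroup T, γ • z ∉ interior (polygon P Q)

namespace Surface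

variable {g : ℕ} (S : Surface g)

/-- The Fuchsian group. -/
abbrev Gam : Subgroup SU11 := sideGroup S.T

/-- The fundamental polygon. -/
def F : Set UnitDisc := polygon S.P S.Q

/-- The unit tangent bundle `SM` of `M = Γ \ 𝔻`. -/
def SM : Type := Quotient (MulAction.orbitRel S.Gam UnitTangent)

instance : TopologicalSpace S.SM := inferInstanceAs (TopologicalSpace (Quotient _))

/-- The projection `S𝔻 → SM`. -/
def proj (v : UnitTangent) : S.SM := Quotient.mk _ v

/-- The geodesic flow on `SM`. -/
def flow (t : ℝ) : S.SM → S.SM :=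
  Quotient.map (diskFlow t) (by
    rintro v w ⟨γ, h⟩
    refine ⟨γ, ?_⟩
    change (γ : SU11) • w = v at h
    change (γ : SU11) • diskFlow t w = diskFlow t v
    rw [← h, diskFlow_smul])

/-! ### Boundary maps, extremal parameters and the domain of the natural extension -/

/-- The parameters are extremal: each `A i` is `P i` or `Q i`. -/
def IsExtremal (A : Idx g → Circle) : Prop := ∀ i, A i = S.P i ∨ A i = S.Q i

/-- The index `i` with `w ∈ [A_i, A_{i+1})`. -/
def index (A : Idx g → Circle) (w : Circle) : Idx g :=
  Classical.epsilon fun i => w ∈ arcIco (A i) (A (i + 1))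

/-- The boundary map `f_A`, `f_A(x) = T_i(x)` if `x ∈ [A_i, A_{i+1})`. -/
def boundaryMap (A : Idx g → Circle) (x : Circle) : Circle := S.T (index A x) • x

/-- The map `F_A(u, w) = (T_i u, T_i w)` if `w ∈ [A_i, A_{i+1})`. -/
def FA (A : Idx g → Circle) (p : Circle × Circle) : Circle × Circle :=
  (S.T (index A p.2) • p.1, boundaryMap S A p.2)

/-- The system of conditions that determines the values `G_i`. -/
def IsCornerSystem (A G : Idx g → Circle) : Prop :=
  ∀ i, G i ∈ arcIcc (S.P i) (S.P (i + 1)) ∧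
    (A i = S.P i → G (sig i) = S.T i • G (i - 2)) ∧
    (A i = S.Q i → G (sig i) = S.T (tau i + 1) • G (tau i))

/-- The values `G_i`: the solution of the system. -/
def G (A : Idx g → Circle) : Idx g → Circle := Classical.epsilon (S.IsCornerSystem A)

/-- `U_i = T_{σ(i)} T_{τ(i)-1}`. -/
def U (i : Idx g) : SU11 := S.T (sig i) * S.T (tau i - 1)

/-- `H_i = U_i G_{τ(i)-1}`. -/
def H (A : Idx g → Circle) (i : Idx g) : Circle := S.U i • S.G A (tau i - 1)

/-- The domain `Ω_A` of the natural extension. -/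
def Omega (A : Idx g → Circle) : Set (Circle × Circle) :=
  ⋃ i, (arcIcc (S.H A (i + 1)) (S.G A (i - 2)) ×ˢ arcIcc (S.P i) (S.Q i)) ∪
    (arcIcc (S.H A (i + 1)) (S.G A (i - 1)) ×ˢ arcIcc (S.Q i) (S.P (i + 1)))

/-! ### Coding sequences -/

/-- `x` is an arithmetic code of the geodesic `p = (u, w)`: there is a full `F_A`-orbit
`(u_k, w_k)`, `k ∈ ℤ`, in `Ω_A` with `(u_0, w_0) = (u, w)`, and `x_k = σ(i)` for the index `i` with
`w_k ∈ [A_i, A_{i+1})`. -/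
def IsCode (A : Idx g → Circle) (x : ℤ → Idx g) (p : Circle × Circle) : Prop :=
  ∃ q : ℤ → Circle × Circle, q 0 = p ∧
    ∀ k, q k ∈ S.Omega A ∧ q (k + 1) = S.FA A (q k) ∧ x k = sig (index A (q k).2)

/-- The space `X_A`: the closure of the set of admissible sequences. -/
def codeSpace (A : Idx g → Circle) : Set (ℤ → Idx g) :=
  closure {x | ∃ p ∈ S.Omega A, S.IsCode A x p}

/-- `p` is a limit of geodesics whose codes converge to `x`. -/
def IsAssociated (A : Idx g → Circle) (x : ℤ → Idx g) (p : Circle × Circle) : Prop :=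
  (x, p) ∈ closure {y : (ℤ → Idx g) × (Circle × Circle) | S.IsCode A y.1 y.2}

/-- The geodesic associated to `x ∈ X_A`, by continuous extension from admissible sequences. -/
def geodesicOf (A : Idx g → Circle) (x : ℤ → Idx g) : Circle × Circle :=
  Classical.epsilon (S.IsAssociated A x)

/-! ### The arithmetic cross-section -/

/-- `v = φ(u, w)`, where `(u, w)` are the ends of `v`: the geodesic enters `F` at `v` or, if
it does not meet `F`, it enters `U_j F` at `v`, where `j = i` if `(u, w)` is in the upper corner
in `[P_{i-1}, P_i] × [Q_i, Q_{i+1}]` and `j = i + 1` if it is in the lower corner in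
`[Q_{i+1}, Q_{i+2}] × [P_i, P_{i+1}]`. -/
def IsSectionPoint (v : UnitTangent) : Prop :=
  Enters v S.F ∨
    ¬ Meets (ends v) S.F ∧ ∃ i,
      ((ends v).1 ∈ arcIcc (S.P (i - 1)) (S.P i) ∧
          (ends v).2 ∈ arcIcc (S.Q i) (S.Q (i + 1)) ∧
          Enters v ((fun z => S.U i • z) '' S.F)) ∨
      ((ends v).1 ∈ arcIcc (S.Q (i + 1)) (S.Q (i + 2)) ∧
          (ends v).2 ∈ arcIcc (S.P i) (S.P (i + 1)) ∧
          Enters v ((fun z => S.U (i + 1) • z) '' S.F))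

/-- The map `φ : Ω_A → S𝔻`. (It is single-valued except possibly at geodesics through vertices.) -/
def sectionPoint (p : Circle × Circle) : UnitTangent :=
  Classical.epsilon fun v => ends v = p ∧ S.IsSectionPoint v

/-- The arithmetic cross-section `C_A = π(φ(Ω_A))`. -/
def crossSection (A : Idx g → Circle) : Set S.SM :=
  S.proj '' {v | ends v ∈ S.Omega A ∧ S.IsSectionPoint v}

/-- The coding map `X_A → SM`, `x ↦ π(φ(u, w))` with `(u, w)` the geodesic associated to `x`. -/
def Cod (A : Idx g → Circle) (x : ℤ → Idx g) : S.SM :=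
  S.proj (S.sectionPoint (S.geodesicOf A x))

/-- The time of the first return of `v` to `C`. -/
def returnTime (C : Set S.SM) (v : S.SM) : ℝ := sInf {t | 0 < t ∧ S.flow t v ∈ C}

/-- The ceiling function `g_A` on `X_A`: the time of the first return to `C_A` of the geodesic
associated to `x`. -/
def ceiling (A : Idx g → Circle) (x : ℤ → Idx g) : ℝ :=
  S.returnTime (S.crossSection A) (S.Cod A x)

/-- The geodesic `p` in the disk passes through no vertex of the tessellation by the images
of the polygon. -/
def AvoidsVertices (p : Circle × Circle) : Prop :=
  ¬ Meets p {z | ∃ γ ∈ S.Gam, ∃ i, z = γ • S.V i}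

/-- The unit tangent vectors of `M` whose geodesic passes through no vertex. -/
def regularVectors : Set S.SM := S.proj '' {v | S.AvoidsVertices (ends v)}

/-- The sequences in `X_A` whose associated geodesic passes through no vertex. -/
def regularCodes (A : Idx g → Circle) : Set (ℤ → Idx g) :=
  {x ∈ S.codeSpace A | S.AvoidsVertices (S.geodesicOf A x)}

end Surface

end GeodesicCoding

end

open GeodesicCoding

noncomputable section

set_option linter.unusedSectionVars false

namespace GeodesicCoding

/-! ### The counterclockwise order on the circle -/

/-! The proof has a combinatorial half, a geometric half, and an expansivity argument that joins
them.

Combinatorics. The points P_i, Q_i cut the circle into cells [P_i, Q_i) and [Q_i, P_{i+1}), and over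
each cell the domain Ω has a single arc as fiber. For extremal parameters one generator acts on each
whole cell. The values G and H are such that this generator maps the fiber into the fiber over every
cell met by the image of the cell, while the image of the cell contains each of those cells entirely
(`trans_of_mem`). Conversely every point of a fiber comes from such a transition (`exists_trans`).
So Ω carries a finite Markov structure: bi-infinite paths of cells form a topological Markov chain,
and reading off the generator at each step gives the code. This is a one-block map, whence soficity
(`isSofic_codeSpace`). What makes the Markov structure possible is the exact action of the side
pairings on the P_i and Q_i. It is not assumed; it follows from the extension condition and the
cycle relations (`T_line`, `T_P_pred`, `T_Q`).

Geometry. A regular geodesic of Ω either meets the polygon F or cuts off one vertex V_k in a corner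
of Ω; in the second case it crosses the tile U_k F opposite to F at that vertex. The pieces of the
corners missing from Ω are carried by the U_k onto pieces that are present. Therefore, on regular
vectors, the cross-section is simply the set of all entrances into tiles, whatever the parameters
are (`proj_mem_crossSection_iff`). Flowing from one entrance to the next and applying the generator
prescribed by the cell gives again a section point (`section_step`). The prescribed generator may
differ from that of the side actually crossed, but then it belongs to a neighbouring side and the
image lies in a corner, where the definition of the section makes the right correction. Hence the
shift is the first return map (`isLeast_ceiling`).

Expansivity. A code determines its geodesic (`forward_unique`, `backward_unique`). If two ends a, a'
had the same forward itinerary, a generic c between them would have it too and would be the end of a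
regular geodesic of Ω. The section points of that geodesic tend to c, and so do suitable vertices
that stay within bounded distance of them. But these vertices all lie on the far side of the
geodesic a a', while c does not. The backward statement is the mirror image.

Consequences. Paths of cells together with orbits following them form a compact set, so the geodesic
of a code exists, is unique and depends continuously on the code. Codes of one geodesic are
ambiguous only at end points of cells and fibers; an orbit avoids one kind of end point of each at
all times, which leaves at most four codes (`finite_geodesicOf_eq`). With discreteness of the group
this makes the coding finite-to-one, and the special flow follows (`exists_special_flow`).

All hyperbolic geometry is done in ℝ^{1,2}: points of the disk and of the circle become time-like
and light-like vectors, and both the cyclic order at infinity and the sides of geodesics are signs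
of 3 × 3 determinants. -/

theorem ccw_nonneg (a x : Circle) : 0 ≤ ccw a x := (toIcoMod_mem_Ico Real.two_pi_pos 0 _).1

theorem ccw_lt_two_pi (a x : Circle) : ccw a x < 2 * Real.pi := by
  simpa [ccw] using (toIcoMod_mem_Ico Real.two_pi_pos 0 (Complex.arg (x / a : Circle))).2

theorem exp_ccw (a x : Circle) : a * Circle.exp (ccw a x) = x := by
  have h := toIcoMod_add_toIcoDiv_zsmul Real.two_pi_pos 0 (Complex.arg (x / a : Circle))
  have h2 : Circle.exp (ccw a x) = x / a := by
    rw [← Circle.exp_arg (x / a), ← h, Circle.exp_add, Circle.exp_zsmul, Circle.exp_two_pi]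
    simp [ccw]
  rw [h2, mul_div_cancel]

theorem ccw_mul_exp (a : Circle) {t : ℝ} (h0 : 0 ≤ t) (h1 : t < 2 * Real.pi) :
    ccw a (a * Circle.exp t) = t := by
  rw [ccw, toIcoMod_eq_iff]
  refine ⟨⟨h0, by simpa using h1⟩, ?_⟩
  rw [mul_div_cancel_left]
  have h : Circle.exp (Complex.arg (Circle.exp t)) = Circle.exp t := Circle.exp_arg _
  rw [Circle.exp_eq_exp] at h
  obtain ⟨m, hm⟩ := h
  exact ⟨m, by rw [hm]; simp⟩

theorem ccw_injective (a : Circle) : Function.Injective (ccw a) := fun x y h => by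
  rw [← exp_ccw a x, ← exp_ccw a y, h]

theorem ccw_inj {a x y : Circle} : ccw a x = ccw a y ↔ x = y := (ccw_injective a).eq_iff

@[simp] theorem ccw_self (a : Circle) : ccw a a = 0 := by
  simpa using ccw_mul_exp a le_rfl Real.two_pi_pos

theorem ccw_eq_zero {a x : Circle} : ccw a x = 0 ↔ x = a := by
  rw [← ccw_self a, ccw_inj]

theorem ccw_pos {a x : Circle} (h : x ≠ a) : 0 < ccw a x :=
  (ccw_nonneg a x).lt_of_ne fun h' => h (ccw_eq_zero.1 h'.symm)

theorem exp_ccw_sub (c a x : Circle) :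
    a * (Circle.exp (ccw c x) / Circle.exp (ccw c a)) = x := by
  have h1 := exp_ccw c a
  have h2 := exp_ccw c x
  rw [← eq_div_iff_mul_eq''] at h1 h2
  rw [h1, h2, div_div_div_cancel_right, mul_div_cancel]

/-- Change of base point. -/
theorem ccw_of_le {c a x : Circle} (h : ccw c a ≤ ccw c x) : ccw a x = ccw c x - ccw c a := by
  have e : x = a * Circle.exp (ccw c x - ccw c a) := by
    rw [Circle.exp_sub, exp_ccw_sub]
  conv_lhs => rw [e]
  exact ccw_mul_exp _ (by linarith) (by linarith [ccw_nonneg c a, ccw_lt_two_pi c x])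

theorem ccw_of_lt {c a x : Circle} (h : ccw c x < ccw c a) :
    ccw a x = ccw c x - ccw c a + 2 * Real.pi := by
  have e : x = a * Circle.exp (ccw c x - ccw c a + 2 * Real.pi) := by
    rw [Circle.exp_add, Circle.exp_two_pi, mul_one, Circle.exp_sub, exp_ccw_sub]
  conv_lhs => rw [e]
  exact ccw_mul_exp _ (by linarith [ccw_nonneg c x, ccw_lt_two_pi c a]) (by linarith)

theorem mem_arcIcc {a b x : Circle} : x ∈ arcIcc a b ↔ ccw a x ≤ ccw a b := Iff.rfl

theorem mem_arcIco {a b x : Circle} : x ∈ arcIco a b ↔ ccw a x < ccw a b := Iff.rfl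

theorem arcIco_subset_arcIcc (a b : Circle) : arcIco a b ⊆ arcIcc a b := fun x h => le_of_lt (show ccw a x < ccw a b from h)

theorem left_mem_arcIcc (a b : Circle) : a ∈ arcIcc a b := by
  rw [mem_arcIcc, ccw_self]; exact ccw_nonneg _ _

theorem right_mem_arcIcc (a b : Circle) : b ∈ arcIcc a b := le_refl (ccw a b)

theorem left_mem_arcIco {a b : Circle} (h : a ≠ b) : a ∈ arcIco a b := by
  rw [mem_arcIco, ccw_self]; exact ccw_pos h.symm

/-- Seen from a base point from which the arc does not wrap around, membership is a pair of linear
inequalities between angles. This and its variants reduce the arc geometry below to linear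
arithmetic. -/
theorem mem_arcIcc_base (c : Circle) {a b x : Circle} (h : ccw c a ≤ ccw c b) :
    x ∈ arcIcc a b ↔ ccw c a ≤ ccw c x ∧ ccw c x ≤ ccw c b := by
  rw [mem_arcIcc, ccw_of_le h]
  rcases le_or_gt (ccw c a) (ccw c x) with h1 | h1
  · rw [ccw_of_le h1]; simp [h1]
  · rw [ccw_of_lt h1]
    constructor
    · intro h2; linarith [ccw_nonneg c x, ccw_lt_two_pi c b]
    · intro h2; linarith [h2.1]

theorem mem_arcIcc_base_wrap (c : Circle) {a b x : Circle} (h : ccw c b < ccw c a) :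
    x ∈ arcIcc a b ↔ ccw c a ≤ ccw c x ∨ ccw c x ≤ ccw c b := by
  rw [mem_arcIcc, ccw_of_lt h]
  rcases le_or_gt (ccw c a) (ccw c x) with h1 | h1
  · rw [ccw_of_le h1]; simp only [h1, true_or, iff_true]
    linarith [ccw_nonneg c b, ccw_lt_two_pi c x]
  · rw [ccw_of_lt h1]
    constructor
    · intro h2; right; linarith
    · rintro (h2 | h2) <;> linarith

theorem mem_arcIco_base (c : Circle) {a b x : Circle} (h : ccw c a ≤ ccw c b) :
    x ∈ arcIco a b ↔ ccw c a ≤ ccw c x ∧ ccw c x < ccw c b := by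
  rw [mem_arcIco, ccw_of_le h]
  rcases le_or_gt (ccw c a) (ccw c x) with h1 | h1
  · rw [ccw_of_le h1]; simp [h1]
  · rw [ccw_of_lt h1]
    constructor
    · intro h2; linarith [ccw_nonneg c x, ccw_lt_two_pi c b]
    · intro h2; linarith [h2.1]

theorem mem_arcIco_base_wrap (c : Circle) {a b x : Circle} (h : ccw c b < ccw c a) :
    x ∈ arcIco a b ↔ ccw c a ≤ ccw c x ∨ ccw c x < ccw c b := by
  rw [mem_arcIco, ccw_of_lt h]
  rcases le_or_gt (ccw c a) (ccw c x) with h1 | h1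
  · rw [ccw_of_le h1]; simp only [h1, true_or, iff_true]
    linarith [ccw_nonneg c b, ccw_lt_two_pi c x]
  · rw [ccw_of_lt h1]
    constructor
    · intro h2; right; linarith
    · rintro (h2 | h2) <;> linarith

/-! ### Determinants -/

/-- Determinant of three vectors of `ℝ^{1,2} = ℝ × ℂ`. -/
def det3 (X Y Z : ℝ × ℂ) : ℝ :=
  X.1 * (Y.2.re * Z.2.im - Y.2.im * Z.2.re) - Y.1 * (X.2.re * Z.2.im - X.2.im * Z.2.re)
    + Z.1 * (X.2.re * Y.2.im - X.2.im * Y.2.re)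

/-- The light-like vector of a point at infinity. -/
def cvec (x : Circle) : ℝ × ℂ := (1, x)

/-- A time-like vector representing a point of the disk. -/
def dvec (z : UnitDisc) : ℝ × ℂ := (1 + normSq z, 2 * z)

theorem sidePos_eq (p q : Circle) (z : UnitDisc) :
    sidePos p q z = det3 (cvec p) (cvec q) (dvec z) := by
  simp [sidePos, det3, cvec, dvec, normSq_apply]
  ring

theorem det3_add (X Y Z W : ℝ × ℂ) : det3 X Y (Z + W) = det3 X Y Z + det3 X Y W := by
  simp [det3]; ring

theorem det3_smul (X Y Z : ℝ × ℂ) (c : ℝ) : det3 X Y (c • Z) = c * det3 X Y Z := by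
  simp [det3]; ring

theorem det3_rotate (X Y Z : ℝ × ℂ) : det3 X Y Z = det3 Y Z X := by simp only [det3]; ring

theorem det3_swap (X Y Z : ℝ × ℂ) : det3 X Y Z = -det3 Y X Z := by simp only [det3]; ring

@[simp] theorem det3_self_left (X Y : ℝ × ℂ) : det3 X Y X = 0 := by simp only [det3]; ring

@[simp] theorem det3_self_right (X Y : ℝ × ℂ) : det3 X Y Y = 0 := by simp only [det3]; ring

@[simp] theorem det3_self_fst (X Y : ℝ × ℂ) : det3 X X Y = 0 := by simp only [det3]; ring

/-- Half-angle formulas factor the determinant into three sines. Half angles stay in [0, π), so the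
sign of the determinant is the cyclic order of the three points. -/
theorem det3_cvec_mul_exp (a : Circle) (s t : ℝ) :
    det3 (cvec a) (cvec (a * Circle.exp s)) (cvec (a * Circle.exp t))
      = 4 * Real.sin (s / 2) * Real.sin (t / 2) * Real.sin (t / 2 - s / 2) := by
  have ha := a.normSq_coe
  rw [normSq_apply] at ha
  have hs := Real.sin_sq_add_cos_sq (s / 2)
  have ht := Real.sin_sq_add_cos_sq (t / 2)
  have es1 : Real.sin s = 2 * Real.sin (s / 2) * Real.cos (s / 2) := by
    rw [← Real.sin_two_mul]; congr 1; ring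
  have et1 : Real.sin t = 2 * Real.sin (t / 2) * Real.cos (t / 2) := by
    rw [← Real.sin_two_mul]; congr 1; ring
  have es2 : Real.cos s = 1 - 2 * Real.sin (s / 2) ^ 2 := by
    rw [← Real.cos_two_mul_eq_one_sub]; ring_nf
  have et2 : Real.cos t = 1 - 2 * Real.sin (t / 2) ^ 2 := by
    rw [← Real.cos_two_mul_eq_one_sub]; ring_nf
  simp only [det3, cvec, Circle.coe_mul, Circle.coe_exp, mul_re, mul_im, exp_ofReal_mul_I_re,
    exp_ofReal_mul_I_im]
  rw [Real.sin_sub, es1, et1, es2, et2]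
  linear_combination (4 * Real.sin (s / 2) * Real.sin (t / 2) * (Real.sin (t / 2) *
    Real.cos (s / 2) - Real.cos (t / 2) * Real.sin (s / 2))) * ha

theorem det3_cvec (a x y : Circle) : det3 (cvec a) (cvec x) (cvec y)
    = 4 * Real.sin (ccw a x / 2) * Real.sin (ccw a y / 2) * Real.sin (ccw a y / 2 - ccw a x / 2) := by
  rw [← det3_cvec_mul_exp, exp_ccw, exp_ccw]

theorem det3_cvec_pos {a x y : Circle} (h0 : a ≠ x) (h : ccw a x < ccw a y) :
    0 < det3 (cvec a) (cvec x) (cvec y) := by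
  have hx := ccw_pos h0.symm
  have hy := ccw_lt_two_pi a y
  rw [det3_cvec]
  have h1 : 0 < Real.sin (ccw a x / 2) := Real.sin_pos_of_pos_of_lt_pi (by linarith) (by linarith)
  have h2 : 0 < Real.sin (ccw a y / 2) := Real.sin_pos_of_pos_of_lt_pi (by linarith) (by linarith)
  have h3 : 0 < Real.sin (ccw a y / 2 - ccw a x / 2) :=
    Real.sin_pos_of_pos_of_lt_pi (by linarith) (by linarith)
  positivity

theorem det3_cvec_pos_iff {a x y : Circle} :
    0 < det3 (cvec a) (cvec x) (cvec y) ↔ a ≠ x ∧ ccw a x < ccw a y := by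
  refine ⟨fun h => ?_, fun h => det3_cvec_pos h.1 h.2⟩
  have hax : a ≠ x := by rintro rfl; simp at h
  refine ⟨hax, ?_⟩
  by_contra h1
  rcases (not_lt.1 h1).lt_or_eq with h2 | h2
  · have hay : a ≠ y := by rintro rfl; simp at h
    have := det3_cvec_pos hay h2
    rw [det3_rotate, det3_swap, det3_rotate, det3_rotate] at this
    rw [det3_rotate, det3_rotate] at h
    simp only [det3] at h this
    linarith
  · rw [ccw_inj] at h2
    simp [h2] at h

theorem det3_cvec_nonpos_of_mem {u w x : Circle} (h : x ∈ arcIcc u w) :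
    det3 (cvec u) (cvec w) (cvec x) ≤ 0 := by
  by_contra h1
  have := (det3_cvec_pos_iff.1 (not_le.1 h1)).2
  exact absurd h (not_le.2 this)

theorem det3_cvec_neg_iff {u w x : Circle} :
    det3 (cvec u) (cvec w) (cvec x) < 0 ↔ u ≠ x ∧ ccw u x < ccw u w := by
  rw [← det3_cvec_pos_iff]
  simp only [det3]
  constructor <;> intro h <;> linarith

theorem det3_cvec_nonneg_of_mem {u w x : Circle} (h : x ∈ arcIcc w u) :
    0 ≤ det3 (cvec u) (cvec w) (cvec x) := by
  rw [det3_swap]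
  linarith [det3_cvec_nonpos_of_mem h]

theorem eq_or_eq_of_det3_cvec_eq_zero {p q x : Circle} (hpq : p ≠ q)
    (h : det3 (cvec p) (cvec q) (cvec x) = 0) : x = p ∨ x = q := by
  by_contra h1
  push Not at h1
  have hne : ccw p x ≠ ccw p q := fun h2 => h1.2 (ccw_inj.1 h2)
  rcases lt_or_gt_of_ne hne with h2 | h2
  · exact (det3_cvec_neg_iff.2 ⟨h1.1.symm, h2⟩).ne h
  · exact (det3_cvec_pos_iff.2 ⟨hpq, h2⟩).ne' h

end GeodesicCoding

namespace GeodesicCoding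

/-! ### The linear action of `SU(1,1)` on `ℝ^{1,2}` -/

/-- The linear action on `ℝ^{1,2}`. -/
def lorentz (A : SU11) (X : ℝ × ℂ) : ℝ × ℂ :=
  ((normSq (coefA A) + normSq (coefB A)) * X.1 + 2 * (coefA A * conj (coefB A) * X.2).re,
    2 * coefA A * coefB A * X.1 + coefA A ^ 2 * X.2 + coefB A ^ 2 * conj X.2)

theorem lorentz_add (A : SU11) (X Y : ℝ × ℂ) : lorentz A (X + Y) = lorentz A X + lorentz A Y := by
  ext
  · simp [lorentz]; ring
  · simp [lorentz]; ring

theorem lorentz_smul (A : SU11) (c : ℝ) (X : ℝ × ℂ) : lorentz A (c • X) = c • lorentz A X := by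
  ext
  · simp [lorentz]; ring
  · simp [lorentz, pow_two]; ring

/-- The linear map has determinant (|a|² − |b|²)³ = 1. All invariance of sides and cyclic order
comes from here. -/
theorem det3_lorentz (A : SU11) (X Y Z : ℝ × ℂ) :
    det3 (lorentz A X) (lorentz A Y) (lorentz A Z) = det3 X Y Z := by
  have h := mob_normSq_sub A
  have key : det3 (lorentz A X) (lorentz A Y) (lorentz A Z)
      = (normSq (coefA A) - normSq (coefB A)) ^ 3 * det3 X Y Z := by
    simp only [det3, lorentz, normSq_apply, add_re, add_im, mul_re, mul_im, conj_re, conj_im,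
      ofReal_re, ofReal_im, pow_two, re_ofNat, im_ofNat]
    ring
  rw [key, h]; ring

theorem normSq_mden_pos (A : SU11) {z : ℂ} (hz : ‖z‖ ≤ 1) : 0 < normSq (mden A z) :=
  normSq_pos.2 (mob_den_ne_zero A hz)

/-- On these vectors the linear action is the Möbius action with denominators cleared. It is stated
for every complex number so as to serve both the disk and the circle. -/
theorem lorentz_aux (A : SU11) (z : ℂ) : lorentz A (1 + normSq z, 2 * z)
    = (normSq (mden A z) + normSq (mnum A z), 2 * mnum A z * conj (mden A z)) := by
  ext
  · simp [lorentz, mden, mnum, normSq_apply]; ring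
  · simp only [lorentz, mden, mnum, ofReal_add, ofReal_one, normSq_eq_conj_mul_self, map_add,
      map_mul, conj_conj, conj_ofNat]
    ring

theorem lorentz_dvec (A : SU11) (z : UnitDisc) :
    lorentz A (dvec z) = normSq (mden A z) • dvec (A • z) := by
  have hd := mob_den_ne_zero A z.norm_lt_one.le
  have hn : normSq (mden A z) ≠ 0 := (normSq_pos.2 hd).ne'
  rw [dvec, lorentz_aux, dvec, mob_coe_smul_disc]
  refine Prod.ext ?_ ?_
  · simp only [map_div₀, Prod.smul_mk, smul_eq_mul]
    field_simp
  · simp only [Prod.smul_mk, real_smul, normSq_eq_conj_mul_self]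
    field_simp

theorem circle_coe_smul (A : SU11) (w : Circle) : ((A • w : Circle) : ℂ) = mnum A w / mden A w :=
  rfl

theorem lorentz_cvec (A : SU11) (w : Circle) :
    lorentz A (cvec w) = normSq (mden A w) • cvec (A • w) := by
  have hd := mob_den_ne_zero A w.norm_coe.le
  have h1 := mob_normSq_den_sub A w
  rw [w.normSq_coe, sub_self, sub_eq_zero] at h1
  have e : cvec w = (1 / 2 : ℝ) • ((1 : ℝ) + normSq (w : ℂ), 2 * (w : ℂ)) := by
    simp [cvec]; norm_num
  rw [e, lorentz_smul, lorentz_aux, ← h1, cvec, circle_coe_smul]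
  refine Prod.ext ?_ ?_
  · simp only [Prod.smul_mk, smul_eq_mul]; ring
  · simp only [Prod.smul_mk, real_smul, normSq_eq_conj_mul_self]
    push_cast
    field_simp

theorem normSq_mden_circle_pos (A : SU11) (x : Circle) : 0 < normSq (mden A x) :=
  normSq_mden_pos A x.norm_coe.le

theorem det3_cvec_smul (A : SU11) (p q x : Circle) :
    ∃ c > 0, det3 (cvec p) (cvec q) (cvec x)
      = c * det3 (cvec (A • p)) (cvec (A • q)) (cvec (A • x)) := by
  refine ⟨normSq (mden A p) * normSq (mden A q) * normSq (mden A x),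
    mul_pos (mul_pos (normSq_mden_circle_pos A p) (normSq_mden_circle_pos A q))
      (normSq_mden_circle_pos A x), ?_⟩
  rw [← det3_lorentz A, lorentz_cvec, lorentz_cvec, lorentz_cvec]
  simp [det3]; ring

theorem sidePos_smul (A : SU11) (p q : Circle) (z : UnitDisc) :
    ∃ c > 0, sidePos p q z = c * sidePos (A • p) (A • q) (A • z) := by
  refine ⟨normSq (mden A p) * normSq (mden A q) * normSq (mden A z),
    mul_pos (mul_pos (normSq_mden_circle_pos A p) (normSq_mden_circle_pos A q))
      (normSq_mden_pos A z.norm_lt_one.le), ?_⟩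
  rw [sidePos_eq, sidePos_eq, ← det3_lorentz A, lorentz_cvec, lorentz_cvec, lorentz_dvec]
  simp [det3]; ring

theorem sidePos_smul_pos_iff (A : SU11) {p q : Circle} {z : UnitDisc} :
    0 < sidePos (A • p) (A • q) (A • z) ↔ 0 < sidePos p q z := by
  obtain ⟨c, hc, h⟩ := sidePos_smul A p q z
  rw [h, mul_pos_iff_of_pos_left hc]

theorem sidePos_swap (p q : Circle) (z : UnitDisc) : sidePos p q z = -sidePos q p z := by
  rw [sidePos_eq, sidePos_eq, det3_swap]

theorem sidePos_smul_neg_iff (A : SU11) {p q : Circle} {z : UnitDisc} :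
    sidePos (A • p) (A • q) (A • z) < 0 ↔ sidePos p q z < 0 := by
  rw [sidePos_swap, neg_lt_zero, sidePos_smul_pos_iff, sidePos_swap q p, neg_pos]

theorem sidePos_smul_eq_zero_iff (A : SU11) {p q : Circle} {z : UnitDisc} :
    sidePos (A • p) (A • q) (A • z) = 0 ↔ sidePos p q z = 0 := by
  obtain ⟨c, hc, h⟩ := sidePos_smul A p q z
  rw [h]; simp [hc.ne']

/-- Cyclic order is the sign of a determinant, which a Möbius transformation changes by a positive
factor. The degenerate case `a = x`, where the determinant vanishes, is treated apart. -/
theorem ccw_smul_lt_iff (A : SU11) {a x y : Circle} :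
    ccw (A • a) (A • x) < ccw (A • a) (A • y) ↔ ccw a x < ccw a y := by
  by_cases hax : a = x
  · subst hax
    simp only [ccw_self]
    constructor
    · intro h; apply ccw_pos; rintro rfl; simp at h
    · intro h; apply ccw_pos; intro h2; rw [smul_left_cancel A h2] at h; simp at h
  · have h1 : A • a ≠ A • x := fun h => hax (smul_left_cancel A h)
    obtain ⟨c, hc, h⟩ := det3_cvec_smul A a x y
    have e1 := det3_cvec_pos_iff (a := a) (x := x) (y := y)
    have e2 := det3_cvec_pos_iff (a := A • a) (x := A • x) (y := A • y)
    rw [h, mul_pos_iff_of_pos_left hc, e2] at e1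
    simpa [hax] using e1

theorem ccw_smul_le_iff (A : SU11) {a x y : Circle} :
    ccw (A • a) (A • x) ≤ ccw (A • a) (A • y) ↔ ccw a x ≤ ccw a y := by
  rw [← not_lt, ccw_smul_lt_iff, not_lt]

theorem smul_mem_arcIcc (A : SU11) {a b x : Circle} :
    A • x ∈ arcIcc (A • a) (A • b) ↔ x ∈ arcIcc a b := ccw_smul_le_iff A

theorem smul_mem_arcIco (A : SU11) {a b x : Circle} :
    A • x ∈ arcIco (A • a) (A • b) ↔ x ∈ arcIco a b := ccw_smul_lt_iff A

/-! ### Elements acting trivially -/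

/-- Evaluation at 0 gives b = 0 and at 1/2 gives that a is real. The relations of the group are
assumed on the disk only, and this carries them over to the circle and to tangent vectors. -/
theorem eq_one_or_neg_one_of_smul_eq (A : SU11) (h : ∀ z : UnitDisc, A • z = z) :
    coefB A = 0 ∧ (coefA A = 1 ∨ coefA A = -1) := by
  have key : ∀ z : UnitDisc, mnum A z = z * mden A z := fun z => by
    have h1 := congrArg UnitDisc.coe (h z)
    rw [mob_coe_smul_disc, div_eq_iff (mob_den_ne_zero A z.norm_lt_one.le)] at h1
    exact h1
  have h0 := key 0
  simp only [mnum, mden, UnitDisc.coe_zero, mul_zero, zero_add, zero_mul] at h0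
  have h1 := key (UnitDisc.mk (1 / 2) (by norm_num))
  simp only [mnum, mden, h0, UnitDisc.coe_mk, map_zero, zero_mul, add_zero, zero_add] at h1
  have h2 : conj (coefA A) = coefA A := by linear_combination -2 * h1
  have h3 := mob_normSq_sub A
  rw [h0, map_zero, sub_zero] at h3
  refine ⟨h0, ?_⟩
  have h4 : coefA A * coefA A = 1 := by
    have h5 := normSq_eq_conj_mul_self (z := coefA A)
    rw [h3, h2] at h5
    simpa using h5.symm
  exact mul_self_eq_one_iff.1 h4

theorem circle_smul_eq_of_trivial {A : SU11} (h : ∀ z : UnitDisc, A • z = z) (x : Circle) :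
    A • x = x := by
  apply Circle.coe_injective
  rw [circle_coe_smul]
  obtain ⟨h0, h1 | h1⟩ := eq_one_or_neg_one_of_smul_eq A h <;> simp [mnum, mden, h0, h1]

theorem tangent_smul_eq_of_trivial {A : SU11} (h : ∀ z : UnitDisc, A • z = z) (v : UnitTangent) :
    A • v = v := by
  apply UnitTangent.ext
  · exact h _
  · apply Circle.coe_injective
    change (v.dir : ℂ) * (conj (mden A v.base) / mden A v.base) = v.dir
    obtain ⟨h0, h1 | h1⟩ := eq_one_or_neg_one_of_smul_eq A h <;> simp [mden, h0, h1]

end GeodesicCoding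

namespace GeodesicCoding

/-! ### Hopf coordinates on the unit tangent bundle -/

theorem den_endpoint_ne_zero (z : UnitDisc) (ζ : Circle) : 1 + conj (z : ℂ) * ζ ≠ 0 := by
  simpa using den_flow_ne_zero z ζ (s := 1) (by simp)

theorem one_sub_conj_mul_ne_zero (z : UnitDisc) : (1 : ℂ) - conj (z : ℂ) * z ≠ 0 := by
  rw [← normSq_eq_conj_mul_self]
  have := z.normSq_lt_one
  exact_mod_cast (sub_pos.2 this).ne'

theorem circle_mul_conj (ζ : Circle) : (ζ : ℂ) * conj (ζ : ℂ) = 1 := by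
  rw [mul_conj, Circle.normSq_coe, ofReal_one]

theorem endpoint_coe (z : UnitDisc) (ζ : Circle) :
    ((endpoint z ζ : Circle) : ℂ) = (z + ζ) / (1 + conj (z : ℂ) * ζ) := by
  change (ζ : ℂ) * (conj (1 + conj (z : ℂ) * ζ * (1 : ℝ)) / (1 + conj (z : ℂ) * ζ * (1 : ℝ))) = _
  rw [ofReal_one, mul_one, ← mul_div_assoc, map_add, map_mul, conj_conj, map_one]
  congr 1
  linear_combination (z : ℂ) * circle_mul_conj ζ

theorem endpoint_neg_coe (z : UnitDisc) (ζ : Circle) :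
    ((endpoint z (-ζ) : Circle) : ℂ) = (z - ζ) / (1 - conj (z : ℂ) * ζ) := by
  rw [endpoint_coe, Circle.coe_neg]
  ring_nf

theorem den_endpoint_neg_ne_zero (z : UnitDisc) (ζ : Circle) : 1 - conj (z : ℂ) * ζ ≠ 0 := by
  have := den_endpoint_ne_zero z (-ζ)
  rwa [Circle.coe_neg, mul_neg, ← sub_eq_add_neg] at this

theorem endpoint_injective (z : UnitDisc) : Function.Injective (endpoint z) := by
  intro ζ ξ h
  have h1 := congrArg (fun x : Circle => (x : ℂ)) h
  rw [endpoint_coe, endpoint_coe, div_eq_div_iff (den_endpoint_ne_zero z ζ)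
    (den_endpoint_ne_zero z ξ)] at h1
  apply Circle.coe_injective
  have h2 : ((ζ : ℂ) - ξ) * (1 - conj (z : ℂ) * z) = 0 := by linear_combination h1
  rcases mul_eq_zero.1 h2 with h3 | h3
  · exact sub_eq_zero.1 h3
  · exact absurd h3 (one_sub_conj_mul_ne_zero z)

theorem endpoint_surjective (z : UnitDisc) : Function.Surjective (endpoint z) := by
  intro w
  refine ⟨-endpoint z (-w), ?_⟩
  apply Circle.coe_injective
  have h1 := den_endpoint_neg_ne_zero z w
  have h2 := one_sub_conj_mul_ne_zero z
  have h3 : (1 : ℂ) + conj (z : ℂ) * -((z - w) / (1 - conj (z : ℂ) * w)) ≠ 0 := by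
    have := den_endpoint_ne_zero z (-endpoint z (-w))
    rwa [Circle.coe_neg, endpoint_neg_coe] at this
  rw [endpoint_coe, Circle.coe_neg, endpoint_neg_coe, div_eq_iff h3]
  set y := conj (z : ℂ)
  have h5 : ((z : ℂ) - w) / (1 - y * w) * (1 - y * w) = z - w := div_mul_cancel₀ _ h1
  apply mul_right_cancel₀ h1
  linear_combination (w * y - 1) * h5

theorem ends_ne (v : UnitTangent) : (ends v).1 ≠ (ends v).2 := by
  intro h
  have h1 := endpoint_injective _ h
  have h2 := congrArg (fun x : Circle => (x : ℂ)) h1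
  rw [Circle.coe_neg] at h2
  have h3 : (v.dir : ℂ) = 0 := by linear_combination -(1 / 2) * h2
  exact v.dir.coe_ne_zero h3

theorem ends_smul (A : SU11) (v : UnitTangent) :
    ends (A • v) = (A • (ends v).1, A • (ends v).2) := by
  have key : ∀ (z : UnitDisc) (ζ : Circle), endpoint (A • z) (ζ * Circle.ofConjDivSelf (mden A z)
      (mob_den_ne_zero A z.norm_lt_one.le)) = A • endpoint z ζ := fun z ζ => by
    apply Circle.coe_injective
    have hd := mob_den_ne_zero A z.norm_lt_one.le
    have hE := den_endpoint_ne_zero z ζ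
    have h1 := den_endpoint_ne_zero (A • z) (ζ * Circle.ofConjDivSelf (mden A z) hd)
    have h2 := mob_den_ne_zero A (endpoint z ζ).norm_coe.le
    have e : (Circle.ofConjDivSelf (mden A z) hd : ℂ) = conj (mden A z) / mden A z := rfl
    rw [endpoint_coe, circle_coe_smul, div_eq_div_iff h1 h2, Circle.coe_mul, e, mob_coe_smul_disc,
      map_div₀]
    have hcd : conj (mden A z) ≠ 0 := by simpa using hd
    have e2 : mden A (endpoint z ζ) * (1 + conj (z : ℂ) * ζ)
        = mden A z + conj (mnum A z) * ζ := by
      rw [endpoint_coe, mden, add_mul, mul_assoc, div_mul_cancel₀ _ hE]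
      simp only [mnum, mden, map_add, map_mul]
      ring
    have e1 : mnum A (endpoint z ζ) * (1 + conj (z : ℂ) * ζ) = mnum A z + conj (mden A z) * ζ := by
      rw [endpoint_coe, mnum, add_mul, mul_assoc, div_mul_cancel₀ _ hE]
      simp only [mnum, mden, map_add, map_mul, conj_conj]
      ring
    rw [← eq_div_iff hE] at e1 e2
    rw [e1, e2]
    field_simp
  refine Prod.ext ?_ (key _ _)
  change _ = A • endpoint _ _
  rw [← key]
  change endpoint _ (-(v.dir * _)) = endpoint _ (-v.dir * _)
  congr 1
  apply Circle.coe_injective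
  simp

/-- With s = tanh(t/2), clearing the denominator of the flow turns base ± direction into (1 ± s)(z ±
ζ). The denominators of the end points pick up the same factor 1 ± s, so the quotients do not
change. -/
theorem ends_diskFlow (t : ℝ) (v : UnitTangent) : ends (diskFlow t v) = ends v := by
  obtain ⟨z, ζ⟩ := v
  set s : ℝ := Real.tanh (t / 2) with hs
  have hs' := abs_lt.1 (abs_tanh_lt_one (t / 2))
  have hD := den_flow_ne_zero z ζ (abs_tanh_lt_one (t / 2)).le
  rw [← hs] at hs' hD
  have hcD : conj (1 + conj (z : ℂ) * ζ * s) ≠ 0 := (map_ne_zero _).2 hD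
  have auxp : ∀ N D x c : ℂ, D ≠ 0 → (N / D + x * (c / D)) * D = N + x * c := by
    intros; field_simp
  have auxs : ∀ N D x c : ℂ, D ≠ 0 → (N / D - x * (c / D)) * D = N - x * c := by
    intros; field_simp
  have auxm : ∀ N D x c : ℂ, D ≠ 0 → c ≠ 0 → N / c * (x * (c / D)) * D = N * x := by
    intros; field_simp
  have eb : ((diskFlow t ⟨z, ζ⟩).base : ℂ) = (z + ζ * s) / (1 + conj (z : ℂ) * ζ * s) := rfl
  have ed : ((diskFlow t ⟨z, ζ⟩).dir : ℂ)
      = ζ * (conj (1 + conj (z : ℂ) * ζ * s) / (1 + conj (z : ℂ) * ζ * s)) := rfl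
  have hc : conj (1 + conj (z : ℂ) * ζ * s) * ζ = ζ + z * s := by
    simp only [map_add, map_one, map_mul, conj_conj, conj_ofReal]
    linear_combination (z : ℂ) * s * circle_mul_conj ζ
  have hm : conj ((diskFlow t ⟨z, ζ⟩).base : ℂ) * (diskFlow t ⟨z, ζ⟩).dir
      * (1 + conj (z : ℂ) * ζ * s) = conj (z : ℂ) * ζ + s := by
    rw [eb, ed, map_div₀, auxm _ _ _ _ hD hcD]
    simp only [map_add, map_mul, conj_ofReal]
    linear_combination (s : ℂ) * circle_mul_conj ζ
  have e1 : ((diskFlow t ⟨z, ζ⟩).base + (diskFlow t ⟨z, ζ⟩).dir : ℂ) * (1 + conj (z : ℂ) * ζ * s)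
      = (1 + s) * (z + ζ) := by
    rw [eb, ed, auxp _ _ _ _ hD]
    linear_combination hc
  have e2 : ((diskFlow t ⟨z, ζ⟩).base - (diskFlow t ⟨z, ζ⟩).dir : ℂ) * (1 + conj (z : ℂ) * ζ * s)
      = (1 - s) * (z - ζ) := by
    rw [eb, ed, auxs _ _ _ _ hD]
    linear_combination -hc
  have hp : (1 : ℂ) + s ≠ 0 := by exact_mod_cast (show (1 : ℝ) + s ≠ 0 by linarith)
  have hm' : (1 : ℂ) - s ≠ 0 := by exact_mod_cast (show (1 : ℝ) - s ≠ 0 by linarith)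
  have q1 := den_endpoint_ne_zero (diskFlow t ⟨z, ζ⟩).base (diskFlow t ⟨z, ζ⟩).dir
  have q2 := den_endpoint_neg_ne_zero (diskFlow t ⟨z, ζ⟩).base (diskFlow t ⟨z, ζ⟩).dir
  refine Prod.ext ?_ ?_ <;> apply Circle.coe_injective
  · change ((endpoint _ (-_) : Circle) : ℂ) = (endpoint _ (-_) : Circle)
    rw [endpoint_neg_coe, endpoint_neg_coe, div_eq_div_iff q2 (den_endpoint_neg_ne_zero z ζ)]
    apply mul_right_cancel₀ hD
    linear_combination (1 - conj (z : ℂ) * ζ) * e2 + (z - ζ : ℂ) * hm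
  · change ((endpoint _ _ : Circle) : ℂ) = (endpoint _ _ : Circle)
    rw [endpoint_coe, endpoint_coe, div_eq_div_iff q1 (den_endpoint_ne_zero z ζ)]
    apply mul_right_cancel₀ hD
    linear_combination (1 + conj (z : ℂ) * ζ) * e1 - (z + ζ : ℂ) * hm

/-- The third Hopf coordinate: the base point of `v` is represented by `u + hopf v • w`. -/
def hopf (v : UnitTangent) : ℝ :=
  normSq (1 + conj (v.base : ℂ) * v.dir) / normSq (1 - conj (v.base : ℂ) * v.dir)

theorem hopf_pos (v : UnitTangent) : 0 < hopf v :=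
  div_pos (normSq_pos.2 (den_endpoint_ne_zero _ _)) (normSq_pos.2 (den_endpoint_neg_ne_zero _ _))

theorem normSq_smul_cvec_endpoint (z : UnitDisc) (ζ : Circle) :
    normSq (1 + conj (z : ℂ) * ζ) • cvec (endpoint z ζ)
      = dvec z + (2 * (conj (z : ℂ) * ζ).re, (ζ : ℂ) + (z : ℂ) ^ 2 * conj (ζ : ℂ)) := by
  have h := den_endpoint_ne_zero z ζ
  have hz := ζ.normSq_coe
  refine Prod.ext ?_ ?_
  · simp only [cvec, dvec, Prod.smul_mk, Prod.mk_add_mk, smul_eq_mul, normSq_apply] at hz ⊢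
    simp only [add_re, one_re, mul_re, conj_re, conj_im, add_im, one_im, mul_im]
    linear_combination ((z : ℂ).re ^ 2 + (z : ℂ).im ^ 2) * hz
  · simp only [cvec, dvec, Prod.smul_mk, Prod.mk_add_mk, real_smul, normSq_eq_conj_mul_self,
      endpoint_coe]
    rw [mul_assoc, mul_div_cancel₀ _ h]
    simp only [map_add, map_one, map_mul, conj_conj]
    linear_combination (z : ℂ) * circle_mul_conj ζ

theorem normSq_smul_cvec_endpoint_neg (z : UnitDisc) (ζ : Circle) :
    normSq (1 - conj (z : ℂ) * ζ) • cvec (endpoint z (-ζ))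
      = dvec z - (2 * (conj (z : ℂ) * ζ).re, (ζ : ℂ) + (z : ℂ) ^ 2 * conj (ζ : ℂ)) := by
  have h := normSq_smul_cvec_endpoint z (-ζ)
  rw [Circle.coe_neg] at h
  rw [sub_eq_add_neg (1 : ℂ), ← mul_neg, h]
  refine Prod.ext ?_ ?_
  · simp [dvec]; ring
  · simp [dvec]; ring

theorem exists_dvec_eq (v : UnitTangent) :
    ∃ c > (0 : ℝ), dvec v.base = c • (cvec (ends v).1 + hopf v • cvec (ends v).2) := by
  have h1 := normSq_smul_cvec_endpoint v.base v.dir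
  have h2 := normSq_smul_cvec_endpoint_neg v.base v.dir
  have p1 := normSq_pos.2 (den_endpoint_ne_zero v.base v.dir)
  have p2 := normSq_pos.2 (den_endpoint_neg_ne_zero v.base v.dir)
  refine ⟨normSq (1 - conj (v.base : ℂ) * v.dir) / 2, by positivity, ?_⟩
  rw [hopf, ends, smul_add, smul_smul, div_mul_div_comm, mul_comm _ (normSq (1 + _)),
    mul_div_mul_right _ _ p2.ne', div_eq_inv_mul, div_eq_inv_mul, mul_smul, mul_smul, h1, h2]
  module

/-- Comparing the two components gives a quadratic equation in the factor `c`. One root is 1; the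
other belongs to the inverse point outside the disk. -/
theorem dvec_injective_ray {z z' : UnitDisc} {c : ℝ} (h : dvec z = c • dvec z') : z = z' := by
  have h1 := congrArg Prod.fst h
  have h2 := congrArg Prod.snd h
  simp only [dvec, Prod.smul_mk, smul_eq_mul, real_smul] at h1 h2
  have h3 : (z : ℂ) = c * z' := by linear_combination h2 / 2
  have h4 : normSq (z : ℂ) = c ^ 2 * normSq (z' : ℂ) := by
    rw [h3, normSq_mul, normSq_ofReal]; ring
  have hz := z.normSq_lt_one
  have hz' := z'.normSq_lt_one
  have h5 : (1 - c) * (1 - c * normSq (z' : ℂ)) = 0 := by linear_combination h1 - h4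
  rcases mul_eq_zero.1 h5 with h6 | h6
  · have : c = 1 := by linarith
    apply UnitDisc.coe_injective
    rw [h3, this]; simp
  · exfalso
    nlinarith [normSq_nonneg (z : ℂ), normSq_nonneg (z' : ℂ)]

theorem unitTangent_ext_hopf {v v' : UnitTangent} (h : ends v = ends v') (h' : hopf v = hopf v') :
    v = v' := by
  obtain ⟨c, hc, e⟩ := exists_dvec_eq v
  obtain ⟨c', hc', e'⟩ := exists_dvec_eq v'
  rw [h, h'] at e
  have hb : v.base = v'.base := by
    apply dvec_injective_ray (c := c / c')
    rw [e, e', smul_smul, div_mul_cancel₀ _ hc'.ne']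
  refine UnitTangent.ext hb ?_
  have h2 := congrArg Prod.snd h
  simp only [ends, hb] at h2
  exact endpoint_injective _ h2

theorem cvec_comb_unique {u w : Circle} (h : u ≠ w) {a b a' b' : ℝ}
    (e : a • cvec u + b • cvec w = a' • cvec u + b' • cvec w) : a = a' ∧ b = b' := by
  have h1 := congrArg Prod.fst e
  have h2 := congrArg Prod.snd e
  simp only [cvec, Prod.smul_mk, Prod.mk_add_mk, smul_eq_mul, mul_one, real_smul] at h1 h2
  have h3 : ((a - a' : ℝ) : ℂ) * ((u : ℂ) - w) = 0 := by
    have : (b : ℂ) = a' + b' - a := by exact_mod_cast (by linarith : b = a' + b' - a)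
    rw [this] at h2
    push_cast
    linear_combination h2
  rcases mul_eq_zero.1 h3 with h4 | h4
  · have : a - a' = 0 := by exact_mod_cast h4
    exact ⟨by linarith, by linarith⟩
  · exact absurd (Circle.coe_injective (sub_eq_zero.1 h4)) h

/-- In the basis of the two light-like end vectors the flow is a boost: the coefficients are scaled
by (1 − s)² and (1 + s)² with s = tanh(t/2), and the ratio of these is e^{2t}. -/
theorem hopf_diskFlow (t : ℝ) (v : UnitTangent) :
    hopf (diskFlow t v) = hopf v * Real.exp (2 * t) := by
  set s : ℝ := Real.tanh (t / 2) with hs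
  have hs' := abs_lt.1 (abs_tanh_lt_one (t / 2))
  have hD := den_flow_ne_zero v.base v.dir (abs_tanh_lt_one (t / 2)).le
  rw [← hs] at hs' hD
  have hN := normSq_pos.2 hD
  have hexp : Real.exp (2 * t) = (1 + s) ^ 2 / (1 - s) ^ 2 := by
    have h1 : (1 : ℝ) + s = 2 * Real.exp (t / 2) / (Real.exp (t / 2) + Real.exp (-(t / 2))) := by
      rw [hs, Real.tanh_eq]
      field_simp
      ring
    have h2 : (1 : ℝ) - s = 2 * Real.exp (-(t / 2)) / (Real.exp (t / 2) + Real.exp (-(t / 2))) := by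
      rw [hs, Real.tanh_eq]
      field_simp
      ring
    rw [h1, h2, ← div_pow, div_div_div_cancel_right₀ (by positivity), mul_div_mul_left _ _ two_ne_zero,
      ← Real.exp_sub, ← Real.exp_nat_mul]
    congr 1; push_cast; ring
  have key : normSq (1 + conj (v.base : ℂ) * v.dir * s) • dvec (diskFlow t v).base
      = (1 + s ^ 2) • dvec v.base + (2 * s) • ((2 * (conj (v.base : ℂ) * v.dir).re,
        (v.dir : ℂ) + (v.base : ℂ) ^ 2 * conj (v.dir : ℂ)) : ℝ × ℂ) := by
    have eb : ((diskFlow t v).base : ℂ)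
      = (v.base + v.dir * s) / (1 + conj (v.base : ℂ) * v.dir * s) := rfl
    have hz := v.dir.normSq_coe
    refine Prod.ext ?_ ?_
    · simp only [dvec, Prod.smul_mk, Prod.mk_add_mk, smul_eq_mul, eb, map_div₀]
      rw [mul_add, mul_div_cancel₀ _ hN.ne']
      simp only [normSq_apply, add_re, one_re, mul_re, conj_re, conj_im, add_im, one_im, mul_im,
        ofReal_re, ofReal_im] at hz ⊢
      linear_combination (((v.base : ℂ).re ^ 2 + (v.base : ℂ).im ^ 2 + 1) * s ^ 2) * hz
    · simp only [dvec, Prod.smul_mk, Prod.mk_add_mk, real_smul, normSq_eq_conj_mul_self, eb]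
      rw [mul_assoc, mul_left_comm _ (2 : ℂ), mul_div_cancel₀ _ hD]
      simp only [map_add, map_one, map_mul, conj_conj, conj_ofReal]
      push_cast
      linear_combination 2 * (v.base : ℂ) * s ^ 2 * circle_mul_conj v.dir
  obtain ⟨c, hc, e⟩ := exists_dvec_eq (diskFlow t v)
  rw [ends_diskFlow] at e
  have h1 := normSq_smul_cvec_endpoint v.base v.dir
  have h2 := normSq_smul_cvec_endpoint_neg v.base v.dir
  have p1 := normSq_pos.2 (den_endpoint_ne_zero v.base v.dir)
  have p2 := normSq_pos.2 (den_endpoint_neg_ne_zero v.base v.dir)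
  have e2 : (2 * normSq (1 + conj (v.base : ℂ) * v.dir * s)) • dvec (diskFlow t v).base
      = ((1 - s) ^ 2 * normSq (1 - conj (v.base : ℂ) * v.dir)) • cvec (ends v).1
        + ((1 + s) ^ 2 * normSq (1 + conj (v.base : ℂ) * v.dir)) • cvec (ends v).2 := by
    rw [mul_smul, key, mul_smul ((1 - s) ^ 2), mul_smul ((1 + s) ^ 2)]
    rw [show (ends v).1 = endpoint v.base (-v.dir) from rfl,
      show (ends v).2 = endpoint v.base v.dir from rfl, h1, h2]
    module
  rw [e, smul_smul, smul_add, smul_smul] at e2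
  obtain ⟨q1, q2⟩ := cvec_comb_unique (ends_ne v) e2
  rw [q1] at q2
  have hs1 : 0 < (1 - s) ^ 2 := by have : 0 < 1 - s := by linarith
                                   positivity
  rw [hexp, hopf.eq_1 v, div_mul_div_comm, eq_div_iff (mul_pos p2 hs1).ne']
  linear_combination q2

theorem diskFlow_add (s t : ℝ) (v : UnitTangent) :
    diskFlow (s + t) v = diskFlow t (diskFlow s v) := by
  apply unitTangent_ext_hopf
  · simp only [ends_diskFlow]
  · simp only [hopf_diskFlow]
    rw [mul_add, Real.exp_add]; ring

theorem diskFlow_zero (v : UnitTangent) : diskFlow 0 v = v := by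
  apply unitTangent_ext_hopf
  · simp only [ends_diskFlow]
  · simp [hopf_diskFlow]

theorem exists_diskFlow_eq {v v' : UnitTangent} (h : ends v = ends v') :
    ∃ t, v' = diskFlow t v := by
  have h1 := hopf_pos v
  have h2 := hopf_pos v'
  refine ⟨Real.log (hopf v' / hopf v) / 2, ?_⟩
  apply unitTangent_ext_hopf
  · rw [ends_diskFlow, h]
  · rw [hopf_diskFlow, mul_div_cancel₀ _ two_ne_zero, Real.exp_log (div_pos h2 h1)]
    field_simp

theorem exists_tangent (z : UnitDisc) (w : Circle) : ∃ v, v.base = z ∧ (ends v).2 = w := by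
  obtain ⟨ζ, h⟩ := endpoint_surjective z w
  exact ⟨⟨z, ζ⟩, rfl, h⟩

theorem exists_tangent_of_sidePos {u w : Circle} (h : u ≠ w) {z : UnitDisc}
    (hz : sidePos u w z = 0) : ∃ v, v.base = z ∧ ends v = (u, w) := by
  obtain ⟨v, hv, hw⟩ := exists_tangent z w
  refine ⟨v, hv, Prod.ext ?_ hw⟩
  obtain ⟨c, hc, e⟩ := exists_dvec_eq v
  rw [sidePos_eq, ← hv, e, det3_smul, det3_add, det3_smul, hw] at hz
  simp only [det3_self_right, mul_zero, add_zero, mul_eq_zero, hc.ne', false_or] at hz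
  rcases eq_or_eq_of_det3_cvec_eq_zero h hz with h1 | h1
  · exact h1
  · exact absurd (h1.trans hw.symm) (ends_ne v)

theorem sidePos_ends (v : UnitTangent) : sidePos (ends v).1 (ends v).2 v.base = 0 := by
  obtain ⟨c, hc, e⟩ := exists_dvec_eq v
  rw [sidePos_eq, e, det3_smul, det3_add, det3_smul]
  simp

theorem dvec_comb {p q : Circle} (h : p ≠ q) {z : UnitDisc} (hz : sidePos p q z = 0) :
    ∃ a > (0 : ℝ), ∃ b > (0 : ℝ), dvec z = a • cvec p + b • cvec q := by
  obtain ⟨v, rfl, h2⟩ := exists_tangent_of_sidePos h hz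
  obtain ⟨c, hc, e⟩ := exists_dvec_eq v
  rw [h2] at e
  refine ⟨c, hc, c * hopf v, mul_pos hc (hopf_pos v), ?_⟩
  rw [e, smul_add, smul_smul]

/-- Every future-directed time-like vector represents a point of the disk. -/
theorem exists_dvec_of_timelike {X : ℝ × ℂ} (h : ‖X.2‖ < X.1) :
    ∃ z : UnitDisc, ∃ c > (0 : ℝ), X = c • dvec z := by
  -- The change of models z ↦ (1 + |z|², 2z) is inverted up to scale by z = X₂ / (X₁ + √(X₁² −
  -- |X₂|²)).
  set q := Real.sqrt (X.1 ^ 2 - ‖X.2‖ ^ 2) with hq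
  have hn := norm_nonneg X.2
  have hX : 0 < X.1 := by linarith
  have hq2 : q ^ 2 = X.1 ^ 2 - ‖X.2‖ ^ 2 := Real.sq_sqrt (by nlinarith)
  have hq0 : 0 ≤ q := Real.sqrt_nonneg _
  have hm : 0 < X.1 + q := by linarith
  have hnorm : ‖X.2 / ((X.1 + q : ℝ) : ℂ)‖ = ‖X.2‖ / (X.1 + q) := by
    rw [norm_div, norm_real, Real.norm_of_nonneg hm.le]
  refine ⟨UnitDisc.mk (X.2 / ((X.1 + q : ℝ) : ℂ)) ?_, (X.1 + q) / 2, by positivity, ?_⟩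
  · rw [hnorm, div_lt_one hm]; linarith
  · refine Prod.ext ?_ ?_
    · simp only [dvec, UnitDisc.coe_mk, Prod.smul_mk, smul_eq_mul, normSq_eq_norm_sq, hnorm]
      field_simp
      nlinarith
    · simp only [dvec, UnitDisc.coe_mk, Prod.smul_mk, real_smul]
      have : ((X.1 + q : ℝ) : ℂ) ≠ 0 := by exact_mod_cast hm.ne'
      push_cast at this ⊢
      field_simp

theorem norm_dvec_lt (z : UnitDisc) : ‖(dvec z).2‖ < (dvec z).1 := by
  simp only [dvec, norm_mul, Complex.norm_ofNat, normSq_eq_norm_sq]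
  nlinarith [z.norm_lt_one]

theorem exists_dvec_add_eq {a b : ℝ} (ha : 0 < a) (hb : 0 ≤ b) (z : UnitDisc) {X : ℝ × ℂ}
    (hX : ‖X.2‖ ≤ X.1) : ∃ z' : UnitDisc, ∃ c > (0 : ℝ), a • dvec z + b • X = c • dvec z' := by
  apply exists_dvec_of_timelike
  have h := norm_dvec_lt z
  calc ‖(a • dvec z + b • X).2‖ ≤ ‖a • (dvec z).2‖ + ‖b • X.2‖ := norm_add_le _ _
    _ = a * ‖(dvec z).2‖ + b * ‖X.2‖ := by
      rw [norm_smul, norm_smul, Real.norm_of_nonneg ha.le, Real.norm_of_nonneg hb]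
    _ < a * (dvec z).1 + b * X.1 :=
      add_lt_add_of_lt_of_le (mul_lt_mul_of_pos_left h ha) (mul_le_mul_of_nonneg_left hX hb)

theorem norm_cvec_le (x : Circle) : ‖(cvec x).2‖ ≤ (cvec x).1 := (x.norm_coe).le

/-- The tangent vector with given end points and given third Hopf coordinate. -/
theorem exists_tangent_hopf {u w : Circle} (h : u ≠ w) {s : ℝ} (hs : 0 < s) :
    ∃ v, ends v = (u, w) ∧ hopf v = s := by
  have : ∃ z, ∃ c > (0 : ℝ), cvec u + s • cvec w = c • dvec z := by
    apply exists_dvec_of_timelike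
    have h1 : ‖(u : ℂ) + s * w‖ < 1 + s := by
      have h2 : normSq ((u : ℂ) + s * w) < (1 + s) ^ 2 := by
        have hu := u.normSq_coe
        have hw := w.normSq_coe
        have huw : 0 < normSq ((u : ℂ) - w) :=
          normSq_pos.2 fun h3 => h (Circle.coe_injective (sub_eq_zero.1 h3))
        simp only [normSq_apply, add_re, add_im, sub_re, sub_im, mul_re, mul_im, ofReal_re,
          ofReal_im] at hu hw huw ⊢
        nlinarith [mul_pos hs huw]
      rw [normSq_eq_norm_sq] at h2
      exact lt_of_pow_lt_pow_left₀ 2 (by linarith) h2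
    simpa [cvec] using h1
  obtain ⟨z, c, hc, e⟩ := this
  have hz : sidePos u w z = 0 := by
    have e2 : dvec z = c⁻¹ • (cvec u + s • cvec w) := by
      rw [e, smul_smul, inv_mul_cancel₀ hc.ne', one_smul]
    rw [sidePos_eq, e2, det3_smul, det3_add, det3_smul]
    simp
  obtain ⟨v, hv, he⟩ := exists_tangent_of_sidePos h hz
  refine ⟨v, he, ?_⟩
  obtain ⟨c', hc', e'⟩ := exists_dvec_eq v
  rw [he, hv] at e'
  rw [e', smul_smul, smul_add, smul_smul] at e
  have e3 := (congrArg (· + s • cvec w) (one_smul ℝ (cvec u))).trans e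
  obtain ⟨h1, h2⟩ := cvec_comb_unique h e3
  rw [← h1, one_mul] at h2
  exact h2.symm

/-- Reversal of a tangent vector. -/
theorem exists_reverse (v : UnitTangent) :
    ∃ v', v'.base = v.base ∧ ends v' = ((ends v).2, (ends v).1) := by
  apply exists_tangent_of_sidePos (ends_ne v).symm
  rw [sidePos_swap, sidePos_ends, neg_zero]

end GeodesicCoding

namespace GeodesicCoding

/-! ### Arithmetic of the side labels -/

section Index

variable {g : ℕ} [hg : Fact (2 ≤ g)]

instance : NeZero (8 * g - 4) := ⟨by have := hg.out; omega⟩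

theorem twelve_le (g : ℕ) [hg : Fact (2 ≤ g)] : 12 ≤ 8 * g - 4 := by have := hg.out; omega

/-- The parity of a label. -/
def parity (i : Idx g) : ZMod 2 := ZMod.castHom (show 2 ∣ 8 * g - 4 by omega) (ZMod 2) i

/-- The only relation in the ring of labels; identities between σ, ρ and τ are linear consequences
of it. -/
theorem eight_mul_idx (g : ℕ) [hg : Fact (2 ≤ g)] : 8 * (g : Idx g) = 4 := by
  have h := hg.out
  have h1 : ((8 * g - 4 : ℕ) : Idx g) = 0 := ZMod.natCast_self _
  rw [Nat.cast_sub (by omega)] at h1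
  push_cast at h1
  linear_combination h1

theorem odd_val_iff (i : Idx g) : Odd i.val ↔ parity i = 1 := by
  rw [← ZMod.natCast_eq_one_iff_odd]
  conv_rhs => rw [parity, ← ZMod.natCast_zmod_val i, map_natCast]

theorem parity_add (i j : Idx g) : parity (i + j) = parity i + parity j := map_add _ _ _
theorem parity_sub (i j : Idx g) : parity (i - j) = parity i - parity j := map_sub _ _ _
theorem parity_one : parity (1 : Idx g) = 1 := map_one _
theorem parity_two : parity (2 : Idx g) = 0 := by
  rw [parity, map_ofNat]; rfl
theorem parity_four_mul : parity (4 * (g : Idx g)) = 0 := by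
  rw [parity, map_mul, map_ofNat, show (4 : ZMod 2) = 0 from rfl, zero_mul]

theorem parity_cases (i : Idx g) : parity i = 0 ∨ parity i = 1 := by
  generalize parity i = x
  revert x; decide

theorem sig_of_one {i : Idx g} (h : parity i = 1) : sig i = 4 * (g : Idx g) - i := by
  rw [sig, if_pos ((odd_val_iff i).2 h)]

theorem sig_of_zero {i : Idx g} (h : parity i = 0) : sig i = 2 - i := by
  rw [sig, if_neg]
  rw [odd_val_iff, h]; decide

theorem parity_sig (i : Idx g) : parity (sig i) = parity i := by
  rcases parity_cases i with h | h
  · rw [sig_of_zero h, parity_sub, parity_two, h]; rfl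
  · rw [sig_of_one h, parity_sub, parity_four_mul, h]; rfl

theorem sig_sig (i : Idx g) : sig (sig i) = i := by
  have e := parity_sig i
  rcases parity_cases i with h | h
  · rw [sig_of_zero (e.trans h), sig_of_zero h]; ring
  · rw [sig_of_one (e.trans h), sig_of_one h]; ring

theorem sig_injective : Function.Injective (sig : Idx g → Idx g) :=
  Function.LeftInverse.injective sig_sig

/-- Adding 1 changes the parity, so the two applications of σ use its two different branches; their
difference is the half-turn 4g − 2. -/
theorem sig_sig_add (i : Idx g) : sig (sig i + 1) = tau i - 1 := by
  have e := parity_sig i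
  have h8 := eight_mul_idx g
  rcases parity_cases i with h | h
  · have h1 : parity (sig i + 1) = 1 := by rw [parity_add, e, h, parity_one]; rfl
    rw [sig_of_one h1, sig_of_zero h, tau]; ring
  · have h1 : parity (sig i + 1) = 0 := by rw [parity_add, e, h, parity_one]; rfl
    rw [sig_of_zero h1, sig_of_one h, tau]; linear_combination -h8

theorem sig_sig_sub (i : Idx g) : sig (sig i - 1) = tau i + 1 := by
  have e := parity_sig i
  have h8 := eight_mul_idx g
  rcases parity_cases i with h | h
  · have h1 : parity (sig i - 1) = 1 := by rw [parity_sub, e, h, parity_one]; rfl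
    rw [sig_of_one h1, sig_of_zero h, tau]; ring
  · have h1 : parity (sig i - 1) = 0 := by rw [parity_sub, e, h, parity_one]; rfl
    rw [sig_of_zero h1, sig_of_one h, tau]; linear_combination -h8

theorem sig_tau_sub (i : Idx g) : sig (tau i - 1) = sig i + 1 := by rw [← sig_sig_add, sig_sig]
theorem sig_tau_add (i : Idx g) : sig (tau i + 1) = sig i - 1 := by rw [← sig_sig_sub, sig_sig]

theorem tau_tau (i : Idx g) : tau (tau i) = i := by
  have h8 := eight_mul_idx g
  rw [tau, tau]; linear_combination h8

theorem tau_add_one (i : Idx g) : tau (i + 1) = tau i + 1 := by rw [tau, tau]; ring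
theorem rho_rho (i : Idx g) : rho (rho i) = tau i := by
  rw [rho, rho, sig_sig_add]; ring

theorem natCast_lt_injective {a b : ℕ} (ha : a < 8 * g - 4) (hb : b < 8 * g - 4)
    (h : (a : Idx g) = b) : a = b := by
  have := congrArg ZMod.val h
  rwa [ZMod.val_natCast_of_lt ha, ZMod.val_natCast_of_lt hb] at this

theorem exists_offset (k j : Idx g) : ∃ d : ℕ, d < 8 * g - 4 ∧ j = k + d :=
  ⟨(j - k).val, ZMod.val_lt _, by rw [ZMod.natCast_zmod_val]; ring⟩

theorem natCast_modulus : ((8 * g - 4 : ℕ) : Idx g) = 0 := ZMod.natCast_self _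

/-- A cyclic sequence of non-zero reals of both signs changes from negative to positive. -/
theorem exists_sign_change {f : Idx g → ℝ} (h0 : ∀ i, f i ≠ 0) {j k : Idx g} (hj : f j < 0)
    (hk : 0 < f k) : ∃ b, f b < 0 ∧ 0 < f (b + 1) := by
  by_contra! hcon
  obtain ⟨d, -, rfl⟩ := exists_offset j k
  have : ∀ d : ℕ, f (j + d) < 0 := by
    intro d
    induction d with
    | zero => simpa using hj
    | succ d ih =>
      have := lt_of_le_of_ne (hcon _ ih) (h0 _)
      rwa [add_assoc, ← Nat.cast_succ] at this
  exact absurd hk (not_lt.2 (this d).le)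

end Index

namespace Surface

variable {g : ℕ} [hg : Fact (2 ≤ g)] (S : Surface g)

/-! ### The cyclic order of the end points -/

theorem base_chain {e : ℕ} (he : e < 8 * g - 4) :
    ccw (S.P 1) (S.P (1 + e)) < ccw (S.P 1) (S.Q (1 + e)) := by
  have := S.order_PQ (e + 1) (by omega) (by omega)
  rw [Nat.cast_succ, add_comm] at this
  exact this

theorem base_chain' {e : ℕ} (he : e + 1 < 8 * g - 4) :
    ccw (S.P 1) (S.Q (1 + e)) < ccw (S.P 1) (S.P (1 + (e + 1 : ℕ))) := by
  have := S.order_QP (e + 1) (by omega) (by omega)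
  rw [Nat.cast_succ e, Nat.cast_succ (e + 1), add_comm (e : Idx g) 1,
    add_comm ((e + 1 : ℕ) : Idx g) 1] at this
  exact this

/-- The structure fixes the order of the points as seen from `P 1` only. With base `P k` the labels
may pass `P 1`, which is the second case. -/
theorem ccw_P_lt_Q (k : Idx g) {d : ℕ} (hd : d < 8 * g - 4) :
    ccw (S.P k) (S.P (k + d)) < ccw (S.P k) (S.Q (k + d)) := by
  obtain ⟨e, he, rfl⟩ := exists_offset 1 k
  have mono : ∀ a b : ℕ, a ≤ b → b < 8 * g - 4 →
      ccw (S.P 1) (S.P (1 + a)) ≤ ccw (S.P 1) (S.P (1 + b)) := by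
    intro a b hab
    induction b, hab using Nat.le_induction with
    | base => exact fun _ => le_rfl
    | succ b hb ih =>
      intro h
      exact (ih (by omega)).trans ((S.base_chain (by omega)).trans (S.base_chain' h)).le
  by_cases hde : e + d < 8 * g - 4
  · have h1 := mono e (e + d) (by omega) hde
    have h2 := S.base_chain hde
    rw [Nat.cast_add, ← add_assoc] at h1 h2
    rw [ccw_of_le h1, ccw_of_le (h1.trans h2.le)]
    linarith
  · obtain ⟨f, hf⟩ : ∃ f, e + d = f + (8 * g - 4) := ⟨e + d - (8 * g - 4), by omega⟩
    have hc : (1 + (e : Idx g) + d) = 1 + (f : ℕ) := by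
      have := congrArg (Nat.cast : ℕ → Idx g) hf
      rw [Nat.cast_add, Nat.cast_add, natCast_modulus] at this
      linear_combination this
    have h2 := S.base_chain (e := f) (by omega)
    have h3 := S.base_chain' (e := f) (by omega)
    have h4 := mono (f + 1) e (by omega) he
    rw [hc, ccw_of_lt (h2.trans (h3.trans_le h4)), ccw_of_lt (h3.trans_le h4)]
    linarith

theorem ccw_Q_lt_P (k : Idx g) {d : ℕ} (hd : d + 1 < 8 * g - 4) :
    ccw (S.P k) (S.Q (k + d)) < ccw (S.P k) (S.P (k + (d + 1 : ℕ))) := by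
  obtain ⟨e, he, rfl⟩ := exists_offset 1 k
  have mono : ∀ a b : ℕ, a ≤ b → b < 8 * g - 4 →
      ccw (S.P 1) (S.P (1 + a)) ≤ ccw (S.P 1) (S.P (1 + b)) := by
    intro a b hab
    induction b, hab using Nat.le_induction with
    | base => exact fun _ => le_rfl
    | succ b hb ih =>
      intro h
      exact (ih (by omega)).trans ((S.base_chain (by omega)).trans (S.base_chain' h)).le
  by_cases hde : e + d + 1 < 8 * g - 4
  · have h1 := mono e (e + d) (by omega) (by omega)
    have h2 := S.base_chain (e := e + d) (by omega)
    have h3 := S.base_chain' (e := e + d) hde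
    rw [show e + d + 1 = e + (d + 1) by omega, Nat.cast_add e (d + 1), ← add_assoc] at h3
    rw [Nat.cast_add, ← add_assoc] at h1 h2 h3
    rw [ccw_of_le (h1.trans h2.le), ccw_of_le (h1.trans (h2.trans h3).le)]
    linarith
  · obtain ⟨f, hf⟩ : ∃ f, e + (d + 1) = f + (8 * g - 4) := ⟨e + d + 1 - (8 * g - 4), by omega⟩
    have hc : (1 + (e : Idx g) + (d + 1 : ℕ)) = 1 + (f : ℕ) := by
      have := congrArg (Nat.cast : ℕ → Idx g) hf
      rw [Nat.cast_add, Nat.cast_add f, natCast_modulus] at this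
      linear_combination this
    have h2 := S.base_chain (e := f) (by omega)
    have h3 := S.base_chain' (e := f) (by omega)
    have h4 := mono (f + 1) e (by omega) he
    rw [hc, ccw_of_lt (h2.trans (h3.trans_le h4))]
    -- For `f = 0` only the `P` point has come around to `P 1`, so the angle of the `Q` point is not
    -- shifted by 2π.
    rcases Nat.eq_zero_or_pos f with hf0 | hf0
    · subst hf0
      have h5 := mono e (e + d) (by omega) (by omega)
      have h6 := S.base_chain (e := e + d) (by omega)
      rw [Nat.cast_add, ← add_assoc] at h5 h6
      rw [ccw_of_le (h5.trans h6.le)]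
      have h7 := ccw_lt_two_pi (S.P 1) (S.Q (1 + e + d))
      have h8 := ccw_nonneg (S.P 1) (S.P (1 + (0 : ℕ)))
      linarith
    · obtain ⟨f', rfl⟩ : ∃ f', f = f' + 1 := ⟨f - 1, by omega⟩
      have hc' : (1 + (e : Idx g) + d) = 1 + (f' : ℕ) := by
        push_cast at hc
        linear_combination hc
      have h5 := S.base_chain' (e := f') (by omega)
      rw [hc', ccw_of_lt (h5.trans (h2.trans (h3.trans_le h4)))]
      linarith

theorem ccw_P_mono (k : Idx g) {d e : ℕ} (h : d ≤ e) (he : e < 8 * g - 4) :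
    ccw (S.P k) (S.P (k + d)) ≤ ccw (S.P k) (S.P (k + e)) := by
  induction e, h using Nat.le_induction with
  | base => exact le_rfl
  | succ b hb ih =>
    exact (ih (by omega)).trans ((S.ccw_P_lt_Q k (by omega)).trans (S.ccw_Q_lt_P k he)).le

theorem ccw_Q_lt_P_of_lt (k : Idx g) {d e : ℕ} (h : d < e) (he : e < 8 * g - 4) :
    ccw (S.P k) (S.Q (k + d)) < ccw (S.P k) (S.P (k + e)) :=
  (S.ccw_Q_lt_P k (by omega)).trans_le (S.ccw_P_mono k h he)

theorem ccw_Q_mono (k : Idx g) {d e : ℕ} (h : d ≤ e) (he : e < 8 * g - 4) :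
    ccw (S.P k) (S.Q (k + d)) ≤ ccw (S.P k) (S.Q (k + e)) := by
  rcases h.eq_or_lt with rfl | h
  · exact le_rfl
  · exact ((S.ccw_Q_lt_P_of_lt k h he).trans (S.ccw_P_lt_Q k he)).le

/-- The end points near `i`, seen from `P (i - 3)`. -/
theorem chain (i : Idx g) :
    0 = ccw (S.P (i - 3)) (S.P (i - 3)) ∧
    ccw (S.P (i - 3)) (S.P (i - 3)) < ccw (S.P (i - 3)) (S.Q (i - 3)) ∧
    ccw (S.P (i - 3)) (S.Q (i - 3)) < ccw (S.P (i - 3)) (S.P (i - 2)) ∧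
    ccw (S.P (i - 3)) (S.P (i - 2)) < ccw (S.P (i - 3)) (S.Q (i - 2)) ∧
    ccw (S.P (i - 3)) (S.Q (i - 2)) < ccw (S.P (i - 3)) (S.P (i - 1)) ∧
    ccw (S.P (i - 3)) (S.P (i - 1)) < ccw (S.P (i - 3)) (S.Q (i - 1)) ∧
    ccw (S.P (i - 3)) (S.Q (i - 1)) < ccw (S.P (i - 3)) (S.P i) ∧
    ccw (S.P (i - 3)) (S.P i) < ccw (S.P (i - 3)) (S.Q i) ∧
    ccw (S.P (i - 3)) (S.Q i) < ccw (S.P (i - 3)) (S.P (i + 1)) ∧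
    ccw (S.P (i - 3)) (S.P (i + 1)) < ccw (S.P (i - 3)) (S.Q (i + 1)) ∧
    ccw (S.P (i - 3)) (S.Q (i + 1)) < ccw (S.P (i - 3)) (S.P (i + 2)) ∧
    ccw (S.P (i - 3)) (S.P (i + 2)) < ccw (S.P (i - 3)) (S.Q (i + 2)) ∧
    ccw (S.P (i - 3)) (S.Q (i + 2)) < ccw (S.P (i - 3)) (S.P (i + 3)) ∧
    ccw (S.P (i - 3)) (S.P (i + 3)) < ccw (S.P (i - 3)) (S.Q (i + 3)) := by
  have hn := twelve_le g
  have h0 : i - 3 + (0 : ℕ) = i - 3 := by push_cast; ring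
  have h1 : i - 3 + (1 : ℕ) = i - 2 := by push_cast; ring
  have h2 : i - 3 + (2 : ℕ) = i - 1 := by push_cast; ring
  have h3 : i - 3 + (3 : ℕ) = i := by push_cast; ring
  have h4 : i - 3 + (4 : ℕ) = i + 1 := by push_cast; ring
  have h5 : i - 3 + (5 : ℕ) = i + 2 := by push_cast; ring
  have h6 : i - 3 + (6 : ℕ) = i + 3 := by push_cast; ring
  have a := fun (d : ℕ) (hd : d < 8 * g - 4) => S.ccw_P_lt_Q (i - 3) hd
  have b := fun (d : ℕ) (hd : d + 1 < 8 * g - 4) => S.ccw_Q_lt_P (i - 3) hd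
  have a0 := a 0 (by omega)
  have a1 := a 1 (by omega)
  have a2 := a 2 (by omega)
  have a3 := a 3 (by omega)
  have a4 := a 4 (by omega)
  have a5 := a 5 (by omega)
  have a6 := a 6 (by omega)
  have b0 := b 0 (by omega)
  have b1 := b 1 (by omega)
  have b2 := b 2 (by omega)
  have b3 := b 3 (by omega)
  have b4 := b 4 (by omega)
  have b5 := b 5 (by omega)
  simp only [Nat.reduceAdd, h0, h1, h2, h3, h4, h5, h6] at *
  exact ⟨(ccw_self _).symm, a0, b0, a1, b1, a2, b2, a3, b3, a4, b4, a5, b5, a6⟩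

theorem P_ne_Q_succ (i : Idx g) : S.P i ≠ S.Q (i + 1) := by
  intro h
  have := S.chain i
  rw [h] at this
  linarith

end Surface

end GeodesicCoding

namespace GeodesicCoding

theorem det3_pos_of_lt {c a x y : Circle} (h1 : ccw c a < ccw c x) (h2 : ccw c x < ccw c y) :
    0 < det3 (cvec a) (cvec x) (cvec y) := by
  apply det3_cvec_pos
  · rintro rfl; exact lt_irrefl _ h1
  · rw [ccw_of_le h1.le, ccw_of_le (h1.trans h2).le]; linarith

theorem det3_comb (X Y Z W : ℝ × ℂ) (a b : ℝ) :
    det3 X Y (a • Z + b • W) = a * det3 X Y Z + b * det3 X Y W := by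
  rw [det3_add, det3_smul, det3_smul]

namespace Surface

variable {g : ℕ} [hg : Fact (2 ≤ g)] (S : Surface g)

/-! ### The vertices -/

theorem line_P_pos (k : Idx g) {d : ℕ} (h2 : 2 ≤ d) (hd : d < 8 * g - 4) :
    0 < det3 (cvec (S.P k)) (cvec (S.Q (k + 1))) (cvec (S.P (k + d))) := by
  have h := S.ccw_Q_lt_P_of_lt k h2 hd
  rw [Nat.cast_one] at h
  refine det3_cvec_pos (S.P_ne_Q_succ k) h

theorem line_Q_pos (k : Idx g) {d : ℕ} (h2 : 2 ≤ d) (hd : d < 8 * g - 4) :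
    0 < det3 (cvec (S.P k)) (cvec (S.Q (k + 1))) (cvec (S.Q (k + d))) := by
  have h := (S.ccw_Q_lt_P_of_lt k h2 hd).trans (S.ccw_P_lt_Q k hd)
  rw [Nat.cast_one] at h
  refine det3_cvec_pos (S.P_ne_Q_succ k) h

theorem vertex_comb_right (i : Idx g) :
    ∃ a > (0 : ℝ), ∃ b > (0 : ℝ), dvec (S.V i) = a • cvec (S.P i) + b • cvec (S.Q (i + 1)) :=
  dvec_comb (S.P_ne_Q_succ i) (S.vertex_right i)

theorem vertex_comb_left (i : Idx g) :
    ∃ a > (0 : ℝ), ∃ b > (0 : ℝ), dvec (S.V i) = a • cvec (S.P (i - 1)) + b • cvec (S.Q i) := by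
  have h := S.P_ne_Q_succ (i - 1)
  rw [sub_add_cancel] at h
  exact dvec_comb h (S.vertex_left i)

/-- A vertex is a positive combination of the end points of either of its lines, and these lie to
the left of line `k`. Line `j` serves unless its end comes around to `Q k`; then line `j - 1` does.
-/
theorem vertex_pos {j k : Idx g} (h1 : k ≠ j - 1) (h2 : k ≠ j) :
    0 < sidePos (S.P k) (S.Q (k + 1)) (S.V j) := by
  have hn := twelve_le g
  obtain ⟨d, hd, rfl⟩ := exists_offset k j
  have hd0 : d ≠ 0 := by rintro rfl; simp at h2
  have hd1 : d ≠ 1 := by rintro rfl; simp at h1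
  rw [sidePos_eq]
  by_cases hd2 : d + 1 < 8 * g - 4
  · obtain ⟨a, ha, b, hb, e⟩ := S.vertex_comb_right (k + d)
    have p1 := S.line_P_pos k (d := d) (by omega) hd
    have p2 := S.line_Q_pos k (d := d + 1) (by omega) hd2
    rw [Nat.cast_succ, ← add_assoc] at p2
    rw [e, det3_comb]
    positivity
  · obtain ⟨a, ha, b, hb, e⟩ := S.vertex_comb_left (k + d)
    have p1 := S.line_P_pos k (d := d - 1) (by omega) (by omega)
    have p2 := S.line_Q_pos k (d := d) (by omega) hd
    rw [Nat.cast_sub (by omega), Nat.cast_one, ← add_sub_assoc] at p1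
    rw [e, det3_comb]
    positivity

/-- Along line `k`, the vertex `V (k + 1)` comes after `V k`. -/
theorem vertex_coords (k : Idx g) : ∃ a > (0 : ℝ), ∃ b > (0 : ℝ), ∃ a' > (0 : ℝ), ∃ b' > (0 : ℝ),
    dvec (S.V k) = a • cvec (S.P k) + b • cvec (S.Q (k + 1)) ∧
    dvec (S.V (k + 1)) = a' • cvec (S.P k) + b' • cvec (S.Q (k + 1)) ∧ 0 < a * b' - a' * b := by
  obtain ⟨a, ha, b, hb, e⟩ := S.vertex_comb_right k
  obtain ⟨a', ha', b', hb', e'⟩ := S.vertex_comb_left (k + 1)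
  rw [add_sub_cancel_right] at e'
  refine ⟨a, ha, b, hb, a', ha', b', hb', e, e', ?_⟩
  have hn := twelve_le g
  have h0 := S.vertex_left k
  have hpos := S.vertex_pos (j := k + 1) (k := k - 1) (by
    intro h
    have := natCast_lt_injective (g := g) (a := 1) (b := 0) (by omega) (by omega) (by
      push_cast; linear_combination -h)
    omega) (by
    intro h
    have := natCast_lt_injective (g := g) (a := 2) (b := 0) (by omega) (by omega) (by
      push_cast; linear_combination -h)
    omega)
  rw [sub_add_cancel, sidePos_eq, e', det3_comb] at hpos
  rw [sidePos_eq, e, det3_comb] at h0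
  have hq := S.line_Q_pos (k - 1) (d := 2) le_rfl (by omega)
  rw [sub_add_cancel, show k - 1 + ((2 : ℕ) : Idx g) = k + 1 by push_cast; ring] at hq
  set x := det3 (cvec (S.P (k - 1))) (cvec (S.Q k)) (cvec (S.P k))
  set y := det3 (cvec (S.P (k - 1))) (cvec (S.Q k)) (cvec (S.Q (k + 1)))
  -- Line `k - 1` vanishes at `V k` and is positive at `V (k + 1)` and `Q (k + 1)`; its unknown
  -- value at `P k` is eliminated.
  have : 0 < (a * b' - a' * b) * y := by
    have e1 : (a * b' - a' * b) * y = a * (a' * x + b' * y) - a' * (a * x + b * y) := by ring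
    rw [e1, h0]
    have := mul_pos ha hpos
    linarith
  exact (mul_pos_iff_of_pos_right hq).1 this

theorem vertex_succ_eq (k : Idx g) : ∃ a > (0 : ℝ), ∃ b > (0 : ℝ),
    dvec (S.V (k + 1)) = a • dvec (S.V k) + b • cvec (S.Q (k + 1)) := by
  obtain ⟨a, ha, b, hb, a', ha', b', hb', e, e', h⟩ := S.vertex_coords k
  refine ⟨a' / a, by positivity, (a * b' - a' * b) / a, by positivity, ?_⟩
  rw [e, e', smul_add, smul_smul, smul_smul, add_assoc, ← add_smul]
  congr 2
  · field_simp
  · field_simp; ring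

theorem vertex_eq_succ (k : Idx g) : ∃ a > (0 : ℝ), ∃ b > (0 : ℝ),
    dvec (S.V k) = a • cvec (S.P k) + b • dvec (S.V (k + 1)) := by
  obtain ⟨a, ha, b, hb, a', ha', b', hb', e, e', h⟩ := S.vertex_coords k
  refine ⟨(a * b' - a' * b) / b', by positivity, b / b', by positivity, ?_⟩
  rw [e, e', smul_add, smul_smul, smul_smul, ← add_assoc, ← add_smul]
  congr 2
  · field_simp; ring
  · field_simp

/-! ### The side pairings -/

theorem T_mem (i : Idx g) : S.T i ∈ S.Gam := Subgroup.subset_closure ⟨i, rfl⟩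

theorem T_sig_T (i : Idx g) (x : Circle) : S.T (sig i) • S.T i • x = x := by
  rw [← mul_smul]
  exact circle_smul_eq_of_trivial (fun z => by rw [mul_smul, S.pairing]) x

theorem T_T_sig (i : Idx g) (x : Circle) : S.T i • S.T (sig i) • x = x := by
  have := S.T_sig_T (sig i) x
  rwa [sig_sig] at this

theorem T_T_sig_disc (i : Idx g) (z : UnitDisc) : S.T i • S.T (sig i) • z = z := by
  have := S.pairing (sig i) z
  rwa [sig_sig] at this

theorem T_V (i : Idx g) : S.T i • S.V i = S.V (sig i + 1) := S.map_vertex i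

theorem T_V_succ (i : Idx g) : S.T i • S.V (i + 1) = S.V (sig i) := by
  have h := S.T_V (sig i)
  rw [sig_sig] at h
  rw [← h, S.T_T_sig_disc]

/-- The images of the two vertices of side i are those of side σ(i), so line i goes to line σ(i) and
end points go to end points. The order of the vertices along both lines rules out the wrong
matching. -/
theorem T_line (i : Idx g) :
    S.T i • S.P i = S.Q (sig i + 1) ∧ S.T i • S.Q (i + 1) = S.P (sig i) := by
  obtain ⟨a, ha, b, hb, a', ha', b', hb', e, e', h⟩ := S.vertex_coords i
  obtain ⟨c, hc, d, hd, c', hc', d', hd', f, f', h'⟩ := S.vertex_coords (sig i)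
  have hxy : S.T i • S.P i ≠ S.T i • S.Q (i + 1) := fun h => S.P_ne_Q_succ i (smul_left_cancel _ h)
  have E := congrArg (lorentz (S.T i)) e
  have E' := congrArg (lorentz (S.T i)) e'
  simp only [lorentz_add, lorentz_smul, lorentz_dvec, lorentz_cvec, smul_smul, T_V, T_V_succ]
    at E E'
  have n1 := normSq_mden_circle_pos (S.T i) (S.P i)
  have n2 := normSq_mden_circle_pos (S.T i) (S.Q (i + 1))
  have n3 := normSq_mden_pos (S.T i) (S.V i).norm_lt_one.le
  have n4 := normSq_mden_pos (S.T i) (S.V (i + 1)).norm_lt_one.le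
  set p := normSq (mden (S.T i) (S.P i))
  set q := normSq (mden (S.T i) (S.Q (i + 1)))
  set r := normSq (mden (S.T i) (S.V i))
  set s := normSq (mden (S.T i) (S.V (i + 1)))
  set x := S.T i • S.P i
  set y := S.T i • S.Q (i + 1)
  have D := congrArg (det3 (cvec (S.P (sig i))) (cvec (S.Q (sig i + 1)))) E
  have D' := congrArg (det3 (cvec (S.P (sig i))) (cvec (S.Q (sig i + 1)))) E'
  rw [f', det3_comb, smul_add, smul_smul, smul_smul, det3_comb, det3_self_left, det3_self_right]
    at D
  rw [f, det3_comb, smul_add, smul_smul, smul_smul, det3_comb, det3_self_left, det3_self_right]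
    at D'
  simp only [mul_zero, add_zero] at D D'
  set X := det3 (cvec (S.P (sig i))) (cvec (S.Q (sig i + 1))) (cvec x)
  set Y := det3 (cvec (S.P (sig i))) (cvec (S.Q (sig i + 1))) (cvec y)
  have hX : X = 0 := by
    have : (a * b' - a' * b) * (p * q * X) = 0 := by linear_combination -b' * q * D + b * q * D'
    simpa [h.ne', n1.ne', n2.ne'] using this
  have hY : Y = 0 := by
    have : (a * b' - a' * b) * (p * q * Y) = 0 := by linear_combination a' * p * D - a * p * D'
    simpa [h.ne', n1.ne', n2.ne'] using this
  rcases eq_or_eq_of_det3_cvec_eq_zero (S.P_ne_Q_succ _) hX with hx | hx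
  · rcases eq_or_eq_of_det3_cvec_eq_zero (S.P_ne_Q_succ _) hY with hy | hy
    · exact absurd (hx.trans hy.symm) hxy
    · exfalso
      rw [hx, hy, f', smul_add, smul_smul, smul_smul] at E
      rw [hx, hy, f, smul_add, smul_smul, smul_smul] at E'
      obtain ⟨g1, g2⟩ := cvec_comb_unique (S.P_ne_Q_succ _) E
      obtain ⟨g3, g4⟩ := cvec_comb_unique (S.P_ne_Q_succ _) E'
      have k1 : 0 < (a * b' - a' * b) * (p * q) := by positivity
      have k2 : 0 < r * s * (c * d' - c' * d) := by positivity
      have : (a * b' - a' * b) * (p * q) = -(r * s * (c * d' - c' * d)) := by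
        linear_combination -b' * q * g1 - r * c' * g4 + b * q * g3 + s * c * g2
      linarith
  · rcases eq_or_eq_of_det3_cvec_eq_zero (S.P_ne_Q_succ _) hY with hy | hy
    · exact ⟨hx, hy⟩
    · exact absurd (hx.trans hy.symm) hxy

theorem T_P (i : Idx g) : S.T i • S.P i = S.Q (sig i + 1) := (S.T_line i).1
theorem T_Q_succ (i : Idx g) : S.T i • S.Q (i + 1) = S.P (sig i) := (S.T_line i).2

/-- A geodesic entering the sector of the polygon at a vertex meets the interior. -/
theorem exists_interior_of_sector (k : Idx g) (y : Circle)
    (h1 : 0 < det3 (cvec (S.P (k - 1))) (cvec (S.Q k)) (cvec y))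
    (h2 : 0 < det3 (cvec (S.P k)) (cvec (S.Q (k + 1))) (cvec y)) :
    ∃ z : UnitDisc, (∀ j, 0 < sidePos (S.P j) (S.Q (j + 1)) z) ∧
      ∃ a > (0 : ℝ), ∃ b : ℝ, dvec z = a • dvec (S.V k) + b • cvec y := by
  -- A small step from `V k` towards `y` suffices: the two lines through the vertex become positive
  -- by hypothesis, and the finitely many others remain positive.
  have key : ∃ ε > (0 : ℝ), ∀ j, 0 < sidePos (S.P j) (S.Q (j + 1)) (S.V k)
      + ε * det3 (cvec (S.P j)) (cvec (S.Q (j + 1))) (cvec y) := by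
    have : ∀ j, ∃ δ > (0 : ℝ), ∀ ε > 0, ε < δ → 0 < sidePos (S.P j) (S.Q (j + 1)) (S.V k)
      + ε * det3 (cvec (S.P j)) (cvec (S.Q (j + 1))) (cvec y) := by
      intro j
      by_cases hj : j = k - 1
      · subst hj
        refine ⟨1, one_pos, fun ε hε _ => ?_⟩
        rw [sub_add_cancel, S.vertex_left, zero_add]
        exact mul_pos hε h1
      by_cases hj' : j = k
      · subst hj'
        refine ⟨1, one_pos, fun ε hε _ => ?_⟩
        rw [S.vertex_right, zero_add]
        exact mul_pos hε h2
      have hp := S.vertex_pos hj hj'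
      set A := sidePos (S.P j) (S.Q (j + 1)) (S.V k)
      set B := det3 (cvec (S.P j)) (cvec (S.Q (j + 1))) (cvec y)
      refine ⟨A / (|B| + 1), by positivity, fun ε hε hlt => ?_⟩
      rw [lt_div_iff₀ (by positivity)] at hlt
      nlinarith [neg_abs_le B, abs_nonneg B]
    choose δ hδ h using this
    obtain ⟨j₀, hj₀⟩ := Finite.exists_min δ
    exact ⟨δ j₀ / 2, by linarith [hδ j₀], fun j =>
      h j _ (by linarith [hδ j₀]) (by linarith [hδ j₀, hj₀ j])⟩
  obtain ⟨ε, hε, h⟩ := key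
  obtain ⟨z, c, hc, e⟩ := exists_dvec_add_eq one_pos hε.le (S.V k) (norm_cvec_le y)
  have e2 : dvec z = c⁻¹ • dvec (S.V k) + (c⁻¹ * ε) • cvec y := by
    rw [mul_smul, ← smul_add, ← one_smul ℝ (dvec (S.V k)), e, smul_smul,
      inv_mul_cancel₀ hc.ne', one_smul]
  refine ⟨z, fun j => ?_, c⁻¹, inv_pos.2 hc, _, e2⟩
  have := h j
  rw [sidePos_eq] at this
  rw [sidePos_eq, e2, det3_comb, mul_assoc, ← mul_add]
  exact mul_pos (inv_pos.2 hc) this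

theorem sidePos_continuous (p q : Circle) : Continuous (sidePos p q) := by
  unfold sidePos
  have := continuous_normSq
  fun_prop

theorem mem_interior_of_pos {z : UnitDisc} (h : ∀ j, 0 < sidePos (S.P j) (S.Q (j + 1)) z) :
    z ∈ interior (polygon S.P S.Q) := by
  rw [mem_interior]
  refine ⟨{z | ∀ j, 0 < sidePos (S.P j) (S.Q (j + 1)) z}, fun z hz j => (hz j).le, ?_, h⟩
  simp only [Set.ofPred_forall]
  exact isOpen_iInter_of_finite fun j => isOpen_lt continuous_const (sidePos_continuous _ _)

/-- The image of line i − 1 passes through V_k, k = σ(i) + 1. If its end T_i Q_i lay to the left of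
both lines through V_k, the image would enter the interior of the polygon, against the extension
condition. This bounds T_i Q_i, and passing through V_k then bounds the other end. -/
theorem T_prev_aux (i : Idx g) :
    (0 < ccw (S.P (sig i)) (S.T i • S.P (i - 1)) ∧
      ccw (S.P (sig i)) (S.T i • S.P (i - 1)) ≤ ccw (S.P (sig i)) (S.P (sig i + 1))) ∧
    ccw (S.P (sig i)) (S.Q (sig i + 1)) < ccw (S.P (sig i)) (S.T i • S.Q i) ∧
      ccw (S.P (sig i)) (S.T i • S.Q i) ≤ ccw (S.P (sig i)) (S.Q (sig i + 1 + 1)) := by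
  set k := sig i + 1 with hk
  have hk1 : k - 1 = sig i := by rw [hk]; ring
  have hc := S.chain i
  have hck := S.chain k
  have tQ : S.T i • S.Q (i + 1) = S.P (k - 1) := by rw [S.T_Q_succ, hk1]
  have tP : S.T i • S.P i = S.Q k := S.T_P i
  rw [← hk1]
  have b1 : ccw (S.P (k - 1)) (S.T i • S.P (i - 1)) < ccw (S.P (k - 1)) (S.Q k) := by
    rw [← tQ, ← tP, ccw_smul_lt_iff,
      ccw_of_lt (c := S.P (i - 3)) (a := S.Q (i + 1)) (x := S.P (i - 1)) (by linarith),
      ccw_of_lt (c := S.P (i - 3)) (a := S.Q (i + 1)) (x := S.P i) (by linarith)]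
    linarith
  have b2 : ccw (S.P (k - 1)) (S.Q k) < ccw (S.P (k - 1)) (S.T i • S.Q i) := by
    rw [← tQ, ← tP, ccw_smul_lt_iff,
      ccw_of_lt (c := S.P (i - 3)) (a := S.Q (i + 1)) (x := S.P i) (by linarith),
      ccw_of_lt (c := S.P (i - 3)) (a := S.Q (i + 1)) (x := S.Q i) (by linarith)]
    linarith
  have b0 : 0 < ccw (S.P (k - 1)) (S.T i • S.P (i - 1)) := by
    apply ccw_pos
    rw [← tQ]
    intro h
    rw [smul_left_cancel _ h] at hc
    linarith
  have ck1 : ccw (S.P (k - 1)) (S.P k) < ccw (S.P (k - 1)) (S.Q k) := by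
    rw [ccw_of_le (c := S.P (k - 3)) (a := S.P (k - 1)) (x := S.P k) (by linarith),
      ccw_of_le (c := S.P (k - 3)) (a := S.P (k - 1)) (x := S.Q k) (by linarith)]
    linarith
  have ck2 : ccw (S.P (k - 1)) (S.Q k) < ccw (S.P (k - 1)) (S.Q (k + 1)) := by
    rw [ccw_of_le (c := S.P (k - 3)) (a := S.P (k - 1)) (x := S.Q k) (by linarith),
      ccw_of_le (c := S.P (k - 3)) (a := S.P (k - 1)) (x := S.Q (k + 1)) (by linarith)]
    linarith
  have hPQ : S.P (k - 1) ≠ S.Q k := by simpa using S.P_ne_Q_succ (k - 1)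
  have y1 : 0 < det3 (cvec (S.P (k - 1))) (cvec (S.Q k)) (cvec (S.T i • S.Q i)) :=
    det3_cvec_pos hPQ b2
  have hne : S.P (i - 1) ≠ S.Q i := by simpa using S.P_ne_Q_succ (i - 1)
  have hzero : det3 (cvec (S.T i • S.P (i - 1))) (cvec (S.T i • S.Q i)) (dvec (S.V k)) = 0 := by
    rw [← sidePos_eq, hk, ← S.T_V, sidePos_smul_eq_zero_iff, S.vertex_left]
  have y2 : det3 (cvec (S.P k)) (cvec (S.Q (k + 1))) (cvec (S.T i • S.Q i)) ≤ 0 := by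
    by_contra hcon
    obtain ⟨z, hz, a, ha, b, e⟩ := S.exists_interior_of_sector k _ y1 (not_le.1 hcon)
    have hz0 : sidePos (S.T i • S.P (i - 1)) (S.T i • S.Q i) z = 0 := by
      rw [sidePos_eq, e, det3_comb, hzero]; simp
    rw [← S.T_T_sig_disc i z, sidePos_smul_eq_zero_iff] at hz0
    refine S.extension_condition (i - 1) (S.T (sig i) • z) ?_ (S.T i) (S.T_mem i) ?_
    · rwa [sub_add_cancel]
    · rw [S.T_T_sig_disc]
      exact S.mem_interior_of_pos hz
  have hb3 : ccw (S.P (k - 1)) (S.T i • S.Q i) ≤ ccw (S.P (k - 1)) (S.Q (k + 1)) := by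
    by_contra hcon
    exact absurd (det3_pos_of_lt (c := S.P (k - 1)) (ck1.trans ck2) (not_le.1 hcon)) (not_lt.2 y2)
  refine ⟨⟨b0, ?_⟩, b2, hb3⟩
  by_contra hcon
  have hx : 0 < det3 (cvec (S.P k)) (cvec (S.T i • S.P (i - 1))) (cvec (S.Q (k + 1))) :=
    det3_pos_of_lt (c := S.P (k - 1)) (not_le.1 hcon) (b1.trans ck2)
  rw [← det3_rotate, det3_rotate, ← det3_rotate] at hx
  have hxy : S.T i • S.P (i - 1) ≠ S.T i • S.Q i := fun h => hne (smul_left_cancel _ h)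
  obtain ⟨a, ha, b, hb, e⟩ := dvec_comb hxy ((sidePos_eq _ _ _).trans hzero)
  have h0 := S.vertex_right k
  rw [sidePos_eq, e, det3_comb] at h0
  have hx' : det3 (cvec (S.P k)) (cvec (S.Q (k + 1))) (cvec (S.T i • S.P (i - 1))) < 0 := by
    rw [← det3_rotate, det3_swap, det3_rotate, det3_rotate] at hx
    simp only [det3] at hx ⊢
    linarith
  nlinarith [mul_pos ha (neg_pos.2 hx'), mul_nonneg hb.le (neg_nonneg.2 y2)]

theorem T_cycle (i : Idx g) (x : Circle) :
    S.T (rho (rho (rho i))) • S.T (rho (rho i)) • S.T (rho i) • S.T i • x = x := by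
  rw [← mul_smul, ← mul_smul, ← mul_smul]
  exact circle_smul_eq_of_trivial (fun z => by rw [mul_smul, mul_smul, mul_smul, S.cycle]) x

/-- At each of the four corners in the cycle `T_prev_aux` allows a displacement in one direction
only. The cycle composes to the identity, so there is no displacement at all. -/
theorem T_P_pred (i : Idx g) : S.T i • S.P (i - 1) = S.P (sig i + 1) := by
  set k := rho i with hk
  set l := rho k with hl
  set m := rho l with hm
  have hmi : sig m + 1 = i := by
    change rho m = i
    rw [hm, hl, rho_rho, hk, rho_rho, tau_tau]
  have ek : sig i + 1 = k := rfl
  have el : sig k + 1 = l := rfl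
  have em : sig l + 1 = m := rfl
  have si : sig m = i - 1 := by rw [← hmi]; ring
  have sk : sig i = k - 1 := by rw [← ek]; ring
  have sl : sig k = l - 1 := by rw [← el]; ring
  have sm : sig l = m - 1 := by rw [← em]; ring
  have A := S.T_prev_aux i
  have B := S.T_prev_aux k
  have C := S.T_prev_aux l
  have D := S.T_prev_aux m
  rw [ek, sk] at A
  rw [el, sl] at B
  rw [em, sm] at C
  rw [hmi, si] at D
  have tk := S.T_P k
  have tl := S.T_P l
  have tm := S.T_P m
  have tm' := S.T_Q_succ m
  rw [el] at tk
  rw [em] at tl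
  rw [hmi] at tm
  rw [si] at tm'
  -- The second half of the cycle; `c` below is the image of `P (i - 1)` under the first half.
  set W : SU11 := S.T m * S.T l
  set c := S.T k • S.T i • S.P (i - 1) with hcdef
  have Wc : W • c = S.P (i - 1) := by
    rw [mul_smul]; exact S.T_cycle i _
  -- the position of `c`
  have c1 : 0 < ccw (S.P (l - 1)) c ∧ ccw (S.P (l - 1)) c ≤ ccw (S.P (l - 1)) (S.Q l) := by
    have h1 : ccw (S.T k • S.P (k - 1)) c ≤ ccw (S.T k • S.P (k - 1)) (S.Q l) := by
      rw [← tk, hcdef, ccw_smul_le_iff]; exact A.1.2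
    have hch := S.chain l
    have h2 : ccw (S.P (l - 1)) (S.P l) < ccw (S.P (l - 1)) (S.Q l) := by
      rw [ccw_of_le (c := S.P (l - 3)) (a := S.P (l - 1)) (x := S.P l) (by linarith),
        ccw_of_le (c := S.P (l - 3)) (a := S.P (l - 1)) (x := S.Q l) (by linarith)]
      linarith
    rw [ccw_of_le (B.1.2.trans h2.le)] at h1
    rcases le_or_gt (ccw (S.P (l - 1)) (S.T k • S.P (k - 1))) (ccw (S.P (l - 1)) c) with h3 | h3
    · rw [ccw_of_le h3] at h1
      exact ⟨B.1.1.trans_le h3, by linarith⟩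
    · rw [ccw_of_lt h3] at h1
      have := ccw_nonneg (S.P (l - 1)) c
      have := ccw_lt_two_pi (S.P (l - 1)) (S.Q l)
      linarith
  have hci := S.chain i
  have hcm := S.chain m
  have m1 : 0 < ccw (S.P (i - 1)) (W • S.P (l - 1)) ∧
      ccw (S.P (i - 1)) (W • S.P (l - 1)) ≤ ccw (S.P (i - 1)) (S.Q i) := by
    rw [mul_smul]
    have h1 : ccw (S.T m • S.P (m - 1)) (S.T m • S.T l • S.P (l - 1))
        ≤ ccw (S.T m • S.P (m - 1)) (S.Q i) := by
      rw [← tm, ccw_smul_le_iff]; exact C.1.2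
    have h2 : ccw (S.P (i - 1)) (S.P i) < ccw (S.P (i - 1)) (S.Q i) := by
      rw [ccw_of_le (c := S.P (i - 3)) (a := S.P (i - 1)) (x := S.P i) (by linarith),
        ccw_of_le (c := S.P (i - 3)) (a := S.P (i - 1)) (x := S.Q i) (by linarith)]
      linarith
    rw [ccw_of_le (D.1.2.trans h2.le)] at h1
    rcases le_or_gt (ccw (S.P (i - 1)) (S.T m • S.P (m - 1)))
      (ccw (S.P (i - 1)) (S.T m • S.T l • S.P (l - 1))) with h3 | h3
    · rw [ccw_of_le h3] at h1
      exact ⟨D.1.1.trans_le h3, by linarith⟩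
    · rw [ccw_of_lt h3] at h1
      have := ccw_nonneg (S.P (i - 1)) (S.T m • S.T l • S.P (l - 1))
      have := ccw_lt_two_pi (S.P (i - 1)) (S.Q i)
      linarith
  have m2 : W • S.Q l = S.P (i - 1) ∨
      ccw (S.P (i - 1)) (S.Q i) < ccw (S.P (i - 1)) (W • S.Q l) := by
    rw [mul_smul]
    by_cases h0 : S.T m • S.T l • S.Q l = S.P (i - 1)
    · exact Or.inl h0
    right
    have h1 : ccw (S.P (m - 1)) (S.Q m) < ccw (S.P (m - 1)) (S.T l • S.Q l) := C.2.1
    have h2 : ccw (S.P (m - 1)) (S.T l • S.Q l) ≤ ccw (S.P (m - 1)) (S.Q (m + 1)) := C.2.2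
    have h2' : ccw (S.P (m - 1)) (S.T l • S.Q l) < ccw (S.P (m - 1)) (S.Q (m + 1)) := by
      refine lt_of_le_of_ne h2 fun h => h0 ?_
      rw [ccw_inj.1 h, tm']
    have h3 : ccw (S.T m • S.Q (m + 1)) (S.T m • S.Q m)
        < ccw (S.T m • S.Q (m + 1)) (S.T m • S.T l • S.Q l) := by
      rw [ccw_smul_lt_iff, ccw_of_lt h2', ccw_of_lt (h1.trans h2')]
      linarith
    rw [tm'] at h3
    exact D.2.1.trans h3
  have hWc : ccw (W • S.P (l - 1)) (S.P (i - 1)) ≤ ccw (W • S.P (l - 1)) (W • S.Q l) := by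
    rw [← Wc, ccw_smul_le_iff]; exact c1.2
  -- If `W • Q l` lay beyond `Q i`, the arc from `W • P (l - 1)` to `W • Q l` would miss `P (i - 1)
  -- = W • c`, although `c` lies between `P (l - 1)` and `Q l`.
  have hWQ : W • S.Q l = S.P (i - 1) := by
    rcases m2 with h | h
    · exact h
    · exfalso
      rw [ccw_of_le (m1.2.trans h.le), ccw_of_lt (c := S.P (i - 1)) (by simpa using m1.1),
        ccw_self] at hWc
      have := ccw_lt_two_pi (S.P (i - 1)) (W • S.Q l)
      linarith
  rw [← Wc] at hWQ
  have := smul_left_cancel _ hWQ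
  rw [← tk] at this
  exact (smul_left_cancel _ this).symm

/-- By `T_P_pred` the image of line i − 1 passes through P_k and V_k with k = σ(i) + 1, hence is
line k; its other end is Q_{k+1}. -/
theorem T_Q (i : Idx g) : S.T i • S.Q i = S.Q (sig i + 2) := by
  set k := sig i + 1 with hk
  have h2 : sig i + 2 = k + 1 := by rw [hk]; ring
  have hzero : sidePos (S.P k) (S.T i • S.Q i) (S.V k) = 0 := by
    rw [hk, ← S.T_P_pred, ← S.T_V, sidePos_smul_eq_zero_iff, S.vertex_left]
  have hne : S.P k ≠ S.T i • S.Q i := by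
    rw [hk, ← S.T_P_pred]
    intro h
    have h3 := S.P_ne_Q_succ (i - 1)
    rw [sub_add_cancel] at h3
    exact h3 (smul_left_cancel _ h)
  obtain ⟨a, ha, b, hb, e⟩ := S.vertex_comb_right k
  rw [sidePos_eq, e, det3_comb] at hzero
  simp only [det3_self_left, mul_zero, zero_add, mul_eq_zero, hb.ne', false_or] at hzero
  rcases eq_or_eq_of_det3_cvec_eq_zero hne hzero with h | h
  · exact absurd h.symm (S.P_ne_Q_succ k)
  · rw [h2, h]

theorem T_P_succ (i : Idx g) : S.T i • S.P (i + 1) = S.P (sig i - 1) := by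
  have := S.T_P_pred (sig i)
  rw [sig_sig] at this
  rw [← this, S.T_T_sig]

theorem T_Q_add_two (i : Idx g) : S.T i • S.Q (i + 2) = S.Q (sig i) := by
  have := S.T_Q (sig i)
  rw [sig_sig] at this
  rw [← this, S.T_T_sig]

end Surface

end GeodesicCoding

/-! ### Monotone action on arcs and the corner values G and H -/

namespace GeodesicCoding

/-- A Möbius transformation preserves the order of points along an arc that stays an arc when seen
from the base points. -/
theorem smul_mono (B : SU11) {c d a b x y : Circle} (h1 : ccw d a ≤ ccw d x)
    (h2 : ccw d x ≤ ccw d y) (h3 : ccw d y ≤ ccw d b) (h : ccw c (B • a) ≤ ccw c (B • b)) :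
    ccw c (B • a) ≤ ccw c (B • x) ∧ ccw c (B • x) ≤ ccw c (B • y) ∧
      ccw c (B • y) ≤ ccw c (B • b) := by
  have hx : B • x ∈ arcIcc (B • a) (B • b) := by
    rw [smul_mem_arcIcc, mem_arcIcc_base d (h1.trans (h2.trans h3))]
    exact ⟨h1, h2.trans h3⟩
  have hy : B • y ∈ arcIcc (B • a) (B • b) := by
    rw [smul_mem_arcIcc, mem_arcIcc_base d (h1.trans (h2.trans h3))]
    exact ⟨h1.trans h2, h3⟩
  rw [mem_arcIcc_base c h] at hx hy
  refine ⟨hx.1, ?_, hy.2⟩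
  have : ccw (B • a) (B • x) ≤ ccw (B • a) (B • y) := by
    rw [ccw_smul_le_iff, ccw_of_le h1, ccw_of_le (h1.trans h2)]
    linarith
  rw [ccw_of_le hx.1, ccw_of_le hy.1] at this
  linarith

namespace Surface

variable {g : ℕ} [hg : Fact (2 ≤ g)] (S : Surface g)

theorem cast_sub_eq {a : ℕ} (h : a ≤ 8 * g - 4) : ((8 * g - 4 - a : ℕ) : Idx g) = -a := by
  rw [Nat.cast_sub h, natCast_modulus, zero_sub]

/-- The end points near `i`, seen from `P (i + 1)`. -/
theorem wrap (i : Idx g) :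
    0 = ccw (S.P (i + 1)) (S.P (i + 1)) ∧
    ccw (S.P (i + 1)) (S.P (i + 1)) < ccw (S.P (i + 1)) (S.Q (i + 1)) ∧
    ccw (S.P (i + 1)) (S.Q (i + 1)) < ccw (S.P (i + 1)) (S.P (i + 2)) ∧
    ccw (S.P (i + 1)) (S.P (i + 2)) < ccw (S.P (i + 1)) (S.Q (i + 2)) ∧
    ccw (S.P (i + 1)) (S.Q (i + 2)) < ccw (S.P (i + 1)) (S.P (i + 3)) ∧
    ccw (S.P (i + 1)) (S.P (i + 3)) < ccw (S.P (i + 1)) (S.Q (i + 3)) ∧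
    ccw (S.P (i + 1)) (S.Q (i + 3)) < ccw (S.P (i + 1)) (S.P (i - 3)) ∧
    ccw (S.P (i + 1)) (S.P (i - 3)) < ccw (S.P (i + 1)) (S.Q (i - 3)) ∧
    ccw (S.P (i + 1)) (S.Q (i - 3)) < ccw (S.P (i + 1)) (S.P (i - 2)) ∧
    ccw (S.P (i + 1)) (S.P (i - 2)) < ccw (S.P (i + 1)) (S.Q (i - 2)) ∧
    ccw (S.P (i + 1)) (S.Q (i - 2)) < ccw (S.P (i + 1)) (S.P (i - 1)) ∧
    ccw (S.P (i + 1)) (S.P (i - 1)) < ccw (S.P (i + 1)) (S.Q (i - 1)) ∧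
    ccw (S.P (i + 1)) (S.Q (i - 1)) < ccw (S.P (i + 1)) (S.P i) ∧
    ccw (S.P (i + 1)) (S.P i) < ccw (S.P (i + 1)) (S.Q i) := by
  have hn := twelve_le g
  have e0 : i + 1 + (0 : ℕ) = i + 1 := by push_cast; ring
  have e1 : i + 1 + (1 : ℕ) = i + 2 := by push_cast; ring
  have e2 : i + 1 + (2 : ℕ) = i + 3 := by push_cast; ring
  have e3 : i + 1 + (8 * g - 4 - 4 : ℕ) = i - 3 := by
    rw [cast_sub_eq (by omega)]; push_cast; ring
  have e4 : i + 1 + (8 * g - 4 - 3 : ℕ) = i - 2 := by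
    rw [cast_sub_eq (by omega)]; push_cast; ring
  have e5 : i + 1 + (8 * g - 4 - 2 : ℕ) = i - 1 := by
    rw [cast_sub_eq (by omega)]; push_cast; ring
  have e6 : i + 1 + (8 * g - 4 - 1 : ℕ) = i := by
    rw [cast_sub_eq (by omega)]; push_cast; ring
  have a := fun (d : ℕ) (hd : d < 8 * g - 4) => S.ccw_P_lt_Q (i + 1) hd
  have b := fun (d e : ℕ) (h : d < e) (hd : e < 8 * g - 4) => S.ccw_Q_lt_P_of_lt (i + 1) h hd
  have a0 := a 0 (by omega)
  have a1 := a 1 (by omega)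
  have a2 := a 2 (by omega)
  have a3 := a (8 * g - 4 - 4) (by omega)
  have a4 := a (8 * g - 4 - 3) (by omega)
  have a5 := a (8 * g - 4 - 2) (by omega)
  have a6 := a (8 * g - 4 - 1) (by omega)
  have b0 := b 0 1 (by omega) (by omega)
  have b1 := b 1 2 (by omega) (by omega)
  have b2 := b 2 (8 * g - 4 - 4) (by omega) (by omega)
  have b3 := b (8 * g - 4 - 4) (8 * g - 4 - 3) (by omega) (by omega)
  have b4 := b (8 * g - 4 - 3) (8 * g - 4 - 2) (by omega) (by omega)
  have b5 := b (8 * g - 4 - 2) (8 * g - 4 - 1) (by omega) (by omega)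
  rw [e0] at a0 b0
  rw [e1] at a1 b0 b1
  rw [e2] at a2 b1 b2
  rw [e3] at a3 b2 b3
  rw [e4] at a4 b3 b4
  rw [e5] at a5 b4 b5
  rw [e6] at a6 b5
  exact ⟨(ccw_self _).symm, a0, b0, a1, b1, a2, b2, a3, b3, a4, b4, a5, b5, a6⟩

/-! ### The corner values -/

section Corner

/-- The point at counterclockwise angle `t` from `P i`. -/
def pt (i : Idx g) (t : ℝ) : Circle := S.P i * Circle.exp t

theorem ccw_pt (i : Idx g) {t : ℝ} (h0 : 0 ≤ t) (h : t ≤ ccw (S.P i) (S.P (i + 1))) :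
    ccw (S.P i) (S.pt i t) = t :=
  ccw_mul_exp _ h0 (h.trans_lt (ccw_lt_two_pi _ _))

theorem chain_sig (i : Idx g) : ccw (S.P (sig i)) (S.Q (sig i)) < ccw (S.P (sig i)) (S.P (sig i + 1)) := by
  have h := S.chain (sig i)
  rw [ccw_of_le (c := S.P (sig i - 3)) (a := S.P (sig i)) (x := S.Q (sig i)) (by linarith),
    ccw_of_le (c := S.P (sig i - 3)) (a := S.P (sig i)) (x := S.P (sig i + 1)) (by linarith)]
  linarith

/-- `T i` maps `[P (i - 2), P (i - 1)]` into `[Q (σ i), P (σ i + 1)]`, monotonically. -/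
theorem T_mono_pred (i : Idx g) {x y : Circle} (h : ccw (S.P (i - 2)) x ≤ ccw (S.P (i - 2)) y)
    (hy : y ∈ arcIcc (S.P (i - 2)) (S.P (i - 1))) :
    ccw (S.P (sig i)) (S.Q (sig i)) ≤ ccw (S.P (sig i)) (S.T i • x) ∧
    ccw (S.P (sig i)) (S.T i • x) ≤ ccw (S.P (sig i)) (S.T i • y) ∧
    ccw (S.P (sig i)) (S.T i • y) ≤ ccw (S.P (sig i)) (S.P (sig i + 1)) := by
  have hw := S.wrap i
  have hx : x ∈ arcIcc (S.P (i - 2)) (S.P (i - 1)) := h.trans hy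
  have hx' := (mem_arcIcc_base (S.P (i + 1)) (by linarith)).1 hx
  have hy' := (mem_arcIcc_base (S.P (i + 1)) (by linarith)).1 hy
  rw [ccw_of_le hx'.1, ccw_of_le hy'.1] at h
  have := smul_mono (S.T i) (c := S.P (sig i)) (d := S.P (i + 1)) (a := S.Q (i + 2))
    (b := S.P (i - 1)) (x := x) (y := y) (by linarith) (by linarith) (by linarith)
    (by rw [S.T_Q_add_two, S.T_P_pred]; exact (S.chain_sig i).le)
  rwa [S.T_Q_add_two, S.T_P_pred] at this

/-- With `σ j = i - 1`, `T j` maps `[P (j - 1), P j]` onto `[P i, Q i]`, monotonically. -/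
theorem T_mono_corner (j : Idx g) {x y : Circle} (h : ccw (S.P (j - 1)) x ≤ ccw (S.P (j - 1)) y)
    (hy : y ∈ arcIcc (S.P (j - 1)) (S.P j)) :
    ccw (S.P (sig j + 1)) (S.T j • x) ≤ ccw (S.P (sig j + 1)) (S.T j • y) ∧
    ccw (S.P (sig j + 1)) (S.T j • y) ≤ ccw (S.P (sig j + 1)) (S.Q (sig j + 1)) := by
  have hx : x ∈ arcIcc (S.P (j - 1)) (S.P j) := h.trans hy
  have := smul_mono (S.T j) (c := S.P (sig j + 1)) (d := S.P (j - 1)) (a := S.P (j - 1))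
    (b := S.P j) (x := x) (y := y) (by rw [ccw_self]; exact ccw_nonneg _ _) h hy
    (by rw [S.T_P_pred, ccw_self]; exact ccw_nonneg _ _)
  rw [S.T_P_pred, S.T_P] at this
  exact this.2

-- In angle coordinates based at the points P_j, the system asks for a fixed point of a monotone
-- self-map of a product of compact intervals. Such a product is a complete lattice, so
-- Knaster–Tarski applies. Uniqueness plays no role: only the system itself is used afterwards.
open Classical in
theorem exists_cornerSystem (A : Idx g → Circle) : ∃ G, S.IsCornerSystem A G := by
  have hPQ : ∀ i, S.P i ≠ S.Q i := fun i h => by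
    have := S.chain i
    rw [h] at this
    linarith
  let ℓ : Idx g → ℝ := fun i => ccw (S.P i) (S.P (i + 1))
  have hℓ : ∀ i, (0 : ℝ) ≤ ℓ i := fun i => ccw_nonneg _ _
  let inst : ∀ i, CompleteLattice (Set.Icc 0 (ℓ i)) := fun i =>
    @Set.Icc.completeLattice ℝ _ 0 (ℓ i) ⟨hℓ i⟩
  let p : (∀ i, Set.Icc 0 (ℓ i)) → Idx g → Circle := fun x i => S.pt i (x i)
  -- The value at `j` is prescribed by the condition for i = σ(j). The first alternative lands in
  -- [Q_j, P_{j+1}] and the second in [P_j, Q_j].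
  let f : (Idx g → Circle) → Idx g → Circle := fun p j =>
    if A (sig j) = S.P (sig j) then S.T (sig j) • p (sig j - 2)
    else S.T (sig (j - 1)) • p (sig (j - 1) - 1)
  have hp : ∀ x i, ccw (S.P i) (p x i) = x i := fun x i => S.ccw_pt i (x i).2.1 (x i).2.2
  have hp' : ∀ x i, p x i ∈ arcIcc (S.P i) (S.P (i + 1)) := fun x i => by
    rw [mem_arcIcc, hp]; exact (x i).2.2
  have key : ∀ x y : ∀ i, Set.Icc 0 (ℓ i), (∀ i, (x i : ℝ) ≤ y i) → ∀ j,
      ccw (S.P j) (f (p x) j) ≤ ccw (S.P j) (f (p y) j) ∧ ccw (S.P j) (f (p y) j) ≤ ℓ j := by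
    intro x y hxy j
    simp only [f]
    split_ifs with h
    · have h1 := hp' y (sig j - 2)
      rw [show sig j - 2 + 1 = sig j - 1 by ring] at h1
      have := S.T_mono_pred (sig j) (x := p x (sig j - 2)) (by rw [hp, hp]; exact hxy _) h1
      rw [sig_sig] at this
      exact this.2
    · have h1 := hp' y (sig (j - 1) - 1)
      rw [sub_add_cancel] at h1
      have := S.T_mono_corner (sig (j - 1)) (x := p x (sig (j - 1) - 1))
        (by rw [hp, hp]; exact hxy _) h1
      rw [sig_sig, sub_add_cancel] at this
      have h2 := S.chain_sig (sig j)
      rw [sig_sig] at h2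
      exact ⟨this.1, this.2.trans h2.le⟩
  let Φ : (∀ i, Set.Icc 0 (ℓ i)) →o ∀ i, Set.Icc 0 (ℓ i) :=
    { toFun := fun x j => ⟨ccw (S.P j) (f (p x) j), ccw_nonneg _ _,
        (key x x (fun _ => le_rfl) j).2⟩
      monotone' := fun x y hxy j => (key x y (fun i => hxy i) j).1 }
  obtain ⟨x, hx⟩ : ∃ x, Φ x = x := ⟨OrderHom.lfp Φ, OrderHom.map_lfp Φ⟩
  have hf : ∀ j, p x j = f (p x) j := by
    intro j
    apply ccw_injective (S.P j)
    rw [hp]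
    conv_lhs => rw [← hx]
    rfl
  refine ⟨p x, fun i => ⟨hp' x i, ?_, ?_⟩⟩
  · intro h
    rw [hf (sig i)]
    simp only [f, sig_sig, if_pos h]
  · intro h
    have h' : A i ≠ S.P i := fun h' => hPQ i (h'.symm.trans h)
    rw [hf (sig i)]
    simp only [f, sig_sig, if_neg h', sig_sig_sub, add_sub_cancel_right]

theorem G_spec (A : Idx g → Circle) : S.IsCornerSystem A (S.G A) :=
  Classical.epsilon_spec (S.exists_cornerSystem A)

theorem P_ne_Q (i : Idx g) : S.P i ≠ S.Q i := fun h => by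
  have := S.chain i
  rw [h] at this
  linarith

/-- The lower candidate for `G m`, in `[P m, Q m]`. -/
def cornerL (A : Idx g → Circle) (m : Idx g) : Circle :=
  S.T (sig (m - 1)) • S.G A (sig (m - 1) - 1)

/-- The upper candidate for `G m`, in `[Q m, P (m + 1)]`. -/
def cornerR (A : Idx g → Circle) (m : Idx g) : Circle := S.T (sig m) • S.G A (sig m - 2)

variable (A : Idx g → Circle)

theorem G_mem (i : Idx g) : S.G A i ∈ arcIcc (S.P i) (S.P (i + 1)) := (S.G_spec A i).1

theorem cornerL_mem (m : Idx g) : S.cornerL A m ∈ arcIcc (S.P m) (S.Q m) := by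
  have h := S.G_mem A (sig (m - 1) - 1)
  rw [sub_add_cancel, ← smul_mem_arcIcc (S.T (sig (m - 1))), S.T_P_pred, S.T_P, sig_sig,
    sub_add_cancel] at h
  exact h

theorem cornerR_mem (m : Idx g) : S.cornerR A m ∈ arcIcc (S.Q m) (S.P (m + 1)) := by
  have h := S.G_mem A (sig m - 2)
  rw [show sig m - 2 + 1 = sig m - 1 by ring] at h
  have := S.T_mono_pred (sig m) (le_refl _) h
  rw [sig_sig] at this
  rw [mem_arcIcc_base (S.P m) (this.1.trans this.2.2)]
  exact ⟨this.1, this.2.2⟩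

theorem G_eq_R {i : Idx g} (h : A i = S.P i) : S.G A (sig i) = S.cornerR A (sig i) := by
  rw [(S.G_spec A i).2.1 h, cornerR, sig_sig]

theorem G_eq_L {i : Idx g} (h : A i = S.Q i) : S.G A (sig i) = S.cornerL A (sig i) := by
  rw [(S.G_spec A i).2.2 h, cornerL, sig_sig_sub, add_sub_cancel_right]

theorem T_G_pred (i : Idx g) : S.T i • S.G A (i - 1) = S.cornerL A (sig i + 1) := by
  rw [cornerL, add_sub_cancel_right, sig_sig]

theorem T_G_pred_two (i : Idx g) : S.T i • S.G A (i - 2) = S.cornerR A (sig i) := by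
  rw [cornerR, sig_sig]

/-- The cycle relation says that both ways around the vertex give the same element; this is the
factorization along the other way. -/
theorem U_smul (i : Idx g) (x : Circle) :
    S.U (i + 1) • x = S.T (sig i) • S.T (tau i + 1) • x := by
  have h := S.T_cycle (i + 1) (S.T (sig (i + 1)) • S.T (tau i) • x)
  have e : rho (i + 1) = sig (tau i) := by
    rw [← add_sub_cancel_right (tau i) 1, ← tau_add_one, sig_tau_sub]; rfl
  have e' : rho (tau i + 1) = sig i := by rw [rho, sig_tau_add, sub_add_cancel]
  rw [rho_rho (i + 1), tau_add_one, e', S.T_T_sig, e, S.T_sig_T] at h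
  rw [U, mul_smul, tau_add_one, add_sub_cancel_right, h]

/-- The source of the Markov property: left ends of fibers are preimages of the lower candidates
`cornerL`, and these cut the circle into arcs, called tiles below. -/
theorem T_H (i : Idx g) : S.T i • S.H A (i + 1) = S.cornerL A (sig i) := by
  rw [H, U_smul, S.T_T_sig, cornerL, sig_sig_sub, tau_add_one, add_sub_cancel_right]

theorem H_mem (k : Idx g) : S.H A k ∈ arcIcc (S.Q k) (S.Q (k + 1)) := by
  obtain ⟨i, rfl⟩ : ∃ i, k = i + 1 := ⟨k - 1, by ring⟩
  have h := S.cornerL_mem A (sig i)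
  rw [← S.T_H, ← S.T_Q_succ, ← S.T_Q_add_two, smul_mem_arcIcc] at h
  rwa [show i + 1 + 1 = i + 2 by ring]

theorem H_sig (i : Idx g) :
    S.H A (sig i) = S.T i • S.T (sig (i + 1)) • S.G A (sig (i + 1)) := by
  have h := sig_sig_add (sig i)
  rw [sig_sig] at h
  rw [H, U, sig_sig, ← h, mul_smul]

/-- Together with `H_sig_of_Q`: a left end of a fiber is either a boundary point of a tile or the
image of another left end, depending on the parameter. -/
theorem H_sig_of_P {i : Idx g} (h : A (i + 1) = S.P (i + 1)) :
    S.H A (sig i) = S.cornerL A (sig i + 1) := by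
  rw [H_sig, S.G_eq_R A h, cornerR, sig_sig, S.T_sig_T, show i + 1 - 2 = i - 1 by ring, T_G_pred]

theorem H_sig_of_Q {i : Idx g} (h : A (i + 1) = S.Q (i + 1)) :
    S.H A (sig i) = S.T i • S.H A (i + 2) := by
  rw [H_sig, S.G_eq_L A h, ← S.T_H, S.T_sig_T, show i + 1 + 1 = i + 2 by ring]

end Corner

end Surface

end GeodesicCoding

/-! ### Cells of the circle, the generator used on each, and the fibers of Ω -/

namespace GeodesicCoding

/-- The cells `[P i, Q i)` and `[Q i, P (i + 1))` of the circle. -/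
abbrev Cell (g : ℕ) : Type := Idx g × Bool

namespace Surface

variable {g : ℕ} [hg : Fact (2 ≤ g)] (S : Surface g)

/-- The left end point of a cell. -/
def cellLo : Cell g → Circle
  | (i, false) => S.P i
  | (i, true) => S.Q i

/-- The right end point of a cell. -/
def cellHi : Cell g → Circle
  | (i, false) => S.Q i
  | (i, true) => S.P (i + 1)

/-- The half-open cell. -/
def cell (J : Cell g) : Set Circle := arcIco (S.cellLo J) (S.cellHi J)

/-- The closed cell. -/
def closedCell (J : Cell g) : Set Circle := arcIcc (S.cellLo J) (S.cellHi J)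

theorem mem_cell_false (b : Idx g) {d : ℕ} (hd : d < 8 * g - 4) {x : Circle} :
    x ∈ S.cell (b + d, false) ↔
      ccw (S.P b) (S.P (b + d)) ≤ ccw (S.P b) x ∧ ccw (S.P b) x < ccw (S.P b) (S.Q (b + d)) :=
  mem_arcIco_base (S.P b) (S.ccw_P_lt_Q b hd).le

theorem mem_cell_true (b : Idx g) {d : ℕ} (hd : d + 1 < 8 * g - 4) {x : Circle} :
    x ∈ S.cell (b + d, true) ↔
      ccw (S.P b) (S.Q (b + d)) ≤ ccw (S.P b) x ∧
        ccw (S.P b) x < ccw (S.P b) (S.P (b + (d + 1 : ℕ))) := by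
  rw [Nat.cast_succ, ← add_assoc]
  have := S.ccw_Q_lt_P b hd
  rw [Nat.cast_succ, ← add_assoc] at this
  exact mem_arcIco_base (S.P b) this.le

theorem mem_cell_true_last (b : Idx g) {d : ℕ} (hd : d + 1 = 8 * g - 4) {x : Circle} :
    x ∈ S.cell (b + d, true) ↔ ccw (S.P b) (S.Q (b + d)) ≤ ccw (S.P b) x := by
  have h0 : b + d + 1 = b := by
    have := congrArg (Nat.cast : ℕ → Idx g) hd
    rw [natCast_modulus] at this
    push_cast at this
    linear_combination this
  have h := S.ccw_P_lt_Q b (d := d) (by omega)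
  change x ∈ arcIco (S.Q (b + d)) (S.P (b + d + 1)) ↔ _
  rw [h0, mem_arcIco_base_wrap (S.P b), ccw_self]
  · exact or_iff_left (not_lt.2 (ccw_nonneg _ _))
  · rw [ccw_self]
    exact (ccw_nonneg _ _).trans_lt h

theorem exists_cell_offset (b : Idx g) (x : Circle) :
    ∃ d : ℕ, d < 8 * g - 4 ∧ ∃ t, x ∈ S.cell (b + d, t) := by
  have hn := twelve_le g
  by_contra! hcon
  have key : ∀ d : ℕ, d < 8 * g - 4 → ccw (S.P b) (S.P (b + d)) ≤ ccw (S.P b) x := by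
    intro d
    induction d with
    | zero =>
      intro _
      rw [Nat.cast_zero, add_zero, ccw_self]
      exact ccw_nonneg _ _
    | succ d ih =>
      intro hd
      have h1 := hcon d (by omega) false
      have h2 := hcon d (by omega) true
      rw [mem_cell_false _ _ (by omega)] at h1
      rw [mem_cell_true _ _ (by omega)] at h2
      have := ih (by omega)
      by_contra! h3
      exact h2 ⟨by by_contra! h4; exact h1 ⟨this, h4⟩, h3⟩
  have h1 := hcon (8 * g - 4 - 1) (by omega) false
  have h2 := hcon (8 * g - 4 - 1) (by omega) true
  rw [mem_cell_false _ _ (by omega)] at h1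
  rw [mem_cell_true_last _ _ (by omega)] at h2
  exact h1 ⟨key _ (by omega), not_le.1 h2⟩

theorem exists_mem_cell (x : Circle) : ∃ J, x ∈ S.cell J := by
  obtain ⟨d, -, t, h⟩ := S.exists_cell_offset 0 x
  exact ⟨_, h⟩

/-- The coordinates of a point of a cell. -/
theorem cell_bounds {k : Idx g} {t : Bool} {x : Circle} (h : x ∈ S.cell (k, t)) :
    ccw (S.P k) x < ccw (S.P k) (S.P (k + 1)) ∧
      (t = false ↔ ccw (S.P k) x < ccw (S.P k) (S.Q k)) := by
  have hn := twelve_le g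
  have e0 : k + (0 : ℕ) = k := by simp
  have e1 : k + (0 + 1 : ℕ) = k + 1 := by simp
  have h1 := S.ccw_Q_lt_P k (d := 0) (by omega)
  rw [e0, e1] at h1
  rw [← e0] at h
  cases t
  · rw [mem_cell_false _ _ (by omega), e0] at h
    exact ⟨h.2.trans h1, by simpa using h.2⟩
  · rw [mem_cell_true _ _ (by omega), e0, e1] at h
    exact ⟨h.2, by simpa using h.1⟩

/-- The first coordinate of a cell with given offset is a lower bound. -/
theorem le_of_mem_cell {b : Idx g} {d : ℕ} (hd : d < 8 * g - 4) {t : Bool} {x : Circle}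
    (h : x ∈ S.cell (b + d, t)) : ccw (S.P b) (S.P (b + d)) ≤ ccw (S.P b) x ∧
      (t = true → ccw (S.P b) (S.Q (b + d)) ≤ ccw (S.P b) x) := by
  cases t
  · rw [mem_cell_false _ _ hd] at h
    exact ⟨h.1, by simp⟩
  · have h0 := S.ccw_P_lt_Q b hd
    by_cases hd' : d + 1 < 8 * g - 4
    · rw [mem_cell_true _ _ hd'] at h
      exact ⟨h0.le.trans h.1, fun _ => h.1⟩
    · rw [mem_cell_true_last _ _ (by omega)] at h
      exact ⟨h0.le.trans h, fun _ => h⟩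

theorem cell_unique {J J' : Cell g} {x : Circle} (h : x ∈ S.cell J) (h' : x ∈ S.cell J') :
    J = J' := by
  have hn := twelve_le g
  obtain ⟨k, t⟩ := J
  obtain ⟨k', t'⟩ := J'
  obtain ⟨d, hd, rfl⟩ := exists_offset k k'
  have h1 := S.cell_bounds h
  rcases Nat.eq_zero_or_pos d with rfl | hpos
  · rw [Nat.cast_zero, add_zero] at h' ⊢
    have h2 := S.cell_bounds h'
    have := h1.2.trans h2.2.symm
    cases t <;> cases t' <;> simp_all
  · have h2 := (S.le_of_mem_cell hd h').1
    have h3 := S.ccw_P_mono k (d := 1) hpos hd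
    rw [Nat.cast_one] at h3
    linarith [h1.1]

variable (A : Idx g → Circle)

open Classical in
/-- The index of the generator applied to the points of a cell. -/
def ind (J : Cell g) : Idx g := if J.2 = true ∨ A J.1 = S.P J.1 then J.1 else J.1 - 1

theorem ind_true (i : Idx g) : S.ind A (i, true) = i := by simp [ind]
theorem ind_false_P {i : Idx g} (h : A i = S.P i) : S.ind A (i, false) = i := by simp [ind, h]
theorem ind_false_Q {i : Idx g} (h : A i = S.Q i) : S.ind A (i, false) = i - 1 := by
  simp [ind, h, (S.P_ne_Q i).symm]

variable {A}

theorem A_bounds (hA : S.IsExtremal A) (b : Idx g) {d : ℕ} (hd : d < 8 * g - 4) :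
    ccw (S.P b) (S.P (b + d)) ≤ ccw (S.P b) (A (b + d)) ∧
      ccw (S.P b) (A (b + d)) ≤ ccw (S.P b) (S.Q (b + d)) := by
  have := (S.ccw_P_lt_Q b hd).le
  rcases hA (b + d) with h | h <;> rw [h]
  · exact ⟨le_rfl, this⟩
  · exact ⟨this, le_rfl⟩

theorem cast_eq_one_sub {d : ℕ} (hd : d + 1 = 8 * g - 4) : ((d : ℕ) : Idx g) = -1 := by
  have := congrArg (Nat.cast : ℕ → Idx g) hd
  rw [natCast_modulus] at this
  push_cast at this
  linear_combination this

/-- For extremal parameters each arc [A_i, A_{i+1}) is a union of whole cells: [Q_i, P_{i+1}) always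
belongs to the arc of i, and [P_i, Q_i) to that of i or of i − 1 according to A_i. -/
theorem mem_arcIco_iff_ind (hA : S.IsExtremal A) {J : Cell g} {w : Circle} (h : w ∈ S.cell J)
    (i : Idx g) : w ∈ arcIco (A i) (A (i + 1)) ↔ S.ind A J = i := by
  have hn := twelve_le g
  obtain ⟨k, t⟩ := J
  obtain ⟨d, hd, rfl⟩ := exists_offset k i
  have hb := S.cell_bounds h
  have h0 := ccw_nonneg (S.P k) w
  have e0 : k + (0 : ℕ) = k := by simp
  have a0 := S.A_bounds hA k (d := 0) (by omega)
  have q0 := S.ccw_Q_lt_P k (d := 0) (by omega)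
  rw [zero_add, Nat.cast_one] at q0
  rw [e0] at a0 q0
  rcases Nat.eq_zero_or_pos d with rfl | hpos
  · have a1 := S.A_bounds hA k (d := 1) (by omega)
    rw [Nat.cast_one] at a1
    rw [e0, mem_arcIco_base (S.P k) (by linarith)]
    cases t
    · have hw := hb.2.1 rfl
      rcases hA k with h | h
      · rw [S.ind_false_P A h, h, ccw_self]
        simp only [iff_true]
        exact ⟨h0, by linarith⟩
      · rw [S.ind_false_Q A h, h]
        refine iff_of_false (fun h => by linarith) fun h => ?_
        have := natCast_lt_injective (g := g) (a := 1) (b := 0) (by omega) (by omega) (by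
          push_cast; linear_combination -h)
        omega
    · have hw : ¬ ccw (S.P k) w < ccw (S.P k) (S.Q k) := fun h => by simpa using hb.2.2 h
      rw [ind_true]
      simp only [iff_true]
      constructor <;> linarith
  have hp1 := S.ccw_P_mono k (d := 1) hpos hd
  rw [Nat.cast_one] at hp1
  have ad := S.A_bounds hA k hd
  by_cases hd' : d + 1 < 8 * g - 4
  · have a1 := S.A_bounds hA k hd'
    rw [Nat.cast_succ, ← add_assoc] at a1
    have b1 := S.ccw_Q_lt_P k hd'
    rw [Nat.cast_succ, ← add_assoc] at b1
    rw [mem_arcIco_base (S.P k) (by linarith)]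
    refine iff_of_false (fun h => by linarith) fun h => ?_
    rw [ind] at h
    split_ifs at h
    · have := natCast_lt_injective (g := g) (a := 0) (b := d) (by omega) (by omega) (by
        push_cast; simp only at h; linear_combination h)
      omega
    · have := natCast_lt_injective (g := g) (a := 0) (b := d + 1) (by omega) (by omega) (by
        push_cast; simp only at h; linear_combination h)
      omega
  · have ed : k + (d : Idx g) = k - 1 := by
      rw [cast_eq_one_sub (by omega), sub_eq_add_neg]
    rw [ed, sub_add_cancel]
    rw [ed] at ad hp1
    rw [mem_arcIco_base_wrap (S.P k) (by linarith), or_iff_right (by linarith)]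
    cases t
    · have hw := hb.2.1 rfl
      rcases hA k with h | h
      · rw [S.ind_false_P A h, h, ccw_self]
        refine iff_of_false (fun h => by linarith) fun h => ?_
        have := natCast_lt_injective (g := g) (a := 1) (b := 0) (by omega) (by omega) (by
          push_cast; linear_combination h)
        omega
      · rw [S.ind_false_Q A h, h]
        simpa using hw
    · have hw : ¬ ccw (S.P k) w < ccw (S.P k) (S.Q k) := fun h => by simpa using hb.2.2 h
      rw [ind_true]
      refine iff_of_false (fun h => by linarith) fun h => ?_
      have := natCast_lt_injective (g := g) (a := 1) (b := 0) (by omega) (by omega) (by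
        push_cast; linear_combination h)
      omega

theorem index_eq (hA : S.IsExtremal A) {J : Cell g} {w : Circle} (h : w ∈ S.cell J) :
    index A w = S.ind A J :=
  ((S.mem_arcIco_iff_ind hA h _).1
    (Classical.epsilon_spec (p := fun i => w ∈ arcIco (A i) (A (i + 1)))
      ⟨_, (S.mem_arcIco_iff_ind hA h _).2 rfl⟩)).symm

/-! ### The fibers over the cells -/

variable (A)

/-- The right end point of the fiber of the domain over a cell. -/
def fiberHi : Cell g → Circle
  | (i, false) => S.G A (i - 2)
  | (i, true) => S.G A (i - 1)

/-- The fiber of the domain over a cell. -/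
def fiber (J : Cell g) : Set Circle := arcIcc (S.H A (J.1 + 1)) (S.fiberHi A J)

theorem Omega_eq : S.Omega A = ⋃ J, S.fiber A J ×ˢ S.closedCell J := by
  ext p
  simp only [Omega, Set.mem_iUnion, Set.mem_union, Prod.exists, Bool.exists_bool]
  rfl

theorem mem_Omega {p : Circle × Circle} :
    p ∈ S.Omega A ↔ ∃ J, p.1 ∈ S.fiber A J ∧ p.2 ∈ S.closedCell J := by
  simp only [Omega_eq, Set.mem_iUnion, Set.mem_prod]

/-- The corner values near `k`, seen from `P (k + 1)`. -/
theorem corner_chain (k : Idx g) :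
    (ccw (S.P (k + 1)) (S.Q (k + 1)) ≤ ccw (S.P (k + 1)) (S.H A (k + 1)) ∧
      ccw (S.P (k + 1)) (S.H A (k + 1)) ≤ ccw (S.P (k + 1)) (S.Q (k + 2))) ∧
    (ccw (S.P (k + 1)) (S.P (k - 2)) ≤ ccw (S.P (k + 1)) (S.G A (k - 2)) ∧
      ccw (S.P (k + 1)) (S.G A (k - 2)) ≤ ccw (S.P (k + 1)) (S.P (k - 1))) ∧
    ccw (S.P (k + 1)) (S.P (k - 1)) ≤ ccw (S.P (k + 1)) (S.G A (k - 1)) ∧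
      ccw (S.P (k + 1)) (S.G A (k - 1)) ≤ ccw (S.P (k + 1)) (S.P k) := by
  have hw := S.wrap k
  have h1 := S.H_mem A (k + 1)
  have h2 := S.G_mem A (k - 2)
  have h3 := S.G_mem A (k - 1)
  rw [show k + 1 + 1 = k + 2 by ring, mem_arcIcc_base (S.P (k + 1)) (by linarith)] at h1
  rw [show k - 2 + 1 = k - 1 by ring, mem_arcIcc_base (S.P (k + 1)) (by linarith)] at h2
  rw [show k - 1 + 1 = k by ring, mem_arcIcc_base (S.P (k + 1)) (by linarith)] at h3
  exact ⟨h1, h2, h3⟩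

theorem mem_fiber_false {k : Idx g} {u : Circle} : u ∈ S.fiber A (k, false) ↔
    ccw (S.P (k + 1)) (S.H A (k + 1)) ≤ ccw (S.P (k + 1)) u ∧
      ccw (S.P (k + 1)) u ≤ ccw (S.P (k + 1)) (S.G A (k - 2)) := by
  have hw := S.wrap k
  have hc := S.corner_chain A k
  exact mem_arcIcc_base (S.P (k + 1)) (a := S.H A (k + 1)) (b := S.G A (k - 2)) (by linarith)

theorem mem_fiber_true {k : Idx g} {u : Circle} : u ∈ S.fiber A (k, true) ↔
    ccw (S.P (k + 1)) (S.H A (k + 1)) ≤ ccw (S.P (k + 1)) u ∧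
      ccw (S.P (k + 1)) u ≤ ccw (S.P (k + 1)) (S.G A (k - 1)) := by
  have hw := S.wrap k
  have hc := S.corner_chain A k
  exact mem_arcIcc_base (S.P (k + 1)) (a := S.H A (k + 1)) (b := S.G A (k - 1)) (by linarith)

/-- For one value of the parameter this is an equality. For the other, both points are images under
one generator of points already in order, H_{i+2} and G_{i−1}. -/
theorem H_le_L (hA : S.IsExtremal A) (k : Idx g) :
    ccw (S.P k) (S.H A k) ≤ ccw (S.P k) (S.cornerL A (k + 1)) := by
  obtain ⟨i, rfl⟩ : ∃ i, k = sig i := ⟨sig k, (sig_sig k).symm⟩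
  rcases hA (i + 1) with h | h
  · rw [S.H_sig_of_P A h]
  · rw [S.H_sig_of_Q A h, ← S.T_G_pred]
    have hw := S.wrap i
    have h1 := S.H_mem A (i + 2)
    have h2 := S.G_mem A (i - 1)
    rw [show i + 2 + 1 = i + 3 by ring, mem_arcIcc_base (S.P (i + 1)) (by linarith)] at h1
    rw [sub_add_cancel, mem_arcIcc_base (S.P (i + 1)) (by linarith)] at h2
    refine (smul_mono (S.T i) (d := S.P (i + 1)) (a := S.Q (i + 2)) (b := S.P i) (by linarith)
      (by linarith) (by linarith) ?_).2.1
    rw [S.T_Q_add_two, S.T_P]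
    have e0 : sig i + (0 : ℕ) = sig i := by simp
    have := S.ccw_Q_mono (sig i) (d := 0) (e := 1) (by omega) (by have := twelve_le g; omega)
    rwa [e0, Nat.cast_one] at this

theorem L_bounds (b : Idx g) {d : ℕ} (hd : d < 8 * g - 4) :
    ccw (S.P b) (S.P (b + d)) ≤ ccw (S.P b) (S.cornerL A (b + d)) ∧
      ccw (S.P b) (S.cornerL A (b + d)) ≤ ccw (S.P b) (S.Q (b + d)) := by
  have := S.cornerL_mem A (b + d)
  rwa [mem_arcIcc_base (S.P b) (S.ccw_P_lt_Q b hd).le] at this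

theorem L_lt (b : Idx g) {d e : ℕ} (h : d < e) (he : e < 8 * g - 4) :
    ccw (S.P b) (S.cornerL A (b + d)) < ccw (S.P b) (S.cornerL A (b + e)) := by
  have h1 := S.L_bounds A b (d := d) (by omega)
  have h2 := S.L_bounds A b he
  have := S.ccw_Q_lt_P_of_lt b h he
  linarith

theorem L_le (b : Idx g) {d e : ℕ} (h : d ≤ e) (he : e < 8 * g - 4) :
    ccw (S.P b) (S.cornerL A (b + d)) ≤ ccw (S.P b) (S.cornerL A (b + e)) := by
  rcases h.eq_or_lt with rfl | h
  · exact le_rfl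
  · exact (S.L_lt A b h he).le

theorem L_le_G_le_R (hA : S.IsExtremal A) (k : Idx g) :
    ccw (S.P k) (S.cornerL A k) ≤ ccw (S.P k) (S.G A k) ∧
      ccw (S.P k) (S.G A k) ≤ ccw (S.P k) (S.cornerR A k) := by
  obtain ⟨i, rfl⟩ : ∃ i, k = sig i := ⟨sig k, (sig_sig k).symm⟩
  have h1 := S.cornerL_mem A (sig i)
  have h2 := S.cornerR_mem A (sig i)
  rw [mem_arcIcc] at h1
  rw [mem_arcIcc_base (S.P (sig i)) (S.chain_sig i).le] at h2
  rcases hA i with h | h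
  · rw [S.G_eq_R A h]; exact ⟨h1.trans h2.1, le_rfl⟩
  · rw [S.G_eq_L A h]; exact ⟨le_rfl, h1.trans h2.1⟩

end Surface
end GeodesicCoding

namespace GeodesicCoding

theorem exists_step {f : ℕ → ℝ} {x : ℝ} {a b : ℕ} (hab : a < b) (ha : f a ≤ x) (hb : x ≤ f b) :
    ∃ d, a ≤ d ∧ d < b ∧ f d ≤ x ∧ x ≤ f (d + 1) := by
  by_contra! hcon
  have : ∀ d, a ≤ d → d < b → f d ≤ x := by
    intro d hd
    induction d, hd using Nat.le_induction with
    | base => exact fun _ => ha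
    | succ d hd ih => exact fun h => (hcon d hd (by omega) (ih (by omega))).le
  have h1 := hcon (b - 1) (by omega) (by omega) (this _ (by omega) (by omega))
  rw [Nat.sub_add_cancel (by omega)] at h1
  linarith

namespace Surface

variable {g : ℕ} [hg : Fact (2 ≤ g)] (S : Surface g) (A : Idx g → Circle)

/-! ### The Markov property -/

/-- The fiber over [Q_i, P_{i+1}) is mapped exactly onto the tile with index σ(i). -/
theorem T_fiber_true (i : Idx g) (u : Circle) : u ∈ S.fiber A (i, true) ↔
    S.T i • u ∈ arcIcc (S.cornerL A (sig i)) (S.cornerL A (sig i + 1)) := by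
  rw [← S.T_H, ← S.T_G_pred, smul_mem_arcIcc]; rfl

theorem T_fiber_false (i : Idx g) (u : Circle) : u ∈ S.fiber A (i, false) ↔
    S.T i • u ∈ arcIcc (S.cornerL A (sig i)) (S.cornerR A (sig i)) := by
  rw [← S.T_H, ← S.T_G_pred_two, smul_mem_arcIcc]; rfl

theorem T_fiber_false_succ {i : Idx g} (h : A (i + 1) = S.Q (i + 1)) (u : Circle) :
    u ∈ S.fiber A (i + 1, false) ↔
      S.T i • u ∈ arcIcc (S.H A (sig i)) (S.cornerL A (sig i + 1)) := by
  rw [← S.T_G_pred, S.H_sig_of_Q A h, smul_mem_arcIcc, fiber, fiberHi,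
    show i + 1 - 2 = i - 1 by ring, show i + 1 + 1 = i + 2 by ring]

theorem T_cell_true (i : Idx g) (w : Circle) : w ∈ S.cell (i, true) ↔
    S.T i • w ∈ arcIco (S.Q (sig i + 2)) (S.P (sig i - 1)) := by
  rw [← S.T_Q, ← S.T_P_succ, smul_mem_arcIco]; rfl

theorem T_cell_false (i : Idx g) (w : Circle) : w ∈ S.cell (i, false) ↔
    S.T i • w ∈ arcIco (S.Q (sig i + 1)) (S.Q (sig i + 2)) := by
  rw [← S.T_Q, ← S.T_P, smul_mem_arcIco]; rfl

theorem T_cell_false_succ (i : Idx g) (w : Circle) : w ∈ S.cell (i + 1, false) ↔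
    S.T i • w ∈ arcIco (S.P (sig i - 1)) (S.P (sig i)) := by
  rw [← S.T_P_succ, ← S.T_Q_succ, smul_mem_arcIco]; rfl

theorem L_le_G_wrap (hA : S.IsExtremal A) (k : Idx g) :
    ccw (S.P (k + 1)) (S.cornerL A (k - 2)) ≤ ccw (S.P (k + 1)) (S.G A (k - 2)) ∧
    ccw (S.P (k + 1)) (S.cornerL A (k - 1)) ≤ ccw (S.P (k + 1)) (S.G A (k - 1)) := by
  have hw := S.wrap k
  have hc := S.corner_chain A k
  have l1 := S.cornerL_mem A (k - 1)
  have l2 := S.cornerL_mem A (k - 2)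
  rw [mem_arcIcc_base (S.P (k + 1)) (by linarith)] at l1 l2
  have h1 := (S.L_le_G_le_R A hA (k - 1)).1
  have h2 := (S.L_le_G_le_R A hA (k - 2)).1
  rw [ccw_of_le l1.1, ccw_of_le hc.2.2.1] at h1
  rw [ccw_of_le l2.1, ccw_of_le hc.2.1.1] at h2
  constructor <;> linarith

theorem offset_eqs (k : Idx g) : k + 1 + (1 : ℕ) = k + 2 ∧
    k + 1 + ((8 * g - 4 - 2 : ℕ) : Idx g) = k - 1 ∧
    k + 1 + ((8 * g - 4 - 3 : ℕ) : Idx g) = k - 2 := by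
  have hn := twelve_le g
  refine ⟨by push_cast; ring, ?_, ?_⟩
  · rw [cast_sub_eq (by omega)]; push_cast; ring
  · rw [cast_sub_eq (by omega)]; push_cast; ring

theorem H_le_L_wrap (hA : S.IsExtremal A) (k : Idx g) :
    ccw (S.P (k + 1)) (S.H A (k + 1)) ≤ ccw (S.P (k + 1)) (S.cornerL A (k + 2)) := by
  have := S.H_le_L A hA (k + 1)
  rwa [show k + 1 + 1 = k + 2 by ring] at this

theorem L_arc_base (k : Idx g) {e : ℕ} (he : e + 1 < 8 * g - 4) {u : Circle} :
    u ∈ arcIcc (S.cornerL A (k + 1 + e)) (S.cornerL A (k + 1 + e + 1)) ↔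
      ccw (S.P (k + 1)) (S.cornerL A (k + 1 + e)) ≤ ccw (S.P (k + 1)) u ∧
      ccw (S.P (k + 1)) u ≤ ccw (S.P (k + 1)) (S.cornerL A (k + 1 + (e + 1 : ℕ))) := by
  rw [add_assoc (k + 1) (e : Idx g) 1, ← Nat.cast_succ]
  exact mem_arcIcc_base _ (S.L_le A (k + 1) (by omega) he)

/-- The fiber contains every tile between L_{k+2} and L_{k−1}: its left end does not exceed the
first of these points and its right end is not before the last. -/
theorem L_arc_subset_true (hA : S.IsExtremal A) (k : Idx g) {e : ℕ} (h1 : 1 ≤ e)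
    (he : e + 3 ≤ 8 * g - 4) {u : Circle}
    (hu : u ∈ arcIcc (S.cornerL A (k + 1 + e)) (S.cornerL A (k + 1 + e + 1))) :
    u ∈ S.fiber A (k, true) := by
  rw [L_arc_base _ _ _ (by omega)] at hu
  obtain ⟨e1, e2, e3⟩ := offset_eqs k
  have a1 := S.L_le A (k + 1) h1 (by omega)
  have a2 := S.L_le A (k + 1) (d := e + 1) (e := 8 * g - 4 - 2) (by omega) (by omega)
  rw [e1] at a1
  rw [e2] at a2
  have b1 := S.H_le_L_wrap A hA k
  have b2 := (S.L_le_G_wrap A hA k).2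
  rw [mem_fiber_true]
  constructor <;> linarith

theorem L_arc_subset_false (hA : S.IsExtremal A) (k : Idx g) {e : ℕ} (h1 : 1 ≤ e)
    (he : e + 4 ≤ 8 * g - 4) {u : Circle}
    (hu : u ∈ arcIcc (S.cornerL A (k + 1 + e)) (S.cornerL A (k + 1 + e + 1))) :
    u ∈ S.fiber A (k, false) := by
  rw [L_arc_base _ _ _ (by omega)] at hu
  obtain ⟨e1, e2, e3⟩ := offset_eqs k
  have a1 := S.L_le A (k + 1) h1 (by omega)
  have a2 := S.L_le A (k + 1) (d := e + 1) (e := 8 * g - 4 - 3) (by omega) (by omega)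
  rw [e1] at a1
  rw [e3] at a2
  have b1 := S.H_le_L_wrap A hA k
  have b2 := (S.L_le_G_wrap A hA k).1
  rw [mem_fiber_false]
  constructor <;> linarith

/-- The transition from `J` to `J'`: the generator maps the fiber over `J` into the fiber over `J'`
and `J` onto an arc that contains `J'`. -/
def Trans (J J' : Cell g) : Prop :=
  (∀ u ∈ S.fiber A J, S.T (S.ind A J) • u ∈ S.fiber A J') ∧
    ∀ w, S.T (S.ind A J) • w ∈ S.cell J' → w ∈ S.cell J

/-- The arc is the image of a cell [Q_i, P_{i+1}) with m = σ(i). It is a union of whole cells, and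
the conditions list their offsets from m. -/
theorem mem_cell_arc (m : Idx g) {d : ℕ} {t : Bool} {x : Circle} (hd : d < 8 * g - 4)
    (hx : x ∈ S.cell (m + d, t)) :
    x ∈ arcIco (S.Q (m + 2)) (S.P (m - 1)) ↔
      (d + 2 ≤ 8 * g - 4) ∧ (2 ≤ d) ∧ (t = false → 3 ≤ d) := by
  have hn := twelve_le g
  have e2 : m + (2 : ℕ) = m + 2 := by simp
  have e1 : m + ((8 * g - 4 - 1 : ℕ) : Idx g) = m - 1 := by
    rw [cast_sub_eq (by omega)]; push_cast; ring
  rw [← e2, ← e1, mem_arcIco_base (S.P m) (S.ccw_Q_lt_P_of_lt m (by omega) (by omega)).le]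
  have hlo := S.le_of_mem_cell hd hx
  have hq := S.ccw_P_lt_Q m (d := 8 * g - 4 - 1) (by omega)
  have hq2 := S.ccw_P_lt_Q m (d := 2) (by omega)
  constructor
  · rintro ⟨h1, h2⟩
    have hd2 : d + 2 ≤ 8 * g - 4 := by
      by_contra hcon
      have : d = 8 * g - 4 - 1 := by omega
      subst this
      linarith
    cases t
    · rw [mem_cell_false _ _ hd] at hx
      have : 3 ≤ d := by
        by_contra hcon
        have := S.ccw_Q_mono m (d := d) (e := 2) (by omega) (by omega)
        linarith
      exact ⟨hd2, by omega, fun _ => this⟩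
    · rw [mem_cell_true _ _ (by omega)] at hx
      refine ⟨hd2, ?_, by simp⟩
      by_contra hcon
      have := S.ccw_P_mono m (d := d + 1) (e := 2) (by omega) (by omega)
      linarith
  · rintro ⟨h1, h2, h3⟩
    cases t
    · rw [mem_cell_false _ _ hd] at hx
      have a1 := S.ccw_Q_lt_P_of_lt m (d := 2) (e := d) (h3 rfl) hd
      have a2 := S.ccw_Q_lt_P_of_lt m (d := d) (e := 8 * g - 4 - 1) (by omega) (by omega)
      constructor <;> linarith
    · rw [mem_cell_true _ _ (by omega)] at hx
      have a1 := S.ccw_Q_mono m h2 hd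
      have a2 := S.ccw_P_mono m (d := d + 1) (e := 8 * g - 4 - 1) (by omega) (by omega)
      constructor <;> linarith

theorem trans_true (hA : S.IsExtremal A) (i : Idx g) {d : ℕ} {t : Bool}
    (h1 : d + 2 ≤ 8 * g - 4) (h2 : 2 ≤ d) (h3 : t = false → 3 ≤ d) :
    S.Trans A (i, true) (sig i + d, t) := by
  constructor
  · intro u hu
    rw [ind_true]
    rw [T_fiber_true] at hu
    have e : sig i = sig i + d + 1 + ((8 * g - 4 - (1 + d) : ℕ) : Idx g) := by
      rw [cast_sub_eq (by omega)]; push_cast; ring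
    rw [e] at hu
    cases t
    · have := S.L_arc_subset_false A hA (sig i + d) (e := 8 * g - 4 - (1 + d))
        (by omega) (by have := h3 rfl; omega) hu
      convert this
    · exact S.L_arc_subset_true A hA (sig i + d) (by omega) (by omega) hu
  · intro w hw
    rw [ind_true] at hw
    rw [T_cell_true, S.mem_cell_arc (sig i) (by omega) hw]
    exact ⟨h1, h2, h3⟩

end Surface
end GeodesicCoding

/-! ### Transitions from and to every cell -/

namespace GeodesicCoding

namespace Surface

variable {g : ℕ} [hg : Fact (2 ≤ g)] (S : Surface g) (A : Idx g → Circle)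

theorem arc_Q_Q (m : Idx g) {w : Circle} : w ∈ arcIco (S.Q (m + 1)) (S.Q (m + 2)) ↔
    w ∈ S.cell (m + 1, true) ∨ w ∈ S.cell (m + 2, false) := by
  have h := S.chain m
  have h1 : w ∈ S.cell (m + 1, true) ↔ ccw (S.P (m - 3)) (S.Q (m + 1)) ≤ ccw (S.P (m - 3)) w ∧
      ccw (S.P (m - 3)) w < ccw (S.P (m - 3)) (S.P (m + 2)) := by
    rw [cell, cellLo, cellHi, show m + 1 + 1 = m + 2 by ring]
    exact mem_arcIco_base _ (by linarith)
  have h2 : w ∈ S.cell (m + 2, false) ↔ _ :=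
    mem_arcIco_base (S.P (m - 3)) (a := S.P (m + 2)) (b := S.Q (m + 2)) (x := w) (by linarith)
  rw [h1, h2, mem_arcIco_base (S.P (m - 3)) (by linarith)]
  constructor
  · rintro ⟨a, b⟩
    rcases lt_or_ge (ccw (S.P (m - 3)) w) (ccw (S.P (m - 3)) (S.P (m + 2))) with h | h
    · exact Or.inl ⟨a, h⟩
    · exact Or.inr ⟨h, b⟩
  · rintro (⟨a, b⟩ | ⟨a, b⟩) <;> constructor <;> linarith

theorem arc_P_P (m : Idx g) {w : Circle} : w ∈ arcIco (S.P (m - 1)) (S.P m) ↔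
    w ∈ S.cell (m - 1, false) ∨ w ∈ S.cell (m - 1, true) := by
  have h := S.chain m
  have h1 : w ∈ S.cell (m - 1, true) ↔ ccw (S.P (m - 3)) (S.Q (m - 1)) ≤ ccw (S.P (m - 3)) w ∧
      ccw (S.P (m - 3)) w < ccw (S.P (m - 3)) (S.P m) := by
    rw [cell, cellLo, cellHi, show m - 1 + 1 = m by ring]
    exact mem_arcIco_base _ (by linarith)
  have h2 : w ∈ S.cell (m - 1, false) ↔ _ :=
    mem_arcIco_base (S.P (m - 3)) (a := S.P (m - 1)) (b := S.Q (m - 1)) (x := w) (by linarith)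
  rw [h1, h2, mem_arcIco_base (S.P (m - 3)) (by linarith)]
  constructor
  · rintro ⟨a, b⟩
    rcases lt_or_ge (ccw (S.P (m - 3)) w) (ccw (S.P (m - 3)) (S.Q (m - 1))) with h | h
    · exact Or.inl ⟨a, h⟩
    · exact Or.inr ⟨h, b⟩
  · rintro (⟨a, b⟩ | ⟨a, b⟩) <;> constructor <;> linarith

theorem arc_L_R (hA : S.IsExtremal A) {i : Idx g} (h : A i = S.P i) {u : Circle}
    (hu : u ∈ arcIcc (S.cornerL A (sig i)) (S.cornerR A (sig i))) :
    u ∈ S.fiber A (sig i + 1, true) ∧ u ∈ S.fiber A (sig i + 2, false) := by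
  rw [← S.G_eq_R A h] at hu
  set m := sig i
  have l := S.cornerL_mem A m
  constructor
  · have hw := S.wrap (m + 1)
    have hc := S.corner_chain A (m + 1)
    have hL := (S.L_le_G_wrap A hA (m + 1)).2
    rw [mem_fiber_true]
    rw [show m + 1 - 1 = m by ring] at hw hc hL ⊢
    rw [mem_arcIcc_base (S.P (m + 1 + 1)) hL] at hu
    rw [mem_arcIcc_base (S.P (m + 1 + 1)) (by linarith)] at l
    constructor <;> linarith
  · have hw := S.wrap (m + 2)
    have hc := S.corner_chain A (m + 2)
    have hL := (S.L_le_G_wrap A hA (m + 2)).1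
    rw [mem_fiber_false]
    rw [show m + 2 - 2 = m by ring] at hw hc hL ⊢
    rw [mem_arcIcc_base (S.P (m + 2 + 1)) hL] at hu
    rw [mem_arcIcc_base (S.P (m + 2 + 1)) (by linarith)] at l
    constructor <;> linarith

theorem arc_H_L (hA : S.IsExtremal A) (m : Idx g) {u : Circle}
    (hu : u ∈ arcIcc (S.H A m) (S.cornerL A (m + 1))) :
    u ∈ S.fiber A (m - 1, false) ∧ u ∈ S.fiber A (m - 1, true) := by
  have l := S.cornerL_mem A (m + 1)
  have hw := S.wrap (m - 1)
  have hc := S.corner_chain A (m - 1)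
  have hL := S.H_le_L_wrap A hA (m - 1)
  rw [mem_fiber_true, mem_fiber_false]
  rw [show m - 1 + 2 = m + 1 by ring] at hw hc hL
  rw [show m - 1 + 1 = m by ring] at hw hc hL ⊢
  rw [mem_arcIcc_base (S.P m) hL] at hu
  rw [mem_arcIcc_base (S.P m) (by linarith)] at l
  constructor <;> constructor <;> linarith

/-- The short cell [P_i, Q_i) is stretched over exactly two cells. Which two depends on the
parameter; `trans_false_Q` is the other case. -/
theorem trans_false_P (hA : S.IsExtremal A) {i : Idx g} (h : A i = S.P i) :
    S.Trans A (i, false) (sig i + 1, true) ∧ S.Trans A (i, false) (sig i + 2, false) := by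
  rw [Trans, Trans, S.ind_false_P A h]
  refine ⟨⟨fun u hu => ?_, fun w hw => ?_⟩, ⟨fun u hu => ?_, fun w hw => ?_⟩⟩
  · rw [T_fiber_false] at hu
    exact (S.arc_L_R A hA h hu).1
  · rw [T_cell_false, arc_Q_Q]; exact Or.inl hw
  · rw [T_fiber_false] at hu
    exact (S.arc_L_R A hA h hu).2
  · rw [T_cell_false, arc_Q_Q]; exact Or.inr hw

theorem trans_false_Q (hA : S.IsExtremal A) {i : Idx g} (h : A (i + 1) = S.Q (i + 1)) :
    S.Trans A (i + 1, false) (sig i - 1, false) ∧ S.Trans A (i + 1, false) (sig i - 1, true) := by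
  rw [Trans, Trans, S.ind_false_Q A h, add_sub_cancel_right]
  refine ⟨⟨fun u hu => ?_, fun w hw => ?_⟩, ⟨fun u hu => ?_, fun w hw => ?_⟩⟩
  · rw [S.T_fiber_false_succ A h] at hu
    exact (S.arc_H_L A hA _ hu).1
  · rw [T_cell_false_succ, arc_P_P]; exact Or.inl hw
  · rw [S.T_fiber_false_succ A h] at hu
    exact (S.arc_H_L A hA _ hu).2
  · rw [T_cell_false_succ, arc_P_P]; exact Or.inr hw

theorem trans_of_mem (hA : S.IsExtremal A) {J J' : Cell g} {w : Circle} (hw : w ∈ S.cell J)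
    (hw' : S.T (S.ind A J) • w ∈ S.cell J') : S.Trans A J J' := by
  obtain ⟨i, t⟩ := J
  cases t
  · rcases hA i with h | h
    · rw [S.ind_false_P A h] at hw'
      rw [T_cell_false, arc_Q_Q] at hw
      rcases hw with hw | hw
      · rw [S.cell_unique hw' hw]; exact (S.trans_false_P A hA h).1
      · rw [S.cell_unique hw' hw]; exact (S.trans_false_P A hA h).2
    · rw [S.ind_false_Q A h] at hw'
      obtain ⟨j, rfl⟩ : ∃ j, i = j + 1 := ⟨i - 1, by ring⟩
      rw [add_sub_cancel_right] at hw'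
      rw [T_cell_false_succ, arc_P_P] at hw
      rcases hw with hw | hw
      · rw [S.cell_unique hw' hw]; exact (S.trans_false_Q A hA h).1
      · rw [S.cell_unique hw' hw]; exact (S.trans_false_Q A hA h).2
  · rw [ind_true] at hw'
    rw [T_cell_true] at hw
    obtain ⟨k, t⟩ := J'
    obtain ⟨d, hd, rfl⟩ := exists_offset (sig i) k
    rw [S.mem_cell_arc _ hd hw'] at hw
    exact S.trans_true A hA i hw.1 hw.2.1 hw.2.2

/-- A point of the fiber over `J'` comes from a cell with a transition to `J'`. -/
theorem exists_trans (hA : S.IsExtremal A) {J' : Cell g} {u : Circle} (hu : u ∈ S.fiber A J') :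
    ∃ J, S.Trans A J J' ∧ S.T (sig (S.ind A J)) • u ∈ S.fiber A J := by
  have hn := twelve_le g
  obtain ⟨k, t⟩ := J'
  obtain ⟨e1, e2, e3⟩ := offset_eqs k
  have hw := S.wrap k
  have hc := S.corner_chain A k
  -- A point in a tile that lies within the fiber comes from the long cell whose fiber is mapped
  -- onto that tile.
  have middle : ∀ e : ℕ, 1 ≤ e → e + 3 ≤ 8 * g - 4 → (t = false → e + 4 ≤ 8 * g - 4) →
      ccw (S.P (k + 1)) (S.cornerL A (k + 1 + e)) ≤ ccw (S.P (k + 1)) u →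
      ccw (S.P (k + 1)) u ≤ ccw (S.P (k + 1)) (S.cornerL A (k + 1 + (e + 1 : ℕ))) →
      ∃ J, S.Trans A J (k, t) ∧ S.T (sig (S.ind A J)) • u ∈ S.fiber A J := by
    intro e h1 h2 h3 h4 h5
    have hm := (S.L_arc_base A k (by omega)).2 ⟨h4, h5⟩
    refine ⟨(sig (k + 1 + e), true), ?_, ?_⟩
    · have := S.trans_true A hA (sig (k + 1 + e)) (d := 8 * g - 4 - (1 + e)) (t := t) (by omega)
        (by omega) (fun h => by have := h3 h; omega)
      rw [sig_sig] at this
      convert this using 2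
      rw [cast_sub_eq (by omega)]; push_cast; ring
    · rw [T_fiber_true, ind_true, S.T_T_sig, sig_sig]
      exact hm
  -- Between the left end of the fiber and the first tile boundary. If the parameter is a `P`, the
  -- two coincide and `middle` applies; otherwise the point comes from a short cell.
  have low : ccw (S.P (k + 1)) (S.H A (k + 1)) ≤ ccw (S.P (k + 1)) u →
      ccw (S.P (k + 1)) u ≤ ccw (S.P (k + 1)) (S.cornerL A (k + 2)) →
      ∃ J, S.Trans A J (k, t) ∧ S.T (sig (S.ind A J)) • u ∈ S.fiber A J := by
    intro h1 h2
    obtain ⟨i, hi⟩ : ∃ i, k + 1 = sig i := ⟨sig (k + 1), (sig_sig _).symm⟩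
    rcases hA (i + 1) with h | h
    · have h3 := S.H_sig_of_P A h
      rw [← hi, show k + 1 + 1 = k + 2 by ring] at h3
      rw [h3] at h1
      refine middle 1 le_rfl (by omega) (by omega) (by rwa [e1]) ?_
      have := S.L_le A (k + 1) (d := 1) (e := 1 + 1) (by omega) (by omega)
      rw [e1] at this
      linarith
    · refine ⟨(i + 1, false), ?_, ?_⟩
      · have := S.trans_false_Q A hA h
        rw [← hi, add_sub_cancel_right] at this
        cases t
        exacts [this.1, this.2]
      · rw [S.T_fiber_false_succ A h, S.ind_false_Q A h, add_sub_cancel_right, S.T_T_sig, ← hi,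
          show k + 1 + 1 = k + 2 by ring, mem_arcIcc_base (S.P (k + 1)) (h1.trans h2)]
        exact ⟨h1, h2⟩
  -- Between the last tile boundary and the right end of the fiber, again degenerate for one value
  -- of the parameter.
  have high : ∀ m : Idx g, (t = true → m = k - 1) → (t = false → m = k - 2) →
      ccw (S.P (k + 1)) (S.cornerL A m) ≤ ccw (S.P (k + 1)) u →
      ccw (S.P (k + 1)) u ≤ ccw (S.P (k + 1)) (S.G A m) →
      ∃ J, S.Trans A J (k, t) ∧ S.T (sig (S.ind A J)) • u ∈ S.fiber A J := by
    intro m ht hf h1 h2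
    obtain ⟨i, rfl⟩ : ∃ i, m = sig i := ⟨sig m, (sig_sig m).symm⟩
    rcases hA i with h | h
    · refine ⟨(i, false), ?_, ?_⟩
      · have := S.trans_false_P A hA h
        cases t
        · rw [hf rfl, sub_add_cancel] at this; exact this.2
        · rw [ht rfl, sub_add_cancel] at this; exact this.1
      · rw [T_fiber_false, S.ind_false_P A h, S.T_T_sig, ← S.G_eq_R A h,
          mem_arcIcc_base (S.P (k + 1)) (h1.trans h2)]
        exact ⟨h1, h2⟩
    · rw [S.G_eq_L A h] at h2
      cases t
      · rw [hf rfl] at h1 h2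
        have := S.L_le A (k + 1) (d := 8 * g - 4 - 4) (e := 8 * g - 4 - 3) (by omega) (by omega)
        rw [e3] at this
        refine middle (8 * g - 4 - 4) (by omega) (by omega) (by omega) (this.trans h1) ?_
        rw [show 8 * g - 4 - 4 + 1 = 8 * g - 4 - 3 by omega, e3]
        exact h2
      · rw [ht rfl] at h1 h2
        have := S.L_le A (k + 1) (d := 8 * g - 4 - 3) (e := 8 * g - 4 - 2) (by omega) (by omega)
        rw [e2] at this
        refine middle (8 * g - 4 - 3) (by omega) (by omega) (by simp) (this.trans h1) ?_
        rw [show 8 * g - 4 - 3 + 1 = 8 * g - 4 - 2 by omega, e2]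
        exact h2
  cases t
  · rw [mem_fiber_false] at hu
    rcases le_or_gt (ccw (S.P (k + 1)) u) (ccw (S.P (k + 1)) (S.cornerL A (k + 2))) with h | h
    · exact low hu.1 h
    rcases le_or_gt (ccw (S.P (k + 1)) (S.cornerL A (k - 2))) (ccw (S.P (k + 1)) u) with h' | h'
    · exact high (k - 2) (by simp) (by simp) h' hu.2
    rw [← e1] at h
    rw [← e3] at h'
    obtain ⟨d, hd1, hd2, h3, h4⟩ := exists_step
      (f := fun d : ℕ => ccw (S.P (k + 1)) (S.cornerL A (k + 1 + d))) (by omega) h.le h'.le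
    exact middle d hd1 (by omega) (by omega) h3 h4
  · rw [mem_fiber_true] at hu
    rcases le_or_gt (ccw (S.P (k + 1)) u) (ccw (S.P (k + 1)) (S.cornerL A (k + 2))) with h | h
    · exact low hu.1 h
    rcases le_or_gt (ccw (S.P (k + 1)) (S.cornerL A (k - 1))) (ccw (S.P (k + 1)) u) with h' | h'
    · exact high (k - 1) (by simp) (by simp) h' hu.2
    rw [← e1] at h
    rw [← e2] at h'
    obtain ⟨d, hd1, hd2, h3, h4⟩ := exists_step
      (f := fun d : ℕ => ccw (S.P (k + 1)) (S.cornerL A (k + 1 + d))) (by omega) h.le h'.le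
    exact middle d hd1 (by omega) (by simp) h3 h4

end Surface
end GeodesicCoding

namespace GeodesicCoding

theorem ends_smul' (B : SU11) (v : UnitTangent) : ends (B • v) = B • ends v := ends_smul B v

theorem meets_smul {B : SU11} {p : Circle × Circle} {K : Set UnitDisc} :
    Meets (B • p) K ↔ Meets p {z | B • z ∈ K} := by
  constructor
  · rintro ⟨v, h, hK⟩
    refine ⟨B⁻¹ • v, by rw [ends_smul', h, inv_smul_smul], ?_⟩
    change B • (B⁻¹ • v.base) ∈ K
    rwa [smul_inv_smul]
  · rintro ⟨v, h, hK⟩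
    exact ⟨B • v, by rw [ends_smul', h], hK⟩

theorem det3_comb_comb (W X Y : ℝ × ℂ) (a b a' b' : ℝ) :
    det3 W (a' • X + b' • Y) (a • X + b • Y) = (a' * b - b' * a) * det3 X Y W := by
  simp [det3]; ring

namespace Surface

variable {g : ℕ} [hg : Fact (2 ≤ g)] (S : Surface g)

/-! ### Geodesics crossing the polygon -/

/-- The linear form that vanishes on line `j` and is positive inside the polygon. -/
def line (j : Idx g) (X : ℝ × ℂ) : ℝ := det3 (cvec (S.P j)) (cvec (S.Q (j + 1))) X

/-- The linear form of line `j` along the geodesic `p`. -/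
def lineAt (p : Circle × Circle) (j : Idx g) (s : ℝ) : ℝ :=
  S.line j (cvec p.1) + s * S.line j (cvec p.2)

/-- The position of vertex `j` with respect to the geodesic `p`. -/
def vpos (p : Circle × Circle) (j : Idx g) : ℝ := sidePos p.1 p.2 (S.V j)

/-- Pairs of distinct points whose geodesic passes through no vertex of the tessellation. -/
def Reg (p : Circle × Circle) : Prop := p.1 ≠ p.2 ∧ S.AvoidsVertices p

theorem Reg.vpos_ne {S : Surface g} {p : Circle × Circle} (h : S.Reg p) (j : Idx g) :
    S.vpos p j ≠ 0 := by
  intro h0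
  obtain ⟨v, hv, he⟩ := exists_tangent_of_sidePos h.1 h0
  exact h.2 ⟨v, he, 1, S.Gam.one_mem, j, by rw [hv, one_smul]⟩

theorem Reg.smul {S : Surface g} {p : Circle × Circle} (h : S.Reg p) {γ : SU11} (hγ : γ ∈ S.Gam) :
    S.Reg (γ • p) := by
  refine ⟨fun h' => h.1 (smul_left_cancel γ h'), fun hm => h.2 ?_⟩
  rw [meets_smul] at hm
  obtain ⟨v, hv, δ, hδ, i, e⟩ := hm
  exact ⟨v, hv, γ⁻¹ * δ, S.Gam.mul_mem (S.Gam.inv_mem hγ) hδ, i, by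
    rw [mul_smul, ← e, inv_smul_smul]⟩

theorem line_comb (j : Idx g) (X Y : ℝ × ℂ) (a b : ℝ) :
    S.line j (a • X + b • Y) = a * S.line j X + b * S.line j Y := det3_comb _ _ _ _ _ _

theorem line_V_pos {j k : Idx g} (h1 : k ≠ j - 1) (h2 : k ≠ j) :
    0 < S.line k (dvec (S.V j)) := by
  rw [line, ← sidePos_eq]; exact S.vertex_pos h1 h2

theorem line_V_self (j : Idx g) : S.line j (dvec (S.V j)) = 0 := by
  rw [line, ← sidePos_eq]; exact S.vertex_right j

theorem line_V_succ (j : Idx g) : S.line j (dvec (S.V (j + 1))) = 0 := by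
  rw [line, ← sidePos_eq]
  have := S.vertex_left (j + 1)
  rwa [add_sub_cancel_right] at this

theorem line_V_nonneg (j k : Idx g) : 0 ≤ S.line k (dvec (S.V j)) := by
  by_cases h1 : k = j
  · rw [h1, line_V_self]
  by_cases h2 : k = j - 1
  · have := S.line_V_succ (j - 1)
    rw [sub_add_cancel] at this
    rw [h2, this]
  · exact (S.line_V_pos h2 h1).le

theorem two_ne_zero_idx : (2 : Idx g) ≠ 0 := by
  intro h
  have := natCast_lt_injective (g := g) (a := 2) (b := 0) (by have := twelve_le g; omega)
    (by have := twelve_le g; omega) (by push_cast; exact h)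
  omega

theorem one_ne_zero_idx : (1 : Idx g) ≠ 0 := by
  intro h
  have := natCast_lt_injective (g := g) (a := 1) (b := 0) (by have := twelve_le g; omega)
    (by have := twelve_le g; omega) (by push_cast; exact h)
  omega

/-- A geodesic with `V b` on its right and `V (b + 1)` on its left leaves the polygon across
side `b`. -/
theorem exit_point {p : Circle × Circle} (hp : p.1 ≠ p.2) {b : Idx g} (h1 : S.vpos p b < 0)
    (h2 : 0 < S.vpos p (b + 1)) : ∃ s > (0 : ℝ), S.lineAt p b s = 0 ∧ S.line b (cvec p.2) < 0 ∧
      0 < S.line b (cvec p.1) ∧ ∀ k, k ≠ b → 0 < S.lineAt p k s := by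
  obtain ⟨u, w⟩ := p
  simp only [vpos, lineAt] at *
  rw [sidePos_eq] at h1 h2
  -- The crossing point is the combination of the two vertices on which the form of the geodesic
  -- vanishes; its coefficients are positive because the vertices are on opposite sides.
  obtain ⟨z, c, hc, e⟩ := exists_dvec_add_eq h2 (neg_pos.2 h1).le (S.V b)
    (norm_dvec_lt (S.V (b + 1))).le
  set d := det3 (cvec u) (cvec w) (dvec (S.V b))
  set d' := det3 (cvec u) (cvec w) (dvec (S.V (b + 1)))
  have hz : sidePos u w z = 0 := by
    have := congrArg (det3 (cvec u) (cvec w)) e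
    rw [det3_comb, det3_smul, ← sidePos_eq u w z] at this
    have h3 : c * sidePos u w z = 0 := by rw [← this]; ring
    simpa [hc.ne'] using h3
  obtain ⟨x, hx, y, hy, e2⟩ := dvec_comb hp hz
  have hl : ∀ k, c * (x * S.line k (cvec u) + y * S.line k (cvec w)) =
      d' * S.line k (dvec (S.V b)) + -d * S.line k (dvec (S.V (b + 1))) := by
    intro k
    rw [← S.line_comb k (dvec (S.V b)), e, e2, smul_add, smul_smul, smul_smul, line_comb]
    ring
  have hs : ∀ k, S.line k (cvec u) + y / x * S.line k (cvec w)
      = (x * S.line k (cvec u) + y * S.line k (cvec w)) / x := fun k => by field_simp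
  have hb := hl b
  rw [line_V_self, line_V_succ, mul_zero, mul_zero, add_zero, mul_eq_zero, or_iff_right hc.ne']
    at hb
  -- The order of the two vertices along side `b` decides that the crossing is outward.
  have hneg : S.line b (cvec w) < 0 := by
    obtain ⟨a, ha, b', hb', a', ha', b'', hb'', f, f', h⟩ := S.vertex_coords b
    have e3 := congrArg (det3 (cvec w) (dvec (S.V (b + 1)))) e
    rw [e2, smul_add, smul_smul, smul_smul, det3_comb, det3_comb, det3_self_right, det3_self_left,
      mul_zero, mul_zero, add_zero, add_zero, ← det3_rotate (cvec u)] at e3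
    have e4 : det3 (cvec w) (dvec (S.V (b + 1))) (dvec (S.V b)) = c * x :=
      mul_left_cancel₀ h2.ne' (e3.trans (mul_comm _ _))
    rw [f, f', det3_comb_comb] at e4
    change (a' * b' - b'' * a) * S.line b (cvec w) = c * x at e4
    have : 0 < c * x := by positivity
    by_contra hcon
    have := mul_nonneg h.le (not_lt.1 hcon)
    linarith
  refine ⟨y / x, by positivity, by rw [hs, hb, zero_div], hneg, ?_, fun k hk => ?_⟩
  · have : 0 < y * -S.line b (cvec w) := mul_pos hy (neg_pos.2 hneg)
    have : 0 < x * S.line b (cvec u) := by linarith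
    exact (mul_pos_iff_of_pos_left hx).1 this
  · rw [hs]
    refine div_pos ((mul_pos_iff_of_pos_left hc).1 ?_) hx
    rw [hl]
    have n1 := S.line_V_nonneg b k
    have n2 := S.line_V_nonneg (b + 1) k
    by_cases h : k = b - 1
    · have n3 : 0 < S.line k (dvec (S.V (b + 1))) := S.line_V_pos (by
        rw [add_sub_cancel_right]; exact hk) (by
        rintro h'
        apply two_ne_zero_idx (g := g)
        linear_combination h - h')
      have := mul_nonneg h2.le n1
      have := mul_pos (neg_pos.2 h1) n3
      linarith
    · have n3 := S.line_V_pos h hk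
      have := mul_pos h2 n3
      have := mul_nonneg (neg_pos.2 h1).le n2
      linarith

/-- A geodesic with `V a` on its left and `V (a + 1)` on its right enters the polygon across
side `a`. -/
theorem entry_point {p : Circle × Circle} (hp : p.1 ≠ p.2) {a : Idx g} (h1 : 0 < S.vpos p a)
    (h2 : S.vpos p (a + 1) < 0) : ∃ s > (0 : ℝ), S.lineAt p a s = 0 ∧ S.line a (cvec p.1) < 0 ∧
      0 < S.line a (cvec p.2) ∧ ∀ k, k ≠ a → 0 < S.lineAt p k s := by
  -- Entering is leaving for the reversed geodesic, whose parameter is `s⁻¹`.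
  obtain ⟨s, hs, e1, e2, e3, e4⟩ := S.exit_point (p := p.swap) (b := a) hp.symm
    (by rw [vpos, sidePos_swap]; exact neg_lt_zero.2 h1)
    (by rw [vpos, sidePos_swap]; exact neg_pos.2 h2)
  have key : ∀ k, S.lineAt p k s⁻¹ = s⁻¹ * S.lineAt p.swap k s := fun k => by
    simp only [lineAt, Prod.fst_swap, Prod.snd_swap]
    field_simp
    ring
  refine ⟨s⁻¹, inv_pos.2 hs, by rw [key, e1, mul_zero], e2, e3, fun k hk => ?_⟩
  rw [key]
  exact mul_pos (inv_pos.2 hs) (e4 k hk)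

/-- The intersection of a geodesic with the polygon. -/
theorem chord {p : Circle × Circle} (hp : p.1 ≠ p.2) {a b : Idx g} (ha : 0 < S.vpos p a)
    (ha' : S.vpos p (a + 1) < 0) (hb : S.vpos p b < 0) (hb' : 0 < S.vpos p (b + 1)) :
    ∃ s t, 0 < s ∧ s < t ∧ S.lineAt p a s = 0 ∧ S.lineAt p b t = 0 ∧
      (∀ r, S.lineAt p a r = 0 → r = s) ∧ (∀ r, S.lineAt p b r = 0 → r = t) ∧
      (∀ r, (∀ k, 0 ≤ S.lineAt p k r) ↔ s ≤ r ∧ r ≤ t) ∧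
      ∀ r, s < r → r < t → ∀ k, 0 < S.lineAt p k r := by
  obtain ⟨s, hs, a1, a2, a3, a4⟩ := S.entry_point hp ha ha'
  obtain ⟨t, ht, b1, b2, b3, b4⟩ := S.exit_point hp hb hb'
  have hab : a ≠ b := by rintro rfl; linarith
  have hb0 := a4 b hab.symm
  have ha0 := b4 a hab
  have diff : ∀ k r r', S.lineAt p k r - S.lineAt p k r' = (r - r') * S.line k (cvec p.2) :=
    fun k r r' => by simp only [lineAt]; ring
  have hst : s < t := by
    by_contra hcon
    have := diff b s t
    nlinarith
  have inter : ∀ k r, s < r → r < t → 0 < S.lineAt p k r := by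
    intro k r h1 h2
    have hs0 : 0 ≤ S.lineAt p k s := by
      by_cases h : k = a
      · rw [h, a1]
      · exact (a4 k h).le
    have ht0 : 0 ≤ S.lineAt p k t := by
      by_cases h : k = b
      · rw [h, b1]
      · exact (b4 k h).le
    have hpos : 0 < S.lineAt p k s ∨ 0 < S.lineAt p k t := by
      by_cases h : k = a
      · exact Or.inr (by rw [h]; exact ha0)
      · exact Or.inl (a4 k h)
    have e : (t - s) * S.lineAt p k r = (t - r) * S.lineAt p k s + (r - s) * S.lineAt p k t := by
      simp only [lineAt]; ring
    have h3 : 0 < (t - r) * S.lineAt p k s + (r - s) * S.lineAt p k t := by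
      rcases hpos with h | h
      · have := mul_pos (sub_pos.2 h2) h
        have := mul_nonneg (sub_pos.2 h1).le ht0
        linarith
      · have := mul_pos (sub_pos.2 h1) h
        have := mul_nonneg (sub_pos.2 h2).le hs0
        linarith
    rw [← e] at h3
    exact (mul_pos_iff_of_pos_left (sub_pos.2 hst)).1 h3
  refine ⟨s, t, hs, hst, a1, b1, fun r hr => ?_, fun r hr => ?_, fun r => ⟨fun h => ?_, ?_⟩,
    fun r h1 h2 k => inter k r h1 h2⟩
  · have := diff a r s
    rw [hr, a1, sub_zero, zero_eq_mul, or_iff_left a3.ne'] at this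
    linarith
  · have := diff b r t
    rw [hr, b1, sub_zero, zero_eq_mul, or_iff_left b2.ne] at this
    linarith
  · constructor
    · have h1 := h a
      have := diff a r s
      rw [a1, sub_zero] at this
      rw [this] at h1
      have := (mul_nonneg_iff_of_pos_right a3).1 h1
      linarith
    · have h1 := h b
      have := diff b r t
      rw [b1, sub_zero] at this
      by_contra hcon
      have := mul_pos (sub_pos.2 (not_le.1 hcon)) (neg_pos.2 b2)
      linarith
  · rintro ⟨h1, h2⟩ k
    rcases h1.eq_or_lt with rfl | h1
    · by_cases h : k = a
      · rw [h, a1]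
      · exact (a4 k h).le
    rcases h2.eq_or_lt with rfl | h2
    · by_cases h : k = b
      · rw [h, b1]
      · exact (b4 k h).le
    exact (inter k r h1 h2).le

theorem exists_sides {p : Circle × Circle} (hp : S.Reg p) {j k : Idx g} (hj : S.vpos p j < 0)
    (hk : 0 < S.vpos p k) : ∃ a b, 0 < S.vpos p a ∧ S.vpos p (a + 1) < 0 ∧
      S.vpos p b < 0 ∧ 0 < S.vpos p (b + 1) := by
  obtain ⟨b, hb⟩ := exists_sign_change (f := S.vpos p) hp.vpos_ne hj hk
  obtain ⟨a, ha⟩ := exists_sign_change (f := fun i => -S.vpos p i)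
    (fun i => neg_ne_zero.2 (hp.vpos_ne i)) (neg_lt_zero.2 hk) (neg_pos.2 hj)
  exact ⟨a, b, neg_lt_zero.1 ha.1, neg_pos.1 ha.2, hb.1, hb.2⟩

theorem sidePos_base (v : UnitTangent) (j : Idx g) : ∃ c > (0 : ℝ),
    sidePos (S.P j) (S.Q (j + 1)) v.base = c * S.lineAt (ends v) j (hopf v) := by
  obtain ⟨c, hc, e⟩ := exists_dvec_eq v
  refine ⟨c, hc, ?_⟩
  rw [sidePos_eq, e, det3_smul, det3_add, det3_smul]; rfl

theorem base_mem_F (v : UnitTangent) :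
    v.base ∈ S.F ↔ ∀ j, 0 ≤ S.lineAt (ends v) j (hopf v) := by
  refine forall_congr' fun j => ?_
  obtain ⟨c, hc, e⟩ := S.sidePos_base v j
  rw [e, mul_nonneg_iff_of_pos_left hc]

/-- The open polygon. -/
def openF : Set UnitDisc := {z | ∀ j, 0 < sidePos (S.P j) (S.Q (j + 1)) z}

theorem base_mem_openF (v : UnitTangent) :
    v.base ∈ S.openF ↔ ∀ j, 0 < S.lineAt (ends v) j (hopf v) := by
  refine forall_congr' fun j => ?_
  obtain ⟨c, hc, e⟩ := S.sidePos_base v j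
  rw [e, mul_pos_iff_of_pos_left hc]

theorem openF_subset_F : S.openF ⊆ S.F := fun _ hz j => (hz j).le

theorem line_cell_neg {j : Idx g} {x : Circle} (h0 : x ≠ S.P j)
    (h : ccw (S.P j) x < ccw (S.P j) (S.Q (j + 1))) : S.line j (cvec x) < 0 :=
  det3_cvec_neg_iff.2 ⟨h0.symm, h⟩

/-- The arcs from P_j to Q_{j+1} overlap and cover the circle, so the polygon has no points at
infinity. Both the existence of an exit and the compactness of the polygon rest on this. -/
theorem exists_line_neg (x : Circle) : ∃ j, S.line j (cvec x) < 0 := by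
  obtain ⟨⟨k, t⟩, h⟩ := S.exists_mem_cell x
  have hb := (S.cell_bounds h).1
  have hc := S.chain k
  by_cases h0 : x = S.P k
  · refine ⟨k - 1, S.line_cell_neg ?_ ?_⟩
    · rw [h0]; intro h'; rw [h'] at hc; linarith
    · rw [h0, sub_add_cancel, ccw_of_le (c := S.P (k - 3)) (a := S.P (k - 1)) (x := S.P k)
        (by linarith), ccw_of_le (c := S.P (k - 3)) (a := S.P (k - 1)) (x := S.Q k) (by linarith)]
      linarith
  · refine ⟨k, S.line_cell_neg h0 (hb.trans ?_)⟩
    rw [ccw_of_le (c := S.P (k - 3)) (a := S.P k) (x := S.P (k + 1)) (by linarith),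
      ccw_of_le (c := S.P (k - 3)) (a := S.P k) (x := S.Q (k + 1)) (by linarith)]
    linarith

/-- A regular geodesic meets the polygon iff it separates vertices. -/
theorem meets_F_iff {p : Circle × Circle} (hp : S.Reg p) :
    Meets p S.F ↔ ∃ j k, S.vpos p j < 0 ∧ 0 < S.vpos p k := by
  constructor
  · rintro ⟨v, rfl, hv⟩
    rw [base_mem_F] at hv
    set p := ends v
    set s := hopf v with hs
    have hspos : 0 < s := hopf_pos v
    -- Among the lines that the geodesic eventually has on the negative side, `b` is the first to be
    -- reached; the geodesic stays in the polygon until then.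
    obtain ⟨b, hb, hmin⟩ := Set.exists_min_image {j | S.line j (cvec p.2) < 0}
      (fun j => -S.line j (cvec p.1) / S.line j (cvec p.2)) (Set.toFinite _) (S.exists_line_neg p.2)
    simp only [Set.mem_ofPred_eq] at hb hmin
    set t := -S.line b (cvec p.1) / S.line b (cvec p.2) with ht
    have hst : s ≤ t := by
      rw [ht, le_div_iff_of_neg hb]
      have := hv b
      rw [lineAt] at this
      linarith
    have hb0 : S.lineAt p b t = 0 := by
      rw [lineAt, ht, div_mul_cancel₀ _ hb.ne]; ring
    have hall : ∀ k, 0 ≤ S.lineAt p k t := by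
      intro k
      rcases lt_or_ge (S.line k (cvec p.2)) 0 with h | h
      · have := hmin k h
        rw [le_div_iff_of_neg h] at this
        rw [lineAt]; linarith
      · have h1 := hv k
        have h2 := mul_nonneg (sub_nonneg.2 hst) h
        rw [lineAt] at h1 ⊢
        linarith
    obtain ⟨v', hv', ht'⟩ := exists_tangent_hopf (u := p.1) (w := p.2) hp.1 (hspos.trans_le hst)
    have hline : ∀ k, 0 ≤ S.line k (dvec v'.base) := fun k => by
      obtain ⟨c, hc, e⟩ := S.sidePos_base v' k
      rw [hv', ht'] at e
      rw [line, ← sidePos_eq, e]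
      exact mul_nonneg hc.le (hall k)
    have hz : sidePos (S.P b) (S.Q (b + 1)) v'.base = 0 := by
      obtain ⟨c, hc, e⟩ := S.sidePos_base v' b
      rw [hv', ht', hb0, mul_zero] at e
      exact e
    obtain ⟨x, hx, y, hy, e⟩ := dvec_comb (S.P_ne_Q_succ b) hz
    obtain ⟨a, ha, b', hb', a', ha', b'', hb'', f, f', h⟩ := S.vertex_coords b
    -- The exit point as a combination of the ends of side `b`. The coefficients are nonnegative
    -- because lines `b - 1` and `b + 1` are nonnegative there, so these ends cannot lie strictly on
    -- one side of the geodesic.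
    have key : (a * b'' - a' * b') • dvec v'.base
        = (x * b'' - y * a') • dvec (S.V b) + (y * a - x * b') • dvec (S.V (b + 1)) := by
      rw [e, f, f']
      module
    have hmu : 0 ≤ y * a - x * b' := by
      have h0 := congrArg (S.line (b - 1)) key
      have h1 := S.line_V_succ (b - 1)
      rw [sub_add_cancel] at h1
      rw [line_comb, h1, mul_zero, zero_add, line, det3_smul] at h0
      have h2 : 0 < S.line (b - 1) (dvec (S.V (b + 1))) := S.line_V_pos
        (by rw [add_sub_cancel_right]; intro h'; exact one_ne_zero_idx (by linear_combination -h'))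
        (fun h' => two_ne_zero_idx (g := g) (by linear_combination -h'))
      have h3 := mul_nonneg h.le (hline (b - 1))
      rw [line, h0] at h3
      exact (mul_nonneg_iff_of_pos_right h2).1 h3
    have hla : 0 ≤ x * b'' - y * a' := by
      have h0 := congrArg (S.line (b + 1)) key
      rw [line_comb, line_V_self, mul_zero, add_zero, line, det3_smul] at h0
      have h2 : 0 < S.line (b + 1) (dvec (S.V b)) := S.line_V_pos
        (fun h' => two_ne_zero_idx (g := g) (by linear_combination h'))
        (fun h' => one_ne_zero_idx (g := g) (by linear_combination h'))
      have h3 := mul_nonneg h.le (hline (b + 1))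
      rw [line, h0] at h3
      exact (mul_nonneg_iff_of_pos_right h2).1 h3
    have hside := congrArg (det3 (cvec p.1) (cvec p.2)) key
    have hzero := sidePos_ends v'
    rw [hv', sidePos_eq] at hzero
    rw [det3_smul, hzero, mul_zero, det3_comb, ← sidePos_eq, ← sidePos_eq] at hside
    change 0 = _ * S.vpos p b + _ * S.vpos p (b + 1) at hside
    have hpos : 0 < x * b'' - y * a' ∨ 0 < y * a - x * b' := by
      by_contra! hcon
      have h1 := le_antisymm hcon.1 hla
      have h2 := le_antisymm hcon.2 hmu
      rw [h1, h2, zero_smul, zero_smul, zero_add] at key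
      have h3 := congrArg Prod.fst key
      have h4 := norm_dvec_lt v'.base
      have h5 : (a * b'' - a' * b') * (dvec v'.base).1 = 0 := h3
      have := mul_pos h ((norm_nonneg _).trans_lt h4)
      linarith
    rcases lt_or_gt_of_ne (hp.vpos_ne b) with n1 | n1 <;>
      rcases lt_or_gt_of_ne (hp.vpos_ne (b + 1)) with n2 | n2
    · exfalso
      rcases hpos with h1 | h1 <;> nlinarith
    · exact ⟨b, b + 1, n1, n2⟩
    · exact ⟨b + 1, b, n2, n1⟩
    · exfalso
      rcases hpos with h1 | h1 <;> nlinarith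
  · rintro ⟨j, k, hj, hk⟩
    obtain ⟨a, b, h1, h2, h3, h4⟩ := S.exists_sides hp hj hk
    obtain ⟨s, t, hs, hst, -, -, -, -, h, -⟩ := S.chord hp.1 h1 h2 h3 h4
    obtain ⟨v, hv, hvs⟩ := exists_tangent_hopf (u := p.1) (w := p.2) hp.1 hs
    refine ⟨v, hv, ?_⟩
    rw [base_mem_F, hv, hvs]
    exact (h s).2 ⟨le_rfl, hst.le⟩

end Surface
end GeodesicCoding

/-! ### Entering, crossing and leaving tiles -/

namespace GeodesicCoding

theorem enters_unique {v v' : UnitTangent} {K : Set UnitDisc} (h : ends v = ends v')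
    (hv : Enters v K) (hv' : Enters v' K) : v = v' := by
  obtain ⟨t, rfl⟩ := exists_diskFlow_eq h
  rcases lt_trichotomy t 0 with ht | rfl | ht
  · exact absurd hv'.1 (hv.2 t ht)
  · rw [diskFlow_zero]
  · have := hv'.2 (-t) (by linarith)
    rw [← diskFlow_add, add_neg_cancel, diskFlow_zero] at this
    exact absurd hv.1 this

theorem enters_image {B : SU11} {v : UnitTangent} {K : Set UnitDisc} :
    Enters v ((fun z => B • z) '' K) ↔ Enters (B⁻¹ • v) K := by
  have key : ∀ v : UnitTangent, v.base ∈ (fun z => B • z) '' K ↔ (B⁻¹ • v).base ∈ K := fun v => by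
    change _ ↔ B⁻¹ • v.base ∈ K
    constructor
    · rintro ⟨z, hz, e⟩
      rw [← e]
      simpa using hz
    · exact fun h => ⟨_, h, by simp⟩
  simp only [Enters, key, diskFlow_smul]

theorem diskFlow_injective (v : UnitTangent) : Function.Injective fun t => diskFlow t v := by
  intro s t h
  have := congrArg hopf h
  simp only [hopf_diskFlow] at this
  have := Real.exp_injective (mul_left_cancel₀ (hopf_pos v).ne' this)
  linarith

namespace Surface

variable {g : ℕ} [hg : Fact (2 ≤ g)] (S : Surface g)

theorem sidePos_base_eq_zero (v : UnitTangent) (j : Idx g) :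
    sidePos (S.P j) (S.Q (j + 1)) v.base = 0 ↔ S.lineAt (ends v) j (hopf v) = 0 := by
  obtain ⟨c, hc, e⟩ := S.sidePos_base v j
  rw [e, mul_eq_zero, or_iff_right hc.ne']

/-- A geodesic enters the polygon where it crosses its side of entrance. -/
theorem enters_iff {v : UnitTangent} (hp : S.Reg (ends v)) {a : Idx g}
    (ha : 0 < S.vpos (ends v) a) (ha' : S.vpos (ends v) (a + 1) < 0) :
    Enters v S.F ↔ sidePos (S.P a) (S.Q (a + 1)) v.base = 0 := by
  obtain ⟨-, b, -, -, hb, hb'⟩ := S.exists_sides hp ha' ha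
  obtain ⟨s, t, hs, hst, e1, e2, u1, u2, hF, hint⟩ := S.chord hp.1 ha ha' hb hb'
  have hflow : ∀ r, (diskFlow r v).base ∈ S.F ↔
      s ≤ hopf v * Real.exp (2 * r) ∧ hopf v * Real.exp (2 * r) ≤ t := fun r => by
    rw [base_mem_F, ends_diskFlow, hopf_diskFlow]; exact hF _
  rw [sidePos_base_eq_zero]
  have hv0 := hopf_pos v
  constructor
  · rintro ⟨h1, h2⟩
    rw [base_mem_F, hF] at h1
    rcases h1.1.eq_or_lt with h | h
    · rw [← h, e1]
    · exfalso
      refine h2 (Real.log (s / hopf v) / 2) ?_ ?_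
      · have := Real.log_neg (div_pos hs hv0) ((div_lt_one hv0).2 h)
        linarith
      · rw [hflow, mul_div_cancel₀ _ two_ne_zero, Real.exp_log (div_pos hs hv0),
          mul_div_cancel₀ _ hv0.ne']
        exact ⟨le_rfl, hst.le⟩
  · intro h
    have h1 := u1 _ h
    refine ⟨(S.base_mem_F v).2 ((hF _).2 ⟨h1.ge, h1.le.trans hst.le⟩), fun r hr hcon => ?_⟩
    rw [hflow, h1] at hcon
    have : Real.exp (2 * r) < 1 := by rw [Real.exp_lt_one_iff]; linarith
    nlinarith [hcon.1]

theorem exists_enters {p : Circle × Circle} (hp : S.Reg p) (hm : Meets p S.F) :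
    ∃ v, ends v = p ∧ Enters v S.F := by
  obtain ⟨j, k, hj, hk⟩ := (S.meets_F_iff hp).1 hm
  obtain ⟨a, b, ha, ha', hb, hb'⟩ := S.exists_sides hp hj hk
  obtain ⟨s, hs, e, -⟩ := S.entry_point hp.1 ha ha'
  obtain ⟨v, hv, hvs⟩ := exists_tangent_hopf (u := p.1) (w := p.2) hp.1 hs
  obtain rfl : ends v = p := hv
  refine ⟨v, rfl, (S.enters_iff hp ha ha').2 ?_⟩
  rw [sidePos_base_eq_zero, hvs]
  exact e

theorem exists_sides_of_enters {v : UnitTangent} (hp : S.Reg (ends v)) (hv : Enters v S.F) :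
    ∃ a b, 0 < S.vpos (ends v) a ∧ S.vpos (ends v) (a + 1) < 0 ∧
      S.vpos (ends v) b < 0 ∧ 0 < S.vpos (ends v) (b + 1) := by
  obtain ⟨j, k, hj, hk⟩ := (S.meets_F_iff hp).1 ⟨v, rfl, hv.1⟩
  exact S.exists_sides hp hj hk

theorem vpos_T (p : Circle × Circle) (i : Idx g) :
    (0 < S.vpos (S.T i • p) (sig i) ↔ 0 < S.vpos p (i + 1)) ∧
    (S.vpos (S.T i • p) (sig i) < 0 ↔ S.vpos p (i + 1) < 0) ∧
    (0 < S.vpos (S.T i • p) (sig i + 1) ↔ 0 < S.vpos p i) ∧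
    (S.vpos (S.T i • p) (sig i + 1) < 0 ↔ S.vpos p i < 0) := by
  simp only [vpos]
  rw [← S.T_V, ← S.T_V_succ]
  exact ⟨sidePos_smul_pos_iff _, sidePos_smul_neg_iff _, sidePos_smul_pos_iff _,
    sidePos_smul_neg_iff _⟩

/-- A geodesic that leaves the polygon across side `b` enters the adjacent polygon. -/
theorem exists_cross {v : UnitTangent} (hp : S.Reg (ends v)) (hv : Enters v S.F) {b : Idx g}
    (hb : S.vpos (ends v) b < 0) (hb' : 0 < S.vpos (ends v) (b + 1)) :
    ∃ τ > 0, Enters (S.T b • diskFlow τ v) S.F ∧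
      ∀ t, 0 < t → t < τ → (diskFlow t v).base ∈ S.openF := by
  obtain ⟨a, -, ha, ha', -, -⟩ := S.exists_sides_of_enters hp hv
  obtain ⟨s, t, hs, hst, e1, e2, u1, u2, hF, hint⟩ := S.chord hp.1 ha ha' hb hb'
  have h0 := (S.enters_iff hp ha ha').1 hv
  rw [sidePos_base_eq_zero] at h0
  have h1 := u1 _ h0
  have hts : 1 < t / s := (one_lt_div hs).2 hst
  have he : s * Real.exp (2 * (Real.log (t / s) / 2)) = t := by
    rw [mul_div_cancel₀ _ two_ne_zero, Real.exp_log (by positivity), mul_div_cancel₀ _ hs.ne']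
  refine ⟨Real.log (t / s) / 2, half_pos (Real.log_pos hts), ?_, fun r hr hr' => ?_⟩
  · have hx : sidePos (S.P b) (S.Q (b + 1)) (diskFlow (Real.log (t / s) / 2) v).base = 0 := by
      rw [sidePos_base_eq_zero, ends_diskFlow, hopf_diskFlow, h1, he, e2]
    obtain ⟨t1, t2, t3, t4⟩ := S.vpos_T (ends v) b
    rw [S.enters_iff (a := sig b)]
    · change sidePos _ _ (S.T b • (diskFlow (Real.log (t / s) / 2) v).base) = 0
      rw [← S.T_Q_succ, ← S.T_P, sidePos_smul_eq_zero_iff, sidePos_swap, hx, neg_zero]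
    · rw [ends_smul', ends_diskFlow]
      exact hp.smul (S.T_mem b)
    · rw [ends_smul', ends_diskFlow, t1]
      exact hb'
    · rw [ends_smul', ends_diskFlow, t4]
      exact hb
  · rw [base_mem_openF, ends_diskFlow, hopf_diskFlow, h1]
    apply hint
    · have : 1 < Real.exp (2 * r) := by rw [Real.one_lt_exp_iff]; linarith
      nlinarith
    · rw [← he]
      have : Real.exp (2 * r) < Real.exp (2 * (Real.log (t / s) / 2)) :=
        Real.exp_lt_exp.2 (by linarith)
      nlinarith

/-- A geodesic that enters the polygon comes from an adjacent polygon. -/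
theorem exists_cross_back {v : UnitTangent} (hp : S.Reg (ends v)) (hv : Enters v S.F) :
    ∃ a v', ∃ τ > 0, Enters v' S.F ∧ S.T a • diskFlow τ v' = v := by
  obtain ⟨a, -, ha, ha', -, -⟩ := S.exists_sides_of_enters hp hv
  obtain ⟨t1, t2, t3, t4⟩ := S.vpos_T (ends v) a
  have hp' := hp.smul (S.T_mem a)
  -- The image of the geodesic under `T a` leaves the polygon across side σ(a), so the forward
  -- statement applies to it.
  obtain ⟨v', e, hv'⟩ := S.exists_enters hp' ((S.meets_F_iff hp').2 ⟨_, _, t2.2 ha', t3.2 ha⟩)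
  rw [← e] at hp'
  obtain ⟨τ, hτ, h, -⟩ := S.exists_cross hp' hv' (b := sig a) (by rw [e]; exact t2.2 ha')
    (by rw [e]; exact t3.2 ha)
  refine ⟨sig a, v', τ, hτ, hv', enters_unique ?_ h hv⟩
  rw [ends_smul', ends_diskFlow, e]
  exact Prod.ext (S.T_sig_T _ _) (S.T_sig_T _ _)

theorem openF_subset_interior : S.openF ⊆ interior S.F := fun _ h => S.mem_interior_of_pos h

theorem not_openF_of_enters {v : UnitTangent} (hp : S.Reg (ends v)) (hv : Enters v S.F) :
    v.base ∉ S.openF := by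
  obtain ⟨a, -, ha, ha', -, -⟩ := S.exists_sides_of_enters hp hv
  intro h
  exact (h a).ne' ((S.enters_iff hp ha ha').1 hv)

/-- Between entrance and exit a geodesic enters no other polygon of the tessellation. -/
theorem not_enters_between {v : UnitTangent} (hp : S.Reg (ends v)) {τ : ℝ}
    (hτ : ∀ t, 0 < t → t < τ → (diskFlow t v).base ∈ S.openF) {t : ℝ} (h0 : 0 < t) (h1 : t < τ)
    {γ : SU11} (hγ : γ ∈ S.Gam) : ¬ Enters (γ • diskFlow t v) S.F := by
  intro h
  have hp' : S.Reg (ends (γ • diskFlow t v)) := by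
    rw [ends_smul', ends_diskFlow]; exact hp.smul hγ
  obtain ⟨-, b, -, -, hb, hb'⟩ := S.exists_sides_of_enters hp' h
  obtain ⟨s, hs, -, hs'⟩ := S.exists_cross hp' h hb hb'
  -- Shortly after time `t` the geodesic is inside two open tiles, so they coincide and `γ` acts
  -- trivially. But the base point at time `t` is in the open polygon, hence not an entrance.
  set r := min (s / 2) ((τ - t) / 2) with hr
  have hr0 : 0 < r := lt_min (by linarith) (by linarith)
  have hr1 : r < s := (min_le_left _ _).trans_lt (by linarith)
  have hr2 : t + r < τ := by
    have := min_le_right (s / 2) ((τ - t) / 2)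
    linarith
  have k1 := hs' r hr0 hr1
  rw [diskFlow_smul, ← diskFlow_add] at k1
  have k2 := hτ (t + r) (by linarith) hr2
  have triv := S.disjoint_interiors γ hγ _ (S.openF_subset_interior k2)
    (S.openF_subset_interior k1)
  rw [tangent_smul_eq_of_trivial triv] at h hp'
  exact S.not_openF_of_enters hp' h (hτ t h0 h1)

end Surface
end GeodesicCoding

namespace GeodesicCoding

/-! ### Topology of the unit tangent bundle -/

theorem circle_isEmbedding : IsEmbedding (fun x : Circle => (x : ℂ)) := .subtypeVal

theorem unitTangent_isEmbedding :
    IsEmbedding (fun v : UnitTangent => ((v.base : ℂ), (v.dir : ℂ))) := by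
  have h : IsEmbedding (fun v : UnitTangent => (v.base, v.dir)) :=
    ⟨⟨rfl⟩, fun v v' h => UnitTangent.ext (congrArg Prod.fst h) (congrArg Prod.snd h)⟩
  exact (UnitDisc.isEmbedding_coe.prodMap circle_isEmbedding).comp h

theorem continuous_base : Continuous fun v : UnitTangent => (v.base : ℂ) :=
  continuous_fst.comp unitTangent_isEmbedding.continuous

theorem continuous_dir : Continuous fun v : UnitTangent => (v.dir : ℂ) :=
  continuous_snd.comp unitTangent_isEmbedding.continuous

theorem continuous_base' : Continuous fun v : UnitTangent => v.base :=
  UnitDisc.isEmbedding_coe.continuous_iff.2 continuous_base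

theorem continuous_conj' : Continuous fun z : ℂ => conj z := Complex.continuous_conj

theorem continuous_tanh_real : Continuous Real.tanh := by
  have : Real.tanh = fun x => Real.sinh x / Real.cosh x := funext Real.tanh_eq_sinh_div_cosh
  rw [this]
  exact Real.continuous_sinh.div Real.continuous_cosh fun x => (Real.cosh_pos x).ne'

theorem continuous_diskFlow : Continuous fun x : ℝ × UnitTangent => diskFlow x.1 x.2 := by
  rw [unitTangent_isEmbedding.continuous_iff]
  have hz : Continuous fun x : ℝ × UnitTangent => (x.2.base : ℂ) :=
    continuous_base.comp continuous_snd
  have hd : Continuous fun x : ℝ × UnitTangent => (x.2.dir : ℂ) :=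
    continuous_dir.comp continuous_snd
  have hs : Continuous fun x : ℝ × UnitTangent => ((Real.tanh (x.1 / 2) : ℝ) : ℂ) :=
    continuous_ofReal.comp (continuous_tanh_real.comp (continuous_fst.div_const 2))
  have hden : Continuous fun x : ℝ × UnitTangent =>
      1 + conj (x.2.base : ℂ) * x.2.dir * (Real.tanh (x.1 / 2) : ℝ) :=
    continuous_const.add (((continuous_conj'.comp hz).mul hd).mul hs)
  have hne : ∀ x : ℝ × UnitTangent,
      1 + conj (x.2.base : ℂ) * x.2.dir * (Real.tanh (x.1 / 2) : ℝ) ≠ 0 := fun x =>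
    den_flow_ne_zero _ _ (abs_tanh_lt_one _).le
  exact ((hz.add (hd.mul hs)).div hden hne).prodMk
    (hd.mul ((continuous_conj'.comp hden).div hden hne))

theorem continuous_mden (B : SU11) : Continuous (mden B) := by unfold mden; fun_prop
theorem continuous_mnum (B : SU11) : Continuous (mnum B) := by unfold mnum; fun_prop

theorem continuous_smul_tangent (B : SU11) : Continuous fun v : UnitTangent => B • v := by
  rw [unitTangent_isEmbedding.continuous_iff]
  have hd := (continuous_mden B).comp continuous_base
  have hne : ∀ v : UnitTangent, mden B v.base ≠ 0 := fun v =>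
    mob_den_ne_zero B v.base.norm_lt_one.le
  exact (((continuous_mnum B).comp continuous_base).div hd hne).prodMk
    (continuous_dir.mul ((continuous_conj'.comp hd).div hd hne))

theorem continuous_smul_circle (B : SU11) : Continuous fun x : Circle => B • x := by
  rw [circle_isEmbedding.continuous_iff]
  have hc : Continuous fun x : Circle => (x : ℂ) := circle_isEmbedding.continuous
  exact ((continuous_mnum B).comp hc).div ((continuous_mden B).comp hc)
    fun x => mob_den_ne_zero B x.norm_coe.le

theorem continuous_smul_pair (B : SU11) : Continuous fun p : Circle × Circle => B • p :=
  ((continuous_smul_circle B).comp continuous_fst).prodMk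
    ((continuous_smul_circle B).comp continuous_snd)

theorem continuous_ends : Continuous ends := by
  have h : ∀ e : ℝ, (∀ v : UnitTangent, 1 + conj (v.base : ℂ) * (e * v.dir) ≠ 0) →
      Continuous fun v : UnitTangent =>
        ((v.base : ℂ) + e * v.dir) / (1 + conj (v.base : ℂ) * (e * v.dir)) := fun e hne =>
    (continuous_base.add (continuous_const.mul continuous_dir)).div (continuous_const.add
      ((continuous_conj'.comp continuous_base).mul (continuous_const.mul continuous_dir))) hne
  refine Continuous.prodMk ?_ ?_
  · rw [circle_isEmbedding.continuous_iff]
    convert h (-1) (fun v => by simpa using den_endpoint_ne_zero v.base (-v.dir)) using 2 with v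
    simp [endpoint_coe]
  · rw [circle_isEmbedding.continuous_iff]
    convert h 1 (fun v => by simpa using den_endpoint_ne_zero v.base v.dir) using 2 with v
    simp [endpoint_coe]

theorem isCompact_norm_base_le {r : ℝ} (hr : r < 1) :
    IsCompact {v : UnitTangent | ‖(v.base : ℂ)‖ ≤ r} := by
  rw [unitTangent_isEmbedding.isInducing.isCompact_iff]
  have : (fun v : UnitTangent => ((v.base : ℂ), (v.dir : ℂ))) '' {v | ‖(v.base : ℂ)‖ ≤ r}
      = Metric.closedBall 0 r ×ˢ Metric.sphere 0 1 := by
    ext ⟨z, ζ⟩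
    simp only [Set.mem_image, Set.mem_ofPred_eq, Set.mem_prod, mem_closedBall_zero_iff,
      mem_sphere_zero_iff_norm, Prod.mk.injEq]
    constructor
    · rintro ⟨v, hv, rfl, rfl⟩
      exact ⟨hv, v.dir.norm_coe⟩
    · rintro ⟨h1, h2⟩
      exact ⟨⟨UnitDisc.mk z (h1.trans_lt hr), ⟨ζ, mem_sphere_zero_iff_norm.2 h2⟩⟩, h1, rfl, rfl⟩
  rw [this]
  exact (isCompact_closedBall 0 r).prod (isCompact_sphere 0 1)

/-! ### Discreteness -/

theorem normSq_mden_smul (B : SU11) (z : UnitDisc) :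
    normSq (mden B z) * (1 - normSq ((B • z : UnitDisc) : ℂ)) = 1 - normSq (z : ℂ) := by
  have h := mob_normSq_den_sub B z
  have h0 := mob_den_ne_zero B z.norm_lt_one.le
  rw [mob_coe_smul_disc, normSq_div, mul_sub, mul_div_cancel₀ _ (normSq_pos.2 h0).ne', ← h]
  ring

theorem norm_coefB_le (B : SU11) : ‖coefB B‖ ≤ ‖coefA B‖ := by
  have h := mob_normSq_sub B
  rw [normSq_eq_norm_sq, normSq_eq_norm_sq] at h
  exact (sq_le_sq₀ (norm_nonneg _) (norm_nonneg _)).1 (by linarith)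

/-- A transformation that keeps some point within a smaller disk has bounded coefficients, because
|den|² (1 − |Bz|²) = 1 − |z|². -/
theorem norm_coefA_le {B : SU11} {r : ℝ} (hr : r < 1) {z : UnitDisc} (h1 : ‖(z : ℂ)‖ ≤ r)
    (h2 : ‖((B • z : UnitDisc) : ℂ)‖ ≤ r) : ‖coefA B‖ ≤ 1 / ((1 - r) * Real.sqrt (1 - r ^ 2)) := by
  have hr0 : 0 ≤ r := (norm_nonneg _).trans h1
  have hq : 0 < 1 - r ^ 2 := by nlinarith
  have hs := Real.sqrt_pos.2 hq
  have h := normSq_mden_smul B z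
  rw [normSq_eq_norm_sq, normSq_eq_norm_sq, normSq_eq_norm_sq] at h
  have h3 : (‖mden B z‖ * Real.sqrt (1 - r ^ 2)) ^ 2 ≤ 1 ^ 2 := by
    rw [mul_pow, Real.sq_sqrt hq.le]
    have : ‖((B • z : UnitDisc) : ℂ)‖ ^ 2 ≤ r ^ 2 := pow_le_pow_left₀ (norm_nonneg _) h2 2
    nlinarith [sq_nonneg ‖mden B z‖, sq_nonneg ‖(z : ℂ)‖]
  have h4 := (sq_le_sq₀ (by positivity) zero_le_one).1 h3
  have h5 : ‖coefA B‖ * (1 - r) ≤ ‖mden B z‖ := by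
    have e : conj (coefA B) = mden B z - conj (coefB B) * z := by rw [mden]; ring
    have h6 := norm_sub_le (mden B z) (conj (coefB B) * z)
    rw [← e, norm_mul, RCLike.norm_conj, RCLike.norm_conj] at h6
    have := mul_le_mul (norm_coefB_le B) h1 (norm_nonneg _) (norm_nonneg _)
    linarith
  rw [le_div_iff₀ (by have := sub_pos.2 hr; positivity), ← mul_assoc]
  exact (mul_le_mul_of_nonneg_right h5 hs.le).trans h4

theorem su11_ext {B C : SU11} (h1 : coefA B = coefA C) (h2 : coefB B = coefB C) : B = C := by
  apply Subtype.ext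
  apply Matrix.SpecialLinearGroup.ext
  intro i j
  fin_cases i <;> fin_cases j
  · exact h1
  · exact h2
  · exact B.2.1.trans ((congrArg conj h2).trans C.2.1.symm)
  · exact B.2.2.trans ((congrArg conj h1).trans C.2.2.symm)

theorem coefA_inv_mul (B C : SU11) :
    coefA (B⁻¹ * C) = conj (coefA B) * coefA C - coefB B * conj (coefB C) := by
  have h1 : coefA B⁻¹ = conj (coefA B) := by
    change (B.1⁻¹ : Matrix.SpecialLinearGroup (Fin 2) ℂ) 0 0 = _
    simp [Matrix.adjugate_fin_two, B.2.2, coefA]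
  have h2 : coefB B⁻¹ = -coefB B := by
    change (B.1⁻¹ : Matrix.SpecialLinearGroup (Fin 2) ℂ) 0 1 = _
    simp [Matrix.adjugate_fin_two, coefB]
  rw [mob_a_mul, h1, h2]; ring

theorem coefB_inv_mul (B C : SU11) :
    coefB (B⁻¹ * C) = conj (coefA B) * coefB C - coefB B * conj (coefA C) := by
  have h1 : coefA B⁻¹ = conj (coefA B) := by
    change (B.1⁻¹ : Matrix.SpecialLinearGroup (Fin 2) ℂ) 0 0 = _
    simp [Matrix.adjugate_fin_two, B.2.2, coefA]
  have h2 : coefB B⁻¹ = -coefB B := by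
    change (B.1⁻¹ : Matrix.SpecialLinearGroup (Fin 2) ℂ) 0 1 = _
    simp [Matrix.adjugate_fin_two, coefB]
  rw [mob_b_mul, h1, h2]; ring

namespace Surface

variable {g : ℕ} [hg : Fact (2 ≤ g)] (S : Surface g)

theorem isOpen_openF : IsOpen S.openF := by
  simp only [openF, Set.ofPred_forall]
  exact isOpen_iInter_of_finite fun j => isOpen_lt continuous_const (sidePos_continuous _ _)

theorem isClosed_F : IsClosed S.F := by
  simp only [F, polygon, Set.ofPred_forall]
  exact isClosed_iInter fun j => isClosed_le continuous_const (sidePos_continuous _ _)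

theorem exists_mem_openF : ∃ z, z ∈ S.openF := by
  have hn := twelve_le g
  have h1 := S.line_P_pos (0 - 1) (d := 4) (by omega) (by omega)
  have h2 := S.line_P_pos 0 (d := 3) (by omega) (by omega)
  rw [show (0 : Idx g) - 1 + (4 : ℕ) = 0 + (3 : ℕ) by push_cast; ring, sub_add_cancel] at h1
  obtain ⟨z, hz, -⟩ := S.exists_interior_of_sector 0 _ h1 h2
  exact ⟨z, hz⟩

/-- Infinitely many such elements would have bounded coefficients, hence a convergent subsequence.
Quotients of successive terms tend to the identity, so one of them keeps an interior point of the
polygon interior and therefore acts trivially, against the terms being distinct. -/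
theorem finite_norm_le {r : ℝ} (hr : r < 1) :
    {γ : SU11 | γ ∈ S.Gam ∧ ∃ z : UnitDisc, ‖(z : ℂ)‖ ≤ r ∧ ‖((γ • z : UnitDisc) : ℂ)‖ ≤ r}.Finite := by
  by_contra hinf
  have hinf' := Set.not_finite.1 hinf
  set K := {γ : SU11 | γ ∈ S.Gam ∧ ∃ z : UnitDisc, ‖(z : ℂ)‖ ≤ r ∧ ‖((γ • z : UnitDisc) : ℂ)‖ ≤ r}
  let f := hinf'.natEmbedding
  set C := 1 / ((1 - r) * Real.sqrt (1 - r ^ 2))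
  have hf : ∀ n, (coefA (f n : SU11), coefB (f n : SU11)) ∈ Metric.closedBall (0 : ℂ × ℂ) C := by
    intro n
    obtain ⟨-, z, h1, h2⟩ := (f n).2
    have := norm_coefA_le hr h1 h2
    rw [mem_closedBall_zero_iff, Prod.norm_def]
    exact max_le this ((norm_coefB_le _).trans this)
  obtain ⟨⟨a, b⟩, -, φ, hφ, hlim⟩ := tendsto_subseq_of_bounded Metric.isBounded_closedBall hf
  have ha : Filter.Tendsto (fun n => coefA (f (φ n) : SU11)) Filter.atTop (𝓝 a) :=
    (continuous_fst.tendsto _).comp hlim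
  have hb : Filter.Tendsto (fun n => coefB (f (φ n) : SU11)) Filter.atTop (𝓝 b) :=
    (continuous_snd.tendsto _).comp hlim
  have ha' := ha.comp (Filter.tendsto_add_atTop_nat 1)
  have hb' := hb.comp (Filter.tendsto_add_atTop_nat 1)
  let δ : ℕ → SU11 := fun n => (f (φ n) : SU11)⁻¹ * f (φ (n + 1))
  have hab : conj a * a - b * conj b = 1 := by
    have h1 : Filter.Tendsto (fun n => normSq (coefA (f (φ n) : SU11)) - normSq (coefB (f (φ n) : SU11)))
        Filter.atTop (𝓝 (normSq a - normSq b)) :=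
      ((continuous_normSq.tendsto _).comp ha).sub ((continuous_normSq.tendsto _).comp hb)
    simp only [mob_normSq_sub] at h1
    have h2 := tendsto_nhds_unique h1 tendsto_const_nhds
    rw [← normSq_eq_conj_mul_self, mul_conj]
    exact_mod_cast h2
  have hδa : Filter.Tendsto (fun n => coefA (δ n)) Filter.atTop (𝓝 1) := by
    simp only [δ, coefA_inv_mul]
    rw [← hab]
    exact (((continuous_conj'.tendsto _).comp ha).mul ha').sub
      (hb.mul ((continuous_conj'.tendsto _).comp hb'))
  have hδb : Filter.Tendsto (fun n => coefB (δ n)) Filter.atTop (𝓝 0) := by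
    simp only [δ, coefB_inv_mul]
    rw [show (0 : ℂ) = conj a * b - b * conj a by ring]
    exact (((continuous_conj'.tendsto _).comp ha).mul hb').sub
      (hb.mul ((continuous_conj'.tendsto _).comp ha'))
  obtain ⟨z, hz⟩ := S.exists_mem_openF
  have hδz : Filter.Tendsto (fun n => δ n • z) Filter.atTop (𝓝 z) := by
    rw [UnitDisc.isEmbedding_coe.tendsto_nhds_iff]
    have h1 : Filter.Tendsto (fun n => mnum (δ n) z) Filter.atTop (𝓝 (1 * z + 0)) :=
      (hδa.mul_const _).add hδb
    have h2 : Filter.Tendsto (fun n => mden (δ n) z) Filter.atTop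
        (𝓝 (conj (0 : ℂ) * z + conj (1 : ℂ))) :=
      (((continuous_conj'.tendsto _).comp hδb).mul_const _).add
        ((continuous_conj'.tendsto _).comp hδa)
    simp only [map_zero, zero_mul, map_one, zero_add, one_mul, add_zero] at h1 h2
    have := h1.div h2 one_ne_zero
    rw [div_one] at this
    exact this
  have h1 := hδz.eventually (S.isOpen_openF.mem_nhds hz)
  -- Keeps the coefficient away from −1, the other matrix that acts trivially.
  have h2 := hδa.eventually (Metric.ball_mem_nhds 1 one_pos)
  obtain ⟨n, hn1, hn2⟩ := (h1.and h2).exists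
  have hmem : δ n ∈ S.Gam := S.Gam.mul_mem (S.Gam.inv_mem (f (φ n)).2.1) (f (φ (n + 1))).2.1
  have triv := S.disjoint_interiors _ hmem z (S.openF_subset_interior hz)
    (S.openF_subset_interior hn1)
  obtain ⟨e1, e2 | e2⟩ := eq_one_or_neg_one_of_smul_eq _ triv
  · have : δ n = 1 := su11_ext (by rw [e2]; simp [coefA]) (by rw [e1]; simp [coefB])
    have h3 := f.injective (Subtype.ext (inv_mul_eq_one.1 this))
    have h4 := hφ (Nat.lt_add_one n)
    rw [h3] at h4
    exact lt_irrefl _ h4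
  · rw [e2] at hn2
    change dist (-1 : ℂ) 1 < 1 at hn2
    rw [Complex.dist_eq] at hn2
    norm_num at hn2

/-- The inequalities of the polygon make sense on the closed unit disk, where |z| attains its
maximum; on the unit circle one of them fails by `exists_line_neg`. -/
theorem exists_norm_le_of_mem_F : ∃ r < 1, ∀ z ∈ S.F, ‖(z : ℂ)‖ ≤ r := by
  let f : Idx g → ℂ → ℝ := fun j z =>
    (conj ((S.Q (j + 1) : ℂ) - S.P j) * (2 * z - (1 + normSq z) * S.P j)).im
  have hf : ∀ j, Continuous (f j) := fun j => by
    have := continuous_normSq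
    fun_prop
  set K := Metric.closedBall (0 : ℂ) 1 ∩ ⋂ j, {z | 0 ≤ f j z} with hK
  have hKc : IsCompact K := (isCompact_closedBall 0 1).inter_right
    (isClosed_iInter fun j => isClosed_le continuous_const (hf j))
  have hFK : ∀ z ∈ S.F, (z : ℂ) ∈ K := fun z hz =>
    ⟨mem_closedBall_zero_iff.2 z.norm_lt_one.le, Set.mem_iInter.2 fun j => hz j⟩
  obtain ⟨z₀, hz₀⟩ := S.exists_mem_openF
  obtain ⟨x, hx, hmax⟩ := hKc.exists_isMaxOn ⟨_, hFK _ (S.openF_subset_F hz₀)⟩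
    continuous_norm.continuousOn
  refine ⟨‖x‖, lt_of_le_of_ne (mem_closedBall_zero_iff.1 hx.1) fun h1 => ?_,
    fun z hz => hmax (hFK z hz)⟩
  obtain ⟨j, hj⟩ := S.exists_line_neg ⟨x, mem_sphere_zero_iff_norm.2 h1⟩
  have h2 : 0 ≤ f j x := Set.mem_iInter.1 hx.2 j
  have h3 : f j x = 2 * S.line j (cvec ⟨x, mem_sphere_zero_iff_norm.2 h1⟩) := by
    have h4 : normSq x = 1 := by rw [normSq_eq_norm_sq, h1, one_pow]
    simp only [f, line, det3, cvec, h4]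
    simp
    ring
  linarith

/-- Each group element accounts for at most one entrance of a given geodesic, and only finitely many
elements bring a bounded piece of the geodesic into the polygon. -/
theorem finite_enter_times (v : UnitTangent) (a b : ℝ) :
    {t | t ∈ Set.Icc a b ∧ ∃ γ ∈ S.Gam, Enters (γ • diskFlow t v) S.F}.Finite := by
  obtain ⟨r, hr, hF⟩ := S.exists_norm_le_of_mem_F
  have hc : Continuous fun t => ‖((diskFlow t v).base : ℂ)‖ :=
    (continuous_base.comp (continuous_diskFlow.comp (continuous_id.prodMk continuous_const))).norm
  obtain ⟨r', hr', hb⟩ : ∃ r' < 1, ∀ t ∈ Set.Icc a b, ‖((diskFlow t v).base : ℂ)‖ ≤ r' := by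
    rcases (Set.Icc a b).eq_empty_or_nonempty with h | h
    · exact ⟨0, one_pos, by simp [h]⟩
    · obtain ⟨x, hx, hmax⟩ := isCompact_Icc.exists_isMaxOn h hc.continuousOn
      exact ⟨_, UnitDisc.norm_lt_one _, fun t ht => hmax ht⟩
  have hfin := S.finite_norm_le (r := max r r') (max_lt hr hr')
  set E := {t | t ∈ Set.Icc a b ∧ ∃ γ ∈ S.Gam, Enters (γ • diskFlow t v) S.F}
  have : ∀ t : E, ∃ γ ∈ S.Gam, Enters (γ • diskFlow t v) S.F := fun t => t.2.2
  choose γ hγ hE using this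
  have hinj : Function.Injective γ := by
    intro s t h
    have h1 := hE t
    rw [← h] at h1
    have h2 := enters_unique (by simp only [ends_smul', ends_diskFlow]) (hE s) h1
    exact Subtype.ext (diskFlow_injective v (smul_left_cancel _ h2))
  have hmaps : ∀ t : E, γ t ∈ {γ : SU11 | γ ∈ S.Gam ∧
      ∃ z : UnitDisc, ‖(z : ℂ)‖ ≤ max r r' ∧ ‖((γ • z : UnitDisc) : ℂ)‖ ≤ max r r'} := fun t =>
    ⟨hγ t, (diskFlow t v).base, (hb t t.2.1).trans (le_max_right _ _),
      (hF _ (hE t).1).trans (le_max_left _ _)⟩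
  have := hfin.to_subtype
  exact Set.finite_coe_iff.1 (Finite.of_injective (fun t : E => (⟨γ t, hmaps t⟩ : {γ : SU11 //
    γ ∈ {γ : SU11 | γ ∈ S.Gam ∧ ∃ z : UnitDisc, ‖(z : ℂ)‖ ≤ max r r' ∧
      ‖((γ • z : UnitDisc) : ℂ)‖ ≤ max r r'}}))
    fun s t h => hinj (congrArg Subtype.val h))

theorem countable_Gam : (S.Gam : Set SU11).Countable := by
  have : (S.Gam : Set SU11) ⊆ ⋃ n : ℕ, {γ : SU11 | γ ∈ S.Gam ∧ ∃ z : UnitDisc,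
      ‖(z : ℂ)‖ ≤ 1 - 1 / (n + 2) ∧ ‖((γ • z : UnitDisc) : ℂ)‖ ≤ 1 - 1 / (n + 2)} := by
    intro γ hγ
    have h := UnitDisc.norm_lt_one (γ • (0 : UnitDisc))
    obtain ⟨n, hn⟩ := exists_nat_one_div_lt (sub_pos.2 h)
    refine Set.mem_iUnion.2 ⟨n, hγ, 0, ?_, ?_⟩
    · rw [UnitDisc.coe_zero, norm_zero, sub_nonneg, div_le_one (by positivity)]
      have : (0 : ℝ) ≤ n := Nat.cast_nonneg n
      linarith
    · have : (1 : ℝ) / (n + 2) ≤ 1 / (n + 1) :=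
        one_div_le_one_div_of_le (by positivity) (by linarith)
      linarith
  refine (Set.countable_iUnion fun n => (S.finite_norm_le ?_).countable).mono this
  have : (0 : ℝ) < 1 / (n + 2) := by positivity
  linarith

/-- Only one geodesic from `u` passes through a given vertex, and the tessellation has countably
many vertices. -/
theorem countable_irregular (u : Circle) : {w | ¬ S.AvoidsVertices (u, w)}.Countable := by
  have : Countable S.Gam := S.countable_Gam.to_subtype
  have : {w | ¬ S.AvoidsVertices (u, w)} ⊆ ⋃ x : S.Gam × Idx g,
      {w | ∃ v, ends v = (u, w) ∧ v.base = (x.1 : SU11) • S.V x.2} := by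
    intro w hw
    obtain ⟨v, hv, γ, hγ, i, h⟩ := not_not.1 hw
    exact Set.mem_iUnion.2 ⟨(⟨γ, hγ⟩, i), v, hv, h⟩
  refine (Set.countable_iUnion fun x => Set.Subsingleton.countable ?_).mono this
  rintro w ⟨v, hv, hb⟩ w' ⟨v', hv', hb'⟩
  have h1 : v.base = v'.base := hb.trans hb'.symm
  have h2 : endpoint v.base (-v.dir) = endpoint v.base (-v'.dir) := by
    have e1 := congrArg Prod.fst hv
    have e2 := congrArg Prod.fst hv'
    simp only [ends, ← h1] at e1 e2
    exact e1.trans e2.symm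
  have h3 : v = v' := UnitTangent.ext h1 (neg_injective (endpoint_injective _ h2))
  rw [h3, hv'] at hv
  exact (congrArg Prod.snd hv).symm

end Surface
end GeodesicCoding

namespace GeodesicCoding
namespace Surface

variable {g : ℕ} [hg : Fact (2 ≤ g)] (S : Surface g)

/-! ### Positions of vertices -/

theorem vpos_nonneg {p : Circle × Circle} {j : Idx g} (h1 : S.P j ∈ arcIcc p.2 p.1)
    (h2 : S.Q (j + 1) ∈ arcIcc p.2 p.1) : 0 ≤ S.vpos p j := by
  obtain ⟨a, ha, b, hb, e⟩ := S.vertex_comb_right j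
  rw [vpos, sidePos_eq, e, det3_comb]
  exact add_nonneg (mul_nonneg ha.le (det3_cvec_nonneg_of_mem h1))
    (mul_nonneg hb.le (det3_cvec_nonneg_of_mem h2))

theorem vpos_nonpos {p : Circle × Circle} {j : Idx g} (h1 : S.P j ∈ arcIcc p.1 p.2)
    (h2 : S.Q (j + 1) ∈ arcIcc p.1 p.2) : S.vpos p j ≤ 0 := by
  obtain ⟨a, ha, b, hb, e⟩ := S.vertex_comb_right j
  rw [vpos, sidePos_eq, e, det3_comb]
  exact add_nonpos (mul_nonpos_of_nonneg_of_nonpos ha.le (det3_cvec_nonpos_of_mem h1))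
    (mul_nonpos_of_nonneg_of_nonpos hb.le (det3_cvec_nonpos_of_mem h2))

theorem vpos_nonneg' {p : Circle × Circle} {j : Idx g} (h1 : S.P (j - 1) ∈ arcIcc p.2 p.1)
    (h2 : S.Q j ∈ arcIcc p.2 p.1) : 0 ≤ S.vpos p j := by
  obtain ⟨a, ha, b, hb, e⟩ := S.vertex_comb_left j
  rw [vpos, sidePos_eq, e, det3_comb]
  exact add_nonneg (mul_nonneg ha.le (det3_cvec_nonneg_of_mem h1))
    (mul_nonneg hb.le (det3_cvec_nonneg_of_mem h2))

/-- If `P j` is not on the left and `V j` is on the left, then so is `V (j + 1)`. -/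
theorem vpos_succ_pos {p : Circle × Circle} {j : Idx g} (h1 : S.P j ∈ arcIcc p.1 p.2)
    (h2 : 0 < S.vpos p j) : 0 < S.vpos p (j + 1) := by
  obtain ⟨a, ha, b, hb, e⟩ := S.vertex_eq_succ j
  rw [vpos, sidePos_eq, e, det3_comb, ← sidePos_eq] at h2
  have h3 := mul_nonpos_of_nonneg_of_nonpos ha.le (det3_cvec_nonpos_of_mem h1)
  change 0 < _ + b * S.vpos p (j + 1) at h2
  exact (mul_pos_iff_of_pos_left hb).1 (by linarith)

/-- If `Q (j + 1)` is not on the right and `V (j + 1)` is on the right, then so is `V j`. -/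
theorem vpos_pred_neg {p : Circle × Circle} {j : Idx g} (h1 : S.Q (j + 1) ∈ arcIcc p.2 p.1)
    (h2 : S.vpos p (j + 1) < 0) : S.vpos p j < 0 := by
  obtain ⟨a, ha, b, hb, e⟩ := S.vertex_succ_eq j
  rw [vpos, sidePos_eq, e, det3_comb, ← sidePos_eq] at h2
  have h3 := mul_nonneg hb.le (det3_cvec_nonneg_of_mem h1)
  change a * S.vpos p j + _ < 0 at h2
  by_contra h4
  have := mul_nonneg ha.le (not_lt.1 h4)
  linarith

/-- The end points of a geodesic that leaves the polygon across side `b`. -/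
theorem exit_arcs {p : Circle × Circle} (hp : p.1 ≠ p.2) {b : Idx g} (h1 : S.vpos p b < 0)
    (h2 : 0 < S.vpos p (b + 1)) :
    (S.P b ≠ p.2 ∧ ccw (S.P b) p.2 < ccw (S.P b) (S.Q (b + 1))) ∧
      ccw (S.P b) (S.Q (b + 1)) < ccw (S.P b) p.1 := by
  obtain ⟨s, hs, e, hw, -⟩ := S.exit_point hp h1 h2
  refine ⟨det3_cvec_neg_iff.1 hw, (det3_cvec_pos_iff.1 ?_).2⟩
  rw [lineAt] at e
  have := mul_neg_of_pos_of_neg hs hw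
  change 0 < S.line b (cvec p.1)
  linarith

theorem mem_closedCell {J : Cell g} {x : Circle} (h : x ∈ S.closedCell J) :
    x ∈ S.cell J ∨ x = S.cellHi J := by
  rcases lt_or_eq_of_le (show ccw _ _ ≤ ccw _ _ from h) with h | h
  · exact .inl h
  · exact .inr (ccw_injective _ h)

theorem cell_subset_closedCell (J : Cell g) : S.cell J ⊆ S.closedCell J :=
  arcIco_subset_arcIcc _ _

theorem Q_mem_cell (k : Idx g) : S.Q k ∈ S.cell (k, true) := by
  have h := S.chain k
  change S.Q k ∈ arcIco (S.Q k) (S.P (k + 1))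
  exact (mem_arcIco_base (S.P (k - 3)) (by linarith)).2 ⟨le_rfl, by linarith⟩

theorem P_mem_cell (k : Idx g) : S.P k ∈ S.cell (k, false) := by
  have h := S.chain k
  change S.P k ∈ arcIco (S.P k) (S.Q k)
  exact (mem_arcIco_base (S.P (k - 3)) (by linarith)).2 ⟨le_rfl, by linarith⟩

/-- The cells that meet the open arc from `P b` to `Q (b + 1)`. -/
theorem cell_of_exit {b : Idx g} {x : Circle} (h : ccw (S.P b) x < ccw (S.P b) (S.Q (b + 1))) :
    x ∈ S.cell (b, false) ∨ x ∈ S.cell (b, true) ∨ x ∈ S.cell (b + 1, false) := by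
  have hc := S.chain b
  have h' : x ∈ arcIco (S.P b) (S.Q (b + 1)) := h
  rw [mem_arcIco_base (S.P (b - 3)) (by linarith)] at h'
  change x ∈ arcIco _ _ ∨ x ∈ arcIco _ _ ∨ x ∈ arcIco _ _
  simp only [cellLo, cellHi]
  rw [mem_arcIco_base (S.P (b - 3)) (by linarith), mem_arcIco_base (S.P (b - 3)) (by linarith),
    mem_arcIco_base (S.P (b - 3)) (by linarith)]
  rcases lt_or_ge (ccw (S.P (b - 3)) x) (ccw (S.P (b - 3)) (S.Q b)) with h1 | h1
  · exact .inl ⟨h'.1, h1⟩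
  rcases lt_or_ge (ccw (S.P (b - 3)) x) (ccw (S.P (b - 3)) (S.P (b + 1))) with h2 | h2
  · exact .inr (.inl ⟨h1, h2⟩)
  · exact .inr (.inr ⟨h2, h'.2⟩)

/-- The closed cells that meet the open arc from `P b` to `Q (b + 1)`. -/
theorem closedCell_of_exit {b : Idx g} {x : Circle} (h0 : S.P b ≠ x)
    (h : ccw (S.P b) x < ccw (S.P b) (S.Q (b + 1))) {J : Cell g} (hJ : x ∈ S.closedCell J) :
    J = (b, false) ∨ J = (b, true) ∨ J = (b + 1, false) := by
  have hcell := S.cell_of_exit h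
  rcases S.mem_closedCell hJ with hJ | hJ
  · rcases hcell with h1 | h1 | h1 <;> simp [S.cell_unique hJ h1]
  · obtain ⟨k, t⟩ := J
    cases t
    · have h2 := S.Q_mem_cell k
      rw [show S.Q k = x from hJ.symm] at h2
      rcases hcell with h1 | h1 | h1
      · simpa using S.cell_unique h2 h1
      · have := S.cell_unique h2 h1
        simp_all
      · simpa using S.cell_unique h2 h1
    · have h2 := S.P_mem_cell (k + 1)
      rw [show S.P (k + 1) = x from hJ.symm] at h2
      rcases hcell with h1 | h1 | h1
      · have := congrArg Prod.fst (S.cell_unique h2 h1)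
        exact absurd (by rw [hJ]; exact congrArg S.P this.symm) h0
      · simpa using S.cell_unique h2 h1
      · have := S.cell_unique h2 h1
        simp_all

/-! ### Corners -/

/-- The pair `p` lies in the upper corner at vertex `k`. -/
def IsUpper (k : Idx g) (p : Circle × Circle) : Prop :=
  p.1 ∈ arcIcc (S.P (k - 1)) (S.P k) ∧ p.2 ∈ arcIcc (S.Q k) (S.Q (k + 1))

/-- The pair `p` lies in the lower corner at vertex `k`. -/
def IsLower (k : Idx g) (p : Circle × Circle) : Prop :=
  p.1 ∈ arcIcc (S.Q k) (S.Q (k + 1)) ∧ p.2 ∈ arcIcc (S.P (k - 1)) (S.P k)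

variable {S}

/-- V_{k+2} serves as reference vertex: it is on a known side of every geodesic of the corner, so
meeting the polygon becomes a question about V_k alone. -/
theorem IsUpper.vpos_add_two {k : Idx g} {p : Circle × Circle} (h : S.IsUpper k p) (hp : S.Reg p) :
    0 < S.vpos p (k + 2) := by
  have hc := S.chain k
  have h1 := (mem_arcIcc_base (S.P (k - 3)) (by linarith)).1 h.1
  have h2 := (mem_arcIcc_base (S.P (k - 3)) (by linarith)).1 h.2
  refine lt_of_le_of_ne (S.vpos_nonneg ?_ ?_) (hp.vpos_ne _).symm
  · exact (mem_arcIcc_base_wrap (S.P (k - 3)) (by linarith)).2 (.inl (by linarith))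
  · rw [show k + 2 + 1 = k + 3 by ring]
    exact (mem_arcIcc_base_wrap (S.P (k - 3)) (by linarith)).2 (.inl (by linarith))

theorem IsLower.vpos_add_two {k : Idx g} {p : Circle × Circle} (h : S.IsLower k p) (hp : S.Reg p) :
    S.vpos p (k + 2) < 0 := by
  have hc := S.chain k
  have h1 := (mem_arcIcc_base (S.P (k - 3)) (by linarith)).1 h.1
  have h2 := (mem_arcIcc_base (S.P (k - 3)) (by linarith)).1 h.2
  refine lt_of_le_of_ne (S.vpos_nonpos ?_ ?_) (hp.vpos_ne _)
  · exact (mem_arcIcc_base_wrap (S.P (k - 3)) (by linarith)).2 (.inl (by linarith))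
  · rw [show k + 2 + 1 = k + 3 by ring]
    exact (mem_arcIcc_base_wrap (S.P (k - 3)) (by linarith)).2 (.inl (by linarith))

theorem IsUpper.vpos_succ_pos {k : Idx g} {p : Circle × Circle} (h : S.IsUpper k p)
    (hv : 0 < S.vpos p k) : 0 < S.vpos p (k + 1) := by
  have hc := S.chain k
  have hu := (mem_arcIcc_base (S.P (k - 3)) (by linarith)).1 h.1
  have hw := (mem_arcIcc_base (S.P (k - 3)) (by linarith)).1 h.2
  exact S.vpos_succ_pos
    ((mem_arcIcc_base (S.P (k - 3)) (by linarith)).2 ⟨by linarith, by linarith⟩) hv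

theorem IsLower.vpos_pred_neg {k : Idx g} {p : Circle × Circle} (h : S.IsLower k p)
    (hv : S.vpos p k < 0) : S.vpos p (k - 1) < 0 := by
  have hc := S.chain k
  have hu := (mem_arcIcc_base (S.P (k - 3)) (by linarith)).1 h.1
  have hw := (mem_arcIcc_base (S.P (k - 3)) (by linarith)).1 h.2
  refine S.vpos_pred_neg ?_ (by rwa [sub_add_cancel])
  rw [sub_add_cancel]
  exact (mem_arcIcc_base (S.P (k - 3)) (by linarith)).2 ⟨by linarith, by linarith⟩

/-- The side of exit of a geodesic in an upper corner. -/
theorem IsUpper.exit {k b : Idx g} {p : Circle × Circle} (h : S.IsUpper k p) (hp : p.1 ≠ p.2)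
    (hb : S.vpos p b < 0) (hb' : 0 < S.vpos p (b + 1)) : b = k ∨ b = k + 1 := by
  have hc := S.chain k
  have hw := (mem_arcIcc_base (S.P (k - 3)) (by linarith)).1 h.2
  obtain ⟨⟨n0, hx⟩, -⟩ := S.exit_arcs hp hb hb'
  have hcase : p.2 ∈ S.closedCell (k, true) ∨ p.2 ∈ S.closedCell (k + 1, false) := by
    change p.2 ∈ arcIcc _ _ ∨ p.2 ∈ arcIcc _ _
    simp only [cellLo, cellHi]
    rw [mem_arcIcc_base (S.P (k - 3)) (by linarith), mem_arcIcc_base (S.P (k - 3)) (by linarith)]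
    rcases le_total (ccw (S.P (k - 3)) p.2) (ccw (S.P (k - 3)) (S.P (k + 1))) with h3 | h3
    · exact .inl ⟨hw.1, h3⟩
    · exact .inr ⟨h3, hw.2⟩
  rcases hcase with h3 | h3 <;> rcases S.closedCell_of_exit n0 hx h3 with e | e | e <;>
    simp only [Prod.mk.injEq, Bool.true_eq_false, Bool.false_eq_true, and_false, and_true] at e
  · exact .inl e.symm
  · exact .inr e.symm
  · exact .inl (by linear_combination -e)

/-- The side of exit of a geodesic in a lower corner. -/
theorem IsLower.exit {k b : Idx g} {p : Circle × Circle} (h : S.IsLower k p) (hp : p.1 ≠ p.2)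
    (hb : S.vpos p b < 0) (hb' : 0 < S.vpos p (b + 1)) : b + 1 = k ∨ b + 1 = k - 1 := by
  have hc := S.chain k
  have hw := (mem_arcIcc_base (S.P (k - 3)) (by linarith)).1 h.2
  obtain ⟨⟨n0, hx⟩, -⟩ := S.exit_arcs hp hb hb'
  have hcase : p.2 ∈ S.closedCell (k - 1, false) ∨ p.2 ∈ S.closedCell (k - 1, true) := by
    change p.2 ∈ arcIcc _ _ ∨ p.2 ∈ arcIcc _ _
    simp only [cellLo, cellHi, sub_add_cancel]
    rw [mem_arcIcc_base (S.P (k - 3)) (by linarith), mem_arcIcc_base (S.P (k - 3)) (by linarith)]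
    rcases le_total (ccw (S.P (k - 3)) p.2) (ccw (S.P (k - 3)) (S.Q (k - 1))) with h3 | h3
    · exact .inl ⟨hw.1, h3⟩
    · exact .inr ⟨h3, hw.2⟩
  rcases hcase with h3 | h3 <;> rcases S.closedCell_of_exit n0 hx h3 with e | e | e <;>
    simp only [Prod.mk.injEq, Bool.true_eq_false, Bool.false_eq_true, and_false, and_true] at e
  · exact .inl (by linear_combination -e)
  · exact .inr e.symm
  · exact .inl (by linear_combination -e)

/-- In an upper corner a geodesic meets the polygon iff the vertex is on its right. -/
theorem IsUpper.meets_iff {k : Idx g} {p : Circle × Circle} (h : S.IsUpper k p) (hp : S.Reg p) :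
    Meets p S.F ↔ S.vpos p k < 0 := by
  refine ⟨fun hm => ?_, fun hv => (S.meets_F_iff hp).2 ⟨_, _, hv, h.vpos_add_two hp⟩⟩
  by_contra hv
  have hv := lt_of_le_of_ne (not_lt.1 hv) (hp.vpos_ne k).symm
  obtain ⟨i, j, h1, h2⟩ := (S.meets_F_iff hp).1 hm
  obtain ⟨-, b, -, -, hb, hb'⟩ := S.exists_sides hp h1 h2
  have hk1 := h.vpos_succ_pos hv
  rcases h.exit hp.1 hb hb' with rfl | rfl <;> linarith

/-- In a lower corner a geodesic meets the polygon iff the vertex is on its left. -/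
theorem IsLower.meets_iff {k : Idx g} {p : Circle × Circle} (h : S.IsLower k p) (hp : S.Reg p) :
    Meets p S.F ↔ 0 < S.vpos p k := by
  refine ⟨fun hm => ?_, fun hv => (S.meets_F_iff hp).2 ⟨_, _, h.vpos_add_two hp, hv⟩⟩
  by_contra hv
  have hv := lt_of_le_of_ne (not_lt.1 hv) (hp.vpos_ne k)
  obtain ⟨i, j, h1, h2⟩ := (S.meets_F_iff hp).1 hm
  obtain ⟨-, b, -, -, hb, hb'⟩ := S.exists_sides hp h1 h2
  have hk1 := h.vpos_pred_neg hv
  rcases h.exit hp.1 hb hb' with e | e <;> rw [e] at hb' <;> linarith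

/-- The reference vertices of the two kinds of corner lie on opposite sides, so the geodesic
separates vertices. -/
theorem not_isUpper_isLower {k k' : Idx g} {p : Circle × Circle} (h : S.IsUpper k p)
    (h' : S.IsLower k' p) (hp : S.Reg p) : Meets p S.F :=
  (S.meets_F_iff hp).2 ⟨_, _, h'.vpos_add_two hp, h.vpos_add_two hp⟩

theorem arc_PP_cell {k : Idx g} {x : Circle} (h : x ∈ arcIcc (S.P (k - 1)) (S.P k)) :
    x = S.P k ∨ ∃ t, x ∈ S.cell (k - 1, t) := by
  have hc := S.chain k
  rw [mem_arcIcc_base (S.P (k - 3)) (by linarith)] at h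
  rcases eq_or_lt_of_le h.2 with e | e
  · exact .inl (ccw_injective _ e)
  · refine .inr ?_
    rcases lt_or_ge (ccw (S.P (k - 3)) x) (ccw (S.P (k - 3)) (S.Q (k - 1))) with h3 | h3
    · exact ⟨false, (mem_arcIco_base (S.P (k - 3)) (by simp only [cellLo, cellHi]; linarith)).2 ⟨h.1, h3⟩⟩
    · refine ⟨true, ?_⟩
      change x ∈ arcIco (S.Q (k - 1)) (S.P (k - 1 + 1))
      rw [sub_add_cancel]
      exact (mem_arcIco_base (S.P (k - 3)) (by linarith)).2 ⟨h3, e⟩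

theorem arc_QQ_cell {k : Idx g} {x : Circle} (h : x ∈ arcIcc (S.Q k) (S.Q (k + 1))) :
    x = S.Q (k + 1) ∨ x ∈ S.cell (k, true) ∨ x ∈ S.cell (k + 1, false) := by
  have hc := S.chain k
  rw [mem_arcIcc_base (S.P (k - 3)) (by linarith)] at h
  rcases eq_or_lt_of_le h.2 with e | e
  · exact .inl (ccw_injective _ e)
  · refine .inr ?_
    rcases lt_or_ge (ccw (S.P (k - 3)) x) (ccw (S.P (k - 3)) (S.P (k + 1))) with h3 | h3
    · exact .inl ((mem_arcIco_base (S.P (k - 3)) (by simp only [cellLo, cellHi]; linarith)).2 ⟨h.1, h3⟩)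
    · exact .inr ((mem_arcIco_base (S.P (k - 3)) (by simp only [cellLo, cellHi]; linarith)).2 ⟨h3, e⟩)

/-- Overlapping arcs `[P (k - 1), P k]` are equal or adjacent. -/
theorem arc_PP_eq {k k' : Idx g} {x : Circle} (h : x ∈ arcIcc (S.P (k - 1)) (S.P k))
    (h' : x ∈ arcIcc (S.P (k' - 1)) (S.P k')) :
    k = k' ∨ (k' = k + 1 ∧ x = S.P k) ∨ (k = k' + 1 ∧ x = S.P k') := by
  rcases arc_PP_cell h with e | ⟨t, e⟩ <;> rcases arc_PP_cell h' with e' | ⟨t', e'⟩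
  · have h1 := S.P_mem_cell k
    have h2 := S.P_mem_cell k'
    rw [← e] at h1
    rw [← e'] at h2
    exact .inl (congrArg Prod.fst (S.cell_unique h1 h2))
  · have h1 := S.P_mem_cell k
    rw [← e] at h1
    have := congrArg Prod.fst (S.cell_unique h1 e')
    exact .inr (.inl ⟨by simp only at this; linear_combination -this, e⟩)
  · have h1 := S.P_mem_cell k'
    rw [← e'] at h1
    have := congrArg Prod.fst (S.cell_unique h1 e)
    exact .inr (.inr ⟨by simp only at this; linear_combination -this, e'⟩)
  · have := congrArg Prod.fst (S.cell_unique e e')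
    exact .inl (by simp only at this; linear_combination this)

theorem arc_QQ_inter {k : Idx g} {x : Circle} (h : x ∈ arcIcc (S.Q k) (S.Q (k + 1)))
    (h' : x ∈ arcIcc (S.Q (k + 1)) (S.Q (k + 2))) : x = S.Q (k + 1) := by
  have hc := S.chain k
  rw [mem_arcIcc_base (S.P (k - 3)) (by linarith)] at h h'
  exact ccw_injective _ (le_antisymm h.2 h'.1)

theorem not_reg_P_Q (k : Idx g) : ¬ S.Reg (S.P k, S.Q (k + 1)) := fun h =>
  h.vpos_ne k (S.vertex_right k)

theorem not_reg_Q_P (k : Idx g) : ¬ S.Reg (S.Q (k + 1), S.P k) := fun h =>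
  h.vpos_ne k (by rw [vpos, sidePos_swap]; simpa using S.vertex_right k)

/-- Different upper corners share at most a pair (P_k, Q_{k+1}), and that is the line of a side,
which passes through vertices. -/
theorem IsUpper.unique {k k' : Idx g} {p : Circle × Circle} (h : S.IsUpper k p)
    (h' : S.IsUpper k' p) (hp : S.Reg p) : k = k' := by
  rcases arc_PP_eq h.1 h'.1 with e | ⟨rfl, e⟩ | ⟨rfl, e⟩
  · exact e
  · have h2 := h'.2
    rw [add_assoc, one_add_one_eq_two] at h2
    have := arc_QQ_inter h.2 h2
    rw [show p = (S.P k, S.Q (k + 1)) from Prod.ext e this] at hp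
    exact absurd hp (not_reg_P_Q k)
  · have h2 := h.2
    rw [add_assoc, one_add_one_eq_two] at h2
    have := arc_QQ_inter h'.2 h2
    rw [show p = (S.P k', S.Q (k' + 1)) from Prod.ext e this] at hp
    exact absurd hp (not_reg_P_Q k')

theorem IsLower.unique {k k' : Idx g} {p : Circle × Circle} (h : S.IsLower k p)
    (h' : S.IsLower k' p) (hp : S.Reg p) : k = k' := by
  rcases arc_PP_eq h.2 h'.2 with e | ⟨rfl, e⟩ | ⟨rfl, e⟩
  · exact e
  · have h2 := h'.1
    rw [add_assoc, one_add_one_eq_two] at h2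
    have := arc_QQ_inter h.1 h2
    rw [show p = (S.Q (k + 1), S.P k) from Prod.ext this e] at hp
    exact absurd hp (not_reg_Q_P k)
  · have h2 := h.1
    rw [add_assoc, one_add_one_eq_two] at h2
    have := arc_QQ_inter h'.1 h2
    rw [show p = (S.Q (k' + 1), S.P k') from Prod.ext this e] at hp
    exact absurd hp (not_reg_Q_P k')

end Surface
end GeodesicCoding

namespace GeodesicCoding

theorem sig_add_one {g : ℕ} [Fact (2 ≤ g)] (i : Idx g) : sig (i + 1) = tau (sig i) - 1 := by
  rw [← sig_sig_add, sig_sig]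

theorem sig_sub_one {g : ℕ} [Fact (2 ≤ g)] (i : Idx g) : sig (i - 1) = tau (sig i) + 1 := by
  rw [← sig_sig_sub, sig_sig]

theorem sig_tau {g : ℕ} [Fact (2 ≤ g)] (i : Idx g) : sig (tau i) = tau (sig i) := by
  have h1 := sig_tau_sub (i + 1)
  rw [tau_add_one, add_sub_cancel_right, sig_add_one] at h1
  rw [h1]; ring

theorem smul_eq_of_disc {B C : SU11} (h : ∀ z : UnitDisc, B • z = C • z) :
    (∀ x : Circle, B • x = C • x) ∧ ∀ v : UnitTangent, B • v = C • v := by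
  have h' : ∀ z : UnitDisc, (C⁻¹ * B) • z = z := fun z => by rw [mul_smul, h, inv_smul_smul]
  refine ⟨fun x => ?_, fun v => ?_⟩
  · have := circle_smul_eq_of_trivial h' x
    rwa [mul_smul, inv_smul_eq_iff] at this
  · have := tangent_smul_eq_of_trivial h' v
    rwa [mul_smul, inv_smul_eq_iff] at this

namespace Surface

variable {g : ℕ} [hg : Fact (2 ≤ g)] (S : Surface g)

/-! ### The elements `U k` -/

theorem U_mem (k : Idx g) : S.U k ∈ S.Gam := S.Gam.mul_mem (S.T_mem _) (S.T_mem _)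

/-- Two sides meeting at V_k are crossed in turn, so U_k carries the polygon to the tile opposite to
it at V_k. -/
theorem U_inv_disc (k : Idx g) (z : UnitDisc) :
    (S.U k)⁻¹ • z = (S.T (sig k + 1) * S.T k) • z := by
  rw [inv_smul_eq_iff, U, mul_smul, mul_smul]
  have := S.T_T_sig_disc (tau k - 1) (S.T k • z)
  rw [sig_tau_sub] at this
  rw [this, S.pairing]

/-- The cycle relation at V_k, split into two halves. -/
theorem U_tau_disc (k : Idx g) (z : UnitDisc) : S.U (tau k) • z = (S.U k)⁻¹ • z := by
  have h := S.cycle k z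
  rw [rho_rho k] at h
  have h1 := congrArg (fun x => S.T (sig (rho (tau k))) • x) h
  simp only [S.pairing] at h1
  have h2 := congrArg (fun x => S.T (sig (tau k)) • x) h1
  simp only [S.pairing] at h2
  rw [U_inv_disc, mul_smul, U, mul_smul, tau_tau]
  have e : sig (rho (tau k)) = k - 1 := by rw [rho, sig_sig_add, tau_tau]
  rw [e] at h2
  exact h2.symm

theorem T_U_disc (k : Idx g) (z : UnitDisc) : (S.T k * S.U k) • z = S.T (tau k - 1) • z := by
  rw [mul_smul, U, mul_smul, S.T_T_sig_disc]

theorem T_pred_U_disc (k : Idx g) (z : UnitDisc) :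
    (S.T (k - 1) * S.U k) • z = S.T (tau k) • z := by
  have h := S.U_tau_disc (tau k) z
  rw [tau_tau, U_inv_disc] at h
  rw [mul_smul, h, mul_smul, sig_tau, show tau (sig k) + 1 = sig (k - 1) from (sig_sub_one k).symm,
    S.T_T_sig_disc]

/-- Neighbouring generators differ by an element U. This and `U_sig_disc` repair the code when the
parameters prescribe the neighbour of the generator for the side that is actually crossed. -/
theorem U_rho_disc (i : Idx g) (z : UnitDisc) :
    ((S.U (sig i + 1))⁻¹ * S.T i) • z = S.T (i - 1) • z := by
  rw [mul_smul, inv_smul_eq_iff, ← mul_smul]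
  have h := S.T_pred_U_disc (sig i + 1) (S.T (i - 1) • z)
  rw [add_sub_cancel_right, tau_add_one, ← sig_sub_one, S.pairing, mul_smul] at h
  have h1 := congrArg (fun x => S.T i • x) h
  simp only [S.T_T_sig_disc] at h1
  rw [mul_smul, h1]

theorem U_sig_disc (i : Idx g) (z : UnitDisc) :
    ((S.U (sig i))⁻¹ * S.T i) • z = S.T (i + 1) • z := by
  rw [mul_smul, inv_smul_eq_iff, U, mul_smul, sig_sig, ← sig_add_one, S.pairing]

theorem U_inv_P_pred (k : Idx g) : (S.U k)⁻¹ • S.P (k - 1) = S.Q (tau k) := by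
  rw [(smul_eq_of_disc (S.U_inv_disc k)).1, mul_smul, S.T_P_pred, S.T_P, sig_sig_add,
    sub_add_cancel]

theorem U_inv_P (k : Idx g) : (S.U k)⁻¹ • S.P k = S.Q (tau k + 1) := by
  rw [(smul_eq_of_disc (S.U_inv_disc k)).1, mul_smul, S.T_P, S.T_Q, sig_sig_add]
  congr 1; ring

theorem U_inv_Q (k : Idx g) : (S.U k)⁻¹ • S.Q k = S.P (tau k - 1) := by
  rw [(smul_eq_of_disc (S.U_inv_disc k)).1, mul_smul, S.T_Q,
    show sig k + 2 = sig k + 1 + 1 by ring, S.T_Q_succ, sig_sig_add]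

theorem U_inv_Q_succ (k : Idx g) : (S.U k)⁻¹ • S.Q (k + 1) = S.P (tau k) := by
  rw [(smul_eq_of_disc (S.U_inv_disc k)).1, mul_smul, S.T_Q_succ]
  have := S.T_P_pred (sig k + 1)
  rw [add_sub_cancel_right, sig_sig_add, sub_add_cancel] at this
  exact this

theorem U_inv_V (k : Idx g) : (S.U k)⁻¹ • S.V k = S.V (tau k) := by
  rw [U_inv_disc, mul_smul, S.T_V, S.T_V, sig_sig_add, sub_add_cancel]

theorem vpos_U_inv (p : Circle × Circle) (k : Idx g) :
    (0 < S.vpos ((S.U k)⁻¹ • p) (tau k) ↔ 0 < S.vpos p k) ∧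
    (S.vpos ((S.U k)⁻¹ • p) (tau k) < 0 ↔ S.vpos p k < 0) := by
  simp only [vpos]
  rw [← S.U_inv_V]
  exact ⟨sidePos_smul_pos_iff _, sidePos_smul_neg_iff _⟩

theorem U_inv_U_inv (k : Idx g) (v : UnitTangent) : (S.U (tau k))⁻¹ • (S.U k)⁻¹ • v = v := by
  rw [← (smul_eq_of_disc (S.U_tau_disc k)).2, inv_smul_smul]

theorem U_inv_H (A : Idx g → Circle) (k : Idx g) :
    (S.U k)⁻¹ • S.H A k = S.G A (tau k - 1) := by
  rw [H, inv_smul_smul]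

theorem U_inv_G (A : Idx g → Circle) (k : Idx g) :
    (S.U k)⁻¹ • S.G A (k - 1) = S.H A (tau k) := by
  rw [← (smul_eq_of_disc (S.U_tau_disc k)).1, H, tau_tau]

variable {S}

/-- U_k⁻¹ sends the four points P_{k−1}, P_k, Q_k, Q_{k+1} that bound the corner to the
corresponding points at V_{τ(k)}, exchanging upper and lower. -/
theorem IsUpper.U_inv {k : Idx g} {p : Circle × Circle} (h : S.IsUpper k p) :
    S.IsLower (tau k) ((S.U k)⁻¹ • p) := by
  refine ⟨?_, ?_⟩
  · rw [← S.U_inv_P, ← S.U_inv_P_pred]; exact (smul_mem_arcIcc _).2 h.1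
  · rw [← S.U_inv_Q, ← S.U_inv_Q_succ]; exact (smul_mem_arcIcc _).2 h.2

theorem IsLower.U_inv {k : Idx g} {p : Circle × Circle} (h : S.IsLower k p) :
    S.IsUpper (tau k) ((S.U k)⁻¹ • p) := by
  refine ⟨?_, ?_⟩
  · rw [← S.U_inv_Q, ← S.U_inv_Q_succ]; exact (smul_mem_arcIcc _).2 h.1
  · rw [← S.U_inv_P, ← S.U_inv_P_pred]; exact (smul_mem_arcIcc _).2 h.2

/-! ### Section points -/

/-- Indexing the lower corner by its vertex rather than by the preceding label lets both corners use
the same U_k. -/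
theorem isSectionPoint_iff {v : UnitTangent} : S.IsSectionPoint v ↔ Enters v S.F ∨
    ¬ Meets (ends v) S.F ∧ ∃ k, (S.IsUpper k (ends v) ∨ S.IsLower k (ends v)) ∧
      Enters ((S.U k)⁻¹ • v) S.F := by
  simp only [IsSectionPoint, enters_image]
  refine or_congr Iff.rfl (and_congr Iff.rfl ⟨?_, ?_⟩)
  · rintro ⟨i, ⟨h1, h2, h3⟩ | ⟨h1, h2, h3⟩⟩
    · exact ⟨i, .inl ⟨h1, h2⟩, h3⟩
    · refine ⟨i + 1, .inr ⟨?_, ?_⟩, h3⟩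
      · rwa [add_assoc, one_add_one_eq_two]
      · rwa [add_sub_cancel_right]
  · rintro ⟨k, ⟨h1, h2⟩ | ⟨h1, h2⟩, h3⟩
    · exact ⟨k, .inl ⟨h1, h2, h3⟩⟩
    · refine ⟨k - 1, .inr ⟨?_, ?_, ?_⟩⟩
      · rwa [show k - 1 + 2 = k + 1 by ring, sub_add_cancel]
      · rwa [sub_add_cancel]
      · rwa [sub_add_cancel]

theorem isSectionPoint_unique {v v' : UnitTangent} (hp : S.Reg (ends v)) (he : ends v = ends v')
    (h : S.IsSectionPoint v) (h' : S.IsSectionPoint v') : v = v' := by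
  rw [isSectionPoint_iff] at h h'
  rcases h with h | ⟨hn, k, hk, h⟩ <;> rcases h' with h' | ⟨hn', k', hk', h'⟩
  · exact enters_unique he h h'
  · exact absurd ⟨v, he, h.1⟩ hn'
  · exact absurd ⟨v', he.symm, h'.1⟩ hn
  · have : k = k' := by
      rw [← he] at hk'
      rcases hk with hk | hk <;> rcases hk' with hk' | hk'
      · exact hk.unique hk' hp
      · exact absurd (not_isUpper_isLower hk hk' hp) hn
      · exact absurd (not_isUpper_isLower hk' hk hp) hn
      · exact hk.unique hk' hp
    subst this
    exact smul_left_cancel _ (enters_unique (by rw [ends_smul', ends_smul', he]) h h')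

/-- U_k⁻¹ keeps the side on which the vertex lies but changes the kind of corner, and for the two
kinds opposite sides mean meeting the polygon. -/
theorem IsUpper.meets_U_inv {k : Idx g} {p : Circle × Circle} (h : S.IsUpper k p) (hp : S.Reg p)
    (hm : ¬ Meets p S.F) : Meets ((S.U k)⁻¹ • p) S.F := by
  rw [h.U_inv.meets_iff (hp.smul (S.Gam.inv_mem (S.U_mem k))), (S.vpos_U_inv p k).1]
  rw [h.meets_iff hp] at hm
  exact lt_of_le_of_ne (not_lt.1 hm) (hp.vpos_ne k).symm

theorem IsLower.meets_U_inv {k : Idx g} {p : Circle × Circle} (h : S.IsLower k p) (hp : S.Reg p)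
    (hm : ¬ Meets p S.F) : Meets ((S.U k)⁻¹ • p) S.F := by
  rw [h.U_inv.meets_iff (hp.smul (S.Gam.inv_mem (S.U_mem k))), (S.vpos_U_inv p k).2]
  rw [h.meets_iff hp] at hm
  exact lt_of_le_of_ne (not_lt.1 hm) (hp.vpos_ne k)

/-- A regular geodesic of the domain of the natural extension that misses the polygon lies in a
corner. -/
theorem exists_corner {A : Idx g → Circle} {p : Circle × Circle} (hO : p ∈ S.Omega A)
    (hp : S.Reg p) (hm : ¬ Meets p S.F) : ∃ k, S.IsUpper k p ∨ S.IsLower k p := by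
  rw [mem_Omega] at hO
  obtain ⟨⟨i, t⟩, hu, hw⟩ := hO
  -- Outside the two corners next to the cell, the beginning of the geodesic is confined to an arc
  -- that puts two explicit vertices on opposite sides.
  by_contra! hcon
  have hn1 := (hcon (i + 1)).2
  have hc := S.wrap i
  obtain ⟨c1, c2, c3⟩ := S.corner_chain A i
  refine hm ((S.meets_F_iff hp).2 ?_)
  cases t
  · have hn2 := (hcon (i - 1)).1
    rw [mem_fiber_false] at hu
    change p.2 ∈ arcIcc (S.P i) (S.Q i) at hw
    rw [mem_arcIcc_base (S.P (i + 1)) (by linarith)] at hw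
    have u1 : ccw (S.P (i + 1)) (S.Q (i + 2)) < ccw (S.P (i + 1)) p.1 := by
      by_contra! h
      refine hn1 ⟨?_, ?_⟩
      · rw [add_assoc, one_add_one_eq_two, mem_arcIcc_base (S.P (i + 1)) (by linarith)]
        exact ⟨by linarith, h⟩
      · rw [add_sub_cancel_right, mem_arcIcc_base_wrap (S.P (i + 1)) (by linarith)]
        exact .inl hw.1
    have u2 : ccw (S.P (i + 1)) p.1 < ccw (S.P (i + 1)) (S.P (i - 2)) := by
      by_contra! h
      refine hn2 ⟨?_, ?_⟩
      · rw [show i - 1 - 1 = i - 2 by ring, mem_arcIcc_base (S.P (i + 1)) (by linarith)]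
        exact ⟨h, by linarith⟩
      · rw [sub_add_cancel, mem_arcIcc_base (S.P (i + 1)) (by linarith)]
        exact ⟨by linarith, by linarith⟩
    refine ⟨i - 2, i + 1, lt_of_le_of_ne (S.vpos_nonpos ?_ ?_) (hp.vpos_ne _),
      lt_of_le_of_ne (S.vpos_nonneg ?_ ?_) (hp.vpos_ne _).symm⟩
    · exact (mem_arcIcc_base (S.P (i + 1)) (by linarith)).2 ⟨by linarith, by linarith⟩
    · rw [show i - 2 + 1 = i - 1 by ring]
      exact (mem_arcIcc_base (S.P (i + 1)) (by linarith)).2 ⟨by linarith, by linarith⟩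
    · exact (mem_arcIcc_base_wrap (S.P (i + 1)) (by linarith)).2 (.inr (by linarith))
    · rw [add_assoc, one_add_one_eq_two]
      exact (mem_arcIcc_base_wrap (S.P (i + 1)) (by linarith)).2 (.inr (by linarith))
  · have hn2 := (hcon i).1
    rw [mem_fiber_true] at hu
    change p.2 ∈ arcIcc (S.Q i) (S.P (i + 1)) at hw
    rw [mem_arcIcc_base_wrap (S.P (i + 1)) (by linarith)] at hw
    have hw0 : p.2 = S.P (i + 1) ∨ ccw (S.P (i + 1)) (S.Q i) ≤ ccw (S.P (i + 1)) p.2 := by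
      rcases hw with h | h
      · exact .inr h
      · exact .inl (ccw_injective (S.P (i + 1)) (le_antisymm h (by rw [ccw_self]; exact ccw_nonneg _ _)))
    have u1 : ccw (S.P (i + 1)) (S.Q (i + 2)) < ccw (S.P (i + 1)) p.1 := by
      by_contra! h
      refine hn1 ⟨?_, ?_⟩
      · rw [add_assoc, one_add_one_eq_two, mem_arcIcc_base (S.P (i + 1)) (by linarith)]
        exact ⟨by linarith, h⟩
      · rw [add_sub_cancel_right, mem_arcIcc_base_wrap (S.P (i + 1)) (by linarith)]
        exact hw.imp (fun h => by linarith) id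
    have u2 : ccw (S.P (i + 1)) p.1 < ccw (S.P (i + 1)) (S.P (i - 1)) := by
      by_contra! h
      refine hn2 ⟨?_, ?_⟩
      · rw [mem_arcIcc_base (S.P (i + 1)) (by linarith)]
        exact ⟨h, by linarith⟩
      · rw [mem_arcIcc_base_wrap (S.P (i + 1)) (by linarith)]
        exact hw.imp id (fun h => by linarith)
    refine ⟨i - 1, i + 1, lt_of_le_of_ne (S.vpos_nonpos ?_ ?_) (hp.vpos_ne _),
      lt_of_le_of_ne (S.vpos_nonneg ?_ ?_) (hp.vpos_ne _).symm⟩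
    · rcases hw0 with e | h
      · rw [e]
        exact (mem_arcIcc_base_wrap (S.P (i + 1)) (by linarith)).2 (.inl (by linarith))
      · exact (mem_arcIcc_base (S.P (i + 1)) (by linarith)).2 ⟨by linarith, by linarith⟩
    · rw [sub_add_cancel]
      rcases hw0 with e | h
      · rw [e]
        exact (mem_arcIcc_base_wrap (S.P (i + 1)) (by linarith)).2 (.inl (by linarith))
      · exact (mem_arcIcc_base (S.P (i + 1)) (by linarith)).2 ⟨by linarith, by linarith⟩
    · rcases hw0 with e | h
      · rw [e]; exact left_mem_arcIcc _ _
      · exact (mem_arcIcc_base_wrap (S.P (i + 1)) (by linarith)).2 (.inr (by linarith))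
    · rw [add_assoc, one_add_one_eq_two]
      rcases hw0 with e | h
      · rw [e]
        exact (mem_arcIcc_base (S.P (i + 1)) (by linarith)).2 ⟨by linarith, by linarith⟩
      · exact (mem_arcIcc_base_wrap (S.P (i + 1)) (by linarith)).2 (.inr (by linarith))

theorem exists_isSectionPoint {A : Idx g → Circle} {p : Circle × Circle} (hO : p ∈ S.Omega A)
    (hp : S.Reg p) : ∃ v, ends v = p ∧ S.IsSectionPoint v := by
  by_cases hm : Meets p S.F
  · obtain ⟨v, hv, h⟩ := S.exists_enters hp hm
    exact ⟨v, hv, .inl h⟩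
  · obtain ⟨k, hk⟩ := exists_corner hO hp hm
    have hm' : Meets ((S.U k)⁻¹ • p) S.F := hk.elim (fun h => h.meets_U_inv hp hm)
      fun h => h.meets_U_inv hp hm
    obtain ⟨v, hv, h⟩ := S.exists_enters (hp.smul (S.Gam.inv_mem (S.U_mem k))) hm'
    have e : ends (S.U k • v) = p := by rw [ends_smul', hv, smul_inv_smul]
    refine ⟨S.U k • v, e, isSectionPoint_iff.2 (.inr ⟨by rwa [e], k, by rwa [e], ?_⟩)⟩
    rwa [inv_smul_smul]

theorem sectionPoint_spec {A : Idx g → Circle} {p : Circle × Circle} (hO : p ∈ S.Omega A)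
    (hp : S.Reg p) : ends (S.sectionPoint p) = p ∧ S.IsSectionPoint (S.sectionPoint p) :=
  Classical.epsilon_spec (exists_isSectionPoint hO hp)

theorem sectionPoint_eq {v : UnitTangent} (hp : S.Reg (ends v)) (h : S.IsSectionPoint v) :
    S.sectionPoint (ends v) = v := by
  have := Classical.epsilon_spec (p := fun v' => ends v' = ends v ∧ S.IsSectionPoint v') ⟨v, rfl, h⟩
  exact (isSectionPoint_unique hp this.1.symm h this.2).symm

theorem IsSectionPoint.exists_enters {v : UnitTangent} (h : S.IsSectionPoint v) :
    ∃ γ ∈ S.Gam, Enters (γ • v) S.F := by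
  rcases isSectionPoint_iff.1 h with h | ⟨-, k, -, h⟩
  · exact ⟨1, S.Gam.one_mem, by rwa [one_smul]⟩
  · exact ⟨_, S.Gam.inv_mem (S.U_mem k), h⟩

end Surface
end GeodesicCoding

namespace GeodesicCoding
namespace Surface

variable {g : ℕ} [hg : Fact (2 ≤ g)] {S : Surface g} {A : Idx g → Circle}

/-! ### The cross-section consists of the entrances into polygons -/

/-- The geodesic can only leave across side i, and then it begins off the arc [P_i, Q_{i+1}]. -/
theorem mem_fiber_of_meets_true {p : Circle × Circle} {i : Idx g} (hp : S.Reg p)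
    (hm : Meets p S.F) (hw : p.2 ∈ S.cell (i, true)) :
    ccw (S.P (i + 1)) (S.Q (i + 1)) ≤ ccw (S.P (i + 1)) p.1 ∧
      ccw (S.P (i + 1)) p.1 ≤ ccw (S.P (i + 1)) (S.P i) := by
  obtain ⟨j, k, h1, h2⟩ := (S.meets_F_iff hp).1 hm
  obtain ⟨-, b, -, -, hb, hb'⟩ := S.exists_sides hp h1 h2
  obtain ⟨⟨-, e1⟩, e2⟩ := S.exit_arcs hp.1 hb hb'
  have hbi : b = i := by
    rcases S.cell_of_exit e1 with h | h | h
    · exact absurd (S.cell_unique h hw) (by simp)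
    · simpa using S.cell_unique h hw
    · exact absurd (S.cell_unique h hw) (by simp)
  subst hbi
  have hc := S.wrap b
  have e3 : p.1 ∉ arcIcc (S.P b) (S.Q (b + 1)) := not_le.2 e2
  rw [mem_arcIcc_base_wrap (S.P (b + 1)) (by linarith)] at e3
  push Not at e3
  exact ⟨e3.2.le, e3.1.le⟩

/-- Sides i and i − 1 are both possible exits here. In either case the side on which V_i must lie
excludes the remaining positions of the beginning. -/
theorem mem_fiber_of_meets_false {p : Circle × Circle} {i : Idx g} (hp : S.Reg p)
    (hm : Meets p S.F) (hw : p.2 ∈ S.cell (i, false)) :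
    ccw (S.P (i + 1)) (S.Q (i + 1)) ≤ ccw (S.P (i + 1)) p.1 ∧
      ccw (S.P (i + 1)) p.1 ≤ ccw (S.P (i + 1)) (S.P (i - 1)) := by
  obtain ⟨j, k, h1, h2⟩ := (S.meets_F_iff hp).1 hm
  obtain ⟨-, b, -, -, hb, hb'⟩ := S.exists_sides hp h1 h2
  obtain ⟨⟨-, e1⟩, e2⟩ := S.exit_arcs hp.1 hb hb'
  have hc := S.wrap i
  have hw' : p.2 ∈ arcIco (S.P i) (S.Q i) := hw
  rw [mem_arcIco_base (S.P (i + 1)) (by linarith)] at hw'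
  have e3 : p.1 ∉ arcIcc (S.P b) (S.Q (b + 1)) := not_le.2 e2
  rcases S.cell_of_exit e1 with h | h | h
  · obtain rfl : b = i := by simpa using S.cell_unique h hw
    rw [mem_arcIcc_base_wrap (S.P (b + 1)) (by linarith)] at e3
    push Not at e3
    refine ⟨e3.2.le, ?_⟩
    by_contra! h3
    refine hb.not_ge (S.vpos_nonneg' ?_ ?_)
    · exact (mem_arcIcc_base_wrap (S.P (b + 1)) (by linarith)).2 (.inr h3.le)
    · exact (mem_arcIcc_base_wrap (S.P (b + 1)) (by linarith)).2 (.inl hw'.2.le)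
  · exact absurd (S.cell_unique h hw) (by simp)
  · obtain rfl : b + 1 = i := by simpa using S.cell_unique h hw
    rw [add_sub_cancel_right] at hc ⊢
    have h0 : ccw (S.P (b + 1 + 1)) (S.P b) < ccw (S.P (b + 1 + 1)) (S.Q (b + 1)) := by linarith
    rw [mem_arcIcc_base (S.P (b + 1 + 1)) h0.le] at e3
    push Not at e3
    by_contra! h3
    rcases lt_or_ge (ccw (S.P (b + 1 + 1)) p.1) (ccw (S.P (b + 1 + 1)) (S.Q (b + 1 + 1))) with h4 | h4
    · refine hb'.not_ge (S.vpos_nonpos ?_ ?_)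
      · exact (mem_arcIcc_base (S.P (b + 1 + 1)) (by linarith)).2 ⟨by linarith, by linarith⟩
      · exact (mem_arcIcc_base (S.P (b + 1 + 1)) (by linarith)).2 ⟨by linarith, by linarith⟩
    · have h5 := h3 h4
      have h6 := e3 h5.le
      refine hb'.not_ge (S.vpos_nonpos ?_ ?_)
      · exact (mem_arcIcc_base_wrap (S.P (b + 1 + 1)) (by linarith)).2 (.inr (by linarith))
      · exact (mem_arcIcc_base_wrap (S.P (b + 1 + 1)) (by linarith)).2 (.inr (by linarith))

/-- H is defined so that U_k⁻¹ takes what Ω lacks in a lower corner to what it contains in the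
opposite upper corner, and conversely. -/
theorem U_inv_mem_Omega_of_lower {p : Circle × Circle} {k : Idx g} (h : S.IsLower k p)
    (hu : p.1 ∈ arcIcc (S.Q k) (S.H A k)) : (S.U k)⁻¹ • p ∈ S.Omega A := by
  have h1 := h.U_inv
  set t := tau k with ht
  have hu' : ((S.U k)⁻¹ • p).1 ∈ arcIcc (S.P (t - 1)) (S.G A (t - 1)) := by
    rw [← S.U_inv_Q, ← S.U_inv_H]; exact (smul_mem_arcIcc _).2 hu
  have hc := S.wrap t
  have hc2 := S.wrap (t + 1)
  obtain ⟨c1, c2, c3⟩ := S.corner_chain A t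
  obtain ⟨d1, d2, d3⟩ := S.corner_chain A (t + 1)
  have e1 : t + 1 - 2 = t - 1 := by ring
  have e2 : t + 1 + 1 = t + 2 := by ring
  have e3 : t + 1 - 1 = t := by ring
  have e4 : t + 1 - 3 = t - 2 := by ring
  have e5 : t + 1 + 2 = t + 3 := by ring
  simp only [e1, e2, e3, e4, e5] at d1 d2 d3 hc2
  rw [mem_Omega]
  rcases arc_QQ_cell h1.2 with h2 | h2 | h2
  · refine ⟨(t + 1, false), (S.mem_fiber_false A).2 ?_, ?_⟩
    · rw [e2, e1]
      exact (mem_arcIcc_base (S.P (t + 2)) (by linarith)).1 hu' |>.imp (fun _ => by linarith) id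
    · rw [h2]; exact right_mem_arcIcc _ _
  · refine ⟨(t, true), (S.mem_fiber_true A).2 ?_, S.cell_subset_closedCell _ h2⟩
    exact (mem_arcIcc_base (S.P (t + 1)) (by linarith)).1 hu' |>.imp (fun _ => by linarith) id
  · refine ⟨(t + 1, false), (S.mem_fiber_false A).2 ?_, S.cell_subset_closedCell _ h2⟩
    rw [e2, e1]
    exact (mem_arcIcc_base (S.P (t + 2)) (by linarith)).1 hu' |>.imp (fun _ => by linarith) id

theorem U_inv_mem_Omega_of_upper {p : Circle × Circle} {k : Idx g} (h : S.IsUpper k p)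
    (hu : p.1 ∈ arcIcc (S.G A (k - 1)) (S.P k)) : (S.U k)⁻¹ • p ∈ S.Omega A := by
  have h1 := h.U_inv
  set t := tau k with ht
  have hu' : ((S.U k)⁻¹ • p).1 ∈ arcIcc (S.H A t) (S.Q (t + 1)) := by
    rw [← S.U_inv_P, ← S.U_inv_G]; exact (smul_mem_arcIcc _).2 hu
  obtain ⟨c1, c2, c3⟩ := S.corner_chain A (t - 1)
  have hc := S.wrap (t - 1)
  have e1 : t - 1 + 1 = t := by ring
  have e2 : t - 1 + 2 = t + 1 := by ring
  simp only [e1, e2] at c1 c2 c3 hc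
  rw [mem_arcIcc_base (S.P t) (by linarith)] at hu'
  rw [mem_Omega]
  rcases arc_PP_cell h1.2 with h2 | ⟨s, h2⟩
  · refine ⟨(t - 1, true), (S.mem_fiber_true A).2 ?_, ?_⟩
    · rw [e1]; exact ⟨hu'.1, hu'.2.trans (by linarith)⟩
    · rw [h2, show S.P t = S.cellHi (t - 1, true) from congrArg S.P e1.symm]
      exact right_mem_arcIcc _ _
  · refine ⟨(t - 1, s), ?_, S.cell_subset_closedCell _ h2⟩
    cases s
    · rw [mem_fiber_false, e1]; exact ⟨hu'.1, hu'.2.trans (by linarith)⟩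
    · rw [mem_fiber_true, e1]; exact ⟨hu'.1, hu'.2.trans (by linarith)⟩

/-- Every regular vector that enters the polygon projects into the cross-section. -/
theorem proj_mem_crossSection_of_enters {v : UnitTangent} (hp : S.Reg (ends v))
    (hv : Enters v S.F) : S.proj v ∈ S.crossSection A := by
  have hm : Meets (ends v) S.F := ⟨v, rfl, hv.1⟩
  -- For a geodesic outside Ω, `(U k)⁻¹ • v` has the same projection, and it is a section point of
  -- the second kind: its geodesic misses the polygon and enters the opposite tile there.
  have hU : ∀ k, (S.U k)⁻¹ • ends v ∈ S.Omega A → (S.IsUpper k (ends v) ∨ S.IsLower k (ends v)) →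
      S.proj v ∈ S.crossSection A := by
    intro k hO hk
    refine ⟨(S.U k)⁻¹ • v, ⟨by rwa [ends_smul'], isSectionPoint_iff.2 (.inr ⟨?_, tau k, ?_, ?_⟩)⟩,
      Quotient.sound ⟨⟨_, S.Gam.inv_mem (S.U_mem k)⟩, rfl⟩⟩
    · have hp' := hp.smul (S.Gam.inv_mem (S.U_mem k))
      rw [ends_smul']
      rcases hk with hk | hk
      · rw [hk.U_inv.meets_iff hp', (S.vpos_U_inv _ k).1, not_lt]
        exact ((hk.meets_iff hp).1 hm).le
      · rw [hk.U_inv.meets_iff hp', (S.vpos_U_inv _ k).2, not_lt]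
        exact ((hk.meets_iff hp).1 hm).le
    · rw [ends_smul']
      exact hk.symm.imp (fun h => h.U_inv) fun h => h.U_inv
    · rwa [U_inv_U_inv]
  obtain ⟨⟨i, s⟩, hw⟩ := S.exists_mem_cell (ends v).2
  by_cases hf : (ends v).1 ∈ S.fiber A (i, s)
  · exact ⟨v, ⟨(S.mem_Omega A).2 ⟨_, hf, S.cell_subset_closedCell _ hw⟩, .inl hv⟩, rfl⟩
  have hc := S.wrap i
  obtain ⟨c1, c2, c3⟩ := S.corner_chain A i
  have hlow : ccw (S.P (i + 1)) (S.Q (i + 1)) ≤ ccw (S.P (i + 1)) (ends v).1 →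
      ccw (S.P (i + 1)) (ends v).1 < ccw (S.P (i + 1)) (S.H A (i + 1)) →
      S.proj v ∈ S.crossSection A := by
    intro h1 h2
    have h3 : S.IsLower (i + 1) (ends v) := by
      refine ⟨(mem_arcIcc_base (S.P (i + 1)) ?_).2 ⟨h1, ?_⟩, ?_⟩
      · rw [add_assoc, one_add_one_eq_two]; linarith
      · rw [add_assoc, one_add_one_eq_two]; linarith
      · rw [add_sub_cancel_right, mem_arcIcc_base_wrap (S.P (i + 1)) (by linarith)]
        left
        cases s
        · have hw' : (ends v).2 ∈ arcIco (S.P i) (S.Q i) := hw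
          exact ((mem_arcIco_base (S.P (i + 1)) (by linarith)).1 hw').1
        · have hw' : (ends v).2 ∈ arcIco (S.Q i) (S.P (i + 1)) := hw
          rw [mem_arcIco_base_wrap (S.P (i + 1)) (by linarith)] at hw'
          rcases hw' with h | h <;> linarith [ccw_nonneg (S.P (i + 1)) (ends v).2]
    exact hU (i + 1) (U_inv_mem_Omega_of_lower h3
      ((mem_arcIcc_base (S.P (i + 1)) (by linarith)).2 ⟨h1, h2.le⟩)) (.inr h3)
  cases s
  · obtain ⟨h1, h2⟩ := mem_fiber_of_meets_false hp hm hw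
    rcases lt_or_ge (ccw (S.P (i + 1)) (ends v).1) (ccw (S.P (i + 1)) (S.H A (i + 1))) with h3 | h3
    · exact hlow h1 h3
    rw [mem_fiber_false, not_and, not_le] at hf
    have h4 := hf h3
    have hw' : (ends v).2 ∈ arcIco (S.P i) (S.Q i) := hw
    rw [mem_arcIco_base (S.P (i + 1)) (by linarith)] at hw'
    have h5 : S.IsUpper (i - 1) (ends v) := by
      refine ⟨?_, ?_⟩
      · rw [show i - 1 - 1 = i - 2 by ring, mem_arcIcc_base (S.P (i + 1)) (by linarith)]
        exact ⟨by linarith, h2⟩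
      · rw [sub_add_cancel, mem_arcIcc_base (S.P (i + 1)) (by linarith)]
        exact ⟨by linarith, hw'.2.le⟩
    refine hU (i - 1) (U_inv_mem_Omega_of_upper h5 ?_) (.inl h5)
    rw [show i - 1 - 1 = i - 2 by ring, mem_arcIcc_base (S.P (i + 1)) (by linarith)]
    exact ⟨h4.le, h2⟩
  · obtain ⟨h1, h2⟩ := mem_fiber_of_meets_true hp hm hw
    rcases lt_or_ge (ccw (S.P (i + 1)) (ends v).1) (ccw (S.P (i + 1)) (S.H A (i + 1))) with h3 | h3
    · exact hlow h1 h3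
    rw [mem_fiber_true, not_and, not_le] at hf
    have h4 := hf h3
    have hw' : (ends v).2 ∈ arcIco (S.Q i) (S.P (i + 1)) := hw
    rw [mem_arcIco_base_wrap (S.P (i + 1)) (by linarith)] at hw'
    have h5 : S.IsUpper i (ends v) := by
      refine ⟨(mem_arcIcc_base (S.P (i + 1)) (by linarith)).2 ⟨by linarith, h2⟩, ?_⟩
      rw [mem_arcIcc_base_wrap (S.P (i + 1)) (by linarith)]
      rcases hw' with h | h
      · exact .inl h
      · exact .inr (by linarith)
    refine hU i (U_inv_mem_Omega_of_upper h5 ?_) (.inl h5)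
    rw [mem_arcIcc_base (S.P (i + 1)) (by linarith)]
    exact ⟨h4.le, h2⟩

theorem exists_enters_of_proj_mem {v : UnitTangent} (h : S.proj v ∈ S.crossSection A) :
    ∃ γ ∈ S.Gam, Enters (γ • v) S.F := by
  obtain ⟨v', ⟨-, h'⟩, e⟩ := h
  obtain ⟨δ, hδ⟩ := Quotient.exact e
  obtain ⟨γ, hγ, hE⟩ := h'.exists_enters
  change (δ : SU11) • v = v' at hδ
  exact ⟨γ * δ, S.Gam.mul_mem hγ δ.2, by rwa [mul_smul, hδ]⟩

theorem proj_smul {γ : SU11} (hγ : γ ∈ S.Gam) (v : UnitTangent) : S.proj (γ • v) = S.proj v :=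
  Quotient.sound ⟨⟨γ, hγ⟩, rfl⟩

/-- On regular vectors, the cross-section consists of the entrances into polygons. -/
theorem proj_mem_crossSection_iff {v : UnitTangent} (hp : S.Reg (ends v)) :
    S.proj v ∈ S.crossSection A ↔ ∃ γ ∈ S.Gam, Enters (γ • v) S.F := by
  refine ⟨exists_enters_of_proj_mem, fun ⟨γ, hγ, h⟩ => ?_⟩
  rw [← proj_smul hγ]
  exact proj_mem_crossSection_of_enters (by rw [ends_smul']; exact hp.smul hγ) h

end Surface
end GeodesicCoding

namespace GeodesicCoding
namespace Surface

variable {g : ℕ} [hg : Fact (2 ≤ g)] {S : Surface g} {A : Idx g → Circle}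

/-! ### The first return -/

theorem isUpper_T {p : Circle × Circle} {i : Idx g}
    (hw : p.2 ∈ arcIcc (S.P i) (S.Q i)) (hu : p.1 ∈ arcIcc (S.Q (i + 1)) (S.P (i - 1))) :
    S.IsUpper (sig i + 1) (S.T i • p) := by
  refine ⟨?_, ?_⟩
  · rw [add_sub_cancel_right, ← S.T_Q_succ, ← S.T_P_pred]
    exact (smul_mem_arcIcc _).2 hu
  · rw [add_assoc, one_add_one_eq_two, ← S.T_P, ← S.T_Q]
    exact (smul_mem_arcIcc _).2 hw

theorem isLower_T {p : Circle × Circle} {i : Idx g}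
    (hw : p.2 ∈ arcIcc (S.P (i + 1)) (S.Q (i + 1)))
    (hu : p.1 ∈ arcIcc (S.Q (i + 2)) (S.P i)) : S.IsLower (sig i) (S.T i • p) := by
  refine ⟨?_, ?_⟩
  · rw [← S.T_Q_add_two, ← S.T_P]
    exact (smul_mem_arcIcc _).2 hu
  · rw [← S.T_P_succ, ← S.T_Q_succ]
    exact (smul_mem_arcIcc _).2 hw

/-- The case in which T_i is prescribed although the geodesic crosses side i − 1. The image misses
the polygon in an upper corner, and `U_rho_disc` turns the true entrance into the one demanded by
the section. -/
theorem isSectionPoint_upper {v : UnitTangent} {i : Idx g} (hp : S.Reg (ends v))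
    (hw : (ends v).2 ∈ arcIcc (S.P i) (S.Q i))
    (hu : (ends v).1 ∈ arcIcc (S.Q (i + 1)) (S.P (i - 1))) (hv : 0 < S.vpos (ends v) i)
    (hE : Enters (S.T (i - 1) • v) S.F) : S.IsSectionPoint (S.T i • v) := by
  have h := isUpper_T hw hu
  refine isSectionPoint_iff.2 (.inr ⟨?_, sig i + 1, .inl ?_, ?_⟩)
  · rw [ends_smul', h.meets_iff (hp.smul (S.T_mem i)), not_lt]
    exact ((S.vpos_T _ i).2.2.1.2 hv).le
  · rwa [ends_smul']
  · rwa [← mul_smul, (smul_eq_of_disc (S.U_rho_disc i)).2]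

theorem isSectionPoint_lower {v : UnitTangent} {i : Idx g} (hp : S.Reg (ends v))
    (hw : (ends v).2 ∈ arcIcc (S.P (i + 1)) (S.Q (i + 1)))
    (hu : (ends v).1 ∈ arcIcc (S.Q (i + 2)) (S.P i)) (hv : S.vpos (ends v) (i + 1) < 0)
    (hE : Enters (S.T (i + 1) • v) S.F) : S.IsSectionPoint (S.T i • v) := by
  have h := isLower_T hw hu
  refine isSectionPoint_iff.2 (.inr ⟨?_, sig i, .inr ?_, ?_⟩)
  · rw [ends_smul', h.meets_iff (hp.smul (S.T_mem i)), not_lt]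
    exact ((S.vpos_T _ i).2.1.2 hv).le
  · rwa [ends_smul']
  · rwa [← mul_smul, (smul_eq_of_disc (S.U_sig_disc i)).2]

theorem arc_QQ_closedCell {k : Idx g} {x : Circle} {J : Cell g}
    (h : x ∈ arcIcc (S.Q k) (S.Q (k + 1))) (hJ : x ∈ S.closedCell J) :
    (J = (k, false) ∧ x = S.Q k) ∨ J = (k, true) ∨ J = (k + 1, false) ∨
      (J = (k + 1, true) ∧ x = S.Q (k + 1)) := by
  have h' : (x = S.Q (k + 1) ∧ x ∈ S.cell (k + 1, true)) ∨ x ∈ S.cell (k, true) ∨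
      x ∈ S.cell (k + 1, false) := (arc_QQ_cell h).imp_left fun e => ⟨e, e ▸ S.Q_mem_cell _⟩
  rcases S.mem_closedCell hJ with hJ | hJ
  · rcases h' with ⟨e, h'⟩ | h' | h' <;> simp [S.cell_unique hJ h', *]
  · obtain ⟨m, t⟩ := J
    cases t
    · have h2 : x ∈ S.cell (m, true) := hJ ▸ S.Q_mem_cell m
      rcases h' with ⟨e, h'⟩ | h' | h'
      · have := S.cell_unique h2 h'
        simp_all
      · obtain rfl : m = k := by simpa using S.cell_unique h2 h'
        exact .inl ⟨rfl, hJ⟩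
      · have := S.cell_unique h2 h'
        simp_all
    · have h2 : x ∈ S.cell (m + 1, false) := hJ ▸ S.P_mem_cell (m + 1)
      rcases h' with ⟨e, h'⟩ | h' | h'
      · have := S.cell_unique h2 h'
        simp_all
      · have := S.cell_unique h2 h'
        simp_all
      · obtain rfl : m = k := by simpa using S.cell_unique h2 h'
        exact .inr (.inl rfl)

theorem arc_PP_closedCell {k : Idx g} {x : Circle} {J : Cell g}
    (h : x ∈ arcIcc (S.P (k - 1)) (S.P k)) (hJ : x ∈ S.closedCell J) :
    (J = (k, false) ∧ x = S.P k) ∨ J = (k - 1, true) ∨ J = (k - 1, false) ∨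
      (J = (k - 2, true) ∧ x = S.P (k - 1)) := by
  have h' : (x = S.P k ∧ x ∈ S.cell (k, false)) ∨ x ∈ S.cell (k - 1, true) ∨
      x ∈ S.cell (k - 1, false) := by
    rcases arc_PP_cell h with e | ⟨t, e⟩
    · exact .inl ⟨e, e ▸ S.P_mem_cell _⟩
    · cases t
      · exact .inr (.inr e)
      · exact .inr (.inl e)
  rcases S.mem_closedCell hJ with hJ | hJ
  · rcases h' with ⟨e, h'⟩ | h' | h' <;> simp [S.cell_unique hJ h', *]
  · obtain ⟨m, t⟩ := J
    cases t
    · have h2 : x ∈ S.cell (m, true) := hJ ▸ S.Q_mem_cell m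
      rcases h' with ⟨e, h'⟩ | h' | h'
      · have := S.cell_unique h2 h'
        simp_all
      · obtain rfl : m = k - 1 := by simpa using S.cell_unique h2 h'
        exact .inr (.inr (.inl rfl))
      · have := S.cell_unique h2 h'
        simp_all
    · have h2 : x ∈ S.cell (m + 1, false) := hJ ▸ S.P_mem_cell (m + 1)
      rcases h' with ⟨e, h'⟩ | h' | h'
      · have : m + 1 = k := by simpa using S.cell_unique h2 h'
        exact .inr (.inl (by rw [← this, add_sub_cancel_right]))
      · have := S.cell_unique h2 h'
        simp_all
      · have : m + 1 = k - 1 := by simpa using S.cell_unique h2 h'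
        exact .inr (.inr (.inr ⟨by rw [show k - 2 = m by linear_combination -this],
          hJ.trans (congrArg S.P this)⟩))

/-- The section point of the image of a geodesic whose section point enters the polygon. -/
theorem section_step_center {v : UnitTangent} (hp : S.Reg (ends v))
    (hA : S.IsExtremal A) {J : Cell g} (hu : (ends v).1 ∈ S.fiber A J)
    (hw : (ends v).2 ∈ S.closedCell J) {b : Idx g} (hb : S.vpos (ends v) b < 0)
    (hb' : 0 < S.vpos (ends v) (b + 1)) {τ : ℝ} (hτ : Enters (S.T b • diskFlow τ v) S.F) :
    S.IsSectionPoint (S.T (S.ind A J) • diskFlow τ v) := by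
  obtain ⟨⟨n0, e1⟩, -⟩ := S.exit_arcs hp.1 hb hb'
  have hc := S.wrap b
  rcases S.closedCell_of_exit n0 e1 hw with rfl | rfl | rfl
  · rcases hA b with h | h
    · rw [S.ind_false_P A h]; exact .inl hτ
    · rw [S.ind_false_Q A h]
      obtain ⟨c1, c2, c3⟩ := S.corner_chain A b
      rw [mem_fiber_false] at hu
      refine isSectionPoint_lower (by rwa [ends_diskFlow]) ?_ ?_ ?_ ?_
      · rw [ends_diskFlow, sub_add_cancel]; exact hw
      · rw [ends_diskFlow, show b - 1 + 2 = b + 1 by ring,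
          mem_arcIcc_base (S.P (b + 1)) (by linarith)]
        exact ⟨by linarith, by linarith⟩
      · rwa [ends_diskFlow, sub_add_cancel]
      · rwa [sub_add_cancel]
  · rw [ind_true]; exact .inl hτ
  · rcases hA (b + 1) with h | h
    · rw [S.ind_false_P A h]
      obtain ⟨c1, c2, c3⟩ := S.corner_chain A (b + 1)
      have hc' := S.wrap (b + 1)
      rw [mem_fiber_false] at hu
      refine isSectionPoint_upper (by rwa [ends_diskFlow]) ?_ ?_ ?_ ?_
      · rw [ends_diskFlow]; exact hw
      · rw [ends_diskFlow, mem_arcIcc_base (S.P (b + 1 + 1)) (by linarith)]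
        exact ⟨by linarith, by linarith⟩
      · rwa [ends_diskFlow]
      · rwa [add_sub_cancel_right]
    · rw [S.ind_false_Q A h, add_sub_cancel_right]; exact .inl hτ

/-- The image of the corner cell under the side pairings. -/
theorem U_inv_corner_pos {k : Idx g} {w : Circle} (hw : w ∈ arcIcc (S.P (k + 1)) (S.Q (k + 1))) :
    (S.U k)⁻¹ • w ∈ arcIcc (S.Q (tau k - 1)) (S.P (tau k)) := by
  rw [(smul_eq_of_disc (S.U_inv_disc k)).1, mul_smul]
  have h1 : S.T k • w ∈ arcIcc (S.P (sig k - 1)) (S.P (sig k)) := by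
    rw [← S.T_P_succ, ← S.T_Q_succ]; exact (smul_mem_arcIcc _).2 hw
  have hc := S.wrap (sig k + 1)
  rw [show sig k + 1 - 2 = sig k - 1 by ring, show sig k + 1 - 1 = sig k by ring] at hc
  have h2 : S.T k • w ∈ arcIcc (S.Q (sig k + 1 + 2)) (S.P (sig k + 1 - 1)) := by
    rw [add_sub_cancel_right]
    have h0 : ccw (S.P (sig k + 1 + 1)) (S.P (sig k - 1)) ≤ ccw (S.P (sig k + 1 + 1)) (S.P (sig k)) := by
      linarith
    rw [mem_arcIcc_base (S.P (sig k + 1 + 1)) h0] at h1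
    rw [mem_arcIcc_base (S.P (sig k + 1 + 1)) (by linarith)]
    exact ⟨by linarith, by linarith⟩
  have h3 := (smul_mem_arcIcc (S.T (sig k + 1))).2 h2
  rwa [S.T_Q_add_two, S.T_P_pred, sig_sig_add, sub_add_cancel] at h3

theorem U_inv_corner_neg {k : Idx g} {w : Circle} (hw : w ∈ arcIcc (S.P (k - 1)) (S.Q (k - 1))) :
    (S.U k)⁻¹ • w ∈ arcIcc (S.Q (tau k)) (S.P (tau k + 1)) := by
  have e := (smul_eq_of_disc (S.T_pred_U_disc k)).1 ((S.U k)⁻¹ • w)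
  rw [mul_smul, smul_inv_smul] at e
  have e' : (S.U k)⁻¹ • w = S.T (sig (tau k)) • S.T (k - 1) • w := by rw [e, S.T_sig_T]
  rw [e']
  set j := sig (tau k) with hj
  have hs : sig (k - 1) = j + 1 := by rw [sig_sub_one, hj, sig_tau]
  have h1 : S.T (k - 1) • w ∈ arcIcc (S.Q (j + 2)) (S.Q (j + 3)) := by
    rw [show j + 2 = sig (k - 1) + 1 by rw [hs]; ring, show j + 3 = sig (k - 1) + 2 by rw [hs]; ring,
      ← S.T_P, ← S.T_Q]
    exact (smul_mem_arcIcc _).2 hw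
  have hc := S.wrap j
  have h2 : S.T (k - 1) • w ∈ arcIcc (S.Q (j + 2)) (S.P (j - 1)) := by
    rw [mem_arcIcc_base (S.P (j + 1)) (by linarith)] at h1 ⊢
    exact ⟨by linarith, by linarith⟩
  have h3 := (smul_mem_arcIcc (S.T j)).2 h2
  rwa [S.T_Q_add_two, S.T_P_pred, hj, sig_sig] at h3

/-- The true entrance is y = U_k⁻¹ v, in the lower corner at τ(k), so it leaves across side τ(k) − 1
or τ(k) − 2. The identity T_k U_k = T_{τ(k)−1} compares the prescribed generator with the one for
that side. -/
theorem section_step_upper {v y : UnitTangent} {k : Idx g} (hy : y = (S.U k)⁻¹ • v)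
    (hp : S.Reg (ends v)) (hm : ¬ Meets (ends v) S.F) (hk : S.IsUpper k (ends v))
    (hA : S.IsExtremal A) {J : Cell g} (hu : (ends v).1 ∈ S.fiber A J)
    (hw : (ends v).2 ∈ S.closedCell J) {b : Idx g} (hb : S.vpos (ends y) b < 0)
    (hb' : 0 < S.vpos (ends y) (b + 1)) {τ : ℝ} (hτ : Enters (S.T b • diskFlow τ y) S.F) :
    S.IsSectionPoint (S.T (S.ind A J) • diskFlow τ v) := by
  have hL : S.IsLower (tau k) (ends y) := by rw [hy, ends_smul']; exact hk.U_inv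
  have hpy : S.Reg (ends y) := by
    rw [hy, ends_smul']; exact hp.smul (S.Gam.inv_mem (S.U_mem k))
  have hv : diskFlow τ v = S.U k • diskFlow τ y := by rw [hy, diskFlow_smul, smul_inv_smul]
  have hTk : S.T k • diskFlow τ v = S.T (tau k - 1) • diskFlow τ y := by
    rw [hv, ← mul_smul, (smul_eq_of_disc (S.T_U_disc k)).2]
  obtain ⟨⟨n0, e1⟩, -⟩ := S.exit_arcs hpy.1 hb hb'
  have hbt : b = tau k - 1 ∨ b + 1 = tau k - 1 := (hL.exit hpy.1 hb hb').imp_left fun h => by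
    rw [← h]; ring
  -- Generator T_k: an entrance for exit side τ(k) − 1, and an upper corner for exit side τ(k) − 2.
  have center : S.IsSectionPoint (S.T k • diskFlow τ v) := by
    rw [hTk]
    rcases hbt with rfl | h
    · exact .inl hτ
    · have hc := S.chain (tau k)
      have hwl := hL.2
      have hul := hL.1
      rw [mem_arcIcc_base (S.P (tau k - 3)) (by linarith)] at hwl hul
      have hbP : b = tau k - 2 := by linear_combination h
      have e1' : (ends y).2 ∈ arcIcc (S.P (tau k - 2)) (S.Q (tau k - 1)) := by
        rw [← h, ← hbP]; exact e1.le
      rw [mem_arcIcc_base (S.P (tau k - 3)) (by linarith)] at e1'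
      refine isSectionPoint_upper (by rwa [ends_diskFlow]) ?_ ?_ ?_ ?_
      · rw [ends_diskFlow, mem_arcIcc_base (S.P (tau k - 3)) (by linarith)]
        exact ⟨hwl.1, e1'.2⟩
      · rw [ends_diskFlow, sub_add_cancel, show tau k - 1 - 1 = tau k - 2 by ring]
        exact (mem_arcIcc_base_wrap (S.P (tau k - 3)) (by linarith)).2 (.inl hul.1)
      · rwa [ends_diskFlow, ← h]
      · rwa [← h, add_sub_cancel_right]
  -- Generator T_{k+1} occurs only with `w` in [P_{k+1}, Q_{k+1}], which leaves τ(k) − 1 as the only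
  -- exit side.
  have side : (ends v).2 ∈ arcIcc (S.P (k + 1)) (S.Q (k + 1)) →
      S.IsSectionPoint (S.T (k + 1) • diskFlow τ v) := by
    intro hw'
    have hb2 : b = tau k - 1 := by
      refine hbt.resolve_right fun h => ?_
      have h1 := U_inv_corner_pos hw'
      have hc := S.chain (tau k)
      rw [mem_arcIcc_base (S.P (tau k - 3)) (by linarith)] at h1
      have e1' : (ends y).2 ∈ arcIco (S.P (tau k - 2)) (S.Q (tau k - 1)) := by
        rw [← h, show tau k - 2 = b by linear_combination -h]; exact e1
      rw [mem_arcIco_base (S.P (tau k - 3)) (by linarith), hy, ends_smul'] at e1'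
      exact h1.1.not_gt e1'.2
    have hvk : 0 < S.vpos (ends v) k :=
      lt_of_le_of_ne (not_lt.1 ((hk.meets_iff hp).not.1 hm)) (hp.vpos_ne k).symm
    have hc := S.chain k
    have hul := hk.1
    rw [mem_arcIcc_base (S.P (k - 3)) (by linarith)] at hul
    refine isSectionPoint_upper (by rwa [ends_diskFlow]) ?_ ?_ ?_ ?_
    · rwa [ends_diskFlow]
    · rw [ends_diskFlow, add_sub_cancel_right, add_assoc, one_add_one_eq_two]
      exact (mem_arcIcc_base_wrap (S.P (k - 3)) (by linarith)).2 (.inr hul.2)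
    · rw [ends_diskFlow]; exact hk.vpos_succ_pos hvk
    · rwa [add_sub_cancel_right, hTk, ← hb2]
  rcases arc_QQ_closedCell hk.2 hw with ⟨rfl, e⟩ | rfl | rfl | ⟨rfl, e⟩
  -- Here `w = Q k`, and the fiber forces `u = P (k - 1)`: the geodesic is the line of a side and
  -- not regular.
  · exfalso
    have hc := S.wrap k
    obtain ⟨c1, c2, c3⟩ := S.corner_chain A k
    rw [mem_fiber_false] at hu
    have h1 := hk.1
    rw [mem_arcIcc_base (S.P (k + 1)) (by linarith)] at h1
    have e' : (ends v).1 = S.P (k - 1) :=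
      ccw_injective (S.P (k + 1)) (le_antisymm (by linarith) h1.1)
    rw [show ends v = (S.P (k - 1), S.Q (k - 1 + 1)) from
      Prod.ext e' (by rw [e, sub_add_cancel])] at hp
    exact not_reg_P_Q _ hp
  · rw [ind_true]; exact center
  · rcases hA (k + 1) with h | h
    · rw [S.ind_false_P A h]; exact side hw
    · rw [S.ind_false_Q A h, add_sub_cancel_right]; exact center
  · rw [ind_true]
    exact side (by rw [e]; exact right_mem_arcIcc _ _)

/-- The mirror image: the true entrance is in the upper corner at τ(k), its exit side is τ(k) or
τ(k) + 1, and the comparison uses T_{k−1} U_k = T_{τ(k)}. -/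
theorem section_step_lower {v y : UnitTangent} {k : Idx g} (hy : y = (S.U k)⁻¹ • v)
    (hp : S.Reg (ends v)) (hm : ¬ Meets (ends v) S.F) (hk : S.IsLower k (ends v))
    (hA : S.IsExtremal A) {J : Cell g} (hu : (ends v).1 ∈ S.fiber A J)
    (hw : (ends v).2 ∈ S.closedCell J) {b : Idx g} (hb : S.vpos (ends y) b < 0)
    (hb' : 0 < S.vpos (ends y) (b + 1)) {τ : ℝ} (hτ : Enters (S.T b • diskFlow τ y) S.F) :
    S.IsSectionPoint (S.T (S.ind A J) • diskFlow τ v) := by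
  have hL : S.IsUpper (tau k) (ends y) := by rw [hy, ends_smul']; exact hk.U_inv
  have hpy : S.Reg (ends y) := by
    rw [hy, ends_smul']; exact hp.smul (S.Gam.inv_mem (S.U_mem k))
  have hv : diskFlow τ v = S.U k • diskFlow τ y := by rw [hy, diskFlow_smul, smul_inv_smul]
  have hTk : S.T (k - 1) • diskFlow τ v = S.T (tau k) • diskFlow τ y := by
    rw [hv, ← mul_smul, (smul_eq_of_disc (S.T_pred_U_disc k)).2]
  obtain ⟨⟨n0, e1⟩, -⟩ := S.exit_arcs hpy.1 hb hb'
  have hbt : b = tau k ∨ b = tau k + 1 := hL.exit hpy.1 hb hb'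
  have hct := S.chain (tau k)
  have center : S.IsSectionPoint (S.T (k - 1) • diskFlow τ v) := by
    rw [hTk]
    rcases hbt with rfl | h
    · exact .inl hτ
    · have hwl := hL.2
      have hul := hL.1
      rw [mem_arcIcc_base (S.P (tau k - 3)) (by linarith)] at hwl hul
      have e1' : (ends y).2 ∈ arcIcc (S.P (tau k + 1)) (S.Q (tau k + 2)) := by
        rw [show tau k + 2 = b + 1 by rw [h]; ring, ← h]; exact e1.le
      rw [mem_arcIcc_base (S.P (tau k - 3)) (by linarith)] at e1'
      refine isSectionPoint_lower (by rwa [ends_diskFlow]) ?_ ?_ ?_ ?_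
      · rw [ends_diskFlow, mem_arcIcc_base (S.P (tau k - 3)) (by linarith)]
        exact ⟨e1'.1, hwl.2⟩
      · rw [ends_diskFlow]
        exact (mem_arcIcc_base_wrap (S.P (tau k - 3)) (by linarith)).2 (.inr hul.2)
      · rwa [ends_diskFlow, ← h]
      · rwa [← h]
  have side : (ends v).2 ∈ arcIcc (S.P (k - 1)) (S.Q (k - 1)) →
      S.IsSectionPoint (S.T (k - 2) • diskFlow τ v) := by
    intro hw'
    have hb2 : b = tau k := by
      refine hbt.resolve_right fun h => ?_
      have h1 := U_inv_corner_neg hw'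
      rw [mem_arcIcc_base (S.P (tau k - 3)) (by linarith)] at h1
      have e1' : (ends y).2 ∈ arcIcc (S.P (tau k + 1)) (S.Q (tau k + 2)) := by
        rw [show tau k + 2 = b + 1 by rw [h]; ring, ← h]; exact e1.le
      rw [mem_arcIcc_base (S.P (tau k - 3)) (by linarith)] at e1'
      refine n0 (ccw_injective (S.P (tau k - 3)) (le_antisymm ?_ ?_))
      · rw [h]; exact e1'.1
      · rw [h, hy, ends_smul']; exact h1.2
    have hvk : S.vpos (ends v) k < 0 :=
      lt_of_le_of_ne (not_lt.1 ((hk.meets_iff hp).not.1 hm)) (hp.vpos_ne k)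
    have hc := S.chain k
    have hul := hk.1
    rw [mem_arcIcc_base (S.P (k - 3)) (by linarith)] at hul
    have e : k - 2 + 1 = k - 1 := by ring
    refine isSectionPoint_lower (by rwa [ends_diskFlow]) ?_ ?_ ?_ ?_
    · rwa [ends_diskFlow, e]
    · rw [ends_diskFlow, sub_add_cancel]
      exact (mem_arcIcc_base_wrap (S.P (k - 3)) (by linarith)).2 (.inl hul.1)
    · rw [ends_diskFlow, e]; exact hk.vpos_pred_neg hvk
    · rwa [e, hTk, ← hb2]
  rcases arc_PP_closedCell hk.2 hw with ⟨rfl, e⟩ | rfl | rfl | ⟨rfl, e⟩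
  · exfalso
    have hc := S.wrap k
    obtain ⟨c1, c2, c3⟩ := S.corner_chain A k
    rw [mem_fiber_false] at hu
    have h1 := hk.1
    rw [mem_arcIcc_base_wrap (S.P (k + 1)) (by linarith)] at h1
    have e' : (ends v).1 = S.Q (k + 1) := ccw_injective (S.P (k + 1))
      (le_antisymm (h1.resolve_left fun h => by linarith) (by linarith))
    rw [show ends v = (S.Q (k + 1), S.P k) from Prod.ext e' e] at hp
    exact not_reg_Q_P _ hp
  · rw [ind_true]; exact center
  · rcases hA (k - 1) with h | h
    · rw [S.ind_false_P A h]; exact center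
    · rw [S.ind_false_Q A h, show k - 1 - 1 = k - 2 by ring]; exact side hw
  · rw [ind_true]
    exact side (by rw [e]; exact left_mem_arcIcc _ _)

/-- The geodesic flow takes a section point to the section point of the image, and there is no
entrance into a polygon in between. -/
theorem section_step (hA : S.IsExtremal A) {v : UnitTangent} (hp : S.Reg (ends v))
    (hv : S.IsSectionPoint v) {J : Cell g} (hu : (ends v).1 ∈ S.fiber A J)
    (hw : (ends v).2 ∈ S.closedCell J) :
    ∃ τ > 0, S.IsSectionPoint (S.T (S.ind A J) • diskFlow τ v) ∧
      ∀ t, 0 < t → t < τ → ∀ γ ∈ S.Gam, ¬ Enters (γ • diskFlow t v) S.F := by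
  -- The time step is measured at the true entrance `γ • v`, where `γ` is the identity or some
  -- (U_k)⁻¹.
  have key : ∀ γ ∈ S.Gam, Enters (γ • v) S.F →
      (∀ b τ, S.vpos (ends (γ • v)) b < 0 → 0 < S.vpos (ends (γ • v)) (b + 1) →
        Enters (S.T b • diskFlow τ (γ • v)) S.F →
          S.IsSectionPoint (S.T (S.ind A J) • diskFlow τ v)) →
      ∃ τ > 0, S.IsSectionPoint (S.T (S.ind A J) • diskFlow τ v) ∧
        ∀ t, 0 < t → t < τ → ∀ γ ∈ S.Gam, ¬ Enters (γ • diskFlow t v) S.F := by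
    intro γ hγ hE h
    have hp' : S.Reg (ends (γ • v)) := by rw [ends_smul']; exact hp.smul hγ
    obtain ⟨-, b, -, -, hb, hb'⟩ := S.exists_sides_of_enters hp' hE
    obtain ⟨τ, hτ, h1, h2⟩ := S.exists_cross hp' hE hb hb'
    refine ⟨τ, hτ, h b τ hb hb' h1, fun t h3 h4 δ hδ h5 => ?_⟩
    refine S.not_enters_between hp' h2 h3 h4 (S.Gam.mul_mem hδ (S.Gam.inv_mem hγ)) ?_
    rwa [diskFlow_smul, mul_smul, inv_smul_smul]
  rcases isSectionPoint_iff.1 hv with h | ⟨hm, k, hk, h⟩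
  · refine key 1 S.Gam.one_mem (by rwa [one_smul]) fun b τ h1 h2 h3 => ?_
    rw [one_smul] at h1 h2 h3
    exact section_step_center hp hA hu hw h1 h2 h3
  · refine key _ (S.Gam.inv_mem (S.U_mem k)) h fun b τ h1 h2 h3 => ?_
    rcases hk with hk | hk
    · exact section_step_upper rfl hp hm hk hA hu hw h1 h2 h3
    · exact section_step_lower rfl hp hm hk hA hu hw h1 h2 h3

end Surface
end GeodesicCoding

/-! ### Limits of rays, images of bounded sets, and expansivity -/

namespace GeodesicCoding

theorem exists_between_not_mem {b a a' : Circle} (h : ccw b a < ccw b a') {C : Set Circle}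
    (hC : C.Countable) : ∃ c ∉ C, ccw b a < ccw b c ∧ ccw b c < ccw b a' := by
  have hs : (Set.Ioo (ccw b a) (ccw b a') ∩ {t | b * Circle.exp t ∈ C}).Countable := by
    refine Set.MapsTo.countable_of_injOn (f := fun t => b * Circle.exp t) (t := C)
      (fun t ht => ht.2) (fun s hs t ht e => ?_) hC
    have h1 := ccw_mul_exp b ((ccw_nonneg b a).trans hs.1.1.le) (hs.1.2.trans (ccw_lt_two_pi b a'))
    have h2 := ccw_mul_exp b ((ccw_nonneg b a).trans ht.1.1.le) (ht.1.2.trans (ccw_lt_two_pi b a'))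
    simp only at e
    rw [← h1, e, h2]
  obtain ⟨t, ht, hn⟩ := (hs.dense_compl ℝ).exists_mem_open isOpen_Ioo (Set.nonempty_Ioo.2 h)
  have h1 := ccw_mul_exp b ((ccw_nonneg b a).trans hn.1.le) (hn.2.trans (ccw_lt_two_pi b a'))
  exact ⟨b * Circle.exp t, fun hc => ht ⟨hn, hc⟩, by rw [h1]; exact hn.1, by rw [h1]; exact hn.2⟩

theorem tendsto_tanh_atTop : Filter.Tendsto Real.tanh Filter.atTop (𝓝 1) := by
  have e : ∀ x, Real.tanh x = 1 - 2 / (Real.exp (2 * x) + 1) := fun x => by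
    have h1 := Real.exp_pos x
    rw [Real.tanh_eq, two_mul, Real.exp_add, Real.exp_neg]
    field_simp
    ring
  simp only [funext e]
  have h : Filter.Tendsto (fun x : ℝ => Real.exp (2 * x) + 1) Filter.atTop Filter.atTop :=
    Filter.tendsto_atTop_add_const_right _ _ (Real.tendsto_exp_atTop.comp
      (Filter.tendsto_id.const_mul_atTop two_pos))
  simpa using (h.const_div_atTop 2).const_sub 1

theorem tendsto_diskFlow_base (v : UnitTangent) :
    Filter.Tendsto (fun t => ((diskFlow t v).base : ℂ)) Filter.atTop (𝓝 ((ends v).2 : ℂ)) := by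
  have h1 : Filter.Tendsto (fun t : ℝ => ((Real.tanh (t / 2) : ℝ) : ℂ)) Filter.atTop
      (𝓝 ((1 : ℝ) : ℂ)) := (continuous_ofReal.tendsto _).comp
    (tendsto_tanh_atTop.comp (Filter.tendsto_id.atTop_div_const two_pos))
  have h2 := ((h1.const_mul (v.dir : ℂ)).const_add (v.base : ℂ)).div
    ((h1.const_mul (conj (v.base : ℂ) * v.dir)).const_add 1)
    (den_flow_ne_zero v.base v.dir (s := 1) (by simp))
  change Filter.Tendsto _ _ (𝓝 ((endpoint v.base v.dir : Circle) : ℂ))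
  rw [endpoint_coe]
  rw [ofReal_one, mul_one, mul_one] at h2
  exact h2

theorem tendsto_diskFlow_base_neg (v : UnitTangent) :
    Filter.Tendsto (fun t => ((diskFlow (-t) v).base : ℂ)) Filter.atTop (𝓝 ((ends v).1 : ℂ)) := by
  have h := tendsto_diskFlow_base ⟨v.base, -v.dir⟩
  refine h.congr fun t => ?_
  change ((v.base : ℂ) + ((-v.dir : Circle) : ℂ) * (Real.tanh (t / 2) : ℝ)) /
      (1 + conj (v.base : ℂ) * ((-v.dir : Circle) : ℂ) * (Real.tanh (t / 2) : ℝ)) =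
    ((v.base : ℂ) + v.dir * (Real.tanh (-t / 2) : ℝ)) /
      (1 + conj (v.base : ℂ) * v.dir * (Real.tanh (-t / 2) : ℝ))
  rw [neg_div, Real.tanh_neg, Circle.coe_neg]
  push_cast
  ring_nf

/-- Since Bx − By = (x − y)/(den x · den y) and |den x|² = (1 − |x|²)/(1 − |Bx|²), images of a
bounded set shrink in the Euclidean metric as they approach the circle. -/
theorem norm_smul_sub_smul_le (B : SU11) {r : ℝ} (hr : r < 1) {x y : UnitDisc} (hx : ‖(x : ℂ)‖ ≤ r)
    (hy : ‖(y : ℂ)‖ ≤ r) : ‖((B • x : UnitDisc) : ℂ) - (B • y : UnitDisc)‖ ≤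
      4 / ((1 - r) * (1 - r ^ 2)) * (1 - normSq ((B • x : UnitDisc) : ℂ)) := by
  have hr0 : 0 ≤ r := (norm_nonneg _).trans hx
  have hq : 0 < 1 - r ^ 2 := by nlinarith
  have hr1 := sub_pos.2 hr
  have dx := mob_den_ne_zero B x.norm_lt_one.le
  have dy := mob_den_ne_zero B y.norm_lt_one.le
  have e : ((B • x : UnitDisc) : ℂ) - (B • y : UnitDisc) = (x - y) / (mden B x * mden B y) := by
    have h := B.1.det_coe
    rw [Matrix.det_fin_two, B.2.1, B.2.2] at h
    rw [mob_coe_smul_disc, mob_coe_smul_disc, div_sub_div _ _ dx dy]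
    congr 1
    rw [mnum, mnum, mden, mden, coefA, coefB]
    linear_combination ((x : ℂ) - y) * h
  have hdx : ‖mden B x‖ ≤ 2 * ‖coefA B‖ := by
    have h6 := norm_add_le (conj (coefB B) * (x : ℂ)) (conj (coefA B))
    rw [norm_mul, RCLike.norm_conj, RCLike.norm_conj] at h6
    have := mul_le_mul (norm_coefB_le B) x.norm_lt_one.le (norm_nonneg _) (norm_nonneg _)
    rw [mden]
    linarith
  have hdy : ‖coefA B‖ * (1 - r) ≤ ‖mden B y‖ := by
    have e : conj (coefA B) = mden B y - conj (coefB B) * y := by rw [mden]; ring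
    have h6 := norm_sub_le (mden B y) (conj (coefB B) * y)
    rw [← e, norm_mul, RCLike.norm_conj, RCLike.norm_conj] at h6
    have := mul_le_mul (norm_coefB_le B) hy (norm_nonneg _) (norm_nonneg _)
    linarith
  have hxy : ‖(x : ℂ) - y‖ ≤ 2 := (norm_sub_le _ _).trans (by linarith [x.norm_lt_one, y.norm_lt_one])
  have h := normSq_mden_smul B x
  have hB := (B • x).normSq_lt_one
  have hx2 : normSq (x : ℂ) ≤ r ^ 2 := by
    rw [normSq_eq_norm_sq]; exact pow_le_pow_left₀ (norm_nonneg _) hx 2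
  rw [normSq_eq_norm_sq (mden B x)] at h
  have px := norm_pos_iff.2 dx
  have py := norm_pos_iff.2 dy
  rw [e, norm_div, norm_mul, div_mul_eq_mul_div, div_le_div_iff₀ (by positivity) (by positivity)]
  set D := ‖mden B x‖
  set D' := ‖mden B y‖
  set N := 1 - normSq ((B • x : UnitDisc) : ℂ)
  have hN : 0 < N := sub_pos.2 hB
  have h7 : D * (1 - r) ≤ 2 * D' := by nlinarith
  calc ‖(x : ℂ) - y‖ * ((1 - r) * (1 - r ^ 2)) ≤ 2 * ((1 - r) * (D ^ 2 * N)) := by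
        rw [h]; gcongr
    _ = 2 * N * D * (D * (1 - r)) := by ring
    _ ≤ 2 * N * D * (2 * D') := by gcongr
    _ = 4 * N * (D * D') := by ring

/-- Images of bounded points under elements that take far points of a geodesic ray to bounded
points converge to the end of the ray. -/
theorem tendsto_inv_smul {z : ℕ → UnitDisc} {ξ : Circle}
    (hz : Filter.Tendsto (fun n => (z n : ℂ)) Filter.atTop (𝓝 (ξ : ℂ))) {B : ℕ → SU11} {r : ℝ}
    (hr : r < 1) (h1 : ∀ n, ‖((B n • z n : UnitDisc) : ℂ)‖ ≤ r) {y : ℕ → UnitDisc}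
    (h2 : ∀ n, ‖(y n : ℂ)‖ ≤ r) :
    Filter.Tendsto (fun n => (((B n)⁻¹ • y n : UnitDisc) : ℂ)) Filter.atTop (𝓝 (ξ : ℂ)) := by
  have h3 : Filter.Tendsto (fun n => 4 / ((1 - r) * (1 - r ^ 2)) * (1 - normSq (z n : ℂ)))
      Filter.atTop (𝓝 0) := by
    have := ((continuous_normSq.tendsto _).comp hz)
    rw [Circle.normSq_coe] at this
    simpa using (this.const_sub 1).const_mul (4 / ((1 - r) * (1 - r ^ 2)))
  have h4 : Filter.Tendsto (fun n => (z n : ℂ) - ((B n)⁻¹ • y n : UnitDisc)) Filter.atTop (𝓝 0) := by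
    refine squeeze_zero_norm (fun n => ?_) h3
    have := norm_smul_sub_smul_le (B n)⁻¹ hr (h1 n) (h2 n)
    rwa [inv_smul_smul] at this
  simpa using hz.sub h4

theorem sidePos_limit {a b : Circle} {z : ℕ → UnitDisc} {ξ : Circle}
    (hz : Filter.Tendsto (fun n => (z n : ℂ)) Filter.atTop (𝓝 (ξ : ℂ)))
    (h : ∀ n, 0 ≤ sidePos a b (z n)) : 0 ≤ det3 (cvec a) (cvec b) (cvec ξ) := by
  have hc : Continuous fun x : ℂ => (conj ((b : ℂ) - a) * (2 * x - (1 + normSq x) * a)).im := by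
    have := continuous_normSq
    fun_prop
  have h1 := ge_of_tendsto' ((hc.tendsto _).comp hz) h
  rw [Circle.normSq_coe] at h1
  have : (conj ((b : ℂ) - a) * (2 * (ξ : ℂ) - (1 + (1 : ℝ)) * a)).im
      = 2 * det3 (cvec a) (cvec b) (cvec ξ) := by
    simp [det3, cvec]
    ring
  linarith

namespace Surface

variable {g : ℕ} [hg : Fact (2 ≤ g)] {S : Surface g} {A : Idx g → Circle}

/-! ### Expansivity -/

/-- The image of [P_i, Q_{i+1}] is [Q_{σ(i)+1}, P_{σ(i)}]. Excluding j = σ(i) ensures that [P_j,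
Q_{j+1}] does not wrap around P_{σ(i)+1}, so the order of the three points survives the change of
base. -/
theorem T_between {i j : Idx g} (hij : j ≠ sig i) {a c a' : Circle}
    (h1 : ccw (S.P i) a < ccw (S.P i) c) (h2 : ccw (S.P i) c < ccw (S.P i) a')
    (ha' : a' ∈ arcIcc (S.P i) (S.Q (i + 1)))
    (hj : S.T i • a ∈ arcIcc (S.P j) (S.Q (j + 1))) (hj' : S.T i • a' ∈ arcIcc (S.P j) (S.Q (j + 1))) :
    ccw (S.P j) (S.T i • a) < ccw (S.P j) (S.T i • c) ∧
      ccw (S.P j) (S.T i • c) < ccw (S.P j) (S.T i • a') := by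
  have k1 := (ccw_smul_lt_iff (S.T i)).2 h1
  have k2 := (ccw_smul_lt_iff (S.T i)).2 h2
  have k3 := (smul_mem_arcIcc (S.T i)).2 ha'
  rw [mem_arcIcc] at k3
  rw [S.T_Q_succ] at k3
  rw [S.T_P] at k1 k2 k3
  set b := sig i + 1 with hb
  obtain ⟨d, hd, rfl⟩ := exists_offset b j
  have hn := twelve_le g
  have hd' : d + 1 < 8 * g - 4 := by
    rcases lt_or_eq_of_le (Nat.succ_le_of_lt hd) with h | h
    · exact h
    · exact absurd (by rw [cast_eq_one_sub h, hb]; ring) hij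
  have hw := S.wrap (sig i)
  rw [← hb] at hw
  have e : ∀ x, ccw (S.Q b) x ≤ ccw (S.Q b) (S.P (sig i)) →
      ccw (S.P b) x = ccw (S.Q b) x + ccw (S.P b) (S.Q b) := by
    intro x hx
    have : x ∈ arcIcc (S.Q b) (S.P (sig i)) := hx
    rw [mem_arcIcc_base (S.P b) (by linarith)] at this
    linarith [ccw_of_le (c := S.P b) (a := S.Q b) (x := x) this.1]
  have e1 := e (S.T i • a) (by linarith)
  have e2 := e (S.T i • c) (by linarith)
  have e3 := e (S.T i • a') k3
  have hle : ccw (S.P b) (S.P (b + d)) ≤ ccw (S.P b) (S.Q (b + d + 1)) := by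
    have h3 := S.ccw_P_lt_Q b hd
    have h4 := S.ccw_Q_lt_P b hd'
    have h5 := S.ccw_P_lt_Q b hd'
    rw [show b + d + 1 = b + ((d + 1 : ℕ) : Idx g) by push_cast; ring]
    linarith
  rw [mem_arcIcc_base (S.P b) hle] at hj hj'
  rw [ccw_of_le (c := S.P b) (a := S.P (b + d)) (x := S.T i • a) hj.1,
    ccw_of_le (c := S.P b) (a := S.P (b + d)) (x := S.T i • c) (by linarith),
    ccw_of_le (c := S.P b) (a := S.P (b + d)) (x := S.T i • a') hj'.1]
  constructor <;> linarith

/-- The partial products of the side pairings along an itinerary. -/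
def word (S : Surface g) (m : ℕ → Idx g) : ℕ → SU11
  | 0 => 1
  | n + 1 => S.T (m n) * S.word m n

theorem word_zero (m : ℕ → Idx g) : S.word m 0 = 1 := rfl

theorem word_succ (m : ℕ → Idx g) (n : ℕ) : S.word m (n + 1) = S.T (m n) * S.word m n := rfl

theorem word_mem (m : ℕ → Idx g) (n : ℕ) : S.word m n ∈ S.Gam := by
  induction n with
  | zero => exact S.Gam.one_mem
  | succ n ih => exact S.Gam.mul_mem (S.T_mem _) ih

theorem between_word {m : ℕ → Idx g} (hm : ∀ n, m (n + 1) ≠ sig (m n)) {a c a' : Circle}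
    (ha : ∀ n, S.word m n • a ∈ arcIcc (S.P (m n)) (S.Q (m n + 1)))
    (ha' : ∀ n, S.word m n • a' ∈ arcIcc (S.P (m n)) (S.Q (m n + 1)))
    (h1 : ccw (S.P (m 0)) a < ccw (S.P (m 0)) c) (h2 : ccw (S.P (m 0)) c < ccw (S.P (m 0)) a')
    (n : ℕ) :
    ccw (S.P (m n)) (S.word m n • a) < ccw (S.P (m n)) (S.word m n • c) ∧
      ccw (S.P (m n)) (S.word m n • c) < ccw (S.P (m n)) (S.word m n • a') := by
  induction n with
  | zero => simpa [word] using ⟨h1, h2⟩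
  | succ n ih =>
    have k1 := ha (n + 1)
    have k2 := ha' (n + 1)
    simp only [word, mul_smul] at k1 k2 ⊢
    exact T_between (hm n) ih.1 ih.2 (ha' n) k1 k2

/-- Two points whose orbits follow the same itinerary cannot be separated by the end of a
geodesic ray whose images along the itinerary stay close to the polygon. -/
theorem false_of_between {m : ℕ → Idx g} (hm : ∀ n, m (n + 1) ≠ sig (m n)) {a c a' : Circle}
    (ha : ∀ n, S.word m n • a ∈ arcIcc (S.P (m n)) (S.Q (m n + 1)))
    (ha' : ∀ n, S.word m n • a' ∈ arcIcc (S.P (m n)) (S.Q (m n + 1)))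
    (h1 : ccw (S.P (m 0)) a < ccw (S.P (m 0)) c) (h2 : ccw (S.P (m 0)) c < ccw (S.P (m 0)) a')
    {z : ℕ → UnitDisc} (hz : Filter.Tendsto (fun n => (z n : ℂ)) Filter.atTop (𝓝 (c : ℂ)))
    (hF : ∀ n, S.word m n • z n ∈ S.F ∨ ∃ k, (S.U k)⁻¹ • S.word m n • z n ∈ S.F) : False := by
  obtain ⟨r, hr, hb⟩ := S.exists_norm_le_of_mem_F
  obtain ⟨q, hq, hq'⟩ : ∃ q < 1, ∀ k j, ‖(((S.U k)⁻¹ • S.V j : UnitDisc) : ℂ)‖ ≤ q := by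
    have hfin : (Set.range fun x : Idx g × Idx g =>
      ‖(((S.U x.1)⁻¹ • S.V x.2 : UnitDisc) : ℂ)‖).Finite := Set.finite_range _
    obtain ⟨y, ⟨x, rfl⟩, hy⟩ := Set.exists_max_image _ id hfin ⟨_, ⟨(0, 0), rfl⟩⟩
    exact ⟨_, UnitDisc.norm_lt_one _, fun k j => hy _ ⟨(k, j), rfl⟩⟩
  have hV : ∀ j, ‖(S.V j : ℂ)‖ ≤ max r q := fun j => (hb _ fun k => by
    have := S.line_V_nonneg j k
    rwa [line, ← sidePos_eq] at this).trans (le_max_left _ _)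
  -- Up to some U_k, the word brings both `z n` and the pulled-back vertex into one fixed smaller
  -- disk, so the pulled-back vertices have the same limit as `z n`.
  have hsel : ∀ n, ∃ B : SU11, ‖((B • z n : UnitDisc) : ℂ)‖ ≤ max r q ∧
      ∃ y : UnitDisc, ‖(y : ℂ)‖ ≤ max r q ∧ B⁻¹ • y = (S.word m n)⁻¹ • S.V (m n + 2) := by
    intro n
    rcases hF n with h | ⟨k, h⟩
    · exact ⟨S.word m n, (hb _ h).trans (le_max_left _ _), _, hV _, rfl⟩
    · refine ⟨(S.U k)⁻¹ * S.word m n, ?_, (S.U k)⁻¹ • S.V (m n + 2),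
        (hq' _ _).trans (le_max_right _ _), ?_⟩
      · rw [mul_smul]; exact (hb _ h).trans (le_max_left _ _)
      · rw [mul_inv_rev, mul_smul, inv_inv, smul_inv_smul]
  choose B hB y hy hBy using hsel
  have hlim := tendsto_inv_smul hz (max_lt hr hq) hB hy
  simp only [hBy] at hlim
  -- The line through P_{m_n+2} and Q_{m_n+3} carries the vertex V_{m_n+2} and lies beyond the arc
  -- [P_{m_n}, Q_{m_n+1}] that contains both images, so the vertex is never on the right. The point
  -- `c`, between `a` and `a'`, is strictly on the right.
  have hpos : ∀ n, 0 ≤ sidePos a a' ((S.word m n)⁻¹ • S.V (m n + 2)) := by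
    intro n
    rw [← not_lt, ← sidePos_smul_neg_iff (S.word m n), smul_inv_smul, not_lt]
    obtain ⟨k1, k2⟩ := between_word hm ha ha' h1 h2 n
    have k3 := ha n
    have k4 := ha' n
    have hc := S.chain (m n)
    have hoff : ccw (S.P (m n - 3)) (S.P (m n)) ≤ ccw (S.P (m n - 3)) (S.Q (m n + 1)) := by linarith
    have k3' := (mem_arcIcc_base (S.P (m n - 3)) hoff).1 k3
    have k4' := (mem_arcIcc_base (S.P (m n - 3)) hoff).1 k4
    have e1 := ccw_of_le (c := S.P (m n - 3)) (a := S.P (m n)) (x := S.word m n • a) k3'.1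
    have e2 := ccw_of_le (c := S.P (m n - 3)) (a := S.P (m n)) (x := S.word m n • a') k4'.1
    refine S.vpos_nonneg (p := (S.word m n • a, S.word m n • a')) ?_ ?_
    · exact (mem_arcIcc_base_wrap (S.P (m n - 3)) (by simp only; linarith)).2
        (.inl (by simp only; linarith))
    · rw [show m n + 2 + 1 = m n + 3 by ring]
      exact (mem_arcIcc_base_wrap (S.P (m n - 3)) (by simp only; linarith)).2
        (.inl (by simp only; linarith))
  have h3 := sidePos_limit hlim hpos
  have h5 : det3 (cvec a) (cvec a') (cvec c) < 0 := by
    have hac : ccw (S.P (m 0)) a ≤ ccw (S.P (m 0)) c := h1.le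
    refine det3_cvec_neg_iff.2 ⟨fun e => by rw [e] at h1; exact lt_irrefl _ h1, ?_⟩
    rw [ccw_of_le (c := S.P (m 0)) (a := a) (x := c) hac,
      ccw_of_le (c := S.P (m 0)) (a := a) (x := a') (by linarith)]
    linarith
  linarith

end Surface
end GeodesicCoding

/-! ### Itineraries and the orbits of section points -/

namespace GeodesicCoding

theorem exists_seq_of_step {α : Type*} {p : ℕ → α → Prop} {r : ℕ → α → α → Prop} {a : α}
    (h0 : p 0 a) (step : ∀ n a, p n a → ∃ b, p (n + 1) b ∧ r n a b) :
    ∃ f : ℕ → α, f 0 = a ∧ ∀ n, p n (f n) ∧ r n (f n) (f (n + 1)) := by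
  choose! F hF hR using step
  let f : ℕ → α := fun n => Nat.rec a (fun n x => F n x) n
  have hf : ∀ n, p n (f n) := fun n => by
    induction n with
    | zero => exact h0
    | succ n ih => exact hF n _ ih
  exact ⟨f, rfl, fun n => ⟨hf n, hR n _ (hf n)⟩⟩

namespace Surface

variable {g : ℕ} [hg : Fact (2 ≤ g)] {S : Surface g} {A : Idx g → Circle}

theorem T_sig_T_tangent (i : Idx g) (v : UnitTangent) : S.T (sig i) • S.T i • v = v := by
  rw [← mul_smul]
  exact tangent_smul_eq_of_trivial (fun z => by rw [mul_smul, S.pairing]) v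

theorem extremal_mem (hA : S.IsExtremal A) (i : Idx g) : A i ∈ arcIcc (S.P i) (S.Q i) := by
  rcases hA i with h | h <;> rw [h]
  · exact left_mem_arcIcc _ _
  · exact right_mem_arcIcc _ _

/-- The arcs between consecutive marked points, seen from `P i`. -/
theorem arc_base {B : Idx g → Circle} (hB : ∀ i, B i ∈ arcIcc (S.P i) (S.Q i)) (i : Idx g) :
    ccw (S.P i) (B i) < ccw (S.P i) (B (i + 1)) ∧
      ccw (S.P i) (S.P (i + 1)) ≤ ccw (S.P i) (B (i + 1)) ∧
      ccw (S.P i) (B (i + 1)) ≤ ccw (S.P i) (S.Q (i + 1)) := by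
  have hc := S.chain i
  have h1 := hB i
  have h2 := hB (i + 1)
  rw [mem_arcIcc_base (S.P (i - 3)) (by linarith)] at h1 h2
  rw [ccw_of_le (c := S.P (i - 3)) (a := S.P i) (x := B i) h1.1,
    ccw_of_le (c := S.P (i - 3)) (a := S.P i) (x := B (i + 1)) (by linarith),
    ccw_of_le (c := S.P (i - 3)) (a := S.P i) (x := S.P (i + 1)) (by linarith),
    ccw_of_le (c := S.P (i - 3)) (a := S.P i) (x := S.Q (i + 1)) (by linarith)]
  exact ⟨by linarith, by linarith, by linarith⟩

theorem mem_arc_iff {B : Idx g → Circle} (hB : ∀ i, B i ∈ arcIcc (S.P i) (S.Q i)) {i : Idx g}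
    {x : Circle} : x ∈ arcIcc (B i) (B (i + 1)) ↔
      ccw (S.P i) (B i) ≤ ccw (S.P i) x ∧ ccw (S.P i) x ≤ ccw (S.P i) (B (i + 1)) :=
  mem_arcIcc_base _ (arc_base hB i).1.le

theorem arc_subset {B : Idx g → Circle} (hB : ∀ i, B i ∈ arcIcc (S.P i) (S.Q i)) {i : Idx g}
    {x : Circle} (h : x ∈ arcIcc (B i) (B (i + 1))) : x ∈ arcIcc (S.P i) (S.Q (i + 1)) :=
  ((mem_arc_iff hB).1 h).2.trans (arc_base hB i).2.2

theorem closedCell_subset (hA : S.IsExtremal A) {J : Cell g} {x : Circle}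
    (h : x ∈ S.closedCell J) : x ∈ arcIcc (A (S.ind A J)) (A (S.ind A J + 1)) := by
  rcases S.mem_closedCell h with h | h
  · exact arcIco_subset_arcIcc _ _ ((S.mem_arcIco_iff_ind hA h _).2 rfl)
  · obtain ⟨i, t⟩ := J
    cases t
    · obtain rfl : x = S.Q i := h
      rcases hA i with h | h
      · rw [S.ind_false_P A h, mem_arc_iff (extremal_mem hA)]
        have h1 := arc_base (extremal_mem hA) i
        have hc := S.ccw_P_lt_Q i (d := 0) (by have := twelve_le g; omega)
        have hc' := S.ccw_Q_lt_P i (d := 0) (by have := twelve_le g; omega)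
        simp only [Nat.cast_zero, add_zero, zero_add, Nat.cast_one] at hc hc'
        rw [h, ccw_self]
        exact ⟨ccw_nonneg _ _, by linarith⟩
      · rw [S.ind_false_Q A h, sub_add_cancel, h]
        exact right_mem_arcIcc _ _
    · obtain rfl : x = S.P (i + 1) := h
      rw [ind_true, mem_arc_iff (extremal_mem hA)]
      have h1 := arc_base (extremal_mem hA) i
      have hc := S.ccw_P_lt_Q i (d := 0) (by have := twelve_le g; omega)
      have hc' := S.ccw_Q_lt_P i (d := 0) (by have := twelve_le g; omega)
      simp only [Nat.cast_zero, add_zero, zero_add, Nat.cast_one] at hc hc'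
      have h2 : ccw (S.P i) (A i) ≤ ccw (S.P i) (S.Q i) := extremal_mem hA i
      exact ⟨by linarith, h1.2.1⟩

/-- Whatever the cell, its fiber lands in the single tile indexed by the code letter. Thus the code
also records the backward itinerary of the beginning `u`. -/
theorem fiber_image (hA : S.IsExtremal A) {J : Cell g} {u : Circle} (h : u ∈ S.fiber A J) :
    S.T (S.ind A J) • u ∈
      arcIcc (S.cornerL A (sig (S.ind A J))) (S.cornerL A (sig (S.ind A J) + 1)) := by
  have key : ∀ m, ccw (S.P m) (S.cornerL A m) ≤ ccw (S.P m) (S.Q m) ∧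
      ccw (S.P m) (S.Q m) ≤ ccw (S.P m) (S.P (m + 1)) := fun m => by
    have h := S.chain_sig (sig m)
    rw [sig_sig] at h
    exact ⟨S.cornerL_mem A m, h.le⟩
  obtain ⟨i, t⟩ := J
  cases t
  · rcases hA i with h' | h'
    · rw [S.ind_false_P A h']
      rw [T_fiber_false] at h
      obtain ⟨k1, k2⟩ := key (sig i)
      have k3 := S.cornerR_mem A (sig i)
      have k4 := arc_base (S.cornerL_mem A) (sig i)
      rw [mem_arcIcc_base (S.P (sig i)) k2] at k3
      rw [mem_arcIcc_base (S.P (sig i)) (by linarith)] at h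
      rw [mem_arc_iff (S.cornerL_mem A)]
      exact ⟨h.1, by linarith⟩
    · rw [S.ind_false_Q A h']
      have h2 := (S.T_fiber_false_succ A (i := i - 1) (by rwa [sub_add_cancel]) u).1
        (by rwa [sub_add_cancel])
      obtain ⟨k1, k2⟩ := key (sig (i - 1))
      have k3 := S.H_mem A (sig (i - 1))
      have k4 := arc_base (S.cornerL_mem A) (sig (i - 1))
      have k5 := S.H_le_L A hA (sig (i - 1))
      have k6 := arc_base (B := S.Q) (fun i => right_mem_arcIcc _ _) (sig (i - 1))
      rw [mem_arcIcc_base (S.P (sig (i - 1))) k6.1.le] at k3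
      rw [mem_arcIcc_base (S.P (sig (i - 1))) k5] at h2
      rw [mem_arc_iff (S.cornerL_mem A)]
      exact ⟨by linarith, h2.2⟩
  · rw [ind_true, ← T_fiber_true]; exact h

/-- No backtracking: otherwise a point of [A_{σ(i)}, A_{σ(i)+1}) would have its preimage under T_i
in [A_i, A_{i+1}), while T_{σ(i)} moves it off the larger arc [P_i, Q_{i+1}). -/
theorem Trans.ind_ne (hA : S.IsExtremal A) {J J' : Cell g} (h : S.Trans A J J') :
    S.ind A J' ≠ sig (S.ind A J) := by
  intro e
  obtain ⟨x, hx⟩ : ∃ x, x ∈ S.cell J' := by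
    obtain ⟨i, t⟩ := J'
    cases t
    · exact ⟨_, S.P_mem_cell i⟩
    · exact ⟨_, S.Q_mem_cell i⟩
  set i := S.ind A J with hi
  have h1 := h.2 (S.T (sig i) • x) (by rwa [S.T_T_sig])
  have h2 := (S.mem_arcIco_iff_ind hA h1 _).2 rfl
  have h3 := (S.mem_arcIco_iff_ind hA hx _).2 rfl
  rw [e] at h3
  rw [← hi] at h2
  have k := arc_base (extremal_mem hA)
  rw [mem_arcIco_base _ (k _).1.le] at h2 h3
  have h4 : x ∈ arcIco (S.P (sig i)) (S.Q (sig i + 1)) := h3.2.trans_le (k _).2.2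
  rw [← smul_mem_arcIco (S.T (sig i)), S.T_P, S.T_Q_succ, sig_sig] at h4
  have k6 := arc_base (B := S.Q) (fun i => right_mem_arcIcc _ _) i
  have k7 : S.P i ≠ S.Q (i + 1) := S.P_ne_Q_succ i
  rw [mem_arcIco_base_wrap (S.P i) (by rw [ccw_self]; exact ccw_pos k7.symm), ccw_self] at h4
  rcases h4 with h4 | h4
  · linarith [(k i).2.2]
  · exact (ccw_nonneg _ _).not_gt h4

/-! ### Orbits of section points -/

/-- Entrance times are locally finite, so an increasing sequence of them is unbounded. -/
theorem tendsto_of_enters {v : UnitTangent} {t : ℕ → ℝ} (ht : StrictMono t)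
    (h : ∀ n, ∃ γ ∈ S.Gam, Enters (γ • diskFlow (t n) v) S.F) :
    Filter.Tendsto t Filter.atTop Filter.atTop := by
  refine Filter.tendsto_atTop_atTop_of_monotone ht.monotone fun b => ?_
  by_contra! hb
  refine Set.infinite_of_injective_forall_mem ht.injective (fun n => ?_)
    (S.finite_enter_times v (t 0) b)
  exact ⟨⟨ht.monotone (Nat.zero_le n), (hb n).le⟩, h n⟩

theorem tendsto_of_enters_neg {v : UnitTangent} {t : ℕ → ℝ} (ht : StrictMono t)
    (h : ∀ n, ∃ γ ∈ S.Gam, Enters (γ • diskFlow (-t n) v) S.F) :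
    Filter.Tendsto t Filter.atTop Filter.atTop := by
  refine Filter.tendsto_atTop_atTop_of_monotone ht.monotone fun b => ?_
  by_contra! hb
  refine Set.infinite_of_injective_forall_mem (neg_injective.comp ht.injective) (fun n => ?_)
    (S.finite_enter_times v (-b) (-t 0))
  exact ⟨⟨neg_le_neg (hb n).le, neg_le_neg (ht.monotone (Nat.zero_le n))⟩, h n⟩

theorem IsSectionPoint.base_mem {v : UnitTangent} (h : S.IsSectionPoint v) :
    v.base ∈ S.F ∨ ∃ k, (S.U k)⁻¹ • v.base ∈ S.F := by
  rcases isSectionPoint_iff.1 h with h | ⟨-, k, -, h⟩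
  · exact .inl h.1
  · exact .inr ⟨k, h.1⟩

-- Repeated use of `section_step`; the accumulated times diverge because they are entrance times.
set_option maxHeartbeats 800000 in
theorem forward_times (hA : S.IsExtremal A) {v : UnitTangent} (hp : S.Reg (ends v))
    (hv : S.IsSectionPoint v) {J : ℕ → Cell g} {m : ℕ → Idx g} (hm : ∀ n, S.ind A (J n) = m n)
    (h : ∀ n, (S.word m n • ends v).1 ∈ S.fiber A (J n) ∧
      (S.word m n • ends v).2 ∈ S.closedCell (J n)) :
    ∃ t : ℕ → ℝ, Filter.Tendsto t Filter.atTop Filter.atTop ∧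
      ∀ n, S.IsSectionPoint (S.word m n • diskFlow (t n) v) := by
  have step : ∀ n s, S.IsSectionPoint (S.word m n • diskFlow s v) →
      ∃ s', S.IsSectionPoint (S.word m (n + 1) • diskFlow s' v) ∧ s < s' := by
    intro n s hs
    have e : ends (S.word m n • diskFlow s v) = S.word m n • ends v := by
      rw [ends_smul', ends_diskFlow]
    obtain ⟨τ, hτ, h1, -⟩ := section_step hA (by rw [e]; exact hp.smul (word_mem _ _)) hs
      (J := J n) (by rw [e]; exact (h n).1) (by rw [e]; exact (h n).2)
    refine ⟨s + τ, ?_, by linarith⟩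
    rw [hm, diskFlow_smul, ← diskFlow_add] at h1
    rwa [word_succ, mul_smul]
  obtain ⟨t, -, ht⟩ := exists_seq_of_step (α := ℝ)
    (p := fun (n : ℕ) (s : ℝ) => S.IsSectionPoint (S.word m n • diskFlow s v))
    (r := fun (_ : ℕ) (s s' : ℝ) => s < s')
    (a := (0 : ℝ)) (by rw [word_zero, one_smul, diskFlow_zero]; exact hv) step
  refine ⟨t, tendsto_of_enters (S := S) (v := v) (strictMono_nat_of_lt_succ fun n => (ht n).2) (fun n => ?_),
    fun n => (ht n).1⟩
  obtain ⟨γ, hγ, hE⟩ := (ht n).1.exists_enters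
  exact ⟨γ * S.word m n, S.Gam.mul_mem hγ (word_mem _ _), by rwa [mul_smul]⟩

/-- `section_step` goes forward only. The section point of the preceding geodesic is pushed forward
and identified with the given one by `isSectionPoint_unique`. -/
theorem backward_times (hA : S.IsExtremal A) {v : UnitTangent} (hp : S.Reg (ends v))
    (hv : S.IsSectionPoint v) {J : ℕ → Cell g} {m : ℕ → Idx g}
    (hm : ∀ n, sig (S.ind A (J n)) = m n)
    (h : ∀ n, (S.word m (n + 1) • ends v).1 ∈ S.fiber A (J n) ∧
      (S.word m (n + 1) • ends v).2 ∈ S.closedCell (J n)) :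
    ∃ t : ℕ → ℝ, Filter.Tendsto t Filter.atTop Filter.atTop ∧
      ∀ n, S.IsSectionPoint (S.word m n • diskFlow (-t n) v) := by
  have step : ∀ n s, S.IsSectionPoint (S.word m n • diskFlow (-s) v) →
      ∃ s', S.IsSectionPoint (S.word m (n + 1) • diskFlow (-s') v) ∧ s < s' := by
    intro n s hs
    have e : ends (S.word m n • diskFlow (-s) v) = S.word m n • ends v := by
      rw [ends_smul', ends_diskFlow]
    have hp' : S.Reg (S.word m (n + 1) • ends v) := hp.smul (word_mem _ _)
    obtain ⟨v', e', hv'⟩ := exists_isSectionPoint ((S.mem_Omega A).2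
      ⟨J n, (h n).1, (h n).2⟩) hp'
    obtain ⟨τ, hτ, h1, -⟩ := section_step hA (by rw [e']; exact hp') hv'
      (J := J n) (by rw [e']; exact (h n).1) (by rw [e']; exact (h n).2)
    have hTT : ∀ u : UnitTangent, S.T (S.ind A (J n)) • S.T (m n) • u = u := fun u => by
      have := T_sig_T_tangent (S := S) (m n) u
      rwa [← hm, sig_sig, hm] at this
    have e2 : ends (S.T (S.ind A (J n)) • diskFlow τ v') = ends (S.word m n • diskFlow (-s) v) := by
      rw [e, ends_smul', ends_diskFlow, e', ← ends_smul', ← ends_smul', word_succ, mul_smul, hTT,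
        ends_smul']
    have e3 := isSectionPoint_unique (by rw [e2, e]; exact hp.smul (word_mem _ _)) e2 h1 hs
    have e5 : diskFlow τ v' = S.word m (n + 1) • diskFlow (-s) v := by
      rw [word_succ, mul_smul, ← e3, ← hm, T_sig_T_tangent]
    have e4 : v' = S.word m (n + 1) • diskFlow (-(s + τ)) v := by
      calc v' = diskFlow (-τ) (diskFlow τ v') := by
            rw [← diskFlow_add, add_neg_cancel, diskFlow_zero]
        _ = _ := by rw [e5, diskFlow_smul, ← diskFlow_add, neg_add]
    exact ⟨s + τ, by rwa [← e4], by linarith⟩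
  obtain ⟨t, -, ht⟩ := exists_seq_of_step (α := ℝ)
    (p := fun (n : ℕ) (s : ℝ) => S.IsSectionPoint (S.word m n • diskFlow (-s) v))
    (r := fun (_ : ℕ) (s s' : ℝ) => s < s')
    (a := (0 : ℝ)) (by rw [word_zero, one_smul, neg_zero, diskFlow_zero]; exact hv) step
  refine ⟨t, tendsto_of_enters_neg (S := S) (v := v) (strictMono_nat_of_lt_succ fun n => (ht n).2)
    (fun n => ?_), fun n => (ht n).1⟩
  obtain ⟨γ, hγ, hE⟩ := (ht n).1.exists_enters
  exact ⟨γ * S.word m n, S.Gam.mul_mem hγ (word_mem _ _), by rwa [mul_smul]⟩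

theorem exists_fiber (c : Circle) : ∃ J, c ∈ S.fiber A J := by
  obtain ⟨⟨j, t⟩, h⟩ := S.exists_mem_cell c
  -- Any cell sufficiently far from the point would do; three labels back clears both ends of the
  -- fiber.
  refine ⟨(j - 3, true), (S.mem_fiber_true A).2 ?_⟩
  have hn := twelve_le g
  have hc := S.wrap (j - 3)
  obtain ⟨c1, c2, c3⟩ := S.corner_chain A (j - 3)
  have e1 : j - 3 + 1 = j - 2 := by ring
  have e2 : j - 3 + 2 = j - 1 := by ring
  have e3 : j - 3 + 3 = j := by ring
  simp only [e1, e2, e3] at c1 c2 c3 hc ⊢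
  have hd1 : j = j - 2 + (2 : ℕ) := by push_cast; ring
  rw [hd1] at h
  have k1 := (S.le_of_mem_cell (by omega) h).1
  rw [← hd1] at k1 h
  have k2 : ccw (S.P (j - 2)) c < ccw (S.P (j - 2)) (S.P (j - 2 + (3 : ℕ))) := by
    rw [hd1] at h
    cases t
    · have k3 := ((S.mem_cell_false _ (by omega)).1 h).2
      have k4 := S.ccw_Q_lt_P (j - 2) (d := 2) (by omega)
      exact k3.trans k4
    · have k3 := ((S.mem_cell_true _ (by omega)).1 h).2
      exact k3
  have k5 := S.ccw_P_mono (j - 2) (d := 3) (e := 8 * g - 4 - 3) (by omega) (by omega)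
  rw [show j - 2 + ((8 * g - 4 - 3 : ℕ) : Idx g) = j - 3 - 2 by
    rw [cast_sub_eq (by omega)]; push_cast; ring] at k5
  exact ⟨by linarith, by linarith⟩

theorem avoidsVertices_swap {u w : Circle} : S.AvoidsVertices (u, w) ↔ S.AvoidsVertices (w, u) := by
  have key : ∀ u w : Circle, ∀ K, Meets (u, w) K → Meets (w, u) K := by
    rintro u w K ⟨v, hv, hK⟩
    obtain ⟨v', hb, he⟩ := exists_reverse v
    exact ⟨v', by rw [he, hv], by rwa [hb]⟩
  exact not_congr ⟨key _ _ _, key _ _ _⟩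

/-! ### Uniqueness of the forward and backward ends -/

/-- The end of a geodesic is determined by its forward itinerary. -/
theorem forward_unique (hA : S.IsExtremal A) {m : ℕ → Idx g} (hm : ∀ n, m (n + 1) ≠ sig (m n))
    {a a' : Circle} (ha : ∀ n, S.word m n • a ∈ arcIcc (A (m n)) (A (m n + 1)))
    (ha' : ∀ n, S.word m n • a' ∈ arcIcc (A (m n)) (A (m n + 1))) : a = a' := by
  by_contra hne
  wlog hlt : ccw (S.P (m 0)) a < ccw (S.P (m 0)) a' generalizing a a'
  · exact this ha' ha (Ne.symm hne) (lt_of_le_of_ne (not_lt.1 hlt)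
      fun e => hne (ccw_injective _ e).symm)
  have hB := extremal_mem hA
  -- The left end of the fiber over the cell of `c` will be the beginning of the geodesic. That cell
  -- is not known yet, so `c` avoids the countably many bad ends for all cells at once.
  obtain ⟨c, hcC, h1, h2⟩ := exists_between_not_mem hlt (C := ⋃ J : Cell g,
    ({w | ¬ S.AvoidsVertices (S.H A (J.1 + 1), w)} ∪ {S.H A (J.1 + 1)}))
    (Set.countable_iUnion fun J => (S.countable_irregular _).union (Set.countable_singleton _))
  have hbet := between_word hm (fun n => arc_subset hB (ha n)) (fun n => arc_subset hB (ha' n)) h1 h2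
  choose J hJ using fun n => S.exists_mem_cell (S.word m n • c)
  have hind : ∀ n, S.ind A (J n) = m n := fun n => by
    refine (S.mem_arcIco_iff_ind hA (hJ n) _).1 ?_
    have k1 := (mem_arc_iff hB).1 (ha n)
    have k2 := (mem_arc_iff hB).1 (ha' n)
    exact (mem_arcIco_base _ (arc_base hB _).1.le).2
      ⟨k1.1.trans (hbet n).1.le, (hbet n).2.trans_le k2.2⟩
  set u := S.H A ((J 0).1 + 1) with hu
  have hfib : ∀ n, S.word m n • u ∈ S.fiber A (J n) := fun n => by
    induction n with
    | zero => rw [word_zero, one_smul]; exact left_mem_arcIcc _ _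
    | succ n ih =>
      have h3 := hJ (n + 1)
      rw [word_succ, mul_smul, ← hind] at h3 ⊢
      exact (S.trans_of_mem A hA (hJ n) h3).1 _ ih
  simp only [Set.mem_iUnion, not_exists, Set.mem_union, not_or, Set.mem_ofPred_eq, not_not,
    Set.mem_singleton_iff] at hcC
  have hreg : S.Reg (u, c) := ⟨Ne.symm (hcC (J 0)).2, (hcC (J 0)).1⟩
  have hOm : (u, c) ∈ S.Omega A := (S.mem_Omega A).2 ⟨J 0, by
    have := hfib 0
    rwa [word_zero, one_smul] at this, by
    have := S.cell_subset_closedCell _ (hJ 0)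
    rwa [word_zero, one_smul] at this⟩
  obtain ⟨v, hv, hs⟩ := exists_isSectionPoint hOm hreg
  rw [← hv] at hreg
  obtain ⟨t, ht, hst⟩ := forward_times hA hreg hs (J := J) hind (fun n => by
    rw [hv]; exact ⟨hfib n, S.cell_subset_closedCell _ (hJ n)⟩)
  have hlim := (tendsto_diskFlow_base v).comp ht
  rw [hv] at hlim
  exact false_of_between hm (fun n => arc_subset hB (ha n)) (fun n => arc_subset hB (ha' n)) h1 h2
    hlim fun n => (hst n).base_mem

set_option maxHeartbeats 800000 in
/-- The beginning of a geodesic is determined by its backward itinerary. -/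
theorem backward_unique (hA : S.IsExtremal A) {m : ℕ → Idx g} (hm : ∀ n, m (n + 1) ≠ sig (m n))
    {a a' : Circle} (ha : ∀ n, S.word m n • a ∈ arcIcc (S.cornerL A (m n)) (S.cornerL A (m n + 1)))
    (ha' : ∀ n, S.word m n • a' ∈ arcIcc (S.cornerL A (m n)) (S.cornerL A (m n + 1))) :
    a = a' := by
  by_contra hne
  wlog hlt : ccw (S.P (m 0)) a < ccw (S.P (m 0)) a' generalizing a a'
  · exact this ha' ha (Ne.symm hne) (lt_of_le_of_ne (not_lt.1 hlt)
      fun e => hne (ccw_injective _ e).symm)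
  have hB := S.cornerL_mem A
  -- Here `c` is the beginning, and the end will be the left end of some cell over which `c` lies in
  -- the fiber.
  obtain ⟨c, hcC, h1, h2⟩ := exists_between_not_mem hlt (C := ⋃ J : Cell g,
    ({u | ¬ S.AvoidsVertices (S.cellLo J, u)} ∪ {S.cellLo J}))
    (Set.countable_iUnion fun J => (S.countable_irregular _).union (Set.countable_singleton _))
  have hbet := between_word hm (fun n => arc_subset hB (ha n)) (fun n => arc_subset hB (ha' n)) h1 h2
  obtain ⟨J0, hJ0⟩ := exists_fiber (S := S) (A := A) c
  have hw0 : S.cellLo J0 ∈ S.cell J0 := by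
    obtain ⟨i, t⟩ := J0
    cases t
    · exact S.P_mem_cell i
    · exact S.Q_mem_cell i
  set w := S.cellLo J0 with hw
  -- The predecessor from `exists_trans` need not follow the itinerary by itself; it does because
  -- `c` is in the interior of the tile of `m n` and therefore in no other tile.
  have step : ∀ n J, S.word m n • c ∈ S.fiber A J ∧ S.word m n • w ∈ S.cell J →
      ∃ J', (S.word m (n + 1) • c ∈ S.fiber A J' ∧ S.word m (n + 1) • w ∈ S.cell J') ∧
        sig (S.ind A J') = m n := by
    intro n J hJ
    obtain ⟨J', h3, h4⟩ := S.exists_trans A hA hJ.1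
    have h5 := fiber_image hA h4
    rw [S.T_T_sig] at h5
    have h6 : sig (S.ind A J') = m n := by
      have k1 := (mem_arc_iff hB).1 (ha n)
      have k2 := (mem_arc_iff hB).1 (ha' n)
      obtain ⟨b1, b2⟩ := hbet n
      have c1 := k1.1.trans_lt b1
      have c2 := b2.trans_le k2.2
      obtain ⟨d, hd, e⟩ := exists_offset (m n) (sig (S.ind A J'))
      rw [e] at h5 ⊢
      rcases Nat.eq_zero_or_pos d with rfl | hd0
      · simp
      exfalso
      by_cases hd' : d + 1 < 8 * g - 4
      · rw [show m n + d + 1 = m n + ((d + 1 : ℕ) : Idx g) by push_cast; ring,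
          mem_arcIcc_base (S.P (m n)) (S.L_le A (m n) (Nat.le_succ d) hd')] at h5
        have h7 := S.L_le A (m n) (d := 1) hd0 hd
        rw [Nat.cast_one] at h7
        linarith
      · have hd2 : d + 1 = 8 * g - 4 := by omega
        have e0 : m n + (d : Idx g) + 1 = m n := by rw [cast_eq_one_sub hd2]; ring
        have hn := twelve_le g
        have h7 := S.L_lt A (m n) (d := 0) (e := d) hd0 hd
        have h8 := S.L_le A (m n) (d := 1) hd0 hd
        rw [Nat.cast_zero, add_zero] at h7
        rw [Nat.cast_one] at h8
        rw [e0, mem_arcIcc_base_wrap (S.P (m n)) h7] at h5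
        rcases h5 with h5 | h5 <;> linarith
    refine ⟨J', ⟨?_, ?_⟩, h6⟩
    · rw [word_succ, mul_smul, ← h6]
      exact h4
    · rw [word_succ, mul_smul, ← h6]
      exact h3.2 _ (by rw [S.T_T_sig]; exact hJ.2)
  obtain ⟨J, -, hJ⟩ := exists_seq_of_step
    (p := fun n J => S.word m n • c ∈ S.fiber A J ∧ S.word m n • w ∈ S.cell J)
    (r := fun n _ J' => sig (S.ind A J') = m n) (a := J0)
    (by rw [word_zero, one_smul, one_smul]; exact ⟨hJ0, hw0⟩)
    step
  simp only [Set.mem_iUnion, not_exists, Set.mem_union, not_or, Set.mem_ofPred_eq, not_not,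
    Set.mem_singleton_iff] at hcC
  have hreg : S.Reg (c, w) := ⟨(hcC J0).2, avoidsVertices_swap.1 (hcC J0).1⟩
  obtain ⟨v, hv, hs⟩ := exists_isSectionPoint ((S.mem_Omega A).2
    ⟨J0, hJ0, S.cell_subset_closedCell _ hw0⟩) hreg
  rw [← hv] at hreg
  obtain ⟨t, ht, hst⟩ := backward_times hA hreg hs (J := fun n => J (n + 1))
    (fun n => (hJ n).2) (fun n => by
    rw [hv]; exact ⟨(hJ (n + 1)).1.1, S.cell_subset_closedCell _ (hJ (n + 1)).1.2⟩)
  have hlim := (tendsto_diskFlow_base_neg v).comp ht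
  rw [hv] at hlim
  exact false_of_between hm (fun n => arc_subset hB (ha n)) (fun n => arc_subset hB (ha' n)) h1 h2
    hlim fun n => (hst n).base_mem

end Surface
end GeodesicCoding

namespace GeodesicCoding

/-! ### Inclusions of arcs -/

theorem exists_ccw_gt (a b : Circle) : ∃ z, ccw a b < ccw a z := by
  have h0 := ccw_nonneg a b
  have h1 := ccw_lt_two_pi a b
  refine ⟨a * Circle.exp ((ccw a b + 2 * Real.pi) / 2), ?_⟩
  rw [ccw_mul_exp a (by linarith) (by linarith)]
  linarith

/-- An arc that contained `a` without starting there would also contain a point outside [a, b]; such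
a point exists because no arc of this kind is the whole circle. -/
theorem eq_left_of_arcIcc_subset {α β a b : Circle} (h : arcIcc α β ⊆ arcIcc a b)
    (ha : a ∈ arcIcc α β) : α = a := by
  by_contra hne
  obtain ⟨z, hz⟩ := exists_ccw_gt a b
  have h1 : ccw a α ≤ ccw a b := h (left_mem_arcIcc α β)
  have h2 := ccw_pos hne
  have h3 : z ∈ arcIcc α a :=
    (mem_arcIcc_base_wrap a (by rwa [ccw_self])).2 (.inl (h1.trans hz.le))
  have h4 : z ∈ arcIcc a b := h (le_trans (show ccw α z ≤ ccw α a from h3) ha)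
  exact hz.not_ge h4

theorem eq_right_of_arcIcc_subset {α β a b : Circle} (h : arcIcc α β ⊆ arcIcc a b)
    (hb : b ∈ arcIcc α β) : β = b := by
  by_contra hne
  obtain ⟨z, hz⟩ := exists_ccw_gt a b
  have h1 : ccw a α ≤ ccw a b := h (left_mem_arcIcc α β)
  have h2 : ccw a β < ccw a b :=
    lt_of_le_of_ne (h (right_mem_arcIcc α β)) fun e => hne (ccw_injective _ e)
  rcases le_or_gt (ccw a α) (ccw a β) with h3 | h3
  · exact h2.not_ge ((mem_arcIcc_base a h3).1 hb).2
  · have h4 : z ∈ arcIcc a b := h ((mem_arcIcc_base_wrap a h3).2 (.inl (h1.trans hz.le)))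
    exact hz.not_ge h4

theorem arcIcc_subset_of_arcIco_subset {α β a b : Circle} (hne : α ≠ β)
    (h : arcIco α β ⊆ arcIco a b) : arcIcc α β ⊆ arcIcc a b := by
  intro x hx
  rcases lt_or_eq_of_le (show ccw α x ≤ ccw α β from hx) with h1 | h1
  · exact arcIco_subset_arcIcc _ _ (h h1)
  obtain rfl := ccw_injective _ h1
  by_contra hcon
  have h2 : ccw a b < ccw a x := not_le.1 hcon
  have h3 : ccw a α < ccw a b := h (left_mem_arcIco hne)
  obtain ⟨z, -, hz1, hz2⟩ := exists_between_not_mem h2 Set.countable_empty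
  have h4 : z ∈ arcIco a b :=
    h ((mem_arcIco_base a (h3.le.trans h2.le)).2 ⟨h3.le.trans hz1.le, hz2⟩)
  exact hz1.not_gt h4

theorem image_smul_arcIcc_subset {B : SU11} {α β a b : Circle}
    (h : ∀ x ∈ arcIcc α β, B • x ∈ arcIcc a b) : arcIcc (B • α) (B • β) ⊆ arcIcc a b := by
  intro x hx
  have := h (B⁻¹ • x) (by rwa [← smul_mem_arcIcc B, smul_inv_smul])
  rwa [smul_inv_smul] at this

theorem eq_left_of_smul {B : SU11} {α β a b x : Circle}
    (h : ∀ x ∈ arcIcc α β, B • x ∈ arcIcc a b) (hx : x ∈ arcIcc α β) (e : B • x = a) : x = α := by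
  have := eq_left_of_arcIcc_subset (image_smul_arcIcc_subset h)
    (by rw [← e]; exact (smul_mem_arcIcc B).2 hx)
  rw [← e] at this
  exact (MulAction.injective B this).symm

theorem eq_right_of_smul {B : SU11} {α β a b x : Circle}
    (h : ∀ x ∈ arcIcc α β, B • x ∈ arcIcc a b) (hx : x ∈ arcIcc α β) (e : B • x = b) : x = β := by
  have := eq_right_of_arcIcc_subset (image_smul_arcIcc_subset h)
    (by rw [← e]; exact (smul_mem_arcIcc B).2 hx)
  rw [← e] at this
  exact (MulAction.injective B this).symm

theorem continuous_det3_cvec (u w : Circle) :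
    Continuous fun x : Circle => det3 (cvec u) (cvec w) (cvec x) := by
  have hc : Continuous fun x : Circle => (x : ℂ) := circle_isEmbedding.continuous
  simp only [det3, cvec]
  fun_prop

theorem isClosed_arcIcc (a b : Circle) : IsClosed (arcIcc a b) := by
  rcases eq_or_ne a b with rfl | hab
  · have : arcIcc a a = {a} := by
      ext x
      rw [mem_arcIcc, ccw_self, Set.mem_singleton_iff]
      refine ⟨fun h => ?_, fun h => by rw [h, ccw_self]⟩
      by_contra hne
      exact (ccw_pos hne).not_ge h
    rw [this]
    exact isClosed_singleton
  · have : arcIcc a b = {x | det3 (cvec a) (cvec b) (cvec x) ≤ 0} := by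
      ext x
      refine ⟨fun h => det3_cvec_nonpos_of_mem h, fun h => ?_⟩
      by_contra hcon
      exact (det3_cvec_pos hab (not_le.1 hcon)).not_ge h
    rw [this]
    exact isClosed_le (continuous_det3_cvec a b) continuous_const

theorem exists_int_seq {α : Type*} {p : α → Prop} {r : α → α → Prop} {a : α} (ha : p a)
    (hf : ∀ a, p a → ∃ b, p b ∧ r a b) (hb : ∀ b, p b → ∃ a, p a ∧ r a b) :
    ∃ f : ℤ → α, f 0 = a ∧ ∀ k, p (f k) ∧ r (f k) (f (k + 1)) := by
  obtain ⟨F, hF0, hF⟩ := exists_seq_of_step (p := fun _ => p) (r := fun _ => r) ha fun _ => hf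
  obtain ⟨B, hB0, hB⟩ := exists_seq_of_step (p := fun _ => p) (r := fun _ a b => r b a) ha
    fun _ => hb
  refine ⟨fun k => if 0 ≤ k then F k.toNat else B (-k).toNat, by simpa using hF0, fun k => ?_⟩
  dsimp only
  rcases le_or_gt 0 k with h | h
  · obtain ⟨n, rfl⟩ := Int.eq_ofNat_of_zero_le h
    rw [if_pos (by omega), if_pos (by omega)]
    exact ⟨(hF n).1, (hF n).2⟩
  · obtain ⟨n, rfl⟩ : ∃ n : ℕ, k = -(n + 1 : ℕ) := ⟨(-k - 1).toNat, by omega⟩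
    rw [if_neg (by omega), neg_neg, Int.toNat_natCast]
    refine ⟨(hB (n + 1)).1, ?_⟩
    cases n with
    | zero =>
      rw [if_pos (by omega)]
      have := (hB 0).2
      rw [hB0, ← hF0] at this
      simpa using this
    | succ n =>
      rw [if_neg (by omega), show -(-((n + 1 + 1 : ℕ) : ℤ) + 1) = ((n + 1 : ℕ) : ℤ) by push_cast; ring,
        Int.toNat_natCast]
      exact (hB (n + 1)).2

namespace Surface

variable {g : ℕ} [hg : Fact (2 ≤ g)] {S : Surface g} {A : Idx g → Circle}

theorem cellLo_mem_cell (J : Cell g) : S.cellLo J ∈ S.cell J := by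
  obtain ⟨i, t⟩ := J
  cases t
  · exact S.P_mem_cell i
  · exact S.Q_mem_cell i

theorem exists_mem_cell_not_mem (J : Cell g) {C : Set Circle} (hC : C.Countable) :
    ∃ c ∈ S.cell J, c ∉ C := by
  obtain ⟨c, hc, -, h⟩ := exists_between_not_mem (S.cellLo_mem_cell J) hC
  exact ⟨c, h, hc⟩

theorem cellLo_ne_cellHi (J : Cell g) : S.cellLo J ≠ S.cellHi J := fun h => by
  have := S.cellLo_mem_cell J
  rw [cell, mem_arcIco, h] at this
  exact lt_irrefl _ this

/-! ### Lifts of codes to the Markov chain of cells -/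

variable (A) in
/-- The orbit `q` follows the sequence of cells `y`. -/
def IsLift (y : ℤ → Cell g) (q : ℤ → Circle × Circle) : Prop :=
  ∀ k, S.Trans A (y k) (y (k + 1)) ∧ (q k).1 ∈ S.fiber A (y k) ∧ (q k).2 ∈ S.closedCell (y k) ∧
    q (k + 1) = S.T (S.ind A (y k)) • q k

variable (S A) in
/-- The code of a sequence of cells. -/
def codeOf (y : ℤ → Cell g) (k : ℤ) : Idx g := sig (S.ind A (y k))

theorem T_T_sig_pair (i : Idx g) (p : Circle × Circle) : S.T i • S.T (sig i) • p = p :=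
  Prod.ext (S.T_T_sig i p.1) (S.T_T_sig i p.2)

theorem T_sig_T_pair (i : Idx g) (p : Circle × Circle) : S.T (sig i) • S.T i • p = p :=
  Prod.ext (S.T_sig_T i p.1) (S.T_sig_T i p.2)

theorem IsLift.word_forward {y : ℤ → Cell g} {q : ℤ → Circle × Circle} (h : S.IsLift A y q)
    (k : ℤ) (n : ℕ) : S.word (fun n => S.ind A (y (k + n))) n • q k = q (k + n) := by
  induction n with
  | zero => rw [word_zero, one_smul]; simp
  | succ n ih =>
    rw [word_succ, mul_smul, ih, ← (h (k + n)).2.2.2]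
    congr 1
    push_cast
    ring

theorem IsLift.word_backward {y : ℤ → Cell g} {q : ℤ → Circle × Circle} (h : S.IsLift A y q)
    (k : ℤ) (n : ℕ) :
    S.word (fun n => sig (S.ind A (y (k - n - 1)))) n • q k = q (k - n) := by
  induction n with
  | zero => rw [word_zero, one_smul]; simp
  | succ n ih =>
    have := (h (k - n - 1)).2.2.2
    rw [sub_add_cancel] at this
    rw [word_succ, mul_smul, ih, this, T_sig_T_pair]
    congr 1
    push_cast
    ring

/-- At every time a common code gives the ends a common forward itinerary and the beginnings a
common backward itinerary, so expansivity applies to both coordinates. -/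
theorem IsLift.eq (hA : S.IsExtremal A) {y y' : ℤ → Cell g} {q q' : ℤ → Circle × Circle}
    (h : S.IsLift A y q) (h' : S.IsLift A y' q') (e : S.codeOf A y = S.codeOf A y') (k : ℤ) :
    q k = q' k := by
  have e' : ∀ k, S.ind A (y k) = S.ind A (y' k) := fun k => sig_injective (congrFun e k)
  refine Prod.ext ?_ ?_
  · refine backward_unique hA (m := fun n => sig (S.ind A (y (k - n - 1)))) (fun n he => ?_)
      (fun n => ?_) (fun n => ?_)
    · have := (h (k - (n + 1 : ℕ) - 1)).1.ind_ne hA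
      apply this
      rw [show k - ((n + 1 : ℕ) : ℤ) - 1 + 1 = k - n - 1 by push_cast; ring]
      exact (he.trans (sig_sig _)).symm
    · have h1 : S.word (fun n => sig (S.ind A (y (k - n - 1)))) n • (q k).1 = _ :=
        congrArg Prod.fst (h.word_backward k n)
      rw [h1]
      have := fiber_image hA (h (k - n - 1)).2.1
      have h2 := congrArg Prod.fst (h (k - n - 1)).2.2.2
      rw [sub_add_cancel] at h2
      rw [h2]
      exact this
    · simp only [e']
      have h1 : S.word (fun n => sig (S.ind A (y' (k - n - 1)))) n • (q' k).1 = _ :=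
        congrArg Prod.fst (h'.word_backward k n)
      rw [h1]
      have := fiber_image hA (h' (k - n - 1)).2.1
      have h2 := congrArg Prod.fst (h' (k - n - 1)).2.2.2
      rw [sub_add_cancel] at h2
      rw [h2]
      exact this
  · refine forward_unique hA (m := fun n => S.ind A (y (k + n))) (fun n he => ?_)
      (fun n => ?_) (fun n => ?_)
    · apply (h (k + n)).1.ind_ne hA
      rw [add_assoc]
      exact_mod_cast he
    · have h1 : S.word (fun n => S.ind A (y (k + n))) n • (q k).2 = _ :=
        congrArg Prod.snd (h.word_forward k n)
      rw [h1]
      exact closedCell_subset hA (h (k + n)).2.2.1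
    · simp only [e']
      have h1 : S.word (fun n => S.ind A (y' (k + n))) n • (q' k).2 = _ :=
        congrArg Prod.snd (h'.word_forward k n)
      rw [h1]
      exact closedCell_subset hA (h' (k + n)).2.2.1

theorem IsLift.isCode (hA : S.IsExtremal A) {y : ℤ → Cell g} {q : ℤ → Circle × Circle}
    (h : S.IsLift A y q) (hc : ∀ k, (q k).2 ∈ S.cell (y k)) :
    S.IsCode A (S.codeOf A y) (q 0) := by
  refine ⟨q, rfl, fun k => ⟨(S.mem_Omega A).2 ⟨_, (h k).2.1, (h k).2.2.1⟩, ?_, ?_⟩⟩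
  · rw [(h k).2.2.2, FA, boundaryMap, S.index_eq hA (hc k)]
    rfl
  · rw [S.index_eq hA (hc k)]
    rfl

/-- Forward, the next cell is the one that contains the image of the end; backward, a predecessor is
supplied by the position of the beginning. -/
theorem exists_orbit (hA : S.IsExtremal A) {J : Cell g} {p : Circle × Circle}
    (hu : p.1 ∈ S.fiber A J) (hw : p.2 ∈ S.cell J) :
    ∃ y q, S.IsLift A y q ∧ (∀ k, (q k).2 ∈ S.cell (y k)) ∧ y 0 = J ∧ q 0 = p := by
  obtain ⟨f, hf0, hf⟩ := exists_int_seq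
    (p := fun x : Cell g × Circle × Circle => x.2.1 ∈ S.fiber A x.1 ∧ x.2.2 ∈ S.cell x.1)
    (r := fun x x' => S.Trans A x.1 x'.1 ∧ x'.2 = S.T (S.ind A x.1) • x.2) (a := (J, p)) ⟨hu, hw⟩
    (by
      rintro ⟨J, p⟩ ⟨h1, h2⟩
      obtain ⟨J', h3⟩ := S.exists_mem_cell (S.T (S.ind A J) • p.2)
      have h4 := S.trans_of_mem A hA h2 h3
      exact ⟨(J', S.T (S.ind A J) • p), ⟨h4.1 _ h1, h3⟩, h4, rfl⟩)
    (by
      rintro ⟨J, p⟩ ⟨h1, h2⟩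
      obtain ⟨J', h3, h4⟩ := S.exists_trans A hA h1
      exact ⟨(J', S.T (sig (S.ind A J')) • p), ⟨h4, h3.2 _ (by rw [Prod.smul_snd, S.T_T_sig]; exact h2)⟩,
        h3, (T_T_sig_pair _ _).symm⟩)
  exact ⟨fun k => (f k).1, fun k => (f k).2, fun k => ⟨(hf k).2.1, (hf k).1.1,
    S.cell_subset_closedCell _ (hf k).1.2, (hf k).2.2⟩, fun k => (hf k).1.2, congrArg Prod.fst hf0,
    congrArg Prod.snd hf0⟩

/-- An orbit that follows a given finite sequence of cells. -/
theorem exists_orbit_of_chain (hA : S.IsExtremal A) {y : ℤ → Cell g}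
    (hy : ∀ k, S.Trans A (y k) (y (k + 1))) (N : ℕ) :
    ∃ y' q, S.IsLift A y' q ∧ (∀ k, (q k).2 ∈ S.cell (y' k)) ∧ S.Reg (q 0) ∧
      ∀ k : ℤ, -N ≤ k → k ≤ N → y' k = y k := by
  obtain ⟨m, hm⟩ : ∃ m : ℕ → Idx g, ∀ n, m n = S.ind A (y (-N + n)) := ⟨_, fun _ => rfl⟩
  -- Transitions pull cells back into cells, so a point of the last cell determines points in all
  -- the earlier ones.
  have pull : ∀ n : ℕ, ∀ w, S.word m n • w ∈ S.cell (y (-N + n)) →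
      ∀ j ≤ n, S.word m j • w ∈ S.cell (y (-N + j)) := by
    intro n
    induction n with
    | zero => intro w hw j hj; obtain rfl := Nat.le_zero.1 hj; exact hw
    | succ n ih =>
      intro w hw j hj
      rcases Nat.le_succ_iff.1 hj with h | rfl
      · refine ih w ((hy (-N + n)).2 _ ?_) j h
        rw [word_succ, mul_smul, hm] at hw
        rw [add_assoc]
        exact_mod_cast hw
      · exact hw
  set u := S.H A ((y (-N)).1 + 1) with hu
  -- The end is chosen generically in the last cell, so that together with `u` its pullback spans a
  -- regular geodesic.
  have hC : ((fun w => S.word m (2 * N) • w) ''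
      ({w | ¬ S.AvoidsVertices (u, w)} ∪ {u})).Countable :=
    ((S.countable_irregular u).union (Set.countable_singleton _)).image _
  obtain ⟨x, hx, hxC⟩ := exists_mem_cell_not_mem (S := S) (y (-N + (2 * N : ℕ))) hC
  set w := (S.word m (2 * N))⁻¹ • x with hw
  have hwx : S.word m (2 * N) • w = x := smul_inv_smul _ _
  have hcell := pull (2 * N) w (by rwa [hwx])
  have hreg : S.Reg (u, w) := by
    refine ⟨fun e => hxC ⟨w, .inr e.symm, hwx⟩, ?_⟩
    by_contra hcon
    exact hxC ⟨w, .inl hcon, hwx⟩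
  have hw0 := hcell 0 (Nat.zero_le _)
  rw [word_zero, one_smul, Nat.cast_zero, add_zero] at hw0
  obtain ⟨y', q, hl, hc, hy0, hq0⟩ := exists_orbit hA (J := y (-N)) (p := (u, w))
    (left_mem_arcIcc _ _) hw0
  have key : ∀ j : ℕ, j ≤ 2 * N → q j = S.word m j • (u, w) ∧ y' j = y (-N + j) := by
    intro j
    induction j with
    | zero =>
      intro _
      rw [word_zero, one_smul, Nat.cast_zero, add_zero]
      exact ⟨hq0, hy0⟩
    | succ j ih =>
      intro hj
      obtain ⟨h1, h2⟩ := ih (by omega)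
      have h3 : q (j + 1 : ℕ) = S.word m (j + 1) • (u, w) := by
        rw [Nat.cast_succ, (hl j).2.2.2, h1, word_succ, mul_smul, hm, h2]
      refine ⟨h3, S.cell_unique (hc _) ?_⟩
      rw [h3]
      exact hcell _ hj
  -- The window was built from time 0 to `2 * N` and is recentred here.
  refine ⟨fun k => y' (k + N), fun k => q (k + N), fun k => ?_, fun k => hc _, ?_, fun k h1 h2 => ?_⟩
  · have := hl (k + N)
    rwa [add_right_comm] at this
  · have := (key N (by omega)).1
    simp only [zero_add]
    rw [this]
    exact hreg.smul (word_mem _ _)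
  · obtain ⟨j, hj⟩ := Int.eq_ofNat_of_zero_le (show 0 ≤ k + N by omega)
    dsimp only
    rw [hj, (key j (by omega)).2]
    congr 1
    omega

/-! ### Codes have lifts -/

/-- Codes use half-open cells, Ω uses closed ones. A discrepancy is possible only at w = P_k, where
Ω also has the fiber over the preceding cell; it has the same right end but may begin earlier. -/
theorem mem_fiber_or {p : Circle × Circle} (hp : p ∈ S.Omega A) {J : Cell g}
    (hJ : p.2 ∈ S.cell J) : p.1 ∈ S.fiber A J ∨
      ∃ k, J = (k, false) ∧ p.2 = S.P k ∧ p.1 ∈ S.fiber A (k - 1, true) := by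
  obtain ⟨⟨i, t⟩, h1, h2⟩ := (S.mem_Omega A).1 hp
  rcases S.mem_closedCell h2 with h | h
  · exact .inl (by rwa [S.cell_unique hJ h])
  cases t
  · have h3 : p.2 = S.Q i := h
    rw [h3] at hJ
    obtain rfl := S.cell_unique hJ (S.Q_mem_cell i)
    rw [mem_fiber_false] at h1
    have hc := S.corner_chain A i
    exact .inl ((S.mem_fiber_true A).2 ⟨h1.1, by linarith⟩)
  · have h3 : p.2 = S.P (i + 1) := h
    rw [h3] at hJ
    obtain rfl := S.cell_unique hJ (S.P_mem_cell (i + 1))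
    exact .inr ⟨i + 1, rfl, h3, by rwa [add_sub_cancel_right]⟩

/-- If the beginning misses the fiber at one time, it does so at all earlier times, since fibers map
into fibers. Then every earlier end is some P_k, which pins down the backward itinerary: it is that
of the left end of the fiber. By `backward_unique` the beginning is this left end, hence in the
fiber after all. -/
theorem mem_fiber_of_orbit (hA : S.IsExtremal A) {q : ℤ → Circle × Circle} {J : ℤ → Cell g}
    (hO : ∀ k, q k ∈ S.Omega A) (hJ : ∀ k, (q k).2 ∈ S.cell (J k))
    (hq : ∀ k, q (k + 1) = S.T (S.ind A (J k)) • q k) (N : ℤ) : (q N).1 ∈ S.fiber A (J N) := by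
  have tr : ∀ k, S.Trans A (J k) (J (k + 1)) := fun k =>
    S.trans_of_mem A hA (hJ k) (by have := hJ (k + 1); rwa [hq] at this)
  by_contra hcon
  have back : ∀ n : ℕ, (q (N - n)).1 ∉ S.fiber A (J (N - n)) := by
    intro n
    induction n with
    | zero => simpa using hcon
    | succ n ih =>
      intro h
      apply ih
      have h1 := (tr _).1 _ h
      have h2 := hq (N - (n + 1 : ℕ))
      rw [show N - ((n + 1 : ℕ) : ℤ) + 1 = N - n by push_cast; ring] at h1 h2
      rw [h2]
      exact h1
  choose k hk1 hk2 hk3 using fun n : ℕ => (mem_fiber_or (hO _) (hJ (N - n))).resolve_left (back n)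
  have hq' : ∀ n : ℕ, q (N - n) = S.T (S.ind A (J (N - (n + 1 : ℕ)))) • q (N - (n + 1 : ℕ)) := by
    intro n
    have h2 := hq (N - (n + 1 : ℕ))
    rwa [show N - ((n + 1 : ℕ) : ℤ) + 1 = N - n by push_cast; ring] at h2
  have hw : ∀ n : ℕ, S.P (k n) = S.T (S.ind A (J (N - (n + 1 : ℕ)))) • S.P (k (n + 1)) := by
    intro n
    rw [← hk2, ← hk2]
    exact congrArg Prod.snd (hq' n)
  -- For the other parameter value the generator would send a `P` point to a `Q` point, but the next
  -- end is again a `P` point.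
  have hAk : ∀ n, A (k (n + 1)) = S.Q (k (n + 1)) := by
    intro n
    refine (hA _).resolve_left fun h => ?_
    have h1 := hw n
    rw [hk1, S.ind_false_P A h, S.T_P] at h1
    have h2 := S.P_mem_cell (k n)
    rw [h1] at h2
    have := S.cell_unique h2 (S.Q_mem_cell _)
    simp at this
  have hind : ∀ n : ℕ, S.ind A (J (N - (n + 1 : ℕ))) = k (n + 1) - 1 := fun n => by
    rw [hk1, S.ind_false_Q A (hAk n)]
  have hks : ∀ n, sig (k (n + 1) - 1) = k n + 1 := fun n => by
    have h1 := hw n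
    rw [hind] at h1
    have h2 := S.T_P_succ (k (n + 1) - 1)
    rw [sub_add_cancel, ← h1] at h2
    have h3 := S.P_mem_cell (k n)
    rw [h2] at h3
    have h4 : k n = sig (k (n + 1) - 1) - 1 :=
      congrArg Prod.fst (S.cell_unique h3 (S.P_mem_cell _))
    rw [h4]
    ring
  have hsig : ∀ n, sig (k n + 1) = k (n + 1) - 1 := fun n => by rw [← hks, sig_sig]
  have e := backward_unique (a := (q N).1) (a' := S.H A (k 0 + 1)) hA (m := fun n => k n + 1)
    (fun n he => ?_) (fun n => ?_) (fun n => ?_)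
  · apply hcon
    have h1 := hk1 0
    rw [Nat.cast_zero, sub_zero] at h1
    rw [e, h1]
    exact left_mem_arcIcc _ _
  · have h1 := (tr (N - (n + 1 + 1 : ℕ))).ind_ne hA
    rw [show N - ((n + 1 + 1 : ℕ) : ℤ) + 1 = N - (n + 1 : ℕ) by push_cast; ring, hind, hind] at h1
    apply h1
    rw [hks, he, hsig]
  · have h1 : ∀ n : ℕ, S.word (fun n => k n + 1) n • (q N).1 = (q (N - n)).1 := by
      intro n
      induction n with
      | zero => rw [word_zero, one_smul]; simp
      | succ n ih =>
        rw [word_succ, mul_smul, ih, hq' n, hind, Prod.smul_fst, ← hks, S.T_sig_T]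
    rw [h1]
    have h2 := fiber_image hA (hk3 (n + 1))
    rw [ind_true, hks] at h2
    rw [hq' n, hind]
    exact h2
  · have h1 : ∀ n, S.H A (k n + 1) = S.T (k (n + 1) - 1) • S.H A (k (n + 1) + 1) := fun n => by
      have h2 := S.H_sig_of_Q A (i := k (n + 1) - 1) (by rw [sub_add_cancel]; exact hAk n)
      rw [hks] at h2
      rw [h2]
      congr 2
      ring
    have h3 : S.word (fun n => k n + 1) n • S.H A (k 0 + 1) = S.H A (k n + 1) := by
      induction n with
      | zero => rw [word_zero, one_smul]
      | succ n ih => rw [word_succ, mul_smul, ih, h1 n, ← hks, S.T_sig_T]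
    rw [h3, h1 n]
    have h4 := fiber_image hA (J := (k (n + 1), false)) (left_mem_arcIcc _ _)
    rw [S.ind_false_Q A (hAk n), hks] at h4
    exact h4

theorem IsCode.exists_lift (hA : S.IsExtremal A) {x : ℤ → Idx g} {p : Circle × Circle}
    (h : S.IsCode A x p) : ∃ y q, S.IsLift A y q ∧ q 0 = p ∧ x = S.codeOf A y := by
  obtain ⟨q, h0, hq⟩ := h
  choose J hJ using fun k => S.exists_mem_cell (q k).2
  have hi : ∀ k, index A (q k).2 = S.ind A (J k) := fun k => S.index_eq hA (hJ k)
  have hstep : ∀ k, q (k + 1) = S.T (S.ind A (J k)) • q k := fun k => by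
    rw [(hq k).2.1, FA, boundaryMap, hi]
    rfl
  refine ⟨J, q, fun k => ⟨?_, mem_fiber_of_orbit hA (fun k => (hq k).1) hJ hstep k,
    S.cell_subset_closedCell _ (hJ k), hstep k⟩, h0, funext fun k => ?_⟩
  · exact S.trans_of_mem A hA (hJ k) (by have := hJ (k + 1); rwa [hstep] at this)
  · rw [(hq k).2.2, hi]
    rfl

end Surface
end GeodesicCoding

/-! ### Compactness of lifts and the space of codes -/

namespace GeodesicCoding

/-- A function on a set whose graph is a part of a compact set that meets each vertical line over
the set in one point only is continuous. -/
theorem continuousOn_of_isCompact {α β γ : Type*} [TopologicalSpace α] [T2Space α]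
    [TopologicalSpace β] [TopologicalSpace γ] {E : Set γ} (hE : IsCompact E) {π : γ → α} {ψ : γ → β}
    (hπ : Continuous π) (hψ : Continuous ψ) {f : α → β} {s : Set α}
    (h : ∀ x ∈ s, (∃ z ∈ E, π z = x) ∧ ∀ z ∈ E, π z = x → ψ z = f x) : ContinuousOn f s := by
  rw [continuousOn_iff_isClosed]
  intro t ht
  refine ⟨π '' (E ∩ ψ ⁻¹' t), ((hE.inter_right (ht.preimage hψ)).image hπ).isClosed, ?_⟩
  ext x
  constructor
  · rintro ⟨h1, h2⟩
    obtain ⟨⟨z, hz, rfl⟩, h3⟩ := h x h2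
    exact ⟨⟨z, ⟨hz, by rw [Set.mem_preimage, h3 z hz rfl]; exact h1⟩, rfl⟩, h2⟩
  · rintro ⟨⟨z, ⟨hz, h1⟩, rfl⟩, h2⟩
    exact ⟨by rw [Set.mem_preimage, ← (h _ h2).2 z hz rfl]; exact h1, h2⟩

theorem arcIcc_subset_closure {a b : Circle} (h : a ≠ b) : arcIcc a b ⊆ closure (arcIco a b) := by
  intro x hx
  rcases lt_or_eq_of_le (show ccw a x ≤ ccw a b from hx) with h1 | h1
  · exact subset_closure h1
  obtain rfl := ccw_injective _ h1
  have hc : Filter.Tendsto (fun t : ℝ => a * Circle.exp t) (𝓝[<] (ccw a x)) (𝓝 x) := by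
    have : Continuous fun t : ℝ => a * Circle.exp t := by fun_prop
    have h2 := this.tendsto (ccw a x)
    rw [exp_ccw] at h2
    exact h2.mono_left nhdsWithin_le_nhds
  refine mem_closure_of_tendsto hc ?_
  filter_upwards [self_mem_nhdsWithin, Ioo_mem_nhdsLT (ccw_pos h.symm)] with t h2 h3
  rw [mem_arcIco, ccw_mul_exp a h3.1.le (h3.2.trans (ccw_lt_two_pi a x))]
  exact h3.2

namespace Surface

variable {g : ℕ} [hg : Fact (2 ≤ g)] {S : Surface g} {A : Idx g → Circle}

theorem isClosed_fiber (J : Cell g) : IsClosed (S.fiber A J) := by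
  rw [fiber]
  exact isClosed_arcIcc _ _

theorem isClosed_closedCell (J : Cell g) : IsClosed (S.closedCell J) := by
  rw [closedCell]
  exact isClosed_arcIcc _ _

theorem isClosed_isLift : IsClosed {x : (ℤ → Cell g) × (ℤ → Circle × Circle) | S.IsLift A x.1 x.2} := by
  simp only [IsLift, Set.ofPred_forall]
  refine isClosed_iInter fun k => ?_
  have hy : ∀ k, Continuous fun x : (ℤ → Cell g) × (ℤ → Circle × Circle) => x.1 k := fun k =>
    (continuous_apply k).comp continuous_fst
  have hq : ∀ k, Continuous fun x : (ℤ → Cell g) × (ℤ → Circle × Circle) => x.2 k := fun k =>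
    (continuous_apply k).comp continuous_snd
  have h1 : IsClosed {z : Cell g × Cell g | S.Trans A z.1 z.2} := isClosed_discrete _
  have h2 : IsClosed {z : Cell g × Circle × Circle | z.2.1 ∈ S.fiber A z.1 ∧
      z.2.2 ∈ S.closedCell z.1} := by
    have : {z : Cell g × Circle × Circle | z.2.1 ∈ S.fiber A z.1 ∧ z.2.2 ∈ S.closedCell z.1}
        = ⋃ J : Cell g, {J} ×ˢ (S.fiber A J ×ˢ S.closedCell J) := by
      ext ⟨J, u, w⟩
      simp
    rw [this]
    refine isClosed_iUnion_of_finite fun J => ?_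
    have hJ : IsClosed (S.fiber A J ×ˢ S.closedCell J) :=
      (isClosed_fiber J).prod (isClosed_closedCell J)
    have hJ' : IsClosed ({J} : Set (Cell g)) := isClosed_discrete _
    exact hJ'.prod hJ
  have h3 : Continuous fun z : Cell g × Circle × Circle => S.T (S.ind A z.1) • z.2 :=
    continuous_prod_of_discrete_left.2 fun J => by
      have := continuous_smul_pair (S.T (S.ind A J))
      exact this
  have h12 := (h1.preimage ((hy k).prodMk (hy (k + 1)))).inter
    ((h2.preimage ((hy k).prodMk (hq k))).inter
      (isClosed_eq (hq (k + 1)) (h3.comp ((hy k).prodMk (hq k)))))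
  convert h12 using 1
  ext x
  simp [and_assoc]

theorem isCompact_lifts : IsCompact {x : (ℤ → Cell g) × (ℤ → Circle × Circle) | S.IsLift A x.1 x.2} :=
  isClosed_isLift.isCompact

theorem continuous_codeOf : Continuous (S.codeOf A) :=
  continuous_pi fun k =>
    (continuous_of_discreteTopology (f := fun J => sig (S.ind A J))).comp (continuous_apply k)

variable (S A) in
/-- The pairs of the code and the geodesic of a lift. -/
def liftPairs : Set ((ℤ → Idx g) × (Circle × Circle)) :=
  {z | ∃ y q, S.IsLift A y q ∧ z = (S.codeOf A y, q 0)}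

theorem isCompact_liftPairs : IsCompact (S.liftPairs A) := by
  have h := (isCompact_lifts (S := S) (A := A)).image
    (f := fun x : (ℤ → Cell g) × (ℤ → Circle × Circle) => (S.codeOf A x.1, x.2 0))
    ((continuous_codeOf.comp continuous_fst).prodMk ((continuous_apply 0).comp continuous_snd))
  have : S.liftPairs A = (fun x : (ℤ → Cell g) × (ℤ → Circle × Circle) =>
      (S.codeOf A x.1, x.2 0)) '' {x | S.IsLift A x.1 x.2} := by
    ext z
    constructor
    · rintro ⟨y, q, h, rfl⟩
      exact ⟨(y, q), h, rfl⟩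
    · rintro ⟨⟨y, q⟩, h, rfl⟩
      exact ⟨y, q, h, rfl⟩
  rwa [this]

theorem liftPairs_unique (hA : S.IsExtremal A) {x : ℤ → Idx g} {p p' : Circle × Circle}
    (h : (x, p) ∈ S.liftPairs A) (h' : (x, p') ∈ S.liftPairs A) : p = p' := by
  obtain ⟨y, q, hq, e⟩ := h
  obtain ⟨y', q', hq', e'⟩ := h'
  obtain ⟨rfl, rfl⟩ := Prod.ext_iff.1 e
  obtain ⟨e1, rfl⟩ := Prod.ext_iff.1 e'
  exact hq.eq hA hq' e1 0

/-- Admissible pairs have lifts, and the pairs with lifts form a compact set, so the closure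
consists of pairs with lifts as well. -/
theorem IsAssociated.mem_liftPairs (hA : S.IsExtremal A) {x : ℤ → Idx g} {p : Circle × Circle}
    (h : S.IsAssociated A x p) : (x, p) ∈ S.liftPairs A := by
  refine closure_minimal ?_ isCompact_liftPairs.isClosed h
  rintro ⟨x, p⟩ h
  obtain ⟨y, q, h1, rfl, rfl⟩ := IsCode.exists_lift hA h
  exact ⟨y, q, h1, rfl⟩

/-- Orbits that agree with a given path on longer and longer windows have codes converging in the
product topology. Their regularity also gives the density of regular codes. -/
theorem exists_tendsto_codeOf (hA : S.IsExtremal A) {y : ℤ → Cell g}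
    (hy : ∀ k, S.Trans A (y k) (y (k + 1))) : ∃ (x : ℕ → ℤ → Idx g) (p : ℕ → Circle × Circle),
      (∀ n, S.IsCode A (x n) (p n) ∧ S.Reg (p n)) ∧
        Filter.Tendsto x Filter.atTop (𝓝 (S.codeOf A y)) := by
  choose y' q h1 h2 h3 h4 using exists_orbit_of_chain hA hy
  refine ⟨fun n => S.codeOf A (y' n), fun n => q n 0, fun n => ⟨(h1 n).isCode hA (h2 n), h3 n⟩, ?_⟩
  rw [tendsto_pi_nhds]
  intro k
  refine tendsto_const_nhds.congr' ?_
  filter_upwards [Filter.eventually_ge_atTop k.natAbs] with n hn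
  simp only [codeOf]
  rw [h4 n k (by omega) (by omega)]

theorem IsCode.mem_Omega {x : ℤ → Idx g} {p : Circle × Circle} (h : S.IsCode A x p) :
    p ∈ S.Omega A := by
  obtain ⟨q, rfl, h⟩ := h
  exact (h 0).1

theorem IsCode.mem_codeSpace {x : ℤ → Idx g} {p : Circle × Circle} (h : S.IsCode A x p) :
    x ∈ S.codeSpace A := subset_closure ⟨p, h.mem_Omega, h⟩

theorem mem_codeSpace_iff_exists_associated {x : ℤ → Idx g} :
    x ∈ S.codeSpace A ↔ ∃ p, S.IsAssociated A x p := by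
  set C := closure {y : (ℤ → Idx g) × (Circle × Circle) | S.IsCode A y.1 y.2} with hC
  have hcl : IsClosed (Prod.fst '' C) := (isClosed_closure.isCompact.image continuous_fst).isClosed
  constructor
  · intro h
    have : S.codeSpace A ⊆ Prod.fst '' C := by
      refine closure_minimal ?_ hcl
      rintro x ⟨p, -, h⟩
      exact ⟨(x, p), subset_closure h, rfl⟩
    obtain ⟨⟨x, p⟩, h1, rfl⟩ := this h
    exact ⟨p, h1⟩
  · rintro ⟨p, h⟩
    have h1 : x ∈ Prod.fst '' C := ⟨(x, p), h, rfl⟩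
    refine closure_mono ?_ (image_closure_subset_closure_image continuous_fst h1)
    rintro _ ⟨⟨x, p⟩, h, rfl⟩
    exact ⟨p, h.mem_Omega, h⟩

theorem codeOf_mem_codeSpace (hA : S.IsExtremal A) {y : ℤ → Cell g}
    (hy : ∀ k, S.Trans A (y k) (y (k + 1))) : S.codeOf A y ∈ S.codeSpace A := by
  obtain ⟨x, p, h, ht⟩ := exists_tendsto_codeOf hA hy
  exact isClosed_closure.mem_of_tendsto ht
    (Filter.Eventually.of_forall fun n => (h n).1.mem_codeSpace)

theorem mem_codeSpace_iff (hA : S.IsExtremal A) {x : ℤ → Idx g} :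
    x ∈ S.codeSpace A ↔ ∃ y, (∀ k, S.Trans A (y k) (y (k + 1))) ∧ S.codeOf A y = x := by
  constructor
  · intro h
    obtain ⟨p, h⟩ := mem_codeSpace_iff_exists_associated.1 h
    obtain ⟨y, q, hq, e⟩ := h.mem_liftPairs hA
    exact ⟨y, fun k => (hq k).1, (congrArg Prod.fst e).symm⟩
  · rintro ⟨y, hy, rfl⟩
    exact codeOf_mem_codeSpace hA hy

theorem isSofic_codeSpace (hA : S.IsExtremal A) : IsSofic (S.codeSpace A) := by
  let e : Cell g ≃ Fin (Fintype.card (Cell g)) := Fintype.equivFin _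
  refine ⟨_, fun a b => S.Trans A (e.symm a) (e.symm b), fun y => S.codeOf A (fun k => e.symm (y k)),
    ?_, ?_, fun y _ => rfl⟩
  · refine (continuous_codeOf.comp (continuous_pi fun k => ?_)).continuousOn
    exact continuous_of_discreteTopology.comp (continuous_apply k)
  · ext x
    rw [mem_codeSpace_iff hA]
    constructor
    · rintro ⟨y, hy, rfl⟩
      exact ⟨fun k => e.symm (y k), hy, rfl⟩
    · rintro ⟨y, hy, rfl⟩
      refine ⟨fun k => e (y k), fun k => ?_, ?_⟩
      · simpa only [Equiv.symm_apply_apply] using hy k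
      · simp only [Equiv.symm_apply_apply]

/-! ### The geodesic of a code -/

theorem existsUnique_isAssociated (hA : S.IsExtremal A) {x : ℤ → Idx g} (h : x ∈ S.codeSpace A) :
    ∃! p, S.IsAssociated A x p := by
  obtain ⟨p, hp⟩ := mem_codeSpace_iff_exists_associated.1 h
  exact ⟨p, hp, fun p' h' => liftPairs_unique hA (h'.mem_liftPairs hA) (hp.mem_liftPairs hA)⟩

theorem exists_lift (hA : S.IsExtremal A) {x : ℤ → Idx g} (h : x ∈ S.codeSpace A) :
    ∃ y q, S.IsLift A y q ∧ S.codeOf A y = x ∧ q 0 = S.geodesicOf A x := by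
  have h1 : S.IsAssociated A x (S.geodesicOf A x) :=
    Classical.epsilon_spec (mem_codeSpace_iff_exists_associated.1 h)
  obtain ⟨y, q, h2, e⟩ := h1.mem_liftPairs hA
  exact ⟨y, q, h2, (congrArg Prod.fst e).symm, (congrArg Prod.snd e).symm⟩

theorem IsLift.mem_codeSpace (hA : S.IsExtremal A) {y : ℤ → Cell g} {q : ℤ → Circle × Circle}
    (h : S.IsLift A y q) : S.codeOf A y ∈ S.codeSpace A :=
  codeOf_mem_codeSpace hA fun k => (h k).1

theorem IsLift.geodesicOf (hA : S.IsExtremal A) {y : ℤ → Cell g} {q : ℤ → Circle × Circle}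
    (h : S.IsLift A y q) : S.geodesicOf A (S.codeOf A y) = q 0 := by
  obtain ⟨y', q', h', e, e'⟩ := exists_lift hA (h.mem_codeSpace hA)
  rw [← e']
  exact h'.eq hA h e 0

theorem IsLift.shift {y : ℤ → Cell g} {q : ℤ → Circle × Circle} (h : S.IsLift A y q) (m : ℤ) :
    S.IsLift A (fun k => y (k + m)) (fun k => q (k + m)) := fun k => by
  have := h (k + m)
  rwa [add_right_comm] at this

theorem geodesicOf_mem_Omega (hA : S.IsExtremal A) {x : ℤ → Idx g} (h : x ∈ S.codeSpace A) :
    S.geodesicOf A x ∈ S.Omega A := by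
  obtain ⟨y, q, hq, -, e⟩ := exists_lift hA h
  rw [← e]
  exact (S.mem_Omega A).2 ⟨_, (hq 0).2.1, (hq 0).2.2.1⟩

/-- Ends in the half-open cell have honest orbits; the right end of the cell is a limit of them and
is reached by compactness. -/
theorem exists_eq_of_mem_Omega (hA : S.IsExtremal A) {p : Circle × Circle} (h : p ∈ S.Omega A) :
    ∃ x ∈ S.codeSpace A, S.geodesicOf A x = p := by
  obtain ⟨J, hu, hw⟩ := (S.mem_Omega A).1 h
  have hcl : IsClosed (Prod.snd '' S.liftPairs A) :=
    (isCompact_liftPairs.image continuous_snd).isClosed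
  have h1 : S.closedCell J ⊆ {w | (p.1, w) ∈ Prod.snd '' S.liftPairs A} := by
    rw [closedCell]
    refine (arcIcc_subset_closure (S.cellLo_ne_cellHi J)).trans (closure_minimal (fun w h => ?_)
      (hcl.preimage (Continuous.prodMk_right p.1)))
    obtain ⟨y, q, hq, -, -, e⟩ := exists_orbit hA (p := (p.1, w)) hu h
    exact ⟨_, ⟨y, q, hq, rfl⟩, e⟩
  obtain ⟨_, ⟨y, q, hq, rfl⟩, e⟩ := h1 hw
  exact ⟨_, hq.mem_codeSpace hA, by rw [hq.geodesicOf hA]; exact e⟩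

theorem IsCode.geodesicOf (hA : S.IsExtremal A) {x : ℤ → Idx g} {p : Circle × Circle}
    (h : S.IsCode A x p) : S.geodesicOf A x = p := by
  obtain ⟨y, q, hq, rfl, rfl⟩ := h.exists_lift hA
  exact hq.geodesicOf hA

theorem ends_ne_of_mem_Omega {p : Circle × Circle} (h : p ∈ S.Omega A) : p.1 ≠ p.2 := by
  obtain ⟨⟨i, t⟩, hu, hw⟩ := (S.mem_Omega A).1 h
  intro e
  rw [← e] at hw
  have hW := S.wrap i
  have hc := S.corner_chain A i
  rcases S.mem_closedCell hw with h1 | h1 <;> cases t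
  · rw [mem_fiber_false] at hu
    have h2 := ((mem_arcIco_base (S.P (i + 1)) (a := S.P i) (b := S.Q i) (by linarith)).1 h1).1
    linarith
  · rw [mem_fiber_true] at hu
    rcases (mem_arcIco_base_wrap (S.P (i + 1)) (a := S.Q i) (b := S.P (i + 1))
      (by linarith)).1 h1 with h2 | h2 <;> linarith
  · rw [mem_fiber_false, show p.1 = S.Q i from h1] at hu
    linarith
  · rw [mem_fiber_true, show p.1 = S.P (i + 1) from h1] at hu
    linarith

theorem codeSpace_subset_closure (hA : S.IsExtremal A) :
    S.codeSpace A ⊆ closure (S.regularCodes A) := by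
  intro x hx
  obtain ⟨y, hy, rfl⟩ := (mem_codeSpace_iff hA).1 hx
  obtain ⟨x, p, h, ht⟩ := exists_tendsto_codeOf hA hy
  refine mem_closure_of_tendsto ht (Filter.Eventually.of_forall fun n => ⟨(h n).1.mem_codeSpace, ?_⟩)
  rw [(h n).1.geodesicOf hA]
  exact (h n).2.2

theorem continuousOn_geodesicOf (hA : S.IsExtremal A) :
    ContinuousOn (S.geodesicOf A) (S.codeSpace A) := by
  refine continuousOn_of_isCompact (isCompact_liftPairs (S := S) (A := A)) continuous_fst
    continuous_snd fun x hx => ?_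
  obtain ⟨y, q, hq, rfl, e⟩ := exists_lift hA hx
  refine ⟨⟨_, ⟨y, q, hq, rfl⟩, rfl⟩, ?_⟩
  rintro ⟨_, _⟩ ⟨y', q', hq', e1⟩ e2
  obtain ⟨rfl, rfl⟩ := Prod.ext_iff.1 e1
  rw [← e]
  exact hq'.eq hA hq e2 0

end Surface
end GeodesicCoding

/-! ### A geodesic has finitely many codes -/

namespace GeodesicCoding

/-- Two properties that persist forward would hold together at a common later time. -/
theorem forall_not_or_forall_not {p q : ℤ → Prop} (hp : ∀ k, p k → p (k + 1))
    (hq : ∀ k, q k → q (k + 1)) (h : ∀ k, ¬ (p k ∧ q k)) : (∀ k, ¬ p k) ∨ ∀ k, ¬ q k := by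
  by_contra! hcon
  obtain ⟨⟨a, ha⟩, b, hb⟩ := hcon
  have key : ∀ {r : ℤ → Prop}, (∀ k, r k → r (k + 1)) → ∀ k, r k → ∀ n : ℕ, r (k + n) := by
    intro r hr k hk n
    induction n with
    | zero => simpa using hk
    | succ n ih =>
      have := hr _ ih
      rwa [add_assoc] at this
  have h1 := key hp a ha (max a b - a).toNat
  have h2 := key hq b hb (max a b - b).toNat
  rw [Int.toNat_of_nonneg (by omega), add_sub_cancel] at h1 h2
  exact h _ ⟨h1, h2⟩

namespace Surface

variable {g : ℕ} [hg : Fact (2 ≤ g)] {S : Surface g} {A : Idx g → Circle}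

theorem Trans.closedCell {J J' : Cell g} (h : S.Trans A J J') {x : Circle}
    (hx : x ∈ S.closedCell J') : S.T (sig (S.ind A J)) • x ∈ S.closedCell J := by
  refine arcIcc_subset_of_arcIco_subset (α := S.T (sig (S.ind A J)) • S.cellLo J')
    (β := S.T (sig (S.ind A J)) • S.cellHi J')
    (fun e => S.cellLo_ne_cellHi J' (MulAction.injective _ e)) (fun z hz => h.2 z ?_)
    ((smul_mem_arcIcc _).2 hx)
  refine (smul_mem_arcIco (S.T (sig (S.ind A J)))).1 ?_
  rwa [S.T_sig_T]

theorem fiber_lo_ne_hi (J : Cell g) : S.H A (J.1 + 1) ≠ S.fiberHi A J := by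
  obtain ⟨i, t⟩ := J
  have hW := S.wrap i
  have hc := S.corner_chain A i
  intro e
  cases t
  · have e' := congrArg (ccw (S.P (i + 1))) (show S.H A (i + 1) = S.G A (i - 2) from e)
    linarith
  · have e' := congrArg (ccw (S.P (i + 1))) (show S.H A (i + 1) = S.G A (i - 1) from e)
    linarith

theorem IsLift.apply_eq_smul {y : ℤ → Cell g} {q : ℤ → Circle × Circle} (h : S.IsLift A y q)
    (k : ℤ) : q k = S.T (S.codeOf A y k) • q (k + 1) := by
  rw [(h k).2.2.2, codeOf, T_sig_T_pair]

/-- The next cell is pulled back into the present one, so being at the left end of the cell persists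
forward, and so does being at the right end. For fibers, in `fiber_ne_lo_or_ne_hi`, the same happens
backward in time. -/
theorem IsLift.ne_lo_or_ne_hi {y : ℤ → Cell g} {q : ℤ → Circle × Circle} (h : S.IsLift A y q) :
    (∀ k, (q k).2 ≠ S.cellLo (y k)) ∨ ∀ k, (q k).2 ≠ S.cellHi (y k) := by
  refine forall_not_or_forall_not (fun k e => ?_) (fun k e => ?_)
    fun k hk => S.cellLo_ne_cellHi _ (hk.1.symm.trans hk.2)
  · refine eq_left_of_smul (fun x hx => (h k).1.closedCell hx) (h (k + 1)).2.2.1 ?_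
    exact (congrArg Prod.snd (h.apply_eq_smul k)).symm.trans e
  · refine eq_right_of_smul (fun x hx => (h k).1.closedCell hx) (h (k + 1)).2.2.1 ?_
    exact (congrArg Prod.snd (h.apply_eq_smul k)).symm.trans e

theorem IsLift.fiber_ne_lo_or_ne_hi {y : ℤ → Cell g} {q : ℤ → Circle × Circle}
    (h : S.IsLift A y q) : (∀ k, (q k).1 ≠ S.H A ((y k).1 + 1)) ∨
      ∀ k, (q k).1 ≠ S.fiberHi A (y k) := by
  have key := forall_not_or_forall_not (p := fun k => (q (-k)).1 = S.H A ((y (-k)).1 + 1))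
    (q := fun k => (q (-k)).1 = S.fiberHi A (y (-k))) (fun k e => ?_) (fun k e => ?_)
    fun k hk => S.fiber_lo_ne_hi _ (hk.1.symm.trans hk.2)
  · exact key.imp (fun H k => by simpa using H (-k)) fun H k => by simpa using H (-k)
  · have h1 := h (-(k + 1))
    rw [show -(k + 1) + 1 = -k by ring] at h1
    refine eq_left_of_smul (fun x hx => h1.1.1 x hx) h1.2.1 ?_
    rw [← e, h1.2.2.2]
    rfl
  · have h1 := h (-(k + 1))
    rw [show -(k + 1) + 1 = -k by ring] at h1
    refine eq_right_of_smul (fun x hx => h1.1.1 x hx) h1.2.1 ?_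
    rw [← e, h1.2.2.2]
    rfl

theorem closedCell_unique {J J' : Cell g} {w : Circle} (h : w ∈ S.closedCell J)
    (h' : w ∈ S.closedCell J') (hne : (w ≠ S.cellLo J ∧ w ≠ S.cellLo J') ∨
      (w ≠ S.cellHi J ∧ w ≠ S.cellHi J')) : J = J' := by
  have next : ∀ J : Cell g, S.cellHi J = S.cellLo (if J.2 then (J.1 + 1, false) else (J.1, true)) := by
    rintro ⟨i, _ | _⟩ <;> rfl
  rcases S.mem_closedCell h with h1 | h1 <;> rcases S.mem_closedCell h' with h2 | h2
  · exact S.cell_unique h1 h2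
  · rcases hne with hne | hne
    · rw [next] at h2
      have := S.cell_unique h1 (h2 ▸ S.cellLo_mem_cell _)
      rw [← this] at h2
      exact absurd h2 hne.1
    · exact absurd h2 hne.2
  · rcases hne with hne | hne
    · rw [next] at h1
      have := S.cell_unique h2 (h1 ▸ S.cellLo_mem_cell _)
      rw [← this] at h1
      exact absurd h1 hne.2
    · exact absurd h1 hne.1
  · rw [next] at h1 h2
    have := S.cell_unique (h1 ▸ S.cellLo_mem_cell _) (h2 ▸ S.cellLo_mem_cell _)
    obtain ⟨i, _ | _⟩ := J <;> obtain ⟨i', _ | _⟩ := J' <;> simp_all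

theorem tile_unique {m m' : Idx g} {u : Circle}
    (h : u ∈ arcIcc (S.cornerL A m) (S.cornerL A (m + 1)))
    (h' : u ∈ arcIcc (S.cornerL A m') (S.cornerL A (m' + 1)))
    (hne : (u ≠ S.cornerL A m ∧ u ≠ S.cornerL A m') ∨
      (u ≠ S.cornerL A (m + 1) ∧ u ≠ S.cornerL A (m' + 1))) : m = m' := by
  have hn := twelve_le g
  obtain ⟨d, hd, rfl⟩ := exists_offset m m'
  rcases Nat.eq_zero_or_pos d with rfl | hd0
  · simp
  exfalso
  have h1 := S.L_lt A m (d := 0) (e := 1) one_pos (by omega)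
  rw [Nat.cast_zero, add_zero, Nat.cast_one] at h1
  rw [mem_arcIcc_base (S.P m) h1.le] at h
  have hinj : ∀ {x : Circle}, u ≠ x → ccw (S.P m) u ≠ ccw (S.P m) x := fun h e =>
    h (ccw_injective _ e)
  have h7 := S.L_le A m (d := 1) hd0 hd
  rw [Nat.cast_one] at h7
  by_cases hd' : d + 1 < 8 * g - 4
  · rw [show m + d + 1 = m + ((d + 1 : ℕ) : Idx g) by push_cast; ring,
      mem_arcIcc_base (S.P m) (S.L_le A m (Nat.le_succ d) hd')] at h'
    rcases hne with hne | hne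
    · exact hinj hne.2 (le_antisymm (by linarith) h'.1)
    · exact hinj hne.1 (le_antisymm (by linarith) (by linarith))
  · have hd2 : d + 1 = 8 * g - 4 := by omega
    have e0 : m + (d : Idx g) + 1 = m := by rw [cast_eq_one_sub hd2]; ring
    have h8 := S.L_lt A m (d := 0) (e := d) hd0 hd
    rw [Nat.cast_zero, add_zero] at h8
    rw [e0] at h' hne
    rw [mem_arcIcc_base_wrap (S.P m) h8] at h'
    rcases hne with hne | hne
    · rcases h' with h' | h'
      · exact hinj hne.2 (le_antisymm (by linarith) h')
      · exact hinj hne.1 (le_antisymm h' h.1)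
    · rcases h' with h' | h'
      · exact hinj hne.1 (le_antisymm (by linarith) (by linarith))
      · exact hinj hne.2 (le_antisymm h' h.1)

variable (A) in
/-- The type of a lift: in each of its cells, and in each of its fibers, one end point is not
visited. -/
def HasType (y : ℤ → Cell g) (q : ℤ → Circle × Circle) (a b : Bool) : Prop :=
  (∀ k, (q k).2 ≠ if a then S.cellLo (y k) else S.cellHi (y k)) ∧
    ∀ k, (q k).1 ≠ if b then S.H A ((y k).1 + 1) else S.fiberHi A (y k)

theorem IsLift.exists_hasType {y : ℤ → Cell g} {q : ℤ → Circle × Circle} (h : S.IsLift A y q) :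
    ∃ a b, S.HasType A y q a b := by
  rcases h.ne_lo_or_ne_hi with h1 | h1 <;> rcases h.fiber_ne_lo_or_ne_hi with h2 | h2
  · exact ⟨true, true, h1, h2⟩
  · exact ⟨true, false, h1, h2⟩
  · exact ⟨false, true, h1, h2⟩
  · exact ⟨false, false, h1, h2⟩

/-- A point common to two different closed cells is the left end of one and the right end of the
other, and likewise for tiles. Knowing which kind is avoided therefore fixes the cells forward and
the code letters backward. -/
theorem codeOf_eq_of_hasType (hA : S.IsExtremal A) {y y' : ℤ → Cell g} {q q' : ℤ → Circle × Circle}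
    (h : S.IsLift A y q) (h' : S.IsLift A y' q') {a b : Bool} (ht : S.HasType A y q a b)
    (ht' : S.HasType A y' q' a b) (e : q 0 = q' 0) : S.codeOf A y = S.codeOf A y' := by
  have cellEq : ∀ k, q k = q' k → y k = y' k := fun k hk => by
    have h1 := (h' k).2.2.1
    have h2 := ht'.1 k
    rw [← hk] at h1 h2
    refine closedCell_unique (h k).2.2.1 h1 ?_
    cases a
    · exact .inr ⟨ht.1 k, h2⟩
    · exact .inl ⟨ht.1 k, h2⟩
  have tile : ∀ {y q}, S.IsLift A y q → S.HasType A y q a b → ∀ k,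
      (q (k + 1)).1 ∈ arcIcc (S.cornerL A (S.codeOf A y k)) (S.cornerL A (S.codeOf A y k + 1)) ∧
      (q (k + 1)).1 ≠ if b then S.cornerL A (S.codeOf A y k) else
        S.cornerL A (S.codeOf A y k + 1) := by
    intro y q h ht k
    rw [(h k).2.2.2]
    refine ⟨fiber_image hA (h k).2.1, fun e => ?_⟩
    cases b
    · exact ht.2 k (eq_right_of_smul (fun x hx => fiber_image hA hx) (h k).2.1 e)
    · exact ht.2 k (eq_left_of_smul (fun x hx => fiber_image hA hx) (h k).2.1 e)
  have fwd : ∀ n : ℕ, q n = q' n := fun n => by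
    induction n with
    | zero => exact e
    | succ n ih => rw [Nat.cast_succ, (h n).2.2.2, (h' n).2.2.2, cellEq _ ih, ih]
  have tileEq : ∀ k, q (k + 1) = q' (k + 1) → S.codeOf A y k = S.codeOf A y' k := fun k hk => by
    have h1 := tile h ht k
    have h2 := tile h' ht' k
    rw [← hk] at h2
    refine tile_unique h1.1 h2.1 ?_
    cases b
    · exact .inr ⟨h1.2, h2.2⟩
    · exact .inl ⟨h1.2, h2.2⟩
  have bwd : ∀ n : ℕ, q (-n) = q' (-n) := fun n => by
    induction n with
    | zero => simpa using e
    | succ n ih =>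
      have e1 : -((n + 1 : ℕ) : ℤ) + 1 = -n := by push_cast; ring
      rw [← e1] at ih
      rw [h.apply_eq_smul, h'.apply_eq_smul, tileEq _ ih, ih]
  funext k
  rcases Int.eq_nat_or_neg k with ⟨n, rfl | rfl⟩
  · rw [codeOf, codeOf, cellEq _ (fwd n)]
  · rw [codeOf, codeOf, cellEq _ (bwd n)]

/-- There are four types, each with at most one code. -/
theorem finite_geodesicOf_eq (hA : S.IsExtremal A) (p : Circle × Circle) :
    {x ∈ S.codeSpace A | S.geodesicOf A x = p}.Finite := by
  have h : ∀ t : Bool × Bool, {x | ∃ y q, S.IsLift A y q ∧ S.HasType A y q t.1 t.2 ∧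
      S.codeOf A y = x ∧ q 0 = p}.Finite := by
    refine fun t => Set.Subsingleton.finite ?_
    rintro _ ⟨y, q, h1, h2, rfl, h3⟩ _ ⟨y', q', h1', h2', rfl, h3'⟩
    exact codeOf_eq_of_hasType hA h1 h1' h2 h2' (h3.trans h3'.symm)
  refine (Set.finite_iUnion h).subset ?_
  rintro x ⟨hx, rfl⟩
  obtain ⟨y, q, h1, h2, h3⟩ := exists_lift hA hx
  obtain ⟨a, b, h4⟩ := h1.exists_hasType
  exact Set.mem_iUnion.2 ⟨(a, b), y, q, h1, h4, h2, h3⟩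

end Surface
end GeodesicCoding

namespace GeodesicCoding

namespace Surface

variable {g : ℕ} [hg : Fact (2 ≤ g)] {S : Surface g} {A : Idx g → Circle}

/-! ### Continuity of the section -/

variable (S) in
/-- The tangent vectors in the polygon that have not been in its interior before. -/
def weakEntries : Set UnitTangent :=
  {v | v.base ∈ S.F ∧ ∀ t < 0, (diskFlow t v).base ∉ S.openF}

theorem isCompact_weakEntries : IsCompact S.weakEntries := by
  obtain ⟨r, hr, hF⟩ := S.exists_norm_le_of_mem_F
  refine (isCompact_norm_base_le hr).of_isClosed_subset ?_ fun v hv => hF _ hv.1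
  have h1 : IsClosed {v : UnitTangent | v.base ∈ S.F} := S.isClosed_F.preimage continuous_base'
  have h2 : ∀ t, IsClosed {v : UnitTangent | t < 0 → (diskFlow t v).base ∉ S.openF} := fun t => by
    by_cases ht : t < 0
    · simp only [ht, true_imp_iff]
      exact S.isOpen_openF.isClosed_compl.preimage (continuous_base'.comp
        (continuous_diskFlow.comp (continuous_const.prodMk continuous_id)))
    · simp [ht]
  have : S.weakEntries = {v : UnitTangent | v.base ∈ S.F} ∩
      ⋂ t : ℝ, {v : UnitTangent | t < 0 → (diskFlow t v).base ∉ S.openF} := by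
    ext v
    simp [weakEntries]
  rw [this]
  exact h1.inter (isClosed_iInter h2)

/-- Entering is not a closed condition; not having been in the open polygon before is. For regular
geodesics they agree, because after its entrance such a geodesic runs inside the open polygon. -/
theorem mem_weakEntries_iff {v : UnitTangent} (hp : S.Reg (ends v)) :
    v ∈ S.weakEntries ↔ Enters v S.F := by
  refine ⟨fun h => ?_, fun h => ⟨h.1, fun t ht h' => h.2 t ht (S.openF_subset_F h')⟩⟩
  obtain ⟨v0, e, hE⟩ := S.exists_enters hp ⟨v, rfl, h.1⟩
  obtain ⟨t, rfl⟩ := exists_diskFlow_eq e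
  rw [ends_diskFlow] at hp
  rcases lt_trichotomy t 0 with ht | rfl | ht
  · exact absurd h.1 (hE.2 t ht)
  · rwa [diskFlow_zero]
  · exfalso
    obtain ⟨-, b, -, -, hb, hb'⟩ := S.exists_sides_of_enters hp hE
    obtain ⟨τ, hτ, -, hint⟩ := S.exists_cross hp hE hb hb'
    have hm := min_le_left t τ
    have hm' := min_le_right t τ
    have h0 : 0 < min t τ := lt_min ht hτ
    refine h.2 (min t τ / 2 - t) (by linarith) ?_
    rw [← diskFlow_add, add_sub_cancel]
    exact hint _ (by linarith) (by linarith)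

variable (S) in
/-- A closed condition that describes the section points with regular geodesics. -/
def weakSection : Set UnitTangent :=
  S.weakEntries ∪ ⋃ k, ({v | S.IsUpper k (ends v) ∧ 0 ≤ S.vpos (ends v) k} ∪
    {v | S.IsLower k (ends v) ∧ S.vpos (ends v) k ≤ 0}) ∩ (fun v => S.U k • v) '' S.weakEntries

theorem continuous_vpos (k : Idx g) : Continuous fun p : Circle × Circle => S.vpos p k := by
  have h1 : Continuous fun p : Circle × Circle => (p.1 : ℂ) :=
    circle_isEmbedding.continuous.comp continuous_fst
  have h2 : Continuous fun p : Circle × Circle => (p.2 : ℂ) :=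
    circle_isEmbedding.continuous.comp continuous_snd
  simp only [vpos, sidePos]
  fun_prop

theorem isCompact_weakSection : IsCompact S.weakSection := by
  refine isCompact_weakEntries.union (isCompact_iUnion fun k => IsCompact.inter_left
    (isCompact_weakEntries.image (continuous_smul_tangent _)) ?_)
  have hv : Continuous fun v => S.vpos (ends v) k := (continuous_vpos k).comp continuous_ends
  have h1 := continuous_fst.comp continuous_ends
  have h2 := continuous_snd.comp continuous_ends
  exact ((((isClosed_arcIcc _ _).preimage h1).inter ((isClosed_arcIcc _ _).preimage h2)).inter
    (isClosed_le continuous_const hv)).union ((((isClosed_arcIcc _ _).preimage h1).inter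
      ((isClosed_arcIcc _ _).preimage h2)).inter (isClosed_le hv continuous_const))

theorem mem_weakSection_iff {v : UnitTangent} (hp : S.Reg (ends v)) :
    v ∈ S.weakSection ↔ S.IsSectionPoint v := by
  have himg : ∀ k, v ∈ (fun v => S.U k • v) '' S.weakEntries ↔ Enters ((S.U k)⁻¹ • v) S.F := by
    intro k
    rw [← mem_weakEntries_iff (by rw [ends_smul']; exact hp.smul (S.Gam.inv_mem (S.U_mem k)))]
    constructor
    · rintro ⟨v, hv, rfl⟩
      rwa [inv_smul_smul]
    · exact fun h => ⟨_, h, smul_inv_smul _ _⟩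
  rw [isSectionPoint_iff, weakSection, Set.mem_union, mem_weakEntries_iff hp]
  simp only [Set.mem_iUnion, Set.mem_inter_iff, Set.mem_union, himg, Set.mem_ofPred_eq]
  constructor
  · rintro (h | ⟨k, h | h, hE⟩)
    · exact .inl h
    · exact .inr ⟨fun hm => h.2.not_gt ((h.1.meets_iff hp).1 hm), k, .inl h.1, hE⟩
    · exact .inr ⟨fun hm => h.2.not_gt ((h.1.meets_iff hp).1 hm), k, .inr h.1, hE⟩
  · rintro (h | ⟨hm, k, h | h, hE⟩)
    · exact .inl h
    · exact .inr ⟨k, .inl ⟨h, not_lt.1 fun h' => hm ((h.meets_iff hp).2 h')⟩, hE⟩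
    · exact .inr ⟨k, .inr ⟨h, not_lt.1 fun h' => hm ((h.meets_iff hp).2 h')⟩, hE⟩

/-- Over regular geodesics the section points are exactly the vectors of the compact set
`weakSection`, one for each geodesic, so the closed graph argument applies. -/
theorem continuousOn_sectionPoint : ContinuousOn S.sectionPoint {p | p ∈ S.Omega A ∧ S.Reg p} := by
  refine continuousOn_of_isCompact (isCompact_weakSection (S := S)) continuous_ends continuous_id
    fun p ⟨hO, hp⟩ => ?_
  obtain ⟨h1, h2⟩ := sectionPoint_spec hO hp
  have hp' : S.Reg (ends (S.sectionPoint p)) := by rwa [h1]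
  refine ⟨⟨_, (mem_weakSection_iff hp').2 h2, h1⟩, ?_⟩
  rintro v hv rfl
  exact (sectionPoint_eq hp ((mem_weakSection_iff hp).1 hv)).symm

/-! ### The coding map -/

theorem reg_geodesicOf (hA : S.IsExtremal A) {x : ℤ → Idx g} (h : x ∈ S.regularCodes A) :
    S.Reg (S.geodesicOf A x) :=
  ⟨ends_ne_of_mem_Omega (geodesicOf_mem_Omega hA h.1), h.2⟩

theorem section_geodesicOf (hA : S.IsExtremal A) {x : ℤ → Idx g} (h : x ∈ S.regularCodes A) :
    ends (S.sectionPoint (S.geodesicOf A x)) = S.geodesicOf A x ∧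
      S.IsSectionPoint (S.sectionPoint (S.geodesicOf A x)) :=
  sectionPoint_spec (geodesicOf_mem_Omega hA h.1) (reg_geodesicOf hA h)

theorem continuous_proj : Continuous S.proj := continuous_quotient_mk'

theorem continuousOn_lift (hA : S.IsExtremal A) :
    ContinuousOn (fun x => S.sectionPoint (S.geodesicOf A x)) (S.regularCodes A) :=
  continuousOn_sectionPoint.comp ((continuousOn_geodesicOf hA).mono fun _ h => h.1)
    fun _ h => ⟨geodesicOf_mem_Omega hA h.1, reg_geodesicOf hA h⟩

theorem continuousOn_Cod (hA : S.IsExtremal A) : ContinuousOn (S.Cod A) (S.regularCodes A) :=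
  continuous_proj.comp_continuousOn (continuousOn_lift hA)

theorem proj_eq_iff {v v' : UnitTangent} : S.proj v = S.proj v' ↔ ∃ γ ∈ S.Gam, γ • v = v' := by
  constructor
  · intro h
    obtain ⟨⟨γ, hγ⟩, h⟩ := Quotient.exact h.symm
    exact ⟨γ, hγ, h⟩
  · rintro ⟨γ, hγ, rfl⟩
    exact (proj_smul hγ v).symm

theorem reg_ends {v : UnitTangent} (h : S.AvoidsVertices (ends v)) : S.Reg (ends v) := ⟨ends_ne v, h⟩

theorem proj_mem_regularVectors_iff {v : UnitTangent} :
    S.proj v ∈ S.regularVectors ↔ S.Reg (ends v) := by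
  refine ⟨fun ⟨v', h, e⟩ => ?_, fun h => ⟨v, h.2, rfl⟩⟩
  obtain ⟨γ, hγ, rfl⟩ := proj_eq_iff.1 e
  rw [ends_smul']
  exact (reg_ends h).smul hγ

theorem flow_proj (t : ℝ) (v : UnitTangent) : S.flow t (S.proj v) = S.proj (diskFlow t v) := rfl

theorem image_Cod (hA : S.IsExtremal A) :
    S.Cod A '' S.regularCodes A = S.crossSection A ∩ S.regularVectors := by
  ext v
  constructor
  · rintro ⟨x, hx, rfl⟩
    obtain ⟨h1, h2⟩ := section_geodesicOf hA hx
    exact ⟨⟨_, ⟨by rw [h1]; exact geodesicOf_mem_Omega hA hx.1, h2⟩, rfl⟩,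
      _, (show S.AvoidsVertices (ends _) by rw [h1]; exact hx.2), rfl⟩
  · rintro ⟨⟨v, ⟨hO, hs⟩, rfl⟩, hr⟩
    have hp := proj_mem_regularVectors_iff.1 hr
    obtain ⟨x, hx, e⟩ := exists_eq_of_mem_Omega hA hO
    refine ⟨x, ⟨hx, by rw [e]; exact hp.2⟩, ?_⟩
    rw [Cod, e, sectionPoint_eq hp hs]

theorem finite_isSectionPoint_orbit (v : UnitTangent) :
    {γ : SU11 | γ ∈ S.Gam ∧ S.IsSectionPoint (γ • v)}.Finite := by
  obtain ⟨r, hr, hF⟩ := S.exists_norm_le_of_mem_F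
  have h0 : {γ : SU11 | γ ∈ S.Gam ∧ γ • v.base ∈ S.F}.Finite := by
    refine (S.finite_norm_le (max_lt hr v.base.norm_lt_one)).subset fun γ hγ => ?_
    exact ⟨hγ.1, v.base, le_max_right _ _, (hF _ hγ.2).trans (le_max_left _ _)⟩
  have h1 : ∀ k, {γ : SU11 | γ ∈ S.Gam ∧ (S.U k)⁻¹ • γ • v.base ∈ S.F}.Finite := fun k => by
    refine (h0.image fun γ => S.U k * γ).subset ?_
    rintro γ ⟨h1, h2⟩
    exact ⟨(S.U k)⁻¹ * γ, ⟨S.Gam.mul_mem (S.Gam.inv_mem (S.U_mem k)) h1, by rwa [mul_smul]⟩,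
      mul_inv_cancel_left _ _⟩
  refine (h0.union (Set.finite_iUnion h1)).subset ?_
  rintro γ ⟨hγ, h⟩
  rcases h.base_mem with h | ⟨k, h⟩
  · exact .inl ⟨hγ, h⟩
  · exact .inr (Set.mem_iUnion.2 ⟨k, hγ, h⟩)

/-- Finitely many translates of a tangent vector are section points, and each translated geodesic
has finitely many codes. -/
theorem finite_Cod_eq (hA : S.IsExtremal A) (v : S.SM) :
    {x ∈ S.regularCodes A | S.Cod A x = v}.Finite := by
  obtain ⟨v, rfl⟩ := Quotient.exists_rep v
  refine ((finite_isSectionPoint_orbit (S := S) v).biUnion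
    fun γ _ => finite_geodesicOf_eq hA (γ • ends v)).subset ?_
  rintro x ⟨hx, e⟩
  obtain ⟨h1, h2⟩ := section_geodesicOf hA hx
  obtain ⟨γ, hγ, e⟩ := proj_eq_iff.1 (show S.proj v = S.proj _ from e.symm)
  refine Set.mem_biUnion (x := γ) ⟨hγ, by rwa [e]⟩ ⟨hx.1, ?_⟩
  rw [← h1, ← e, ends_smul']

/-! ### The shift and the first return -/

theorem shift_codeOf (y : ℤ → Cell g) :
    GeodesicCoding.shift (S.codeOf A y) = S.codeOf A (fun k => y (k + 1)) := rfl

theorem geodesicOf_shift (hA : S.IsExtremal A) {x : ℤ → Idx g} (h : x ∈ S.codeSpace A) :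
    GeodesicCoding.shift x ∈ S.codeSpace A ∧
      ∃ J, (S.geodesicOf A x).1 ∈ S.fiber A J ∧ (S.geodesicOf A x).2 ∈ S.closedCell J ∧
        S.geodesicOf A (GeodesicCoding.shift x) = S.T (S.ind A J) • S.geodesicOf A x := by
  obtain ⟨y, q, hq, rfl, e⟩ := exists_lift hA h
  rw [shift_codeOf]
  refine ⟨(hq.shift 1).mem_codeSpace hA, y 0, ?_, ?_, ?_⟩
  · rw [← e]; exact (hq 0).2.1
  · rw [← e]; exact (hq 0).2.2.1
  · rw [(hq.shift 1).geodesicOf hA, ← e]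
    exact (hq 0).2.2.2

theorem bijOn_shift (hA : S.IsExtremal A) :
    Set.BijOn GeodesicCoding.shift (S.regularCodes A) (S.regularCodes A) := by
  refine ⟨fun x hx => ?_, fun x _ x' _ e => ?_, fun x hx => ?_⟩
  · obtain ⟨h1, J, -, -, e⟩ := geodesicOf_shift hA hx.1
    refine ⟨h1, ?_⟩
    rw [e]
    exact ((reg_geodesicOf hA hx).smul (S.T_mem _)).2
  · funext k
    have := congrFun e (k - 1)
    simpa [GeodesicCoding.shift] using this
  · obtain ⟨y, q, hq, rfl, e⟩ := exists_lift hA hx.1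
    have h1 := hq.shift (-1)
    have e1 : GeodesicCoding.shift (S.codeOf A fun k => y (k + -1)) = S.codeOf A y := by
      rw [shift_codeOf]
      simp
    refine ⟨_, ⟨h1.mem_codeSpace hA, ?_⟩, e1⟩
    rw [h1.geodesicOf hA]
    have h2 := hq.apply_eq_smul (-1)
    rw [show (-1 : ℤ) + 1 = 0 by norm_num, e] at h2
    simp only [zero_add]
    rw [h2]
    exact ((reg_geodesicOf hA hx).smul (S.T_mem _)).2

/-- The time from `section_step` is a return. There is no earlier one because every visit to the
cross-section is an entrance into a tile. -/
theorem isLeast_ceiling (hA : S.IsExtremal A) {x : ℤ → Idx g} (hx : x ∈ S.regularCodes A) :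
    IsLeast {t | 0 < t ∧ S.flow t (S.Cod A x) ∈ S.crossSection A} (S.ceiling A x) ∧
      S.flow (S.ceiling A x) (S.Cod A x) = S.Cod A (GeodesicCoding.shift x) := by
  obtain ⟨h1, h2⟩ := section_geodesicOf hA hx
  obtain ⟨hs, J, hu, hw, e⟩ := geodesicOf_shift hA hx.1
  have hp := reg_geodesicOf hA hx
  set v := S.sectionPoint (S.geodesicOf A x) with hv
  rw [← h1] at hu hw hp
  obtain ⟨τ, hτ, h3, h4⟩ := section_step hA hp h2 hu hw
  have hC : S.Cod A x = S.proj v := rfl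
  have hleast : IsLeast {t | 0 < t ∧ S.flow t (S.Cod A x) ∈ S.crossSection A} τ := by
    refine ⟨⟨hτ, ?_⟩, fun t ⟨ht, ht'⟩ => ?_⟩
    · rw [hC, flow_proj, proj_mem_crossSection_iff (by rwa [ends_diskFlow])]
      obtain ⟨γ, hγ, h5⟩ := h3.exists_enters
      exact ⟨γ * S.T (S.ind A J), S.Gam.mul_mem hγ (S.T_mem _), by rwa [mul_smul]⟩
    · by_contra! hlt
      rw [hC, flow_proj] at ht'
      obtain ⟨γ, hγ, h5⟩ := exists_enters_of_proj_mem ht'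
      exact h4 t ht hlt γ hγ h5
  have hce : S.ceiling A x = τ := hleast.csInf_eq
  rw [hce]
  refine ⟨hleast, ?_⟩
  have e2 : S.geodesicOf A (GeodesicCoding.shift x) = ends (S.T (S.ind A J) • diskFlow τ v) := by
    rw [e, ends_smul', ends_diskFlow, h1]
  rw [hC, flow_proj, ← proj_smul (S.T_mem (S.ind A J)), Cod, e2, sectionPoint_eq ?_ h3]
  rw [ends_smul', ends_diskFlow]
  exact hp.smul (S.T_mem _)

/-! ### Recurrence to the cross-section -/

theorem exists_times_forward {v : UnitTangent} (hp : S.Reg (ends v)) (hv : Enters v S.F) (t₀ : ℝ) :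
    ∃ t > t₀, ∃ γ ∈ S.Gam, Enters (γ • diskFlow t v) S.F := by
  obtain ⟨t, -, ht⟩ := exists_seq_of_step (α := ℝ)
    (p := fun (_ : ℕ) (s : ℝ) => ∃ γ ∈ S.Gam, Enters (γ • diskFlow s v) S.F)
    (r := fun (_ : ℕ) (s s' : ℝ) => s < s') (a := (0 : ℝ))
    ⟨1, S.Gam.one_mem, by rwa [one_smul, diskFlow_zero]⟩ (by
      rintro - s ⟨γ, hγ, h⟩
      have hp' : S.Reg (ends (γ • diskFlow s v)) := by
        rw [ends_smul', ends_diskFlow]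
        exact hp.smul hγ
      obtain ⟨-, b, -, -, hb, hb'⟩ := S.exists_sides_of_enters hp' h
      obtain ⟨τ, hτ, h1, -⟩ := S.exists_cross hp' h hb hb'
      rw [diskFlow_smul, ← diskFlow_add, ← mul_smul] at h1
      exact ⟨s + τ, ⟨_, S.Gam.mul_mem (S.T_mem b) hγ, h1⟩, by linarith⟩)
  have h := tendsto_of_enters (S := S) (v := v) (strictMono_nat_of_lt_succ fun n => (ht n).2)
    fun n => (ht n).1
  obtain ⟨n, hn⟩ := (h.eventually (Filter.eventually_gt_atTop t₀)).exists
  exact ⟨t n, hn, (ht n).1⟩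

theorem exists_times_backward {v : UnitTangent} (hp : S.Reg (ends v)) (hv : Enters v S.F) (t₀ : ℝ) :
    ∃ t < t₀, ∃ γ ∈ S.Gam, Enters (γ • diskFlow t v) S.F := by
  obtain ⟨t, -, ht⟩ := exists_seq_of_step (α := ℝ)
    (p := fun (_ : ℕ) (s : ℝ) => ∃ γ ∈ S.Gam, Enters (γ • diskFlow (-s) v) S.F)
    (r := fun (_ : ℕ) (s s' : ℝ) => s < s') (a := (0 : ℝ))
    ⟨1, S.Gam.one_mem, by rwa [one_smul, neg_zero, diskFlow_zero]⟩ (by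
      rintro - s ⟨γ, hγ, h⟩
      have hp' : S.Reg (ends (γ • diskFlow (-s) v)) := by
        rw [ends_smul', ends_diskFlow]
        exact hp.smul hγ
      obtain ⟨a, v', τ, hτ, h1, h2⟩ := S.exists_cross_back hp' h
      have e : v' = (S.T (sig a) * γ) • diskFlow (-(s + τ)) v := by
        rw [mul_smul, neg_add, diskFlow_add, ← diskFlow_smul γ (-τ), ← h2, diskFlow_smul,
          T_sig_T_tangent, ← diskFlow_add, add_neg_cancel, diskFlow_zero]
      exact ⟨s + τ, ⟨_, S.Gam.mul_mem (S.T_mem _) hγ, by rwa [← e]⟩, by linarith⟩)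
  have h := tendsto_of_enters_neg (S := S) (v := v) (strictMono_nat_of_lt_succ fun n => (ht n).2)
    fun n => (ht n).1
  obtain ⟨n, hn⟩ := (h.eventually (Filter.eventually_gt_atTop (-t₀))).exists
  exact ⟨-t n, by linarith, (ht n).1⟩

/-- A regular vector is on the way from an entrance into a polygon. -/
theorem exists_enters_orbit {v : UnitTangent} (hp : S.Reg (ends v)) :
    ∃ γ ∈ S.Gam, ∃ s, Enters (γ • diskFlow s v) S.F := by
  obtain ⟨γ, hγ, h⟩ := S.covers v.base
  have hp' : S.Reg (ends (γ • v)) := by rw [ends_smul']; exact hp.smul hγ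
  obtain ⟨v', e, h'⟩ := S.exists_enters hp' ⟨γ • v, rfl, h⟩
  obtain ⟨t, rfl⟩ := exists_diskFlow_eq e.symm
  exact ⟨γ, hγ, t, by rwa [← diskFlow_smul]⟩

theorem visits_crossSection {v : S.SM} (hv : v ∈ S.regularVectors) (t₀ : ℝ) :
    (∃ t > t₀, S.flow t v ∈ S.crossSection A) ∧ ∃ t < t₀, S.flow t v ∈ S.crossSection A := by
  obtain ⟨v, hv, rfl⟩ := hv
  have hp := reg_ends hv
  obtain ⟨γ, hγ, s, hE⟩ := exists_enters_orbit hp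
  have hp' : S.Reg (ends (γ • diskFlow s v)) := by
    rw [ends_smul', ends_diskFlow]
    exact hp.smul hγ
  have key : ∀ t, (∃ δ ∈ S.Gam, Enters (δ • diskFlow t (γ • diskFlow s v)) S.F) →
      S.flow (s + t) (S.proj v) ∈ S.crossSection A := by
    rintro t ⟨δ, hδ, h⟩
    rw [flow_proj, proj_mem_crossSection_iff (by rwa [ends_diskFlow])]
    refine ⟨δ * γ, S.Gam.mul_mem hδ hγ, ?_⟩
    rwa [mul_smul, diskFlow_add, ← diskFlow_smul]
  obtain ⟨t, ht, h⟩ := exists_times_forward hp' hE (t₀ - s)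
  obtain ⟨t', ht', h'⟩ := exists_times_backward hp' hE (t₀ - s)
  exact ⟨⟨s + t, by linarith, key t h⟩, s + t', by linarith, key t' h'⟩

end Surface
end GeodesicCoding

namespace GeodesicCoding

namespace Surface

variable {g : ℕ} [hg : Fact (2 ≤ g)] {S : Surface g} {A : Idx g → Circle}

/-! ### The special flow -/

theorem flow_add (s t : ℝ) (v : S.SM) : S.flow (s + t) v = S.flow t (S.flow s v) := by
  obtain ⟨v, rfl⟩ := Quotient.exists_rep v
  exact congrArg S.proj (diskFlow_add s t v)

theorem flow_zero (v : S.SM) : S.flow 0 v = v := by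
  obtain ⟨v, rfl⟩ := Quotient.exists_rep v
  exact congrArg S.proj (diskFlow_zero v)

theorem flow_mem_regularVectors {v : S.SM} (hv : v ∈ S.regularVectors) (t : ℝ) :
    S.flow t v ∈ S.regularVectors := by
  obtain ⟨v, hv, rfl⟩ := hv
  exact ⟨diskFlow t v, by rwa [Set.mem_ofPred_eq, ends_diskFlow], rfl⟩

theorem Cod_mem (hA : S.IsExtremal A) {x : ℤ → Idx g} (hx : x ∈ S.regularCodes A) :
    S.Cod A x ∈ S.crossSection A ∩ S.regularVectors := by
  rw [← image_Cod hA]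
  exact ⟨x, hx, rfl⟩

theorem finite_visits (v : S.SM) (a b : ℝ) :
    {t | t ∈ Set.Icc a b ∧ S.flow t v ∈ S.crossSection A}.Finite := by
  obtain ⟨v, rfl⟩ := Quotient.exists_rep v
  exact (S.finite_enter_times v a b).subset fun t ht => ⟨ht.1, exists_enters_of_proj_mem ht.2⟩

theorem mk_shift (hA : S.IsExtremal A) {x : ℤ → Idx g} (hx : x ∈ S.regularCodes A) (s : ℝ) :
    SpecialFlowSpace.mk (S.ceiling A) ⟨x, hx⟩ (s + S.ceiling A x) =
      SpecialFlowSpace.mk (S.ceiling A) ⟨GeodesicCoding.shift x, (bijOn_shift hA).mapsTo hx⟩ s :=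
  Quot.sound ⟨rfl, rfl⟩

/-- Points of the special flow that are mapped to the same vector can be represented with the
same height. -/
theorem exists_mk_eq (hA : S.IsExtremal A) {v : S.SM} {t₁ : ℝ} (h₁ : S.flow t₁ v ∈ S.crossSection A)
    {x : ℤ → Idx g} (hx : x ∈ S.regularCodes A) {s : ℝ} (h : S.flow s (S.Cod A x) = v) :
    ∃ x', ∃ hx' : x' ∈ S.regularCodes A, SpecialFlowSpace.mk (S.ceiling A) ⟨x, hx⟩ s =
      SpecialFlowSpace.mk (S.ceiling A) ⟨x', hx'⟩ (-t₁) := by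
  have hback : ∀ {x s}, S.flow s (S.Cod A x) = v → ∀ t, S.flow t v = S.flow (s + t) (S.Cod A x) :=
    fun h t => by rw [flow_add, h]
  have hvis : ∀ {x s}, x ∈ S.regularCodes A → S.flow s (S.Cod A x) = v →
      S.flow (-s) v ∈ S.crossSection A := fun hx h => by
    rw [hback h, add_neg_cancel, flow_zero]
    exact (Cod_mem hA hx).1
  have hshift : ∀ {x s}, x ∈ S.regularCodes A → S.flow (s + S.ceiling A x) (S.Cod A x) = v →
      S.flow s (S.Cod A (GeodesicCoding.shift x)) = v := fun hx h => by
    rwa [← (isLeast_ceiling hA hx).2, ← flow_add, add_comm]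
  -- The visits to the cross-section between the times −s and t₁. Each change of representative
  -- towards t₁ removes at least one of them, so induction runs on their number.
  let V (a b : ℝ) : Set ℝ := {t | t ∈ Set.Icc a b ∧ S.flow t v ∈ S.crossSection A}
  have hV : ∀ a b, (V a b).Finite := fun a b => finite_visits v a b
  rcases le_total (-s) t₁ with hle | hle
  · obtain ⟨n, hn⟩ : ∃ n, (V (-s) t₁).ncard ≤ n := ⟨_, le_rfl⟩
    induction n generalizing x s with
    | zero =>
      rw [Nat.le_zero, Set.ncard_eq_zero (hV _ _)] at hn
      exact absurd (show t₁ ∈ V (-s) t₁ from ⟨⟨hle, le_rfl⟩, h₁⟩) (hn ▸ Set.notMem_empty _)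
    | succ n ih =>
      rcases eq_or_lt_of_le hle with e | hlt
      · exact ⟨x, hx, by rw [← e, neg_neg]⟩
      obtain ⟨s, rfl⟩ : ∃ s', s = s' + S.ceiling A x := ⟨s - S.ceiling A x, by ring⟩
      have hl := (isLeast_ceiling hA hx).1
      -- The visit at t₁ is still ahead, so the first return comes no later and does not overshoot
      -- it.
      have h1 : S.ceiling A x ≤ s + S.ceiling A x + t₁ :=
        hl.2 ⟨by linarith, by rwa [← hback h]⟩
      have h0 : 0 < S.ceiling A x := hl.1.1
      rw [mk_shift hA hx]
      refine ih _ (hshift hx h) (by linarith) ?_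
      have hss : V (-s) t₁ ⊂ V (-(s + S.ceiling A x)) t₁ := by
        refine ⟨fun t ht => ⟨⟨by linarith [ht.1.1], ht.1.2⟩, ht.2⟩, fun hcon => ?_⟩
        have := (hcon ⟨⟨le_rfl, hle⟩, hvis hx h⟩).1.1
        linarith
      have := Set.ncard_lt_ncard hss (hV _ _)
      omega
  · obtain ⟨n, hn⟩ : ∃ n, (V t₁ (-s)).ncard ≤ n := ⟨_, le_rfl⟩
    induction n generalizing x s with
    | zero =>
      rw [Nat.le_zero, Set.ncard_eq_zero (hV _ _)] at hn
      exact absurd (show t₁ ∈ V t₁ (-s) from ⟨⟨le_rfl, hle⟩, h₁⟩) (hn ▸ Set.notMem_empty _)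
    | succ n ih =>
      rcases eq_or_lt_of_le hle with e | hlt
      · exact ⟨x, hx, by rw [e, neg_neg]⟩
      obtain ⟨x, hx', rfl⟩ := (bijOn_shift hA).surjOn hx
      have hl := (isLeast_ceiling hA hx').1
      have h0 : 0 < S.ceiling A x := hl.1.1
      have h' : S.flow (s + S.ceiling A x) (S.Cod A x) = v := by
        rw [add_comm, flow_add, (isLeast_ceiling hA hx').2]
        exact h
      have h1 : t₁ ≤ -(s + S.ceiling A x) := by
        by_contra! hcon
        have : S.ceiling A x ≤ s + S.ceiling A x + t₁ :=
          hl.2 ⟨by linarith, by rwa [← hback h']⟩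
        linarith
      rw [← mk_shift hA hx']
      refine ih hx' h' h1 ?_
      have hss : V t₁ (-(s + S.ceiling A x)) ⊂ V t₁ (-s) := by
        refine ⟨fun t ht => ⟨⟨ht.1.1, by linarith [ht.1.2]⟩, ht.2⟩, fun hcon => ?_⟩
        have := (hcon ⟨⟨hle, le_rfl⟩, hvis hx h⟩).1.2
        linarith
      have := Set.ncard_lt_ncard hss (hV _ _)
      omega

/-- The first return identity makes the map well defined, recurrence makes it onto the regular
vectors, and continuity is inherited from the lift to the tangent bundle of the disk. For
finiteness, fix a visit time t of v: every preimage can be represented at height −t over a code of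
the vector reached at time t, and these codes are finite in number. -/
theorem exists_special_flow (hA : S.IsExtremal A) :
    ∃ Ψ : SpecialFlowSpace (S.regularCodes A) (S.ceiling A) → S.SM,
      (∀ x s, Ψ (SpecialFlowSpace.mk (S.ceiling A) x s) = S.flow s (S.Cod A x)) ∧
      Continuous Ψ ∧
      (∀ t y, Ψ (specialFlow t y) = S.flow t (Ψ y)) ∧
      Set.range Ψ = S.regularVectors ∧
      ∀ v, {y | Ψ y = v}.Finite := by
  let Ψ : SpecialFlowSpace (S.regularCodes A) (S.ceiling A) → S.SM :=
    Quot.lift (fun a => S.flow a.2 (S.Cod A a.1)) (by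
      rintro ⟨⟨x, hx⟩, s⟩ ⟨⟨x', hx'⟩, s'⟩ ⟨h1, h2⟩
      dsimp only at h1 h2 ⊢
      rw [h2, h1, add_comm, flow_add, (isLeast_ceiling hA hx).2])
  have hΨ : ∀ x s, Ψ (SpecialFlowSpace.mk (S.ceiling A) x s) = S.flow s (S.Cod A x) :=
    fun _ _ => rfl
  have hrange : ∀ y, Ψ y ∈ S.regularVectors := fun y => by
    obtain ⟨⟨⟨x, hx⟩, s⟩, rfl⟩ := Quot.exists_rep y
    exact flow_mem_regularVectors (Cod_mem hA hx).2 s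
  refine ⟨Ψ, hΨ, ?_, ?_, ?_, fun v => ?_⟩
  · refine continuous_quot_lift _ ?_
    have h1 : Continuous fun a : S.regularCodes A × ℝ => S.sectionPoint (S.geodesicOf A a.1) :=
      (continuousOn_iff_continuous_domRestrict.1 (continuousOn_lift hA)).comp continuous_fst
    exact continuous_proj.comp (continuous_diskFlow.comp (continuous_snd.prodMk h1))
  · rintro t ⟨⟨x, s⟩⟩
    exact flow_add s t _
  · refine Set.Subset.antisymm (Set.range_subset_iff.2 hrange) fun v hv => ?_
    obtain ⟨t, -, ht⟩ := (visits_crossSection (A := A) hv 0).1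
    have h1 : S.flow t v ∈ S.Cod A '' S.regularCodes A := by
      rw [image_Cod hA]
      exact ⟨ht, flow_mem_regularVectors hv t⟩
    obtain ⟨x, hx, e⟩ := h1
    refine ⟨SpecialFlowSpace.mk _ ⟨x, hx⟩ (-t), ?_⟩
    rw [hΨ, e, ← flow_add, add_neg_cancel, flow_zero]
  · by_cases hv : v ∈ S.regularVectors
    · obtain ⟨t, -, ht⟩ := (visits_crossSection (A := A) hv 0).1
      have hfin := (finite_Cod_eq hA (S.flow t v)).preimage
        (Subtype.val_injective (p := fun x => x ∈ S.regularCodes A)).injOn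
      refine (hfin.image fun x => SpecialFlowSpace.mk (S.ceiling A) x (-t)).subset ?_
      intro y hy
      obtain ⟨⟨⟨x, hx⟩, s⟩, rfl⟩ := Quot.exists_rep y
      obtain ⟨x', hx', e⟩ := exists_mk_eq hA ht hx hy
      refine ⟨⟨x', hx'⟩, ⟨hx', ?_⟩, e.symm⟩
      have h2 : Ψ (SpecialFlowSpace.mk (S.ceiling A) ⟨x', hx'⟩ (-t)) = v := by
        rw [← e]
        exact hy
      rw [hΨ] at h2
      rw [← h2, ← flow_add, neg_add_cancel, flow_zero]
    · refine Set.finite_empty.subset fun y hy => hv ?_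
      rw [← show Ψ y = v from hy]
      exact hrange y

end Surface
end GeodesicCoding

end

theorem mainTheorem9 (g : ℕ) (hg : 2 ≤ g) (S : Surface g) (A : Idx g → Circle)
    (hA : S.IsExtremal A) :
    -- the shift on `X_A` is sofic over the alphabet of side labels
    IsSofic (S.codeSpace A) ∧
    -- the geodesic associated to a sequence in `X_A` is well defined
    (∀ x ∈ S.codeSpace A, (∃! p, S.IsAssociated A x p) ∧ S.geodesicOf A x ∈ S.Omega A) ∧
    -- only countably many geodesics from a given point at infinity pass through a vertex
    (∀ u, {w | ¬ S.AvoidsVertices (u, w)}.Countable) ∧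
    -- the sequences whose geodesic passes through no vertex are dense in `X_A`
    S.codeSpace A ⊆ closure (S.regularCodes A) ∧
    -- `C_A` is a cross-section
    (∀ v ∈ S.regularVectors, ∀ t₀ : ℝ,
      (∃ t > t₀, S.flow t v ∈ S.crossSection A) ∧ ∃ t < t₀, S.flow t v ∈ S.crossSection A) ∧
    -- the coding map
    ContinuousOn (S.Cod A) (S.regularCodes A) ∧
    S.Cod A '' S.regularCodes A = S.crossSection A ∩ S.regularVectors ∧
    (∀ v, {x ∈ S.regularCodes A | S.Cod A x = v}.Finite) ∧
    -- it carries the shift to the first return map, and the ceiling is the first return time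
    Set.BijOn shift (S.regularCodes A) (S.regularCodes A) ∧
    (∀ x ∈ S.regularCodes A,
      IsLeast {t | 0 < t ∧ S.flow t (S.Cod A x) ∈ S.crossSection A} (S.ceiling A x) ∧
      S.flow (S.ceiling A x) (S.Cod A x) = S.Cod A (shift x)) ∧
    -- the geodesic flow is a special flow over the shift on `X_A` with this ceiling
    ∃ Ψ : SpecialFlowSpace (S.regularCodes A) (S.ceiling A) → S.SM,
      (∀ x s, Ψ (SpecialFlowSpace.mk (S.ceiling A) x s) = S.flow s (S.Cod A x)) ∧
      Continuous Ψ ∧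
      (∀ t y, Ψ (specialFlow t y) = S.flow t (Ψ y)) ∧
      Set.range Ψ = S.regularVectors ∧
      ∀ v, {y | Ψ y = v}.Finite := by
  have : Fact (2 ≤ g) := ⟨hg⟩
  exact ⟨Surface.isSofic_codeSpace hA,
    fun x hx => ⟨Surface.existsUnique_isAssociated hA hx, Surface.geodesicOf_mem_Omega hA hx⟩,
    S.countable_irregular, Surface.codeSpace_subset_closure hA,
    fun v hv => Surface.visits_crossSection hv, Surface.continuousOn_Cod hA,
    Surface.image_Cod hA, Surface.finite_Cod_eq hA, Surface.bijOn_shift hA,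
    fun x hx => Surface.isLeast_ceiling hA hx, Surface.exists_special_flow hA⟩
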